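/- Let $\nu$ be a positive integer $m$, or $\infty$, or $\mathrm{hol}$; put $r=\mathrm{hol}$ if $\nu=\mathrm{hol}$ and $r=\infty$ otherwise, and put $\mathbb{F}=\mathbb{C}$ if $\nu=\mathrm{hol}$ and $\mathbb{F}=\mathbb{R}$ otherwise. Let $M$ be a Hausdorff, second countable, connected, finite-dimensional manifold, smooth if $\nu\in\{m,\infty\}$ and a Stein manifold if $\nu=\mathrm{hol}$. Let $C^r(M)$ be the set of smooth real-valued (for $\nu=\mathrm{hol}$: holomorphic complex-valued) functions on $M$, let $\Gamma^\nu(TM)$ be the space of vector fields of class $C^\nu$ on $M$, let $\mathbb{T}\subseteq\mathbb{R}$ be an interval, and let $\mathcal{P}$ be an arbitrary topological space. *Seminorms.* If $\nu\neq\mathrm{hol}$, fix a smooth Riemannian metric $\mathbb{G}_M$ and a smooth affine connection $\nabla^M$ on $M$. For a vector bundle $\pi:E\to M$ with a fibre metric $\mathbb{G}_\pi$ and a connection $\nabla^\pi$, let $D^j\xi$ be the symmetrization of the $j$-th iterated covariant derivative of a section $\xi$, and let $$\|j_k\xi(x)\|^2=\sum_{j=0}^{k}\Big\|\tfrac1{j!}D^j\xi(x)\Big\|^2$$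 be the resulting fibre norm on the jet bundle $J^kE$, where the norms on the right are those induced by $\mathbb{G}_M$ and $\mathbb{G}_\pi$ on $T^j(T^*M)\otimes E$. For compact $K$ put $p_{K,k}(\xi)=\sup_{x\in K}\|j_k\xi(x)\|$. The $C^\nu$-topology is defined by the seminorms $p_{K,m}$ with $K$ compact if $\nu=m$, by all $p_{K,k}$ with $K$ compact and $k\in\mathbb{Z}_{\ge0}$ if $\nu=\infty$, and by $p_K(\xi)=\sup_{x\in K}\|\xi(x)\|$ with $K$ compact if $\nu=\mathrm{hol}$. For $E=TM$ any smooth fibre metric and smooth connection (for $\nu=\mathrm{hol}$: any Hermitian metric) may be used; for functions, $E$ is the trivial line bundle with its flat connection and standard metric. Write $p^\nu_K$ for any of these seminorms. *Vector fields.* $L^1_{\mathrm{loc}}(\mathbb{T};\Gamma^\nu(TM))$ is the space of time-varying vector fields $X:\mathbb{T}\times M\to TM$ such that $X_t\in\Gamma^\nu(TM)$ for every $t$, $t\mapsto X(t,x)$ is measurable for every $x$, and $t\mapsto p^\nu_K(X_t)$ is integrable on $\mathbb{S}$ for every compact $\mathbb{S}\subseteq\mathbb{T}$ and every seminorm $p^\nu_K$;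 its topology is defined by the seminorms $X\mapsto\int_{\mathbb{S}}p^\nu_K(X_t)\,dt$. *Flows.* An integral curve of $X$ on an interval $\mathbb{S}\subseteq\mathbb{T}$ is a continuous curve $\xi:\mathbb{S}\to M$ such that for all $f\in C^r(M)$ and $a,t\in\mathbb{S}$ the function $s\mapsto(X_sf)(\xi(s))$ is integrable between $a$ and $t$ and $$f(\xi(t))=f(\xi(a))+\int_a^t(X_sf)(\xi(s))\,ds .$$ For a family $X=(X^p)_{p\in\mathcal{P}}$, let $D_X(t_1,t_0,p)$ be the set of $x\in M$ for which there is an integral curve $\xi$ of $X^p$ on a subinterval of $\mathbb{T}$ containing $t_0$ and $t_1$ with $\xi(t_0)=x$; then $\Phi^{X^p}_{t_1,t_0}(x)=\xi(t_1)$. *Maps.* For $\mathcal{U}\subseteq M$ open, $C^\nu(\mathcal{U};M)$ is the set of maps $\mathcal{U}\to M$ of class $C^\nu$, with the initial topology of the maps $\Phi\mapsto f\circ\Phi\in C^\nu(\mathcal{U};\mathbb{F})$, $f\in C^r(M)$, where $C^\nu(\mathcal{U};\mathbb{F})$ has the $C^\nu$-topology (with $K\subseteq\mathcal{U}$ compact).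 **Theorem.** Let $X\in C^0(\mathcal{P};L^1_{\mathrm{loc}}(\mathbb{T};\Gamma^\nu(TM)))$, that is, let $p\mapsto X^p\in L^1_{\mathrm{loc}}(\mathbb{T};\Gamma^\nu(TM))$ be continuous. Let $t_0,t_1\in\mathbb{T}$, let $p_0\in\mathcal{P}$, and let $\mathcal{U}\subseteq M$ be a precompact open set with $\mathrm{cl}(\mathcal{U})\subseteq D_X(t_1,t_0,p_0)$. Then there is a neighbourhood $\mathcal{O}\subseteq\mathcal{P}$ of $p_0$ such that the map $$\mathcal{O}\ni p\mapsto\Phi^{X^p}_{t_1,t_0}\in C^\nu(\mathcal{U};M)$$ is well defined and continuous: for every $p\in\mathcal{O}$ one has $\mathcal{U}\subseteq D_X(t_1,t_0,p)$, for $x\in\mathcal{U}$ the value $\Phi^{X^p}_{t_1,t_0}(x)$ does not depend on the integral curve, the map $\Phi^{X^p}_{t_1,t_0}:\mathcal{U}\to M$ is of class $C^\nu$, and it depends continuously on $p\in\mathcal{O}$. -/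

import Mathlib

open Bundle MeasureTheory Set Filter
open scoped Manifold ContDiff Topology ENNReal Nat

noncomputable section

namespace ParamFlow

/-! ### Covariant derivatives of higher order and fibre norms on jet bundles -/

section Jets

variable {E : Type*} [NormedAddCommGroup E] [NormedSpace ℝ E]
  {M : Type*} [TopologicalSpace M] [ChartedSpace E M] [IsManifold 𝓘(ℝ, E) ∞ M]
  {F : Type*} [NormedAddCommGroup F] [NormedSpace ℝ F]
  {V : M → Type*} [TopologicalSpace (TotalSpace F V)]
  [∀ x, AddCommGroup (V x)] [∀ x, Module ℝ (V x)] [∀ x, TopologicalSpace (V x)]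
  [∀ x, IsTopologicalAddGroup (V x)] [∀ x, ContinuousSMul ℝ (V x)] [FiberBundle F V]

/-- The `j`-th covariant derivative `∇^j σ` of a section `σ` of `V`, as a function of `j` vector
fields. It is obtained from the connection `covV` on `V` and the affine connection `covM` on `M` by
`(∇^{j+1} σ)(X₀, X₁, …, X_j)
  = ∇_{X₀} ((∇^j σ)(X₁, …, X_j)) - ∑ i, (∇^j σ)(X₁, …, ∇_{X₀} X_i, …, X_j)`,
the Leibniz rule for the connection induced on `T^j(T^*M) ⊗ V`. -/
def iteratedCov
    (covM : CovariantDerivative 𝓘(ℝ, E) E (fun x : M ↦ TangentSpace 𝓘(ℝ, E) x))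
    (covV : CovariantDerivative 𝓘(ℝ, E) F V) (σ : Π x : M, V x) :
    (j : ℕ) → (Fin j → Π x : M, TangentSpace 𝓘(ℝ, E) x) → Π x : M, V x
  | 0, _ => σ
  | j + 1, X => fun x ↦
      covV (iteratedCov covM covV σ j (Fin.tail X)) x (X 0 x)
        - ∑ i : Fin j, iteratedCov covM covV σ j
            (Function.update (Fin.tail X) i (fun y ↦ covM (Fin.tail X i) y (X 0 y))) x

/-- The symmetrised `j`-th covariant derivative `D^j σ = Sym_j (∇^j σ)` at `x`, evaluated on tangent
vectors at `x`. As `∇^j σ` is tensorial, the tangent vectors may be extended to vector fields in any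
way that is smooth near `x`. -/
def symCov
    (covM : CovariantDerivative 𝓘(ℝ, E) E (fun x : M ↦ TangentSpace 𝓘(ℝ, E) x))
    (covV : CovariantDerivative 𝓘(ℝ, E) F V) (σ : Π x : M, V x) (j : ℕ) (x : M)
    (v : Fin j → TangentSpace 𝓘(ℝ, E) x) : V x :=
  ((j ! : ℕ) : ℝ)⁻¹ • ∑ s : Equiv.Perm (Fin j),
    iteratedCov covM covV σ j (fun i ↦ FiberBundle.extend E (v (s i))) x

/-- The squared norm of a tensor `A` in `T^j(T_x^*M) ⊗ V x` for the inner product induced by the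
Riemannian metric `gM` on `M` and a fibre metric on `V` whose squared fibre norm is `q`:
the sum of `q (A (e_{i₁}, …, e_{i_j}))` over an orthonormal basis `e` of `T_x M`. -/
def tensorNormSq [FiniteDimensional ℝ E]
    (gM : ContMDiffRiemannianMetric 𝓘(ℝ, E) ∞ E (fun x : M ↦ TangentSpace 𝓘(ℝ, E) x))
    {j : ℕ} {x : M} (q : V x → ℝ) (A : (Fin j → TangentSpace 𝓘(ℝ, E) x) → V x) : ℝ :=
  letI : RiemannianBundle (fun x : M ↦ TangentSpace 𝓘(ℝ, E) x) := ⟨gM.toRiemannianMetric⟩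
  letI : FiniteDimensional ℝ (TangentSpace 𝓘(ℝ, E) x) := inferInstanceAs (FiniteDimensional ℝ E)
  ∑ i : Fin j → Fin (Module.finrank ℝ (TangentSpace 𝓘(ℝ, E) x)),
    q (A (fun k ↦ stdOrthonormalBasis ℝ (TangentSpace 𝓘(ℝ, E) x) (i k)))

/-- The fibre norm of the `m`-jet of the section `σ` at `x`:
`‖j_m σ (x)‖² = ∑_{j ≤ m} ‖(1 / j!) D^j σ (x)‖²`. Here `q x` is the squared fibre norm on `V x`. -/
def jetNorm [FiniteDimensional ℝ E]
    (gM : ContMDiffRiemannianMetric 𝓘(ℝ, E) ∞ E (fun x : M ↦ TangentSpace 𝓘(ℝ, E) x))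
    (covM : CovariantDerivative 𝓘(ℝ, E) E (fun x : M ↦ TangentSpace 𝓘(ℝ, E) x))
    (q : ∀ x, V x → ℝ) (covV : CovariantDerivative 𝓘(ℝ, E) F V)
    (m : ℕ) (σ : Π x : M, V x) (x : M) : ℝ :=
  √(∑ j ∈ Finset.range (m + 1),
    tensorNormSq gM (q x) (fun v ↦ ((j ! : ℕ) : ℝ)⁻¹ • symCov covM covV σ j x v))

end Jets

/-- The flat connection `f ↦ df` of the trivial line bundle `M × ℝ`, whose sections are the
real-valued functions on `M`. -/
def flatConnection (E : Type*) [NormedAddCommGroup E] [NormedSpace ℝ E]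
    (M : Type*) [TopologicalSpace M] [ChartedSpace E M] :
    CovariantDerivative 𝓘(ℝ, E) ℝ (Bundle.Trivial M ℝ) where
  toFun f := mvfderiv 𝓘(ℝ, E) (fun x ↦ (f x : ℝ))
  isCovariantDerivativeOnUniv :=
    { add := by
        intro σ σ' x hσ hσ' _
        rw [mdifferentiableAt_section] at hσ hσ'
        exact mvfderiv_add hσ hσ'
      leibniz := by
        intro σ g x hσ hg _
        rw [mdifferentiableAt_section] at hσ
        exact mvfderiv_smul hg hσ }

/-! ### Integrability in time, continuity in the parameter, integral curves and flows

These notions are the same for smooth manifolds (`𝕜 = ℝ`) and complex manifolds (`𝕜 = ℂ`). -/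

section General

variable {𝕜 : Type*} [RCLike 𝕜] {E : Type*} [NormedAddCommGroup E] [NormedSpace 𝕜 E]
  {M : Type*} [TopologicalSpace M] [ChartedSpace E M]

/-- `X ∈ L¹_loc(T; Γ)`, where `Γ` is a space of vector fields whose topology is defined by the family
`Q` of seminorms: integrability by seminorm. -/
structure IsL1Loc (T : Set ℝ) (Γ : Set (Π x : M, TangentSpace 𝓘(𝕜, E) x))
    (Q : Set ((Π x : M, TangentSpace 𝓘(𝕜, E) x) → ℝ≥0∞))
    (X : ℝ → Π x : M, TangentSpace 𝓘(𝕜, E) x) : Prop where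
  mem : ∀ t ∈ T, X t ∈ Γ
  measurable : ∀ x, AEStronglyMeasurable (fun t ↦ X t x) (volume.restrict T)
  integrable : ∀ q ∈ Q, ∀ S ⊆ T, IsCompact S →
    AEMeasurable (fun t ↦ q (X t)) (volume.restrict S) ∧ ∫⁻ t in S, q (X t) < ⊤

/-- Continuity of `p ↦ X p` for the topology on `L¹_loc(T; Γ)` defined by the seminorms
`X ↦ ∫_S q (X t) dt`, with `q` in the family `Q` and `S ⊆ T` compact. -/
def ContinuousInParameter {P : Type*} [TopologicalSpace P] (T : Set ℝ)
    (Q : Set ((Π x : M, TangentSpace 𝓘(𝕜, E) x) → ℝ≥0∞))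
    (X : P → ℝ → Π x : M, TangentSpace 𝓘(𝕜, E) x) : Prop :=
  ∀ p₀ : P, ∀ q ∈ Q, ∀ S ⊆ T, IsCompact S → ∀ ε > 0,
    ∀ᶠ p in 𝓝 p₀, ∫⁻ t in S, q (X p t - X p₀ t) < ε

/-- `ξ` is an integral curve of the time-varying vector field `X` on the interval `S`: it is a
continuous curve with `f (ξ t) = f (ξ a) + ∫_a^t (X_s f)(ξ s) ds` for all `a, t ∈ S` and all `f` in
the set `A` of test functions (all functions of class `C^r` on `M`). -/
structure IsIntegralCurve (A : Set (M → 𝕜)) (X : ℝ → Π x : M, TangentSpace 𝓘(𝕜, E) x)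
    (S : Set ℝ) (ξ : ℝ → M) : Prop where
  continuousOn : ContinuousOn ξ S
  intervalIntegrable : ∀ f ∈ A, ∀ a ∈ S, ∀ t ∈ S,
    IntervalIntegrable (fun s ↦ mvfderiv 𝓘(𝕜, E) f (ξ s) (X s (ξ s))) volume a t
  integral_eq : ∀ f ∈ A, ∀ a ∈ S, ∀ t ∈ S,
    f (ξ t) = f (ξ a) + ∫ s in a..t, mvfderiv 𝓘(𝕜, E) f (ξ s) (X s (ξ s))

/-- `ξ` is an integral curve of `X` on an interval in `T` that contains `t₀` and `t₁`, and it starts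
at `x` at time `t₀`. -/
def IsIntegralCurveFrom (A : Set (M → 𝕜)) (T : Set ℝ)
    (X : ℝ → Π x : M, TangentSpace 𝓘(𝕜, E) x) (t₁ t₀ : ℝ) (x : M) (ξ : ℝ → M) : Prop :=
  ∃ S ⊆ T, S.OrdConnected ∧ t₀ ∈ S ∧ t₁ ∈ S ∧ IsIntegralCurve A X S ξ ∧ ξ t₀ = x

/-- The domain `D_X(t₁, t₀)` of the flow of `X` from time `t₀` to time `t₁`. -/
def flowDomain (A : Set (M → 𝕜)) (T : Set ℝ)
    (X : ℝ → Π x : M, TangentSpace 𝓘(𝕜, E) x) (t₁ t₀ : ℝ) : Set M :=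
  {x | ∃ ξ, IsIntegralCurveFrom A T X t₁ t₀ x ξ}

open Classical in
/-- The flow `Φ^X_{t₁,t₀}`: the value at `t₁` of an integral curve that passes through `x` at time
`t₀` (and `x` outside the domain of the flow). -/
def flow (A : Set (M → 𝕜)) (T : Set ℝ)
    (X : ℝ → Π x : M, TangentSpace 𝓘(𝕜, E) x) (t₁ t₀ : ℝ) (x : M) : M :=
  if h : x ∈ flowDomain A T X t₁ t₀ then h.choose t₁ else x

/-- The topology defined by a family `D` of semimetrics: the open balls are a subbasis. -/
@[reducible]
def semimetricTopology {α : Type*} (D : Set (α → α → ℝ≥0∞)) : TopologicalSpace α :=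
  TopologicalSpace.generateFrom {B | ∃ d ∈ D, ∃ a, ∃ ε > 0, B = {b | d b a < ε}}

end General

/-! ### Regularity `ν = m` and `ν = ∞` on a smooth manifold -/

section Smooth

/-- The orders of the jets that enter the seminorms for regularity `ν`: only `m` if `ν = m` is
finite, and all orders if `ν = ∞`. -/
def IsJetOrder (ν : ℕ∞) (m : ℕ) : Prop := ν = ⊤ ∨ ν = m

variable {E : Type*} [NormedAddCommGroup E] [NormedSpace ℝ E]
  {M : Type*} [TopologicalSpace M] [ChartedSpace E M]

variable (E M) in
/-- The set `C^∞(M)`. -/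
def smoothFunctions : Set (M → ℝ) := {f | ContMDiff 𝓘(ℝ, E) 𝓘(ℝ, ℝ) ∞ f}

variable [IsManifold 𝓘(ℝ, E) ∞ M]

variable (E M) in
/-- The set `Γ^ν(TM)`. -/
def fields (ν : ℕ∞) : Set (Π x : M, TangentSpace 𝓘(ℝ, E) x) :=
  {ξ | ContMDiff 𝓘(ℝ, E) 𝓘(ℝ, E).tangent ν
    (fun x ↦ (⟨x, ξ x⟩ : TangentBundle 𝓘(ℝ, E) M))}

/-- The seminorms `ξ ↦ sup {‖j_m ξ (x)‖ | x ∈ K}` defining the `C^ν`-topology of `Γ^ν(TM)`. -/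
def fieldSeminorms [FiniteDimensional ℝ E]
    (gM : ContMDiffRiemannianMetric 𝓘(ℝ, E) ∞ E (fun x : M ↦ TangentSpace 𝓘(ℝ, E) x))
    (covM : CovariantDerivative 𝓘(ℝ, E) E (fun x : M ↦ TangentSpace 𝓘(ℝ, E) x))
    (gV : ContMDiffRiemannianMetric 𝓘(ℝ, E) ∞ E (fun x : M ↦ TangentSpace 𝓘(ℝ, E) x))
    (covV : CovariantDerivative 𝓘(ℝ, E) E (fun x : M ↦ TangentSpace 𝓘(ℝ, E) x))
    (ν : ℕ∞) : Set ((Π x : M, TangentSpace 𝓘(ℝ, E) x) → ℝ≥0∞) :=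
  {q | ∃ K : Set M, IsCompact K ∧ ∃ m, IsJetOrder ν m ∧
    q = fun ξ ↦ ⨆ x ∈ K, ENNReal.ofReal
      (jetNorm gM covM (fun x v ↦ gV.inner x v v) covV m ξ x)}

/-- The set `C^ν(U)`. -/
def CFun (E : Type*) [NormedAddCommGroup E] [NormedSpace ℝ E]
    {M : Type*} [TopologicalSpace M] [ChartedSpace E M] (ν : ℕ∞) (U : TopologicalSpace.Opens M) :
    Type _ := {g : U → ℝ // ContMDiff 𝓘(ℝ, E) 𝓘(ℝ, ℝ) ν g}

/-- The set `C^ν(U; M)`. -/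
def CMap (E : Type*) [NormedAddCommGroup E] [NormedSpace ℝ E]
    {M : Type*} [TopologicalSpace M] [ChartedSpace E M] (ν : ℕ∞) (U : TopologicalSpace.Opens M) :
    Type _ := {Φ : U → M // ContMDiff 𝓘(ℝ, E) 𝓘(ℝ, E) ν Φ}

/-- The `C^ν`-topology of `C^ν(U)`, defined by the seminorms `g ↦ sup {‖j_m g (x)‖ | x ∈ K}` with
`K ⊆ U` compact. Functions on `U` are extended by zero to `M`, which does not affect their jets at
points of the open set `U`. -/
@[reducible]
def funTopology [FiniteDimensional ℝ E]
    (gM : ContMDiffRiemannianMetric 𝓘(ℝ, E) ∞ E (fun x : M ↦ TangentSpace 𝓘(ℝ, E) x))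
    (covM : CovariantDerivative 𝓘(ℝ, E) E (fun x : M ↦ TangentSpace 𝓘(ℝ, E) x))
    (ν : ℕ∞) (U : TopologicalSpace.Opens M) : TopologicalSpace (CFun E ν U) :=
  semimetricTopology {d | ∃ K : Set M, IsCompact K ∧ K ⊆ U ∧ ∃ m, IsJetOrder ν m ∧
    d = fun g₁ g₂ ↦ ⨆ x ∈ K, ENNReal.ofReal
      (jetNorm gM covM (fun _ (v : ℝ) ↦ v ^ 2) (flatConnection E M) m
        (Function.extend Subtype.val (g₁.1 - g₂.1) 0) x)}

/-- The map `Φ ↦ Φ^* f = f ∘ Φ` from `C^ν(U; M)` to `C^ν(U)`, for `f ∈ C^∞(M)`. -/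
def CMap.pullback {ν : ℕ∞} {U : TopologicalSpace.Opens M}
    (f : smoothFunctions E M) (Φ : CMap E ν U) : CFun E ν U :=
  ⟨f.1 ∘ Φ.1, (f.2.of_le (mod_cast le_top)).comp Φ.2⟩

/-- The `C^ν`-topology of `C^ν(U; M)`: the initial topology of the maps `Φ ↦ f ∘ Φ ∈ C^ν(U)`,
`f ∈ C^∞(M)`. -/
@[reducible]
def mapTopology [FiniteDimensional ℝ E]
    (gM : ContMDiffRiemannianMetric 𝓘(ℝ, E) ∞ E (fun x : M ↦ TangentSpace 𝓘(ℝ, E) x))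
    (covM : CovariantDerivative 𝓘(ℝ, E) E (fun x : M ↦ TangentSpace 𝓘(ℝ, E) x))
    (ν : ℕ∞) (U : TopologicalSpace.Opens M) : TopologicalSpace (CMap E ν U) :=
  ⨅ f : smoothFunctions E M, (funTopology gM covM ν U).induced (CMap.pullback f)

end Smooth

/-! ### Regularity `ν = hol` on a complex manifold -/

section Holomorphic

variable {E : Type*} [NormedAddCommGroup E] [NormedSpace ℂ E]
  {M : Type*} [TopologicalSpace M] [ChartedSpace E M]

variable (E M) in
/-- The set `C^hol(M)` of holomorphic functions on `M`. -/
def holFunctions : Set (M → ℂ) := {f | MDifferentiable 𝓘(ℂ, E) 𝓘(ℂ, ℂ) f}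

variable (E M) in
/-- Stein manifolds: holomorphically convex, with enough global holomorphic functions to separate
points and to provide local coordinates. -/
structure IsStein : Prop where
  convex : ∀ K : Set M, IsCompact K →
    IsCompact {x | ∀ f ∈ holFunctions E M, ∀ c : ℝ, (∀ y ∈ K, ‖f y‖ ≤ c) → ‖f x‖ ≤ c}
  separates : ∀ x y : M, x ≠ y → ∃ f ∈ holFunctions E M, f x ≠ f y
  coordinates : ∀ x : M, ∃ z : M → E, MDifferentiable 𝓘(ℂ, E) 𝓘(ℂ, E) z ∧
    Function.Bijective (mvfderiv 𝓘(ℂ, E) z x)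

variable [IsManifold 𝓘(ℂ, E) ω M]

variable (E M) in
/-- A continuous Hermitian metric on the holomorphic tangent bundle of `M`. -/
structure HermitianMetric where
  inner (x : M) : TangentSpace 𝓘(ℂ, E) x →ₗ⋆[ℂ] TangentSpace 𝓘(ℂ, E) x →ₗ[ℂ] ℂ
  conj_symm (x : M) (v w : TangentSpace 𝓘(ℂ, E) x) :
    starRingEnd ℂ (inner x w v) = inner x v w
  pos (x : M) (v : TangentSpace 𝓘(ℂ, E) x) (hv : v ≠ 0) : 0 < (inner x v v).re
  continuous : Continuous (fun v : TangentBundle 𝓘(ℂ, E) M ↦ inner v.proj v.snd v.snd)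

variable (E M) in
/-- The set `Γ^hol(TM)` of holomorphic vector fields. -/
def holFields : Set (Π x : M, TangentSpace 𝓘(ℂ, E) x) :=
  {ξ | MDifferentiable 𝓘(ℂ, E) 𝓘(ℂ, E).tangent
    (fun x ↦ (⟨x, ξ x⟩ : TangentBundle 𝓘(ℂ, E) M))}

/-- The seminorms `ξ ↦ sup {‖ξ z‖ | z ∈ K}` defining the topology of `Γ^hol(TM)`. -/
def holFieldSeminorms (g : HermitianMetric E M) :
    Set ((Π x : M, TangentSpace 𝓘(ℂ, E) x) → ℝ≥0∞) :=
  {q | ∃ K : Set M, IsCompact K ∧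
    q = fun ξ ↦ ⨆ z ∈ K, ENNReal.ofReal √(g.inner z (ξ z) (ξ z)).re}

/-- The set `C^hol(U)`. -/
def HolFun (E : Type*) [NormedAddCommGroup E] [NormedSpace ℂ E]
    {M : Type*} [TopologicalSpace M] [ChartedSpace E M] (U : TopologicalSpace.Opens M) :
    Type _ := {g : U → ℂ // MDifferentiable 𝓘(ℂ, E) 𝓘(ℂ, ℂ) g}

/-- The set `C^hol(U; M)`. -/
def HolMap (E : Type*) [NormedAddCommGroup E] [NormedSpace ℂ E]
    {M : Type*} [TopologicalSpace M] [ChartedSpace E M] (U : TopologicalSpace.Opens M) :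
    Type _ := {Φ : U → M // MDifferentiable 𝓘(ℂ, E) 𝓘(ℂ, E) Φ}

/-- The topology of `C^hol(U)`, defined by the seminorms `g ↦ sup {|g z| | z ∈ K}` with `K ⊆ U`
compact. -/
@[reducible]
def holFunTopology (U : TopologicalSpace.Opens M) : TopologicalSpace (HolFun E U) :=
  semimetricTopology {d | ∃ K : Set U, IsCompact K ∧
    d = fun g₁ g₂ ↦ ⨆ z ∈ K, ENNReal.ofReal ‖g₁.1 z - g₂.1 z‖}

/-- The map `Φ ↦ Φ^* f = f ∘ Φ` from `C^hol(U; M)` to `C^hol(U)`, for `f ∈ C^hol(M)`. -/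
def HolMap.pullback {U : TopologicalSpace.Opens M}
    (f : holFunctions E M) (Φ : HolMap E U) : HolFun E U :=
  ⟨f.1 ∘ Φ.1, MDifferentiable.comp f.2 Φ.2⟩

/-- The topology of `C^hol(U; M)`: the initial topology of the maps `Φ ↦ f ∘ Φ ∈ C^hol(U)`,
`f ∈ C^hol(M)`. -/
@[reducible]
def holMapTopology (U : TopologicalSpace.Opens M) : TopologicalSpace (HolMap E U) :=
  ⨅ f : holFunctions E M, (holFunTopology U).induced (HolMap.pullback f)

end Holomorphic

end ParamFlow

end

noncomputable section

namespace ParamFlow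

universe u v w

/-! ### Integral equations in time -/

section Time

variable {E : Type*} [NormedAddCommGroup E] [NormedSpace ℝ E]
  {F : Type*} [NormedAddCommGroup F] [NormedSpace ℝ F]

/-! In a chart, a family of time-varying fields becomes a family of Carathéodory fields: regular in
space, measurable in time, locally integrably bounded, and continuous in the parameter in the mean.
The proof has a local part about such families, a gluing part, and a translation of the intrinsic
topologies into coordinates.

Local part. A Picard iteration with an exponential weight solves the integral equation for short
times, uniformly for nearby parameters and initial points, and Grönwall's inequality gives
uniqueness and continuity (`exists_isSolFamily`, `IsSol.unique`). The flow is strictly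
differentiable in the initial point, with an estimate uniform in the parameter
(`IsSolFamily.exists_strict`). Its tangent map is therefore a jointly continuous family of solutions
for the tangent fields `tmap (X p t)` (`IsSolFamily.tmap`). Iterating the tangent functor gives
joint continuity of all derivatives up to order `m` (`IsSolFamily.isJointC`). If the fields are
holomorphic, the variational equation commutes with multiplication by `i`, hence so does the
derivative of the flow (`IsSolFamily.fderiv_comm`).

Gluing. Integral curves are defined by test functions. Since test functions supply local
coordinates, by bump functions or by the Stein property, integral curves are the solutions in charts
(`IsIntegralCurve.eventually_isSol`). Local uniqueness gives global uniqueness on a Hausdorff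
manifold. Local flows are composed along a reference curve by connectedness of the time interval
(`exists_patched_flow`), for any notion of regularity stable under composition. So the domain is
open in parameter and initial point, and compactness of the closure of the given open set yields the
neighbourhood of parameters.

Translation. In coordinates the `j`-th covariant derivative is the usual one plus a differential
operator of lower order (`exists_covIter_eq`). The usual derivative is symmetric, so symmetrization
loses nothing, and jet norms are locally equivalent to sums of norms of coordinate derivatives
(`exists_jetNorm_le`, `exists_norm_iteratedFDeriv_le_jetNorm`). For holomorphic fields, Cauchy's
estimate bounds first derivatives by suprema on a larger ball. Continuity into the initial topology
then follows from local smallness of the jets of `f ∘ Φ p - f ∘ Φ p₁` and compactness of `K`. -/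

theorem intervalIntegrable_of_Icc {E : Type*} [NormedAddCommGroup E] {g : ℝ → E} {c d a b : ℝ} (hg : IntegrableOn g (Icc c d))
    (ha : a ∈ Icc c d) (hb : b ∈ Icc c d) : IntervalIntegrable g volume a b := by
  rw [intervalIntegrable_iff]
  exact hg.mono_set (uIoc_subset_uIcc.trans (ordConnected_Icc.uIcc_subset ha hb))

theorem continuousOn_integral_Icc {g : ℝ → E} {c d a : ℝ}
    (hg : IntegrableOn g (Icc c d)) (ha : a ∈ Icc c d) :
    ContinuousOn (fun t ↦ ∫ s in a..t, g s) (Icc c d) := by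
  have hcd : c ≤ d := ha.1.trans ha.2
  have := intervalIntegral.continuousOn_primitive_interval' (a := a) (b₁ := c) (b₂ := d) (f := g)
    (μ := volume) (intervalIntegrable_of_Icc hg ⟨le_rfl, hcd⟩ ⟨hcd, le_rfl⟩)
    (by rwa [uIcc_of_le hcd])
  rwa [uIcc_of_le hcd] at this

theorem integrableOn_clm_apply {c d : ℝ} {A : ℝ → E →L[ℝ] F} {g : ℝ → E}
    (hA : ContinuousOn A (Icc c d)) (hg : IntegrableOn g (Icc c d)) :
    IntegrableOn (fun s ↦ A s (g s)) (Icc c d) := by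
  obtain ⟨C, hC⟩ := isCompact_Icc.exists_bound_of_continuousOn hA
  refine Integrable.mono' (hg.norm.const_mul C) ?_ ?_
  · have := hA.aestronglyMeasurable (μ := volume) measurableSet_Icc
    exact (ContinuousLinearMap.apply ℝ F : E →L[ℝ] (E →L[ℝ] F) →L[ℝ] F).aestronglyMeasurable_comp₂
      hg.aestronglyMeasurable this
  · refine (ae_restrict_iff' measurableSet_Icc).2 (Eventually.of_forall fun s hs ↦ ?_)
    exact ((A s).le_opNorm _).trans (by gcongr; exact hC s hs)

/-- The chain rule for a curve given as an indefinite integral. -/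
theorem chain_integral_of_le [CompleteSpace E] [CompleteSpace F] {η g : ℝ → E} {a b : ℝ}
    (hab : a ≤ b)
    {Φ : E → F} {Φ' : E → E →L[ℝ] F} (hg : IntegrableOn g (Icc a b))
    (hη : ∀ t ∈ Icc a b, η t = η a + ∫ s in a..t, g s)
    (hΦ : ∀ t ∈ Icc a b, HasStrictFDerivAt Φ (Φ' (η t)) (η t))
    (hΦ' : ContinuousOn (fun t ↦ Φ' (η t)) (Icc a b)) :
    Φ (η b) = Φ (η a) + ∫ s in a..b, Φ' (η s) (g s) := by
  have hInt := integrableOn_clm_apply hΦ' hg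
  have haI : a ∈ Icc a b := ⟨le_rfl, hab⟩
  have hηc : ContinuousOn η (Icc a b) :=
    (continuousOn_const.add (continuousOn_integral_Icc hg haI)).congr hη
  have hΦc : ContinuousOn (fun t ↦ Φ (η t)) (Icc a b) := fun t ht ↦
    (hΦ t ht).continuousAt.comp_continuousWithinAt (hηc t ht)
  have hηsub : ∀ t ∈ Icc a b, ∀ t' ∈ Icc a b, η t' - η t = ∫ s in t..t', g s := by
    intro t ht t' ht'
    rw [hη t ht, hη t' ht', add_sub_add_left_eq_sub,
      intervalIntegral.integral_interval_sub_left (intervalIntegrable_of_Icc hg haI ht')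
        (intervalIntegrable_of_Icc hg haI ht)]
  -- The integrand need not be continuous, so the formula is not differentiated in time. The defect
  -- is compared with `ε * ∫ ‖g‖`, an estimate that propagates along the interval, and `ε` then
  -- tends to zero.
  have key : ∀ ε > 0, ∀ t ∈ Icc a b, ‖Φ (η t) - Φ (η a) - ∫ s in a..t, Φ' (η s) (g s)‖
      ≤ ε * ∫ s in a..t, ‖g s‖ := by
    intro ε hε
    have hcl : IsClosed ({t | ‖Φ (η t) - Φ (η a) - ∫ s in a..t, Φ' (η s) (g s)‖
      ≤ ε * ∫ s in a..t, ‖g s‖} ∩ Icc a b) := by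
      rw [inter_comm]
      have h1 : ContinuousOn (fun t ↦ ‖Φ (η t) - Φ (η a) - ∫ s in a..t, Φ' (η s) (g s)‖)
        (Icc a b) := ((hΦc.sub continuousOn_const).sub (continuousOn_integral_Icc hInt haI)).norm
      have h2 : ContinuousOn (fun t ↦ ε * ∫ s in a..t, ‖g s‖) (Icc a b) :=
        continuousOn_const.mul (continuousOn_integral_Icc hg.norm haI)
      exact isClosed_Icc.isClosed_le h1 h2
    -- Continuous induction: a closed set of times that contains `a` and extends to the right of
    -- each of its points is everything.
    refine hcl.Icc_subset_of_forall_mem_nhdsWithin (by simp) ?_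
    rintro t ⟨ht, htI⟩
    have htI' : t ∈ Icc a b := Ico_subset_Icc_self htI
    have hmem : Icc a b ∈ 𝓝[>] t :=
      mem_of_superset (Ioc_mem_nhdsGT htI.2) fun s hs ↦ ⟨htI.1.trans hs.1.le, hs.2⟩
    have hle : 𝓝[>] t ≤ 𝓝[Icc a b] t := by
      rw [nhdsWithin, nhdsWithin]
      refine le_inf inf_le_left (le_principal_iff.2 hmem)
    have hη_t : Tendsto η (𝓝[>] t) (𝓝 (η t)) := (hηc t htI').mono_left hle
    -- Half of `ε` pays for the first-order remainder of `Φ` at `η t`, the other half for the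
    -- oscillation of `Φ'` along `η` just after `t`.
    have h1 := (hΦ t htI').isLittleO.def (half_pos hε)
    have h1' : ∀ᶠ t' in 𝓝[>] t, ‖Φ (η t') - Φ (η t) - Φ' (η t) (η t' - η t)‖
        ≤ ε / 2 * ‖η t' - η t‖ := by
      have : Tendsto (fun t' ↦ (η t', η t)) (𝓝[>] t) (𝓝 (η t, η t)) :=
        hη_t.prodMk_nhds tendsto_const_nhds
      exact this.eventually h1
    have h2 : ∀ᶠ t' in 𝓝[>] t, ‖Φ' (η t') - Φ' (η t)‖ < ε / 2 := by
      have : Tendsto (fun t' ↦ Φ' (η t')) (𝓝[>] t) (𝓝 (Φ' (η t))) := (hΦ' t htI').mono_left hle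
      simpa [dist_eq_norm] using (Metric.tendsto_nhds.1 this) (ε / 2) (half_pos hε)
    obtain ⟨u, hu, hsub⟩ := (mem_nhdsGT_iff_exists_Ioo_subset).1
      (h2.and (eventually_mem_set.2 hmem))
    filter_upwards [h1', Ioo_mem_nhdsGT hu, hmem] with t' h1' htu htb
    have htt' : t ≤ t' := htu.1.le
    have i1 := intervalIntegrable_of_Icc hg htI' htb
    have i2 := intervalIntegrable_of_Icc hInt htI' htb
    have e1 : (∫ s in a..t', Φ' (η s) (g s)) = (∫ s in a..t, Φ' (η s) (g s))
        + ∫ s in t..t', Φ' (η s) (g s) :=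
      (intervalIntegral.integral_add_adjacent_intervals
        (intervalIntegrable_of_Icc hInt haI htI') i2).symm
    have e2 : (∫ s in a..t', ‖g s‖) = (∫ s in a..t, ‖g s‖) + ∫ s in t..t', ‖g s‖ :=
      (intervalIntegral.integral_add_adjacent_intervals
        (intervalIntegrable_of_Icc hg.norm haI htI') i1.norm).symm
    have e3 : Φ' (η t) (η t' - η t) = ∫ s in t..t', Φ' (η t) (g s) := by
      rw [hηsub t htI' t' htb, ContinuousLinearMap.intervalIntegral_comp_comm _ i1]
    have i3 : IntervalIntegrable (fun s ↦ Φ' (η t) (g s)) volume t t' :=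
      ⟨(Φ' (η t)).integrable_comp i1.1, (Φ' (η t)).integrable_comp i1.2⟩
    have e4 : ‖(∫ s in t..t', Φ' (η s) (g s)) - ∫ s in t..t', Φ' (η t) (g s)‖
        ≤ ε / 2 * ∫ s in t..t', ‖g s‖ := by
      rw [← intervalIntegral.integral_sub i2 i3, ← intervalIntegral.integral_const_mul]
      refine intervalIntegral.norm_integral_le_of_norm_le htt' ?_ (i1.norm.const_mul _)
      refine Eventually.of_forall fun s hs ↦ ?_
      have hs' : ‖Φ' (η s) - Φ' (η t)‖ < ε / 2 := (hsub ⟨hs.1, hs.2.trans_lt htu.2⟩).1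
      rw [← sub_apply]
      exact (ContinuousLinearMap.le_opNorm _ _).trans (by gcongr)
    have e5 : ‖η t' - η t‖ ≤ ∫ s in t..t', ‖g s‖ := by
      rw [hηsub t htI' t' htb]
      exact intervalIntegral.norm_integral_le_integral_norm htt'
    have e6 : Φ (η t') - Φ (η a) - ∫ s in a..t', Φ' (η s) (g s)
        = (Φ (η t) - Φ (η a) - ∫ s in a..t, Φ' (η s) (g s))
        + (Φ (η t') - Φ (η t) - Φ' (η t) (η t' - η t))
        - ((∫ s in t..t', Φ' (η s) (g s)) - ∫ s in t..t', Φ' (η t) (g s)) := by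
      rw [e1, e3]; abel
    show ‖_‖ ≤ _
    have ht0 : ‖Φ (η t) - Φ (η a) - ∫ s in a..t, Φ' (η s) (g s)‖ ≤ ε * ∫ s in a..t, ‖g s‖ := ht
    rw [e6, e2]
    refine (norm_sub_le _ _).trans ?_
    have := norm_add_le (Φ (η t) - Φ (η a) - ∫ s in a..t, Φ' (η s) (g s))
      (Φ (η t') - Φ (η t) - Φ' (η t) (η t' - η t))
    have h5 := mul_le_mul_of_nonneg_left e5 (half_pos hε).le
    linarith
  have hb : b ∈ Icc a b := ⟨hab, le_rfl⟩
  have h0 : ‖Φ (η b) - Φ (η a) - ∫ s in a..b, Φ' (η s) (g s)‖ ≤ 0 := by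
    have hI : 0 ≤ ∫ s in a..b, ‖g s‖ :=
      intervalIntegral.integral_nonneg hab fun _ _ ↦ norm_nonneg _
    refine le_of_forall_pos_le_add fun δ hδ ↦ ?_
    refine (key (δ / ((∫ s in a..b, ‖g s‖) + 1)) (by positivity) b hb).trans ?_
    rw [div_mul_eq_mul_div, zero_add, div_le_iff₀ (by positivity)]
    nlinarith
  have := norm_le_zero_iff.1 h0
  rw [sub_sub, sub_eq_zero] at this
  exact this

/-- The chain rule for a curve given as an indefinite integral. -/
theorem chain_integral [CompleteSpace E] [CompleteSpace F] {η g : ℝ → E} {c d : ℝ}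
    {Φ : E → F} {Φ' : E → E →L[ℝ] F} (hg : IntegrableOn g (Icc c d))
    (hη : ∀ a ∈ Icc c d, ∀ t ∈ Icc c d, η t = η a + ∫ s in a..t, g s)
    (hΦ : ∀ t ∈ Icc c d, HasStrictFDerivAt Φ (Φ' (η t)) (η t))
    (hΦ' : ContinuousOn (fun t ↦ Φ' (η t)) (Icc c d)) {a b : ℝ} (ha : a ∈ Icc c d)
    (hb : b ∈ Icc c d) :
    Φ (η b) = Φ (η a) + ∫ s in a..b, Φ' (η s) (g s) := by
  have aux : ∀ a ∈ Icc c d, ∀ b ∈ Icc c d, a ≤ b →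
      Φ (η b) = Φ (η a) + ∫ s in a..b, Φ' (η s) (g s) := by
    intro a ha b hb hab
    have hsub : Icc a b ⊆ Icc c d := Icc_subset_Icc ha.1 hb.2
    exact chain_integral_of_le hab (hg.mono_set hsub) (fun t ht ↦ hη a ha t (hsub ht))
      (fun t ht ↦ hΦ t (hsub ht)) (hΦ'.mono hsub)
  rcases le_total a b with h | h
  · exact aux a ha b hb h
  · rw [aux b hb a ha h, intervalIntegral.integral_symm a b]; abel

/-! ### Grönwall's inequality with an integrable coefficient -/

/-- The integrand is the derivative of half the exponential, so the integral equals the right side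
minus `1/2`. The chain rule for indefinite integrals replaces the fundamental theorem because `L` is
merely integrable. The gain of a factor two drives both Grönwall's inequality and the Picard
contraction. -/
theorem integral_mul_exp_le {L : ℝ → ℝ} {c d a : ℝ} (hL : IntegrableOn L (Icc c d))
    (ha : a ∈ Icc c d) {t : ℝ} (ht : t ∈ Icc c d) :
    ∫ s in uIoc a t, L s * Real.exp (2 * ∫ r in uIoc a s, L r)
      ≤ Real.exp (2 * ∫ s in uIoc a t, L s) / 2 := by
  have hη : ∀ a' ∈ Icc c d, ∀ t ∈ Icc c d,
      (∫ s in a..t, L s) = (∫ s in a..a', L s) + ∫ s in a'..t, L s := fun a' ha' t ht ↦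
    (intervalIntegral.integral_add_adjacent_intervals (intervalIntegrable_of_Icc hL ha ha')
      (intervalIntegrable_of_Icc hL ha' ht)).symm
  have hc := continuousOn_integral_Icc hL ha
  rcases le_total a t with h | h
  · have := chain_integral (η := fun t ↦ ∫ s in a..t, L s) (g := L) (c := c) (d := d)
      (Φ := fun y ↦ Real.exp (2 * y))
      (Φ' := fun y ↦ (ContinuousLinearMap.toSpanSingleton ℝ (Real.exp (2 * y) * 2))) hL hη
      (fun t _ ↦ by
        have h1 : HasStrictDerivAt (fun y : ℝ ↦ Real.exp (2 * y))
            (Real.exp (2 * (∫ s in a..t, L s)) * 2) (∫ s in a..t, L s) := by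
          have h2 := (hasStrictDerivAt_id (∫ s in a..t, L s)).const_mul (2 : ℝ)
          simpa using h2.exp
        exact h1.hasStrictFDerivAt)
      (by
        have : Continuous (fun y : ℝ ↦
            (ContinuousLinearMap.toSpanSingleton ℝ (Real.exp (2 * y) * 2))) :=
          (ContinuousLinearMap.toSpanSingletonCLE (𝕜 := ℝ) (E := ℝ)).continuous.comp (by fun_prop)
        exact this.comp_continuousOn hc) ha ht
    simp only [intervalIntegral.integral_same, mul_zero, Real.exp_zero,
      ContinuousLinearMap.toSpanSingleton_apply, smul_eq_mul] at this
    rw [intervalIntegral.integral_of_le h] at this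
    rw [uIoc_of_le h]
    have e : ∫ s in Ioc a t, L s * Real.exp (2 * ∫ r in uIoc a s, L r)
        = (∫ s in Ioc a t, L s * (Real.exp (2 * ∫ r in a..s, L r) * 2)) / 2 := by
      rw [← integral_div]
      refine setIntegral_congr_fun measurableSet_Ioc fun s hs ↦ ?_
      simp only [uIoc_of_le hs.1.le, intervalIntegral.integral_of_le hs.1.le]
      ring
    rw [e, this, ← intervalIntegral.integral_of_le h]
    rw [← intervalIntegral.integral_of_le h] at *
    linarith
  · have := chain_integral (η := fun t ↦ ∫ s in a..t, L s) (g := L) (c := c) (d := d)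
      (Φ := fun y ↦ Real.exp (-2 * y))
      (Φ' := fun y ↦ (ContinuousLinearMap.toSpanSingleton ℝ (Real.exp (-2 * y) * (-2)))) hL hη
      (fun t _ ↦ by
        have h1 : HasStrictDerivAt (fun y : ℝ ↦ Real.exp (-2 * y))
            (Real.exp (-2 * (∫ s in a..t, L s)) * (-2)) (∫ s in a..t, L s) := by
          have h2 := (hasStrictDerivAt_id (∫ s in a..t, L s)).const_mul (-2 : ℝ)
          simpa using h2.exp
        exact h1.hasStrictFDerivAt)
      (by
        have : Continuous (fun y : ℝ ↦
            (ContinuousLinearMap.toSpanSingleton ℝ (Real.exp (-2 * y) * (-2)))) :=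
          (ContinuousLinearMap.toSpanSingletonCLE (𝕜 := ℝ) (E := ℝ)).continuous.comp (by fun_prop)
        exact this.comp_continuousOn hc) ht ha
    simp only [intervalIntegral.integral_same, mul_zero, Real.exp_zero,
      ContinuousLinearMap.toSpanSingleton_apply, smul_eq_mul] at this
    have hneg : ∀ s, s ≤ a → (∫ r in a..s, L r) = - ∫ r in Ioc s a, L r := fun s hs ↦ by
      rw [intervalIntegral.integral_symm, intervalIntegral.integral_of_le hs]
    rw [uIoc_of_ge h]
    have e : ∫ s in Ioc t a, L s * Real.exp (2 * ∫ r in uIoc a s, L r)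
        = -(∫ s in t..a, L s * (Real.exp (-2 * ∫ r in a..s, L r) * (-2))) / 2 := by
      rw [intervalIntegral.integral_of_le h, ← integral_neg, ← integral_div]
      refine setIntegral_congr_fun measurableSet_Ioc fun s hs ↦ ?_
      simp only [uIoc_of_ge hs.2, hneg s hs.2]
      rw [neg_mul_neg]
      ring
    rw [hneg t h, neg_mul_neg] at this
    rw [e]
    linarith

/-- Grönwall's inequality: the constant depends on the coefficient `L` only. -/
theorem exists_gronwall {L : ℝ → ℝ} {c d a : ℝ} (hL : IntegrableOn L (Icc c d))
    (hL0 : ∀ t ∈ Icc c d, 0 ≤ L t) (ha : a ∈ Icc c d) :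
    ∃ G : ℝ, 1 ≤ G ∧ ∀ (u : ℝ → ℝ) (k : ℝ), 0 ≤ k → ContinuousOn u (Icc c d) →
      (∀ t ∈ Icc c d, u t ≤ k + ∫ s in uIoc a t, L s * u s) → ∀ t ∈ Icc c d, u t ≤ G * k := by
  have hsub : ∀ t ∈ Icc c d, uIoc a t ⊆ Icc c d := fun t ht ↦
    uIoc_subset_uIcc.trans (ordConnected_Icc.uIcc_subset ha ht)
  set Λ : ℝ → ℝ := fun t ↦ ∫ s in uIoc a t, L s with hΛ
  have hΛ0 : ∀ t ∈ Icc c d, 0 ≤ Λ t := fun t ht ↦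
    setIntegral_nonneg measurableSet_uIoc fun s hs ↦ hL0 s (hsub t ht hs)
  have hΛ1 : ∀ t ∈ Icc c d, Λ t ≤ ∫ s in Icc c d, L s := fun t ht ↦
    setIntegral_mono_set hL ((ae_restrict_iff' measurableSet_Icc).2 (Eventually.of_forall hL0))
      (Eventually.of_forall (hsub t ht))
  have hΛc : ContinuousOn Λ (Icc c d) := by
    refine (continuousOn_integral_Icc hL ha).abs.congr fun t ht ↦ ?_
    simp only [hΛ]
    rw [intervalIntegral.abs_integral_eq_abs_integral_uIoc, abs_of_nonneg (hΛ0 t ht)]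
  refine ⟨2 * Real.exp (2 * ∫ s in Icc c d, L s), ?_, ?_⟩
  · have : (0 : ℝ) ≤ ∫ s in Icc c d, L s := setIntegral_nonneg measurableSet_Icc hL0
    have := Real.one_le_exp (x := 2 * ∫ s in Icc c d, L s) (by linarith)
    linarith
  intro u k hk hu hle t ht
  -- At the maximum `m` of `u * exp (-2Λ)` the integral term is at most half of the left side, so it
  -- is absorbed and `m ≤ 2 * k`. Removing the weight produces the exponential in `G`.
  obtain ⟨t', ht', hmax⟩ := isCompact_Icc.exists_isMaxOn ⟨a, ha⟩
    (f := fun t ↦ u t * Real.exp (-(2 * Λ t))) (hu.mul (Real.continuous_exp.comp_continuousOn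
      (continuousOn_const.mul hΛc).neg))
  set m := u t' * Real.exp (-(2 * Λ t')) with hm
  have hum : ∀ s ∈ Icc c d, u s ≤ m * Real.exp (2 * Λ s) := fun s hs ↦ by
    have h1 : u s * Real.exp (-(2 * Λ s)) ≤ m := hmax hs
    have h2 := mul_le_mul_of_nonneg_right h1 (Real.exp_pos (2 * Λ s)).le
    rwa [mul_assoc, ← Real.exp_add, neg_add_cancel, Real.exp_zero, mul_one] at h2
  have hexp : Real.exp (2 * Λ t) ≤ Real.exp (2 * ∫ s in Icc c d, L s) := by
    have := hΛ1 t ht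
    gcongr
  rcases le_or_gt m 0 with hm0 | hm0
  · have h1 := hum t ht
    have h2 : m * Real.exp (2 * Λ t) ≤ 0 := mul_nonpos_of_nonpos_of_nonneg hm0 (Real.exp_pos _).le
    have h3 : 0 ≤ 2 * Real.exp (2 * ∫ s in Icc c d, L s) * k := by positivity
    linarith
  · have i1 : IntegrableOn (fun s ↦ L s * u s) (uIoc a t') :=
      ((hL.mul_continuousOn hu isCompact_Icc)).mono_set (hsub t' ht')
    have i2 : IntegrableOn (fun s ↦ m * (L s * Real.exp (2 * Λ s))) (uIoc a t') :=
      ((hL.mul_continuousOn (Real.continuous_exp.comp_continuousOn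
        (continuousOn_const.mul hΛc)) isCompact_Icc).mono_set (hsub t' ht')).const_mul m
    have h1 : ∫ s in uIoc a t', L s * u s ≤ m * (Real.exp (2 * Λ t') / 2) := by
      refine (setIntegral_mono_on i1 i2 measurableSet_uIoc fun s hs ↦ ?_).trans ?_
      · have := mul_le_mul_of_nonneg_left (hum s (hsub t' ht' hs)) (hL0 s (hsub t' ht' hs))
        linarith
      · rw [integral_const_mul]
        exact mul_le_mul_of_nonneg_left (integral_mul_exp_le hL ha ht') hm0.le
    have h2 := hle t' ht'
    have h3 : u t' = m * Real.exp (2 * Λ t') := by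
      rw [hm, mul_assoc, ← Real.exp_add, neg_add_cancel, Real.exp_zero, mul_one]
    have h4 : 1 ≤ Real.exp (2 * Λ t') := Real.one_le_exp (by linarith [hΛ0 t' ht'])
    have h5 : m ≤ 2 * k := by nlinarith
    have h6 := hum t ht
    calc u t ≤ m * Real.exp (2 * Λ t) := h6
      _ ≤ (2 * k) * Real.exp (2 * ∫ s in Icc c d, L s) := by gcongr
      _ = _ := by ring

/-! ### Carathéodory functions -/

/-- The curve is a pointwise limit of simple functions with values in `Ω`. Along a simple function
the field is evaluated at finitely many points, so measurability in time suffices there; continuity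
in space passes to the limit. -/
theorem aestronglyMeasurable_caratheodory [FiniteDimensional ℝ E] {F : Type*}
    [NormedAddCommGroup F] {Y : ℝ → E → F} {Ω : Set E}
    {c d : ℝ} (hY : ∀ t ∈ Icc c d, ContinuousOn (Y t) Ω)
    (hm : ∀ x ∈ Ω, AEStronglyMeasurable (fun t ↦ Y t x) (volume.restrict (Icc c d)))
    {γ : ℝ → E} (hγ : ContinuousOn γ (Icc c d)) (hγΩ : ∀ t ∈ Icc c d, γ t ∈ Ω) :
    AEStronglyMeasurable (fun t ↦ Y t (γ t)) (volume.restrict (Icc c d)) := by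
  rcases lt_or_ge d c with hcd | hcd
  · simp [Icc_eq_empty (not_le.2 hcd)]
  borelize E
  have : ProperSpace E := FiniteDimensional.proper ℝ E
  -- Projecting time to `[c, d]` extends the curve continuously to the line, without leaving `Ω`.
  set γ' : ℝ → E := fun t ↦ γ (projIcc c d hcd t) with hγ'
  have hγ'c : Continuous γ' := by
    have : Continuous ((Icc c d).domRestrict γ) := continuousOn_iff_continuous_domRestrict.1 hγ
    exact this.comp continuous_projIcc
  have hγ'Ω : ∀ t, γ' t ∈ Ω := fun t ↦ hγΩ _ (projIcc c d hcd t).2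
  set ψ : ℕ → SimpleFunc ℝ E := fun n ↦
    SimpleFunc.approxOn γ' hγ'c.measurable Ω (γ' c) (hγ'Ω c) n with hψ
  have hψΩ : ∀ n t, ψ n t ∈ Ω := fun n t ↦ SimpleFunc.approxOn_mem _ _ n t
  have hψt : ∀ t, Tendsto (fun n ↦ ψ n t) atTop (𝓝 (γ' t)) := fun t ↦
    SimpleFunc.tendsto_approxOn _ _ (subset_closure (hγ'Ω t))
  refine aestronglyMeasurable_of_tendsto_ae (u := atTop) (f := fun n t ↦ Y t (ψ n t)) ?_ ?_
  · intro n
    have e : (fun t ↦ Y t (ψ n t)) = fun t ↦ ∑ y ∈ (ψ n).range,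
        indicator (ψ n ⁻¹' {y}) (fun t ↦ Y t y) t := by
      ext t
      rw [Finset.sum_eq_single (ψ n t)]
      · simp
      · intro y _ hy
        exact indicator_of_notMem (fun h ↦ hy (by simpa using Eq.symm h)) _
      · intro h
        exact absurd (SimpleFunc.mem_range_self (ψ n) t) h
    rw [e]
    refine Finset.aestronglyMeasurable_fun_sum _ fun y hy ↦ ?_
    obtain ⟨t, rfl⟩ := SimpleFunc.mem_range.1 hy
    exact (hm _ (hψΩ n t)).indicator ((ψ n).measurableSet_preimage _)
  · refine (ae_restrict_iff' measurableSet_Icc).2 (Eventually.of_forall fun t ht ↦ ?_)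
    have e : γ' t = γ t := by simp [hγ', projIcc_of_mem hcd ht]
    have h1 : Tendsto (fun n ↦ ψ n t) atTop (𝓝[Ω] (γ t)) :=
      tendsto_nhdsWithin_iff.2 ⟨e ▸ hψt t, Eventually.of_forall fun n ↦ hψΩ n t⟩
    exact (hY t ht (γ t) (hγΩ t ht)).tendsto.comp h1

/-- The modulus of continuity of a Carathéodory function on a compact set is small in the mean. -/
theorem exists_modulus {E F : Type*} [PseudoMetricSpace E] [SecondCountableTopology E]
    [NormedAddCommGroup F]
    {Y : ℝ → E → F} {K : Set E} (hK : IsCompact K)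
    {c d : ℝ} (hY : ∀ t ∈ Icc c d, ContinuousOn (Y t) K)
    (hm : ∀ x ∈ K, AEStronglyMeasurable (fun t ↦ Y t x) (volume.restrict (Icc c d)))
    {h : ℝ → ℝ} (hh : IntegrableOn h (Icc c d)) (hb : ∀ t ∈ Icc c d, ∀ x ∈ K, ‖Y t x‖ ≤ h t)
    {ε : ℝ≥0∞} (hε : 0 < ε) :
    ∃ ρ > 0, ∃ w : ℝ → ℝ≥0∞, AEMeasurable w (volume.restrict (Icc c d)) ∧
      ∫⁻ t in Icc c d, w t < ε ∧
      ∀ t ∈ Icc c d, ∀ y ∈ K, ∀ y' ∈ K, dist y y' ≤ ρ → ‖Y t y - Y t y'‖ₑ ≤ w t := by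
  set S : ℕ → Set (E × E) := fun n ↦ {z | z.1 ∈ K ∧ z.2 ∈ K ∧ dist z.1 z.2 ≤ 1 / ((n : ℝ) + 1)}
  have hD : ∀ n, ∃ D ⊆ S n, D.Countable ∧ S n ⊆ closure D := fun n ↦
    (TopologicalSpace.IsSeparable.of_separableSpace (S n)).exists_countable_dense_subset
  -- The supremum over a countable dense set of pairs is measurable in time, and by continuity in
  -- space it bounds all pairs.
  choose D hDS hDc hDd using hD
  set w : ℕ → ℝ → ℝ≥0∞ := fun n t ↦ ⨆ z ∈ D n, ‖Y t z.1 - Y t z.2‖ₑ with hw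
  have hwm : ∀ n, AEMeasurable (w n) (volume.restrict (Icc c d)) := fun n ↦
    AEMeasurable.biSup _ (hDc n) fun z hz ↦
      ((hm _ (hDS n hz).1).sub (hm _ (hDS n hz).2.1)).enorm
  have hwb : ∀ n, ∀ t ∈ Icc c d, ∀ z ∈ S n, ‖Y t z.1 - Y t z.2‖ₑ ≤ w n t := by
    intro n t ht z hz
    have hcont : ContinuousOn (fun z : E × E ↦ ‖Y t z.1 - Y t z.2‖ₑ) (S n) :=
      (ContinuousOn.sub ((hY t ht).comp continuousOn_fst fun z hz ↦ hz.1)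
        ((hY t ht).comp continuousOn_snd fun z hz ↦ hz.2.1)).enorm
    have := hcont z hz
    have hzD : z ∈ closure (D n) := hDd n hz
    have hne : (𝓝[D n] z).NeBot := mem_closure_iff_nhdsWithin_neBot.1 hzD
    refine le_of_tendsto (this.mono_left (nhdsWithin_mono _ (hDS n))) ?_
    filter_upwards [self_mem_nhdsWithin] with z' hz'
    exact le_biSup (fun z : E × E ↦ ‖Y t z.1 - Y t z.2‖ₑ) hz'
  -- The moduli are dominated by `2 * |h|` and tend to zero at each time, by uniform continuity on
  -- the compact set.
  have hlim : Tendsto (fun n ↦ ∫⁻ t in Icc c d, w n t) atTop (𝓝 0) := by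
    have := tendsto_lintegral_of_dominated_convergence' (μ := volume.restrict (Icc c d))
      (F := w) (f := fun _ ↦ 0) (fun t ↦ 2 * ‖h t‖ₑ) hwm ?_ ?_ ?_
    · simpa using this
    · intro n
      refine (ae_restrict_iff' measurableSet_Icc).2 (Eventually.of_forall fun t ht ↦ ?_)
      refine iSup₂_le fun z hz ↦ ?_
      have hle : ∀ y ∈ K, ‖Y t y‖ₑ ≤ ‖h t‖ₑ := fun y hy ↦ by
        rw [enorm_le_iff_norm_le]
        exact (hb t ht y hy).trans (le_abs_self _)
      refine (enorm_sub_le).trans ?_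
      refine le_trans ?_ (two_mul _).ge
      exact add_le_add (hle _ (hDS n hz).1) (hle _ (hDS n hz).2.1)
    · rw [lintegral_const_mul' _ _ (by simp)]
      exact ENNReal.mul_ne_top (by simp) hh.hasFiniteIntegral.ne
    · refine (ae_restrict_iff' measurableSet_Icc).2 (Eventually.of_forall fun t ht ↦ ?_)
      have huc := hK.uniformContinuousOn_of_continuous (hY t ht)
      rw [ENNReal.tendsto_nhds_zero]
      intro δ hδ
      obtain ⟨δ', hδ', hδδ⟩ : ∃ δ' : ℝ, 0 < δ' ∧ ENNReal.ofReal δ' ≤ δ := by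
        rcases eq_or_ne δ ⊤ with rfl | hne
        · exact ⟨1, one_pos, le_top⟩
        · exact ⟨δ.toReal, ENNReal.toReal_pos hδ.ne' hne, (ENNReal.ofReal_toReal hne).le⟩
      obtain ⟨ρ, hρ, hρ'⟩ := (Metric.uniformContinuousOn_iff.1 huc) δ' hδ'
      obtain ⟨N, hN⟩ := exists_nat_one_div_lt hρ
      filter_upwards [eventually_ge_atTop N] with n hn
      refine iSup₂_le fun z hz ↦ ?_
      have hz' := hDS n hz
      have : dist z.1 z.2 < ρ := hz'.2.2.trans_lt
        ((one_div_le_one_div_of_le (by positivity) (by gcongr)).trans_lt hN)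
      have := hρ' _ hz'.1 _ hz'.2.1 this
      refine le_trans ?_ hδδ
      rw [← ofReal_norm, ← dist_eq_norm]
      exact ENNReal.ofReal_le_ofReal this.le
  obtain ⟨n, hn⟩ := ((tendsto_order.1 hlim).2 ε hε).exists
  exact ⟨1 / ((n : ℝ) + 1), by positivity, w n, hwm n, hn,
    fun t ht y hy y' hy' hyy ↦ hwb n t ht (y, y') ⟨hy, hy', hyy⟩⟩

/-! ### Solutions of integral equations -/

/-- `ξ` is a solution in `Ω` on `[c, d]` of the integral equation of `X` with `ξ a = x`. -/
structure IsSol (X : ℝ → E → E) (c d a : ℝ) (Ω : Set E) (x : E) (ξ : ℝ → E) : Prop where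
  cont : ContinuousOn ξ (Icc c d)
  mem : ∀ t ∈ Icc c d, ξ t ∈ Ω
  int : IntegrableOn (fun s ↦ X s (ξ s)) (Icc c d)
  eq : ∀ t ∈ Icc c d, ξ t = x + ∫ s in a..t, X s (ξ s)

/-- Global existence for a globally Lipschitz field with integrable Lipschitz constant. -/
theorem exists_isSol_of_lipschitz [FiniteDimensional ℝ E] {X : ℝ → E → E} {c d a : ℝ}
    (ha : a ∈ Icc c d) (hm : ∀ x, AEStronglyMeasurable (fun t ↦ X t x) (volume.restrict (Icc c d)))
    {L h : ℝ → ℝ} (hL : IntegrableOn L (Icc c d)) (hL0 : ∀ t ∈ Icc c d, 0 ≤ L t)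
    (hlip : ∀ t ∈ Icc c d, ∀ x y, ‖X t x - X t y‖ ≤ L t * ‖x - y‖)
    (hh : IntegrableOn h (Icc c d)) (h0 : ∀ t ∈ Icc c d, ‖X t 0‖ ≤ h t) (x : E) :
    ∃ ξ, IsSol X c d a univ x ξ := by
  have hcE : CompleteSpace E := FiniteDimensional.complete ℝ E
  have hcd : c ≤ d := ha.1.trans ha.2
  have hsub : ∀ t ∈ Icc c d, uIoc a t ⊆ Icc c d := fun t ht ↦
    uIoc_subset_uIcc.trans (ordConnected_Icc.uIcc_subset ha ht)
  have hXc : ∀ t ∈ Icc c d, ContinuousOn (X t) univ := fun t ht ↦ by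
    have : LipschitzWith (L t).toNNReal (X t) := LipschitzWith.of_dist_le_mul fun x y ↦ by
      rw [dist_eq_norm, dist_eq_norm, Real.coe_toNNReal _ (hL0 t ht)]
      exact hlip t ht x y
    exact this.continuous.continuousOn
  have hInt : ∀ γ : ℝ → E, ContinuousOn γ (Icc c d) →
      IntegrableOn (fun s ↦ X s (γ s)) (Icc c d) := by
    intro γ hγ
    obtain ⟨C, hC⟩ := isCompact_Icc.exists_bound_of_continuousOn hγ
    refine Integrable.mono' (hh.add (hL.mul_const C)) (aestronglyMeasurable_caratheodory hXc
      (fun x _ ↦ hm x) hγ fun _ _ ↦ mem_univ _) ?_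
    refine (ae_restrict_iff' measurableSet_Icc).2 (Eventually.of_forall fun s hs ↦ ?_)
    have h1 := hlip s hs (γ s) 0
    have h2 := norm_le_norm_add_norm_sub' (X s (γ s)) (X s 0)
    rw [sub_zero] at h1
    have h3 := mul_le_mul_of_nonneg_left (hC s hs) (hL0 s hs)
    simp only [Pi.add_apply]
    linarith [h0 s hs]
  set Λ : ℝ → ℝ := fun t ↦ ∫ s in uIoc a t, L s with hΛ
  have hΛ0 : ∀ t ∈ Icc c d, 0 ≤ Λ t := fun t ht ↦
    setIntegral_nonneg measurableSet_uIoc fun s hs ↦ hL0 s (hsub t ht hs)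
  have hΛc : ContinuousOn Λ (Icc c d) := by
    refine (continuousOn_integral_Icc hL ha).abs.congr fun t ht ↦ ?_
    simp only [hΛ]
    rw [intervalIntegral.abs_integral_eq_abs_integral_uIoc, abs_of_nonneg (hΛ0 t ht)]
  have hec : ContinuousOn (fun t ↦ Real.exp (2 * Λ t)) (Icc c d) :=
    Real.continuous_exp.comp_continuousOn (continuousOn_const.mul hΛc)
  have hec' : ContinuousOn (fun t ↦ Real.exp (-(2 * Λ t))) (Icc c d) :=
    Real.continuous_exp.comp_continuousOn (continuousOn_const.mul hΛc).neg
  -- The unknown `w` is the solution multiplied by `exp (-2Λ)`. In this variable the Picard map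
  -- contracts by `1/2` for the plain supremum distance on the whole interval, so no subdivision of
  -- time is needed.
  set γ : C(Icc c d, E) → ℝ → E := fun w t ↦ Real.exp (2 * Λ t) • w (projIcc c d hcd t) with hγ
  have hγc : ∀ w, ContinuousOn (γ w) (Icc c d) := fun w ↦
    hec.smul (w.continuous.comp continuous_projIcc).continuousOn
  set A : C(Icc c d, E) → ℝ → E := fun w t ↦
    Real.exp (-(2 * Λ t)) • (x + ∫ s in a..t, X s (γ w s)) with hA
  have hAc : ∀ w, ContinuousOn (A w) (Icc c d) := fun w ↦
    hec'.smul (continuousOn_const.add (continuousOn_integral_Icc (hInt _ (hγc w)) ha))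
  set B : C(Icc c d, E) → C(Icc c d, E) := fun w ↦
    ⟨(Icc c d).domRestrict (A w), continuousOn_iff_continuous_domRestrict.1 (hAc w)⟩ with hB
  have hcontr : ContractingWith (1 / 2) B := by
    refine ⟨by norm_num, LipschitzWith.of_dist_le_mul fun w w' ↦ ?_⟩
    rw [ContinuousMap.dist_le (by positivity)]
    rintro ⟨t, ht⟩
    set D := dist w w' with hDdef
    have e : dist (B w ⟨t, ht⟩) (B w' ⟨t, ht⟩) = Real.exp (-(2 * Λ t)) *
        ‖∫ s in a..t, (X s (γ w s) - X s (γ w' s))‖ := by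
      simp only [hB, hA, ContinuousMap.coe_mk, domRestrict_apply]
      rw [dist_eq_norm, ← smul_sub, norm_smul, add_sub_add_left_eq_sub,
        ← intervalIntegral.integral_sub (intervalIntegrable_of_Icc (hInt _ (hγc w)) ha ht)
          (intervalIntegrable_of_Icc (hInt _ (hγc w')) ha ht), Real.norm_of_nonneg (Real.exp_pos _).le]
    have i2 : IntegrableOn (fun s ↦ D * (L s * Real.exp (2 * Λ s))) (uIoc a t) :=
      ((hL.mul_continuousOn hec isCompact_Icc).mono_set (hsub t ht)).const_mul D
    have i1 : IntegrableOn (fun s ↦ ‖X s (γ w s) - X s (γ w' s)‖) (uIoc a t) :=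
      (((hInt _ (hγc w)).sub (hInt _ (hγc w'))).mono_set (hsub t ht)).norm
    have h1 : ‖∫ s in a..t, (X s (γ w s) - X s (γ w' s))‖ ≤ D * (Real.exp (2 * Λ t) / 2) := by
      refine intervalIntegral.norm_integral_le_integral_norm_uIoc.trans ?_
      refine (setIntegral_mono_on i1 i2 measurableSet_uIoc fun s hs ↦ ?_).trans ?_
      · refine (hlip s (hsub t ht hs) _ _).trans ?_
        simp only [hγ]
        rw [← smul_sub, norm_smul, Real.norm_of_nonneg (Real.exp_pos _).le, ← dist_eq_norm]
        have h2 := ContinuousMap.dist_apply_le_dist (f := w) (g := w') (projIcc c d hcd s)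
        have h3 : 0 ≤ L s * Real.exp (2 * Λ s) :=
          mul_nonneg (hL0 s (hsub t ht hs)) (Real.exp_pos _).le
        have := mul_le_mul_of_nonneg_left h2 h3
        linarith
      · rw [integral_const_mul]
        exact mul_le_mul_of_nonneg_left (integral_mul_exp_le hL ha ht) dist_nonneg
    rw [e]
    calc _ ≤ Real.exp (-(2 * Λ t)) * (D * (Real.exp (2 * Λ t) / 2)) := by gcongr
      _ = (Real.exp (-(2 * Λ t)) * Real.exp (2 * Λ t)) * (D / 2) := by ring
      _ ≤ _ := by
        rw [← Real.exp_add, neg_add_cancel, Real.exp_zero]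
        apply le_of_eq
        push_cast
        ring
  obtain ⟨w, hw⟩ : ∃ w, B w = w := ⟨_, hcontr.fixedPoint_isFixedPt⟩
  refine ⟨γ w, hγc w, fun _ _ ↦ mem_univ _, hInt _ (hγc w), fun t ht ↦ ?_⟩
  have h1 : w ⟨t, ht⟩ = A w t := by
    conv_lhs => rw [← hw]
    rfl
  have h2 : γ w t = Real.exp (2 * Λ t) • w ⟨t, ht⟩ := by
    simp only [hγ, projIcc_of_mem hcd ht]
  rw [h2, h1]
  simp only [hA]
  rw [smul_smul, ← Real.exp_add, add_neg_cancel, Real.exp_zero, one_smul]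

end Time

/-! ### The tangent functor and classes of parametrised maps -/

section Classes

/-- The tangent map `(x, v) ↦ (f x, Df(x) v)`. -/
def tmap {E F : Type*} [NormedAddCommGroup E] [NormedSpace ℝ E] [NormedAddCommGroup F]
    [NormedSpace ℝ F] (f : E → F) : E × E → F × F := fun z ↦ (f z.1, fderiv ℝ f z.1 z.2)

variable {P : Type w} [TopologicalSpace P]

/-- A family of time-varying maps on `Ω`, continuous in space, measurable in time, locally
integrably bounded, and depending continuously in the mean on the parameter. -/
structure IsCaratheodory {E F : Type*} [NormedAddCommGroup E] [NormedAddCommGroup F] (c d : ℝ)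
    (Ω : Set E) (X : P → ℝ → E → F) : Prop where
  cont : ∀ p, ∀ t ∈ Icc c d, ContinuousOn (X p t) Ω
  meas : ∀ p, ∀ x ∈ Ω, AEStronglyMeasurable (fun t ↦ X p t x) (volume.restrict (Icc c d))
  bound : ∀ p, ∀ K ⊆ Ω, IsCompact K →
    ∃ h : ℝ → ℝ, IntegrableOn h (Icc c d) ∧ ∀ t ∈ Icc c d, ∀ x ∈ K, ‖X p t x‖ ≤ h t
  tend : ∀ p₀, ∀ K ⊆ Ω, IsCompact K → ∀ ε > 0, ∀ᶠ p in 𝓝 p₀,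
    ∫⁻ t in Icc c d, ⨆ x ∈ K, ‖X p t x - X p₀ t x‖ₑ < ε

/-- The family `X` and its first `m` derivatives in space are Carathéodory families. -/
def IsCaratheodoryC (c d : ℝ) : (m : ℕ) → {E : Type u} → [NormedAddCommGroup E] →
    [NormedSpace ℝ E] → {F : Type v} → [NormedAddCommGroup F] → [NormedSpace ℝ F] →
    (Ω : Set E) → (X : P → ℝ → E → F) → Prop
  | 0, _, _, _, _, _, _, Ω, X => IsCaratheodory c d Ω X
  | m + 1, _, _, _, _, _, _, Ω, X => IsCaratheodory c d Ω X ∧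
      (∀ p, ∀ t ∈ Icc c d, DifferentiableOn ℝ (X p t) Ω) ∧
      IsCaratheodoryC c d m (Ω ×ˢ univ) (fun p t ↦ tmap (X p t))

/-- The maps `f p`, `p ∈ O`, are of class `C^m` on `W`, and their derivatives up to order `m` are
jointly continuous. -/
def IsJointC (O : Set P) : (m : ℕ) → {E : Type u} → [NormedAddCommGroup E] →
    [NormedSpace ℝ E] → {F : Type v} → [NormedAddCommGroup F] → [NormedSpace ℝ F] →
    (W : Set E) → (f : P → E → F) → Prop
  | 0, _, _, _, _, _, _, W, f => ContinuousOn (fun z : P × _ ↦ f z.1 z.2) (O ×ˢ W)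
  | m + 1, _, _, _, _, _, _, W, f => ContinuousOn (fun z : P × _ ↦ f z.1 z.2) (O ×ˢ W) ∧
      (∀ p ∈ O, DifferentiableOn ℝ (f p) W) ∧
      IsJointC O m (W ×ˢ univ) (fun p ↦ tmap (f p))

variable {E : Type u} [NormedAddCommGroup E] [NormedSpace ℝ E]
  {F : Type v} [NormedAddCommGroup F] [NormedSpace ℝ F]

theorem IsCaratheodoryC.zero {c d : ℝ} {m : ℕ} {Ω : Set E} {X : P → ℝ → E → F}
    (h : IsCaratheodoryC c d m Ω X) : IsCaratheodory c d Ω X := by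
  cases m with
  | zero => exact h
  | succ m => exact h.1

/-- A jointly continuous family of solutions of the integral equations of `X p`. -/
structure IsSolFamily (X : P → ℝ → E → E) (c d a : ℝ) (Ω : Set E) (O : Set P) (W : Set E)
    (ξ : P → E → ℝ → E) : Prop where
  sol : ∀ p ∈ O, ∀ x ∈ W, IsSol (X p) c d a Ω x (ξ p x)
  unif : ∀ p₀ ∈ O, ∀ x₀ ∈ W, ∀ ε > 0, ∀ᶠ z in 𝓝 (p₀, x₀), ∀ t ∈ Icc c d,
    ‖ξ z.1 z.2 t - ξ p₀ x₀ t‖ < ε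

end Classes

/-! ### Differentiability of the flow in the initial point -/

section Differentiability

variable {P : Type w} [TopologicalSpace P]
  {E : Type u} [NormedAddCommGroup E] [NormedSpace ℝ E]

/-- Here `δ` is a difference of two solutions, or its deviation from a linearization, and `e` is the
part of its velocity not controlled by `δ`. Only the total integral of `e` enters, and `G` depends
on `L` alone, which makes the estimate uniform over parameters. -/
theorem norm_le_of_gronwall {L : ℝ → ℝ} {c d a G : ℝ} (hL : IntegrableOn L (Icc c d))
    (ha : a ∈ Icc c d)
    (hG : ∀ (u : ℝ → ℝ) (k : ℝ), 0 ≤ k → ContinuousOn u (Icc c d) →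
      (∀ t ∈ Icc c d, u t ≤ k + ∫ s in uIoc a t, L s * u s) → ∀ t ∈ Icc c d, u t ≤ G * k)
    {δ f : ℝ → E} {e : ℝ → ℝ} {x : E} {k : ℝ} (hδ : ContinuousOn δ (Icc c d))
    (hf : IntegrableOn f (Icc c d))
    (hδf : ∀ t ∈ Icc c d, δ t = x + ∫ s in a..t, f s)
    (he : IntegrableOn e (Icc c d)) (he0 : ∀ t ∈ Icc c d, 0 ≤ e t)
    (hfe : ∀ t ∈ Icc c d, ‖f t‖ ≤ L t * ‖δ t‖ + e t) (hk : ‖x‖ + ∫ t in Icc c d, e t ≤ k) :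
    ∀ t ∈ Icc c d, ‖δ t‖ ≤ G * k := by
  have hsub : ∀ t ∈ Icc c d, uIoc a t ⊆ Icc c d := fun t ht ↦
    uIoc_subset_uIcc.trans (ordConnected_Icc.uIcc_subset ha ht)
  have he1 : 0 ≤ ∫ t in Icc c d, e t := setIntegral_nonneg measurableSet_Icc he0
  refine hG (fun t ↦ ‖δ t‖) k (by linarith [norm_nonneg x]) hδ.norm fun t ht ↦ ?_
  have i1 : IntegrableOn (fun s ↦ L s * ‖δ s‖) (uIoc a t) :=
    (hL.mul_continuousOn hδ.norm isCompact_Icc).mono_set (hsub t ht)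
  have i2 : IntegrableOn e (uIoc a t) := he.mono_set (hsub t ht)
  have h1 : ‖∫ s in a..t, f s‖ ≤ (∫ s in uIoc a t, L s * ‖δ s‖) + ∫ t in Icc c d, e t := by
    refine intervalIntegral.norm_integral_le_integral_norm_uIoc.trans ?_
    refine (setIntegral_mono_on (hf.mono_set (hsub t ht)).norm (i1.add i2) measurableSet_uIoc
      fun s hs ↦ hfe s (hsub t ht hs)).trans ?_
    simp only [Pi.add_apply]
    rw [integral_add i1 i2]
    refine add_le_add le_rfl ?_
    exact setIntegral_mono_set he ((ae_restrict_iff' measurableSet_Icc).2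
      (Eventually.of_forall he0)) (Eventually.of_forall (hsub t ht))
  have h2 : ‖δ t‖ ≤ ‖x‖ + ‖∫ s in a..t, f s‖ := by
    rw [hδf t ht]
    exact norm_add_le _ _
  linarith

/-- Carathéodory bounds on the tangent fields hold on compact sets such as `K` times the closed unit
ball; this turns them into bounds on operator norms. -/
theorem opNorm_le_of_tmap {F : Type*} [NormedAddCommGroup F] [NormedSpace ℝ F] {A : E →L[ℝ] F}
    {C : ℝ} (h : ∀ v ∈ Metric.closedBall (0 : E) 1, ‖A v‖ ≤ C) : ‖A‖ ≤ C := by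
  have hC : 0 ≤ C := by simpa using h 0 (by simp)
  exact ContinuousLinearMap.opNorm_le_of_unit_norm hC fun v hv ↦ h v (by simp [hv])

variable [FiniteDimensional ℝ E]

/-- Strict differentiability of the flow in the initial point, uniformly in the parameter. -/
theorem IsSolFamily.exists_strict {X : P → ℝ → E → E} {c d a : ℝ} (ha : a ∈ Icc c d)
    {Ω : Set E} (hΩ : IsOpen Ω) {O : Set P} (hO : IsOpen O) {W : Set E} (hW : IsOpen W)
    (hd : ∀ p, ∀ t ∈ Icc c d, DifferentiableOn ℝ (X p t) Ω)
    (hT : IsCaratheodory c d (Ω ×ˢ univ) (fun p t ↦ tmap (X p t)))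
    {ξ : P → E → ℝ → E} (hξ : IsSolFamily X c d a Ω O W ξ) {p₀ : P} (hp₀ : p₀ ∈ O) {x₀ : E}
    (hx₀ : x₀ ∈ W) :
    ∃ V : ℝ → E →L[ℝ] E, (∀ v, IsSol (fun t y ↦ fderiv ℝ (X p₀ t) (ξ p₀ x₀ t) y) c d a univ v
        (fun t ↦ V t v)) ∧ (∃ G, ∀ t ∈ Icc c d, ‖V t‖ ≤ G) ∧
      ∀ ε > 0, ∃ N ∈ 𝓝 p₀, ∃ r > 0, ∀ p ∈ N, ∀ x ∈ Metric.ball x₀ r, ∀ x' ∈ Metric.ball x₀ r,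
        ∀ t ∈ Icc c d, ‖ξ p x' t - ξ p x t - V t (x' - x)‖ ≤ ε * ‖x' - x‖ := by
  have hcE : CompleteSpace E := FiniteDimensional.complete ℝ E
  have hpE : ProperSpace E := FiniteDimensional.proper ℝ E
  set γ := ξ p₀ x₀ with hγ
  have hγs := hξ.sol p₀ hp₀ x₀ hx₀
  -- A compact tube around the reference trajectory. It contains the closed balls about `γ t`, whose
  -- convexity is needed for the mean value inequality.
  obtain ⟨r₀, hr₀, hKΩ⟩ := (isCompact_Icc.image_of_continuousOn hγs.cont).exists_cthickening_subset_open
    hΩ (image_subset_iff.2 hγs.mem)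
  set K := Metric.cthickening r₀ (γ '' Icc c d) with hK
  have hKc : IsCompact K := (isCompact_Icc.image_of_continuousOn hγs.cont).cthickening
  have hballK : ∀ t ∈ Icc c d, ∀ ρ ≤ r₀, Metric.closedBall (γ t) ρ ⊆ K := fun t ht ρ hρ ↦
    (Metric.closedBall_subset_closedBall hρ).trans
      (Metric.closedBall_subset_cthickening (mem_image_of_mem _ ht) _)
  set K' : Set (E × E) := K ×ˢ Metric.closedBall 0 1 with hK'
  have hK'c : IsCompact K' := hKc.prod (isCompact_closedBall 0 1)
  have hK'Ω : K' ⊆ Ω ×ˢ univ := prod_mono hKΩ (subset_univ _)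
  obtain ⟨L, hL, hLb⟩ := hT.bound p₀ K' hK'Ω hK'c
  set B : ℝ → E →L[ℝ] E := fun t ↦ fderiv ℝ (X p₀ t) (γ t) with hB
  have hγK : ∀ t ∈ Icc c d, γ t ∈ K := fun t ht ↦
    hballK t ht r₀ le_rfl (Metric.mem_closedBall_self hr₀.le)
  have hBL : ∀ t ∈ Icc c d, ‖B t‖ ≤ L t := fun t ht ↦ opNorm_le_of_tmap fun v hv ↦
    (norm_snd_le (tmap (X p₀ t) (γ t, v))).trans (hLb t ht (γ t, v) ⟨hγK t ht, hv⟩)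
  have hL0 : ∀ t ∈ Icc c d, 0 ≤ L t := fun t ht ↦ (norm_nonneg _).trans (hBL t ht)
  have hBm : ∀ y : ℝ → E, ContinuousOn y (Icc c d) →
      IntegrableOn (fun t ↦ B t (y t)) (Icc c d) := by
    intro y hy
    obtain ⟨C, hC⟩ := isCompact_Icc.exists_bound_of_continuousOn hy
    have hm := aestronglyMeasurable_caratheodory (hT.cont p₀) (hT.meas p₀)
      (γ := fun t ↦ (γ t, y t)) (hγs.cont.prodMk hy) (fun t ht ↦ ⟨hγs.mem t ht, mem_univ _⟩)
    refine Integrable.mono' (hL.mul_const C) (continuous_snd.comp_aestronglyMeasurable hm) ?_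
    refine (ae_restrict_iff' measurableSet_Icc).2 (Eventually.of_forall fun t ht ↦ ?_)
    refine ((B t).le_opNorm (y t)).trans ?_
    exact mul_le_mul (hBL t ht) (hC t ht) (norm_nonneg _) (hL0 t ht)
  obtain ⟨G, hG1, hG⟩ := exists_gronwall hL hL0 ha
  have hG0 : 0 < G := by linarith
  have hq : ∀ v : E, ∃ q, IsSol (fun t y ↦ B t y) c d a univ v q := fun v ↦
    exists_isSol_of_lipschitz ha (fun x ↦ (hBm (fun _ ↦ x) continuousOn_const).aestronglyMeasurable)
      hL hL0 (fun t ht x y ↦ by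
        rw [← map_sub]
        exact ((B t).le_opNorm _).trans (by gcongr; exact hBL t ht))
      (integrableOn_zero) (fun t ht ↦ by simp) v
  choose q hq using hq
  -- Uniqueness for the homogeneous variational equation; it makes the solution linear in its
  -- initial value.
  have hlin0 : ∀ (δ : ℝ → E), ContinuousOn δ (Icc c d) →
      (∀ t ∈ Icc c d, δ t = 0 + ∫ s in a..t, B s (δ s)) → ∀ t ∈ Icc c d, δ t = 0 := by
    intro δ hδ hδe t ht
    have := norm_le_of_gronwall hL ha hG (k := 0) (e := fun _ ↦ 0) hδ (hBm δ hδ) hδe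
      integrableOn_zero (fun _ _ ↦ le_rfl) (fun t ht ↦ by
        rw [add_zero]
        exact ((B t).le_opNorm _).trans (by gcongr; exact hBL t ht)) (by simp) t ht
    simpa using this
  have hii : ∀ v, ∀ t ∈ Icc c d, IntervalIntegrable (fun s ↦ B s (q v s)) volume a t :=
    fun v t ht ↦ intervalIntegrable_of_Icc (hq v).int ha ht
  have hadd : ∀ v w, ∀ t ∈ Icc c d, q (v + w) t = q v t + q w t := by
    intro v w t ht
    have := hlin0 (fun t ↦ q (v + w) t - (q v t + q w t))
      ((hq _).cont.sub ((hq v).cont.add (hq w).cont)) (fun t ht ↦ by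
        simp only [map_sub, map_add]
        rw [intervalIntegral.integral_sub (hii _ t ht) ((hii v t ht).add (hii w t ht)),
          intervalIntegral.integral_add (hii v t ht) (hii w t ht), (hq (v + w)).eq t ht,
          (hq v).eq t ht, (hq w).eq t ht]
        abel) t ht
    exact sub_eq_zero.1 this
  have hsmul : ∀ (k : ℝ) v, ∀ t ∈ Icc c d, q (k • v) t = k • q v t := by
    intro k v t ht
    have := hlin0 (fun t ↦ q (k • v) t - k • q v t)
      ((hq _).cont.sub ((hq v).cont.const_smul k)) (fun t ht ↦ by
        simp only [map_sub, map_smul]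
        have hsm : IntervalIntegrable (fun s ↦ k • B s (q v s)) volume a t := (hii v t ht).smul k
        rw [intervalIntegral.integral_sub (hii _ t ht) hsm,
          intervalIntegral.integral_smul, (hq (k • v)).eq t ht, (hq v).eq t ht, smul_add]
        abel) t ht
    exact sub_eq_zero.1 this
  classical
  set V : ℝ → E →L[ℝ] E := fun t ↦ if ht : t ∈ Icc c d then
    LinearMap.toContinuousLinearMap
      { toFun := fun v ↦ q v t
        map_add' := fun v w ↦ hadd v w t ht
        map_smul' := fun k v ↦ hsmul k v t ht } else 0 with hV
  have hVq : ∀ t ∈ Icc c d, ∀ v, V t v = q v t := fun t ht v ↦ by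
    simp only [hV, dif_pos ht]
    rfl
  have hVs : ∀ v, IsSol (fun t y ↦ B t y) c d a univ v (fun t ↦ V t v) := fun v ↦ by
    refine ⟨(hq v).cont.congr fun t ht ↦ hVq t ht v, fun _ _ ↦ mem_univ _,
      (hq v).int.congr_fun (fun t ht ↦ by simp only [hVq t ht v]) measurableSet_Icc, fun t ht ↦ ?_⟩
    rw [hVq t ht, (hq v).eq t ht]
    congr 1
    refine intervalIntegral.integral_congr fun s hs ↦ ?_
    simp only [hVq s (ordConnected_Icc.uIcc_subset ha ht hs)]
  have hVG : ∀ v, ∀ t ∈ Icc c d, ‖V t v‖ ≤ G * ‖v‖ := fun v ↦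
    norm_le_of_gronwall hL ha hG (e := fun _ ↦ 0) (hVs v).cont (hVs v).int (hVs v).eq
      integrableOn_zero (fun _ _ ↦ le_rfl) (fun t ht ↦ by
        rw [add_zero]
        exact ((B t).le_opNorm _).trans (by gcongr; exact hBL t ht)) (by simp)
  refine ⟨V, hVs, ⟨G, fun t ht ↦ ContinuousLinearMap.opNorm_le_bound _ hG0.le fun v ↦ hVG v t ht⟩,
    fun ε hε ↦ ?_⟩
  -- The argument ends with `D ≤ G * κ * (D + G * ‖x' - x‖)`. The first condition on `κ` absorbs the
  -- term in `D`; the second turns what remains into `ε * ‖x' - x‖`.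
  obtain ⟨κ, hκ0, hκ1, hκ2⟩ : ∃ κ > 0, G * κ ≤ 1 / 2 ∧ 2 * G ^ 2 * κ ≤ ε := by
    refine ⟨min (1 / (2 * G)) (ε / (2 * G ^ 2)), by positivity, ?_, ?_⟩
    · calc G * min (1 / (2 * G)) (ε / (2 * G ^ 2)) ≤ G * (1 / (2 * G)) := by
            gcongr; exact min_le_left _ _
        _ = 1 / 2 := by field_simp
    · calc 2 * G ^ 2 * min (1 / (2 * G)) (ε / (2 * G ^ 2)) ≤ 2 * G ^ 2 * (ε / (2 * G ^ 2)) := by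
            gcongr; exact min_le_right _ _
        _ = ε := by field_simp
  obtain ⟨ρ', hρ', w, hwm, hw, hwb⟩ := exists_modulus hK'c
    (fun t ht ↦ (hT.cont p₀ t ht).mono hK'Ω) (fun x hx ↦ hT.meas p₀ x (hK'Ω hx)) hL hLb
    (ε := ENNReal.ofReal (κ / 2)) (by simpa using hκ0)
  set ρ := min ρ' r₀ with hρ
  have hρ0 : 0 < ρ := lt_min hρ' hr₀
  have hN := hξ.unif p₀ hp₀ x₀ hx₀ ρ hρ0
  obtain ⟨N₁, hN₁, N₂, hN₂, hN12⟩ := mem_nhds_prod_iff.1 hN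
  obtain ⟨r, hr, hrN⟩ := Metric.mem_nhds_iff.1 (inter_mem hN₂ (hW.mem_nhds hx₀))
  refine ⟨_, inter_mem (inter_mem hN₁ (hO.mem_nhds hp₀)) (hT.tend p₀ K' hK'Ω hK'c
    (ENNReal.ofReal (κ / 2)) (by simpa using hκ0)), r, hr, ?_⟩
  rintro p ⟨⟨hpN, hpO⟩, hpS⟩ x hx x' hx'
  have hsx := hξ.sol p hpO x (hrN hx).2
  have hsx' := hξ.sol p hpO x' (hrN hx').2
  have hxb : ∀ t ∈ Icc c d, ξ p x t ∈ Metric.closedBall (γ t) ρ := fun t ht ↦ by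
    rw [mem_closedBall_iff_norm]
    exact ((hN12 (mk_mem_prod hpN (hrN hx).1)) t ht).le
  have hxb' : ∀ t ∈ Icc c d, ξ p x' t ∈ Metric.closedBall (γ t) ρ := fun t ht ↦ by
    rw [mem_closedBall_iff_norm]
    exact ((hN12 (mk_mem_prod hpN (hrN hx').1)) t ht).le
  set δ : ℝ → E := fun t ↦ ξ p x' t - ξ p x t - V t (x' - x) with hδ
  have hδc : ContinuousOn δ (Icc c d) := (hsx'.cont.sub hsx.cont).sub (hVs _).cont
  obtain ⟨t', ht', hmax⟩ := isCompact_Icc.exists_isMaxOn ⟨a, ha⟩ hδc.norm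
  set D := ‖δ t'‖ with hD
  have hDb : ∀ t ∈ Icc c d, ‖δ t‖ ≤ D := fun t ht ↦ hmax ht
  have hD0 : 0 ≤ D := norm_nonneg _
  set f : ℝ → E := fun t ↦ X p t (ξ p x' t) - X p t (ξ p x t) - B t (V t (x' - x)) with hf
  have hfi : IntegrableOn f (Icc c d) := (hsx'.int.sub hsx.int).sub (hVs _).int
  -- The error against the linearization at `p₀` along `γ`. By the mean value inequality it is at
  -- most the increment times `S t + w t`: `S` measures the change of parameter, `w` the oscillation
  -- in space of the derivative at `p₀`.
  set e : ℝ → E := fun t ↦ X p t (ξ p x' t) - X p t (ξ p x t) - B t (ξ p x' t - ξ p x t) with he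
  have hei : IntegrableOn e (Icc c d) := (hsx'.int.sub hsx.int).sub
    (hBm _ (hsx'.cont.sub hsx.cont))
  have hδf : ∀ t ∈ Icc c d, δ t = 0 + ∫ s in a..t, f s := fun t ht ↦ by
    have i1 := intervalIntegrable_of_Icc hsx.int ha ht
    have i2 := intervalIntegrable_of_Icc hsx'.int ha ht
    have i3 := intervalIntegrable_of_Icc (hVs (x' - x)).int ha ht
    simp only [hf, hδ]
    rw [intervalIntegral.integral_sub (i2.sub i1) i3, intervalIntegral.integral_sub i2 i1,
      hsx.eq t ht, hsx'.eq t ht, (hVs (x' - x)).eq t ht]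
    abel
  set Wm := D + G * ‖x' - x‖ with hWm
  have hWm0 : 0 ≤ Wm := by positivity
  have hwd : ∀ t ∈ Icc c d, ‖ξ p x' t - ξ p x t‖ ≤ Wm := fun t ht ↦ by
    have : ξ p x' t - ξ p x t = δ t + V t (x' - x) := by simp [hδ]
    rw [this]
    exact (norm_add_le _ _).trans (add_le_add (hDb t ht) (hVG _ t ht))
  set S : ℝ → ℝ≥0∞ := fun t ↦ ⨆ z ∈ K', ‖tmap (X p t) z - tmap (X p₀ t) z‖ₑ with hS
  have heb : ∀ t ∈ Icc c d, ‖e t‖ₑ ≤ ENNReal.ofReal Wm * (S t + w t) := by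
    intro t ht
    have hmv : ∀ C : ℝ, 0 ≤ C → S t + w t ≤ ENNReal.ofReal C → ‖e t‖ ≤ C * Wm := by
      intro C hC0 hC
      have hder : ∀ y ∈ Metric.closedBall (γ t) ρ, HasFDerivWithinAt (X p t)
          (fderiv ℝ (X p t) y) (Metric.closedBall (γ t) ρ) y := fun y hy ↦
        (((hd p t ht).differentiableAt (hΩ.mem_nhds
          (hKΩ (hballK t ht ρ (min_le_right _ _) hy)))).hasFDerivAt).hasFDerivWithinAt
      have hbd : ∀ y ∈ Metric.closedBall (γ t) ρ, ‖fderiv ℝ (X p t) y - B t‖ ≤ C := by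
        intro y hy
        refine opNorm_le_of_tmap fun v hv ↦ ?_
        have hyK : (y, v) ∈ K' := ⟨hballK t ht ρ (min_le_right _ _) hy, hv⟩
        have h1 : ‖tmap (X p t) (y, v) - tmap (X p₀ t) (y, v)‖ₑ ≤ S t :=
          le_biSup (fun z ↦ ‖tmap (X p t) z - tmap (X p₀ t) z‖ₑ) hyK
        have h2 : ‖tmap (X p₀ t) (y, v) - tmap (X p₀ t) (γ t, v)‖ₑ ≤ w t := by
          refine hwb t ht _ hyK _ ⟨hγK t ht, hv⟩ ?_
          rw [Prod.dist_eq, dist_self, max_eq_left dist_nonneg]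
          exact (Metric.mem_closedBall.1 hy).trans (min_le_left _ _)
        have h3 : ‖tmap (X p t) (y, v) - tmap (X p₀ t) (γ t, v)‖ₑ ≤ ENNReal.ofReal C := by
          refine le_trans ?_ ((add_le_add h1 h2).trans hC)
          rw [← sub_add_sub_cancel _ (tmap (X p₀ t) (y, v))]
          exact enorm_add_le _ _
        rw [← ofReal_norm, ENNReal.ofReal_le_ofReal_iff hC0] at h3
        exact (norm_snd_le (tmap (X p t) (y, v) - tmap (X p₀ t) (γ t, v))).trans h3
      have := (convex_closedBall (γ t) ρ).norm_image_sub_le_of_norm_hasFDerivWithin_le' hder hbd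
        (hxb t ht) (hxb' t ht)
      exact this.trans (by gcongr; exact hwd t ht)
    -- At times where the supremum is infinite the bound is trivial, unless `Wm = 0`; then the two
    -- trajectories coincide and `e t` vanishes.
    rcases eq_or_ne (S t + w t) ⊤ with htop | htop
    · rcases hWm0.eq_or_lt with h0 | h0
      · have : ξ p x' t = ξ p x t := by
          have := hwd t ht
          rw [← h0] at this
          exact sub_eq_zero.1 (norm_le_zero_iff.1 this)
        simp [he, this]
      · rw [htop, ENNReal.mul_top (by simpa using h0)]
        exact le_top
    · have := hmv (S t + w t).toReal ENNReal.toReal_nonneg (ENNReal.ofReal_toReal htop).ge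
      rw [← ofReal_norm]
      refine (ENNReal.ofReal_le_ofReal this).trans ?_
      rw [ENNReal.ofReal_mul ENNReal.toReal_nonneg, ENNReal.ofReal_toReal htop, mul_comm]
  -- Splitting the integral uses measurability of `w` only; `S` is a supremum over an uncountable
  -- set and is not shown to be measurable.
  have hek : ∫ t in Icc c d, ‖e t‖ ≤ Wm * κ := by
    rw [integral_norm_eq_lintegral_enorm hei.aestronglyMeasurable]
    refine ENNReal.toReal_le_of_le_ofReal (by positivity) ?_
    calc ∫⁻ t in Icc c d, ‖e t‖ₑ ≤ ∫⁻ t in Icc c d, ENNReal.ofReal Wm * (S t + w t) :=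
          setLIntegral_mono' measurableSet_Icc heb
      _ = ENNReal.ofReal Wm * ((∫⁻ t in Icc c d, S t) + ∫⁻ t in Icc c d, w t) := by
          rw [lintegral_const_mul' _ _ ENNReal.ofReal_ne_top, lintegral_add_right' _ hwm]
      _ ≤ ENNReal.ofReal Wm * (ENNReal.ofReal (κ / 2) + ENNReal.ofReal (κ / 2)) := by
          gcongr
          exact hpS.le
      _ = ENNReal.ofReal (Wm * κ) := by
          rw [← ENNReal.ofReal_add (by positivity) (by positivity), add_halves,
            ENNReal.ofReal_mul hWm0]
  have hfin := norm_le_of_gronwall hL ha hG (k := Wm * κ) (e := fun t ↦ ‖e t‖) hδc hfi hδf hei.norm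
    (fun _ _ ↦ norm_nonneg _) (fun t ht ↦ by
      have : f t = B t (δ t) + e t := by simp only [hf, hδ, he, map_sub]; abel
      rw [this]
      refine (norm_add_le _ _).trans (add_le_add (((B t).le_opNorm _).trans ?_) le_rfl)
      gcongr
      exact hBL t ht) (by simpa using hek)
  have hD1 : D ≤ G * (Wm * κ) := hfin t' ht'
  have hD2 : D ≤ ε * ‖x' - x‖ := by
    have h1 : G * (Wm * κ) = (G * κ) * D + G ^ 2 * κ * ‖x' - x‖ := by rw [hWm]; ring
    have h2 : (G * κ) * D ≤ 1 / 2 * D := by gcongr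
    have h3 : 2 * G ^ 2 * κ * ‖x' - x‖ ≤ ε * ‖x' - x‖ := by gcongr
    linarith
  exact fun t ht ↦ (hDb t ht).trans hD2

/-- The tangent maps of a family of solutions solve the variational equations. -/
theorem IsSolFamily.tmap {X : P → ℝ → E → E} {c d a : ℝ} (ha : a ∈ Icc c d)
    {Ω : Set E} (hΩ : IsOpen Ω) {O : Set P} (hO : IsOpen O) {W : Set E} (hW : IsOpen W)
    (hd : ∀ p, ∀ t ∈ Icc c d, DifferentiableOn ℝ (X p t) Ω)
    (hT : IsCaratheodory c d (Ω ×ˢ univ) (fun p t ↦ tmap (X p t)))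
    {ξ : P → E → ℝ → E} (hξ : IsSolFamily X c d a Ω O W ξ) :
    (∀ p ∈ O, ∀ t ∈ Icc c d, DifferentiableOn ℝ (fun x ↦ ξ p x t) W) ∧
    IsSolFamily (fun p t ↦ ParamFlow.tmap (X p t)) c d a (Ω ×ˢ univ) O (W ×ˢ univ)
      (fun p z t ↦ ParamFlow.tmap (fun x ↦ ξ p x t) z) := by
  have hcE : CompleteSpace E := FiniteDimensional.complete ℝ E
  have hder : ∀ p ∈ O, ∀ x ∈ W, ∃ V : ℝ → E →L[ℝ] E,
      (∀ v, IsSol (fun t y ↦ fderiv ℝ (X p t) (ξ p x t) y) c d a univ v (fun t ↦ V t v)) ∧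
      (∃ G, ∀ t ∈ Icc c d, ‖V t‖ ≤ G) ∧
      (∀ t ∈ Icc c d, HasFDerivAt (fun y ↦ ξ p y t) (V t) x) ∧
      ∀ ε > 0, ∃ N ∈ 𝓝 p, ∃ r > 0, ∀ p' ∈ N, ∀ y ∈ Metric.ball x r, ∀ y' ∈ Metric.ball x r,
        ∀ t ∈ Icc c d, ‖ξ p' y' t - ξ p' y t - V t (y' - y)‖ ≤ ε * ‖y' - y‖ := by
    intro p hp x hx
    obtain ⟨V, hV, hG, hV'⟩ := hξ.exists_strict ha hΩ hO hW hd hT hp hx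
    refine ⟨V, hV, hG, fun t ht ↦ ?_, hV'⟩
    rw [hasFDerivAt_iff_isLittleO, Asymptotics.isLittleO_iff]
    intro ε hε
    obtain ⟨N, hN, r, hr, h⟩ := hV' ε hε
    filter_upwards [Metric.ball_mem_nhds x hr] with y hy
    exact h p (mem_of_mem_nhds hN) x (Metric.mem_ball_self hr) y hy t ht
  refine ⟨fun p hp t ht x hx ↦ ?_, ?_, ?_⟩
  · obtain ⟨V, -, -, hV, -⟩ := hder p hp x hx
    exact (hV t ht).differentiableAt.differentiableWithinAt
  · rintro p hp ⟨x, v⟩ ⟨hx, -⟩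
    obtain ⟨V, hVs, -, hV, -⟩ := hder p hp x hx
    have hs := hξ.sol p hp x hx
    have heq : ∀ t ∈ Icc c d, ParamFlow.tmap (fun x ↦ ξ p x t) (x, v) = (ξ p x t, V t v) :=
      fun t ht ↦ by simp only [ParamFlow.tmap, (hV t ht).fderiv]
    have hInt : IntegrableOn (fun t ↦ ParamFlow.tmap (X p t) (ξ p x t, V t v)) (Icc c d) :=
      hs.int.prodMk (hVs v).int
    refine ⟨(hs.cont.prodMk (hVs v).cont).congr heq, fun t ht ↦ ?_,
      hInt.congr_fun (fun t ht ↦ by simp only [heq t ht]) measurableSet_Icc, fun t ht ↦ ?_⟩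
    · simp only [heq t ht]
      exact ⟨hs.mem t ht, mem_univ _⟩
    · simp only [heq t ht]
      have e1 : (∫ s in a..t, ParamFlow.tmap (X p s) (ParamFlow.tmap (fun x ↦ ξ p x s) (x, v)))
          = ∫ s in a..t, ParamFlow.tmap (X p s) (ξ p x s, V s v) :=
        intervalIntegral.integral_congr fun s hs ↦ by
          simp only [heq s (ordConnected_Icc.uIcc_subset ha ht hs)]
      have hii := intervalIntegrable_of_Icc hInt ha ht
      have e2 := (ContinuousLinearMap.fst ℝ E E).intervalIntegral_comp_comm hii
      have e3 := (ContinuousLinearMap.snd ℝ E E).intervalIntegral_comp_comm hii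
      rw [e1]
      refine Prod.ext ?_ ?_
      · simp only [Prod.fst_add]
        rw [hs.eq t ht]
        exact congrArg _ e2
      · simp only [Prod.snd_add]
        rw [(hVs v).eq t ht]
        exact congrArg _ e3
  · rintro p₀ hp₀ ⟨x₀, v₀⟩ ⟨hx₀, -⟩ ε hε
    obtain ⟨V, hVs, ⟨G, hG⟩, hV, hV'⟩ := hder p₀ hp₀ x₀ hx₀
    have hG0 : 0 ≤ G := (norm_nonneg _).trans (hG a ha)
    set κ := ε / (2 * (‖v₀‖ + 1)) with hκ
    have hκ0 : 0 < κ := by positivity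
    obtain ⟨N, hN, r, hr, hNr⟩ := hV' κ hκ0
    have h1 := hξ.unif p₀ hp₀ x₀ hx₀ ε hε
    have hproj : Tendsto (fun z : P × E × E ↦ (z.1, z.2.1)) (𝓝 (p₀, x₀, v₀)) (𝓝 (p₀, x₀)) :=
      (Continuous.tendsto (by fun_prop) _)
    have h2 : ∀ᶠ z : P × E × E in 𝓝 (p₀, x₀, v₀), ‖z.2.2 - v₀‖ < min 1 (ε / (2 * (G + 1))) := by
      have : Tendsto (fun z : P × E × E ↦ ‖z.2.2 - v₀‖) (𝓝 (p₀, x₀, v₀)) (𝓝 ‖v₀ - v₀‖) :=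
        Continuous.tendsto (by fun_prop) _
      refine this.eventually_lt_const ?_
      rw [sub_self, norm_zero]
      positivity
    have h3 : ∀ᶠ z : P × E × E in 𝓝 (p₀, x₀, v₀), z.1 ∈ N ∩ O ∧ z.2.1 ∈ Metric.ball x₀ r ∩ W :=
      hproj.eventually (prod_mem_nhds (inter_mem hN (hO.mem_nhds hp₀))
        (inter_mem (Metric.ball_mem_nhds x₀ hr) (hW.mem_nhds hx₀)))
    filter_upwards [hproj.eventually h1, h2, h3] with z hz1 hz2 hz3 t ht
    obtain ⟨p, x, v⟩ := z
    obtain ⟨⟨hpN, hpO⟩, hxr, hxW⟩ := hz3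
    obtain ⟨A, -, -, hA, -⟩ := hder p hpO x hxW
    -- The strict estimate at `(p₀, x₀)` holds for nearby parameters and nearby pairs of points, so
    -- it bounds the derivative at `(p, x)` directly. Joint continuity of the derivative thus needs
    -- no separate perturbation argument for the variational equation.
    have hAV : ‖A t - V t‖ ≤ κ := by
      refine ((hA t ht).sub (V t).hasFDerivAt).le_of_lip' hκ0.le ?_
      filter_upwards [Metric.isOpen_ball.mem_nhds hxr] with x' hx'
      have := hNr p hpN x hxr x' hx' t ht
      rw [map_sub] at this
      convert this using 2
      simp only [Pi.sub_apply]
      abel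
    simp only [ParamFlow.tmap, (hA t ht).fderiv, (hV t ht).fderiv, Prod.mk_sub_mk, Prod.norm_mk]
    refine max_lt (hz1 t ht) ?_
    simp only at hz2
    have e : A t v - V t v₀ = (A t - V t) v + V t (v - v₀) := by
      simp only [sub_apply, map_sub]; abel
    have hv : ‖v‖ < ‖v₀‖ + 1 := by
      have := norm_le_norm_add_norm_sub' v v₀
      linarith [hz2.trans_le (min_le_left _ _)]
    have b1 : ‖(A t - V t) v‖ < ε / 2 := by
      calc ‖(A t - V t) v‖ ≤ κ * ‖v‖ := ((A t - V t).le_opNorm v).trans (by gcongr)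
        _ < κ * (‖v₀‖ + 1) := by gcongr
        _ = ε / 2 := by rw [hκ]; field_simp
    have b2 : ‖V t (v - v₀)‖ ≤ ε / 2 := by
      calc ‖V t (v - v₀)‖ ≤ G * ‖v - v₀‖ := ((V t).le_opNorm _).trans (by gcongr; exact hG t ht)
        _ ≤ (G + 1) * (ε / (2 * (G + 1))) := by
          gcongr
          · linarith
          · exact (hz2.trans_le (min_le_right _ _)).le
        _ = ε / 2 := by field_simp
    rw [e]
    linarith [norm_add_le ((A t - V t) v) (V t (v - v₀))]

/-- Families of solutions inherit the regularity of the field. -/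
theorem IsSolFamily.isJointC {c d a : ℝ} (ha : a ∈ Icc c d) {O : Set P} (hO : IsOpen O) (m : ℕ) :
    ∀ {E : Type u} [NormedAddCommGroup E] [NormedSpace ℝ E] [FiniteDimensional ℝ E]
      {X : P → ℝ → E → E} {Ω : Set E} (_ : IsOpen Ω) {W : Set E} (_ : IsOpen W)
      (_ : IsCaratheodoryC c d m Ω X) {ξ : P → E → ℝ → E} (_ : IsSolFamily X c d a Ω O W ξ),
      ∀ t ∈ Icc c d, IsJointC O m W (fun p x ↦ ξ p x t) := by
  have hcont : ∀ {E : Type u} [NormedAddCommGroup E] [NormedSpace ℝ E]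
      {X : P → ℝ → E → E} {Ω : Set E} {W : Set E} {ξ : P → E → ℝ → E}
      (_ : IsSolFamily X c d a Ω O W ξ),
      ∀ t ∈ Icc c d, ContinuousOn (fun z : P × E ↦ ξ z.1 z.2 t) (O ×ˢ W) := by
    intro E _ _ X Ω W ξ hξ t ht z hz
    refine ContinuousAt.continuousWithinAt ?_
    rw [ContinuousAt, Metric.tendsto_nhds]
    intro ε hε
    filter_upwards [hξ.unif z.1 hz.1 z.2 hz.2 ε hε] with z' hz'
    rw [dist_eq_norm]
    exact hz' t ht
  induction m with
  | zero =>
    intro E _ _ _ X Ω _ W _ _ ξ hξ t ht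
    exact hcont hξ t ht
  | succ m ih =>
    intro E _ _ _ X Ω hΩ W hW hX ξ hξ t ht
    -- The tangent maps are again a family of solutions, now on `E × E` for the tangent fields,
    -- which have one derivative less. The induction therefore ranges over all finite-dimensional
    -- spaces.
    obtain ⟨h1, h2⟩ := hξ.tmap ha hΩ hO hW hX.2.1 hX.2.2.zero
    exact ⟨hcont hξ t ht, fun p hp ↦ h1 p hp t ht,
      ih (hΩ.prod isOpen_univ) (hW.prod isOpen_univ) hX.2.2 h2 t ht⟩

end Differentiability

/-! ### Calculus of jointly `C^m` families -/

section JointC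

variable {P : Type w} [TopologicalSpace P] {O : Set P}

theorem IsJointC.continuousOn {m : ℕ} {E : Type u} [NormedAddCommGroup E] [NormedSpace ℝ E]
    {F : Type v} [NormedAddCommGroup F] [NormedSpace ℝ F] {W : Set E} {f : P → E → F}
    (h : IsJointC O m W f) : ContinuousOn (fun z : P × E ↦ f z.1 z.2) (O ×ˢ W) := by
  cases m with
  | zero => exact h
  | succ m => exact h.1

theorem IsJointC.mono {O' : Set P} (hO : O' ⊆ O) (m : ℕ) :
    ∀ {E : Type u} [NormedAddCommGroup E] [NormedSpace ℝ E]
      {F : Type v} [NormedAddCommGroup F] [NormedSpace ℝ F] {W W' : Set E} {f : P → E → F}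
      (_ : IsJointC O m W f) (_ : W' ⊆ W), IsJointC O' m W' f := by
  induction m with
  | zero =>
    intro E _ _ F _ _ W W' f hf hW
    exact ContinuousOn.mono hf (prod_mono hO hW)
  | succ m ih =>
    intro E _ _ F _ _ W W' f hf hW
    exact ⟨hf.1.mono (prod_mono hO hW), fun p hp ↦ (hf.2.1 p (hO hp)).mono hW,
      ih hf.2.2 (prod_mono hW le_rfl)⟩

theorem tmap_congr {E F : Type*} [NormedAddCommGroup E] [NormedSpace ℝ E] [NormedAddCommGroup F]
    [NormedSpace ℝ F] {W : Set E} (hW : IsOpen W) {f g : E → F} (h : EqOn f g W) :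
    EqOn (tmap f) (tmap g) (W ×ˢ univ) := by
  rintro ⟨x, v⟩ ⟨hx, -⟩
  have : f =ᶠ[𝓝 x] g := eventually_of_mem (hW.mem_nhds hx) h
  simp only [tmap, this.fderiv_eq, h hx]

theorem IsJointC.congr (m : ℕ) :
    ∀ {E : Type u} [NormedAddCommGroup E] [NormedSpace ℝ E]
      {F : Type v} [NormedAddCommGroup F] [NormedSpace ℝ F] {W : Set E} (_ : IsOpen W)
      {f g : P → E → F} (_ : IsJointC O m W f) (_ : ∀ p ∈ O, EqOn (g p) (f p) W),
      IsJointC O m W g := by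
  induction m with
  | zero =>
    intro E _ _ F _ _ W hW f g hf h
    exact ContinuousOn.congr hf fun z hz ↦ h z.1 hz.1 hz.2
  | succ m ih =>
    intro E _ _ F _ _ W hW f g hf h
    exact ⟨hf.1.congr fun z hz ↦ h z.1 hz.1 hz.2, fun p hp ↦ (hf.2.1 p hp).congr (h p hp),
      ih (hW.prod isOpen_univ) hf.2.2 fun p hp ↦ tmap_congr hW (h p hp)⟩

theorem tmap_comp {E F H : Type*} [NormedAddCommGroup E] [NormedSpace ℝ E] [NormedAddCommGroup F]
    [NormedSpace ℝ F] [NormedAddCommGroup H] [NormedSpace ℝ H] {f : E → F} {g : F → H} {x v : E}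
    (hg : DifferentiableAt ℝ g (f x)) (hf : DifferentiableAt ℝ f x) :
    tmap (g ∘ f) (x, v) = tmap g (tmap f (x, v)) := by
  simp only [tmap, fderiv_comp x hg hf, Function.comp_apply, ContinuousLinearMap.comp_apply]

/-- Functoriality of the tangent map reduces order `m + 1` to order `m`, so no formula for higher
derivatives of a composite is needed. -/
theorem IsJointC.comp (m : ℕ) :
    ∀ {E : Type u} [NormedAddCommGroup E] [NormedSpace ℝ E]
      {F : Type v} [NormedAddCommGroup F] [NormedSpace ℝ F]
      {H : Type*} [NormedAddCommGroup H] [NormedSpace ℝ H]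
      {W : Set E} (_ : IsOpen W) {W' : Set F} (_ : IsOpen W')
      {f : P → E → F} {g : P → F → H} (_ : IsJointC O m W' g) (_ : IsJointC O m W f)
      (_ : ∀ p ∈ O, MapsTo (f p) W W'), IsJointC O m W (fun p ↦ g p ∘ f p) := by
  have hcont : ∀ {E : Type u} [NormedAddCommGroup E]
      {F : Type v} [NormedAddCommGroup F] {H : Type _} [NormedAddCommGroup H]
      {W : Set E} {W' : Set F} {f : P → E → F} {g : P → F → H}
      (_ : ContinuousOn (fun z : P × F ↦ g z.1 z.2) (O ×ˢ W'))
      (_ : ContinuousOn (fun z : P × E ↦ f z.1 z.2) (O ×ˢ W))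
      (_ : ∀ p ∈ O, MapsTo (f p) W W'),
      ContinuousOn (fun z : P × E ↦ (g z.1 ∘ f z.1) z.2) (O ×ˢ W) := by
    intro E _ F _ H _ W W' f g hg hf h
    exact hg.comp (continuousOn_fst.prodMk hf) fun z hz ↦ ⟨hz.1, h z.1 hz.1 hz.2⟩
  induction m with
  | zero =>
    intro E _ _ F _ _ H _ _ W hW W' hW' f g hg hf h
    exact hcont hg hf h
  | succ m ih =>
    intro E _ _ F _ _ H _ _ W hW W' hW' f g hg hf h
    refine ⟨hcont hg.1 hf.1 h, fun p hp ↦ (hg.2.1 p hp).comp (hf.2.1 p hp) (h p hp), ?_⟩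
    refine IsJointC.congr m (hW.prod isOpen_univ) (ih (hW.prod isOpen_univ) (hW'.prod isOpen_univ)
      hg.2.2 hf.2.2 fun p hp z hz ↦ ⟨h p hp hz.1, mem_univ _⟩) ?_
    rintro p hp ⟨x, v⟩ ⟨hx, -⟩
    exact tmap_comp ((hg.2.1 p hp).differentiableAt (hW'.mem_nhds (h p hp hx)))
      ((hf.2.1 p hp).differentiableAt (hW.mem_nhds hx))

theorem contDiffOn_tmap {E F : Type*} [NormedAddCommGroup E] [NormedSpace ℝ E]
    [NormedAddCommGroup F] [NormedSpace ℝ F] {W : Set E} (hW : IsOpen W) {f : E → F} {m : ℕ}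
    (hf : ContDiffOn ℝ (m + 1 : ℕ) f W) : ContDiffOn ℝ m (tmap f) (W ×ˢ univ) := by
  have h1 : ContDiffOn ℝ m (fderiv ℝ f) W :=
    hf.fderiv_of_isOpen hW (by norm_cast)
  have h2 : ContDiffOn ℝ m f W := hf.of_le (by norm_cast; omega)
  refine ContDiffOn.prodMk (h2.comp contDiffOn_fst fun z hz ↦ hz.1) ?_
  exact (h1.comp contDiffOn_fst fun z hz ↦ hz.1).clm_apply contDiffOn_snd

theorem IsJointC.of_contDiffOn (O : Set P) (m : ℕ) :
    ∀ {E : Type u} [NormedAddCommGroup E] [NormedSpace ℝ E]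
      {F : Type v} [NormedAddCommGroup F] [NormedSpace ℝ F] {W : Set E} (_ : IsOpen W)
      {f : E → F} (_ : ContDiffOn ℝ m f W), IsJointC O m W (fun _ ↦ f) := by
  have hcont : ∀ {E : Type u} [NormedAddCommGroup E]
      {F : Type v} [NormedAddCommGroup F] {W : Set E} {f : E → F} (_ : ContinuousOn f W),
      ContinuousOn (fun z : P × E ↦ f z.2) (O ×ˢ W) := by
    intro E _ F _ W f hf
    exact hf.comp continuousOn_snd fun z hz ↦ hz.2
  induction m with
  | zero =>
    intro E _ _ F _ _ W hW f hf
    exact hcont hf.continuousOn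
  | succ m ih =>
    intro E _ _ F _ _ W hW f hf
    exact ⟨hcont hf.continuousOn, fun _ _ ↦ hf.differentiableOn (by simp),
      ih (hW.prod isOpen_univ) (contDiffOn_tmap hW hf)⟩

/-- Directional derivatives of a jointly `C^(m+1)` family. -/
theorem IsJointC.fderiv_apply {m : ℕ} {E : Type u} [NormedAddCommGroup E] [NormedSpace ℝ E]
    {F : Type v} [NormedAddCommGroup F] [NormedSpace ℝ F] {W : Set E} (hW : IsOpen W)
    {f : P → E → F} (hf : IsJointC O (m + 1) W f) (v : E) :
    IsJointC O m W (fun p x ↦ fderiv ℝ (f p) x v) := by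
  have h1 : IsJointC O m W (fun (_ : P) (x : E) ↦ (x, v)) :=
    IsJointC.of_contDiffOn O m hW (contDiffOn_id.prodMk contDiffOn_const)
  have h2 : IsJointC O m univ (fun (_ : P) (z : F × F) ↦ z.2) :=
    IsJointC.of_contDiffOn O m isOpen_univ contDiffOn_snd
  have h3 := IsJointC.comp m hW (hW.prod isOpen_univ) hf.2.2 h1
    fun p hp x hx ↦ ⟨hx, mem_univ v⟩
  exact IsJointC.comp m hW isOpen_univ h2 h3 fun _ _ _ _ ↦ mem_univ _

/-- In finite dimension the derivative is of class `C^m` as soon as all directional derivatives are,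
and these are the tangent map restricted to a constant vector. -/
theorem IsJointC.contDiffOn (m : ℕ) :
    ∀ {E : Type u} [NormedAddCommGroup E] [NormedSpace ℝ E] [FiniteDimensional ℝ E]
      {F : Type v} [NormedAddCommGroup F] [NormedSpace ℝ F] {W : Set E} (_ : IsOpen W)
      {f : P → E → F} (_ : IsJointC O m W f), ∀ p ∈ O, ContDiffOn ℝ m (f p) W := by
  induction m with
  | zero =>
    intro E _ _ _ F _ _ W hW f hf p hp
    simp only [CharP.cast_eq_zero, contDiffOn_zero]
    exact hf.continuousOn.comp (continuousOn_const.prodMk continuousOn_id) fun x hx ↦ ⟨hp, hx⟩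
  | succ m ih =>
    intro E _ _ _ F _ _ W hW f hf p hp
    push_cast
    rw [contDiffOn_succ_iff_fderiv_of_isOpen hW]
    refine ⟨hf.2.1 p hp, fun h ↦ absurd h (by simp), ?_⟩
    rw [contDiffOn_clm_apply]
    exact fun v ↦ ih hW (hf.fderiv_apply hW v) p hp

theorem IsJointC.of_succ (m : ℕ) :
    ∀ {E : Type u} [NormedAddCommGroup E] [NormedSpace ℝ E]
      {F : Type v} [NormedAddCommGroup F] [NormedSpace ℝ F] {W : Set E}
      {f : P → E → F} (_ : IsJointC O (m + 1) W f), IsJointC O m W f := by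
  induction m with
  | zero => exact fun h ↦ h.1
  | succ m ih => exact fun h ↦ ⟨h.1, h.2.1, ih h.2.2⟩

theorem IsJointC.of_le {j m : ℕ} (hj : j ≤ m) {E : Type u} [NormedAddCommGroup E] [NormedSpace ℝ E]
    {F : Type v} [NormedAddCommGroup F] [NormedSpace ℝ F] {W : Set E}
    {f : P → E → F} (h : IsJointC O m W f) : IsJointC O j W f := by
  induction hj with
  | refl => exact h
  | step _ ih => exact ih (IsJointC.of_succ _ h)

/-- Joint continuity of the iterated derivatives of a jointly `C^j` family. -/
theorem IsJointC.continuousOn_iteratedFDeriv_apply {E : Type u} [NormedAddCommGroup E]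
    [NormedSpace ℝ E] [FiniteDimensional ℝ E]
    {F : Type v} [NormedAddCommGroup F] [NormedSpace ℝ F] {W : Set E} (hW : IsOpen W) (j : ℕ) :
    ∀ {f : P → E → F} (_ : IsJointC O j W f) (y : Fin j → E),
      ContinuousOn (fun z : P × E ↦ iteratedFDeriv ℝ j (f z.1) z.2 y) (O ×ˢ W) := by
  induction j with
  | zero =>
    intro f hf y
    simpa using hf.continuousOn
  | succ j ih =>
    intro f hf y
    -- The derivative in the last direction is taken first, so the induction hypothesis applies to a
    -- directional derivative with values in the same space `F`.
    refine (ih (hf.fderiv_apply hW (y (Fin.last j))) (Fin.init y)).congr ?_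
    rintro ⟨p, x⟩ ⟨hp, hx⟩
    have h1 : ContDiffOn ℝ j (fderiv ℝ (f p)) W :=
      (IsJointC.contDiffOn _ hW hf p hp).fderiv_of_isOpen hW (by norm_cast)
    have h2 := (ContinuousLinearMap.apply ℝ F (y (Fin.last j))).iteratedFDeriv_comp_left
      (h1.contDiffAt (hW.mem_nhds hx)) le_rfl
    change iteratedFDeriv ℝ (j + 1) (f p) x y = _
    rw [iteratedFDeriv_succ_apply_right]
    have h3 := congrArg (fun A ↦ A (Fin.init y)) h2
    exact h3.symm

end JointC

/-! ### Multilinear maps and bases -/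

section Multilinear

variable {E : Type*} [NormedAddCommGroup E] [NormedSpace ℝ E]
  {F : Type*} [NormedAddCommGroup F] [NormedSpace ℝ F]

/-- The bound `C` on the coordinate functionals is kept apart from the basis, because the basis will
be an orthonormal frame that varies with the point while `C` stays fixed. -/
theorem norm_multilinear_apply_le_of_basis {ι : Type*} [Fintype ι] [DecidableEq ι] {j : ℕ}
    (b : Module.Basis ι ℝ E)
    {C : ℝ} (hC : ∀ v k, |b.repr v k| ≤ C * ‖v‖) (A : MultilinearMap ℝ (fun _ : Fin j ↦ E) F)
    (v : Fin j → E) :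
    ‖A v‖ ≤ C ^ j * (∏ k, ‖v k‖) * ∑ i : Fin j → ι, ‖A (fun k ↦ b (i k))‖ := by
  have h1 : A v = ∑ i : Fin j → ι, (∏ k, b.repr (v k) (i k)) • A (fun k ↦ b (i k)) := by
    conv_lhs => rw [show v = fun k ↦ ∑ l, b.repr (v k) l • b l from
      funext fun k ↦ (b.sum_repr (v k)).symm]
    rw [MultilinearMap.map_sum]
    exact Finset.sum_congr rfl fun i _ ↦ A.map_smul_univ _ _
  rw [h1, Finset.mul_sum]
  refine (norm_sum_le _ _).trans (Finset.sum_le_sum fun i _ ↦ ?_)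
  rw [norm_smul]
  gcongr
  rw [Real.norm_eq_abs, Finset.abs_prod]
  calc ∏ k, |b.repr (v k) (i k)| ≤ ∏ k : Fin j, (C * ‖v k‖) :=
        Finset.prod_le_prod (fun _ _ ↦ abs_nonneg _) fun k _ ↦ hC _ _
    _ = C ^ j * ∏ k, ‖v k‖ := by rw [Finset.prod_mul_distrib]; simp

/-- Finitely many evaluations control the operator norm, so continuity of evaluated derivatives
upgrades to operator norms. -/
theorem exists_norm_multilinear_le [FiniteDimensional ℝ E] (j : ℕ) :
    ∃ (s : Finset (Fin j → E)) (C : ℝ), 0 ≤ C ∧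
      ∀ A : ContinuousMultilinearMap ℝ (fun _ : Fin j ↦ E) F, ‖A‖ ≤ C * ∑ v ∈ s, ‖A v‖ := by
  classical
  set b := Module.finBasis ℝ E
  have hb : ∀ k, ∃ C, 0 ≤ C ∧ ∀ v, |b.repr v k| ≤ C * ‖v‖ := fun k ↦
    ⟨‖LinearMap.toContinuousLinearMap (b.coord k)‖, norm_nonneg _, fun v ↦
      (LinearMap.toContinuousLinearMap (b.coord k)).le_opNorm v⟩
  choose C hC0 hC using hb
  set C' := ∑ k, C k with hC'
  have hC'0 : 0 ≤ C' := Finset.sum_nonneg fun k _ ↦ hC0 k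
  have hCC : ∀ v k, |b.repr v k| ≤ C' * ‖v‖ := fun v k ↦ (hC k v).trans
    (by gcongr; exact Finset.single_le_sum (fun k _ ↦ hC0 k) (Finset.mem_univ k))
  have hinj : Function.Injective (fun (i : Fin j → Fin (Module.finrank ℝ E)) k ↦ b (i k)) :=
    fun i i' h ↦ funext fun k ↦ b.injective (congrFun h k)
  refine ⟨Finset.univ.map ⟨_, hinj⟩, C' ^ j, by positivity, fun A ↦ ?_⟩
  refine A.opNorm_le_bound (by positivity) fun v ↦ ?_
  have := norm_multilinear_apply_le_of_basis b hCC A.toMultilinearMap v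
  rw [Finset.sum_map]
  refine this.trans (le_of_eq ?_)
  simp only [Function.Embedding.coeFn_mk, ContinuousMultilinearMap.coe_coe]
  ring

end Multilinear

section JointC

variable {P : Type w} [TopologicalSpace P] {O : Set P}

/-- Both derivatives are taken at the same moving point. This is the local form of uniform
convergence on compact sets, to be combined with a finite cover. -/
theorem IsJointC.eventually_norm_iteratedFDeriv_sub_lt {E : Type u} [NormedAddCommGroup E]
    [NormedSpace ℝ E] [FiniteDimensional ℝ E]
    {F : Type v} [NormedAddCommGroup F] [NormedSpace ℝ F] {W : Set E} (hO : IsOpen O)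
    (hW : IsOpen W) {j : ℕ} {f : P → E → F} (hf : IsJointC O j W f) {p₀ : P} (hp₀ : p₀ ∈ O) {x₀ : E}
    (hx₀ : x₀ ∈ W) {ε : ℝ} (hε : 0 < ε) :
    ∀ᶠ z in 𝓝 (p₀, x₀), ‖iteratedFDeriv ℝ j (f z.1) z.2 - iteratedFDeriv ℝ j (f p₀) z.2‖ < ε := by
  obtain ⟨s, C, hC0, hC⟩ := exists_norm_multilinear_le (E := E) (F := F) j
  have h1 : Tendsto (fun z : P × E ↦ C * ∑ y ∈ s, ‖iteratedFDeriv ℝ j (f z.1) z.2 y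
      - iteratedFDeriv ℝ j (f p₀) z.2 y‖) (𝓝 (p₀, x₀)) (𝓝 (C * ∑ y ∈ s,
        ‖iteratedFDeriv ℝ j (f p₀) x₀ y - iteratedFDeriv ℝ j (f p₀) x₀ y‖)) := by
    refine tendsto_const_nhds.mul (tendsto_finsetSum _ fun y _ ↦ ?_)
    have hc := IsJointC.continuousOn_iteratedFDeriv_apply hW j hf y
    have hc1 : ContinuousAt (fun z : P × E ↦ iteratedFDeriv ℝ j (f z.1) z.2 y) (p₀, x₀) :=
      hc.continuousAt (prod_mem_nhds (hO.mem_nhds hp₀) (hW.mem_nhds hx₀))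
    have hc2 : ContinuousAt (fun z : P × E ↦ iteratedFDeriv ℝ j (f p₀) z.2 y) (p₀, x₀) := by
      have : ContinuousAt (fun z : P × E ↦ ((p₀, z.2) : P × E)) (p₀, x₀) := by fun_prop
      exact ContinuousAt.comp (f := fun z : P × E ↦ ((p₀, z.2) : P × E)) hc1 this
    exact (hc1.tendsto.sub hc2.tendsto).norm
  simp only [sub_self, norm_zero, Finset.sum_const_zero, mul_zero] at h1
  filter_upwards [h1.eventually_lt_const hε] with z hz
  refine (hC _).trans_lt ?_
  simpa using hz

end JointC

/-! ### Lipschitz cutoffs for localizing vector fields -/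

section Cutoff

variable {E : Type*} [NormedAddCommGroup E]

/-- A Lipschitz cutoff function. -/
def cutoff (y₀ : E) (r : ℝ) (x : E) : ℝ := max 0 (min 1 (3 - ‖x - y₀‖ / r))

theorem cutoff_mem (y₀ : E) (r : ℝ) (x : E) : 0 ≤ cutoff y₀ r x ∧ cutoff y₀ r x ≤ 1 :=
  ⟨le_max_left _ _, max_le zero_le_one (min_le_left _ _)⟩

theorem cutoff_eq_one {y₀ : E} {r : ℝ} (hr : 0 < r) {x : E} (hx : ‖x - y₀‖ ≤ 2 * r) :
    cutoff y₀ r x = 1 := by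
  have : ‖x - y₀‖ / r ≤ 2 := by rwa [div_le_iff₀ hr]
  rw [cutoff, min_eq_left (by linarith), max_eq_right zero_le_one]

theorem cutoff_eq_zero {y₀ : E} {r : ℝ} (hr : 0 < r) {x : E} (hx : 3 * r ≤ ‖x - y₀‖) :
    cutoff y₀ r x = 0 := by
  have : 3 ≤ ‖x - y₀‖ / r := by rwa [le_div_iff₀ hr]
  rw [cutoff, max_eq_left (min_le_of_right_le (by linarith))]

theorem abs_cutoff_sub_le (y₀ : E) {r : ℝ} (hr : 0 < r) (x y : E) :
    |cutoff y₀ r x - cutoff y₀ r y| ≤ ‖x - y‖ / r := by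
  have h1 : |cutoff y₀ r x - cutoff y₀ r y| ≤
      |min 1 (3 - ‖x - y₀‖ / r) - min 1 (3 - ‖y - y₀‖ / r)| := by
    simpa [cutoff] using abs_max_sub_max_le_max 0 (min 1 (3 - ‖x - y₀‖ / r)) 0
      (min 1 (3 - ‖y - y₀‖ / r))
  have h2 := abs_min_sub_min_le_max 1 (3 - ‖x - y₀‖ / r) 1 (3 - ‖y - y₀‖ / r)
  rw [sub_self, abs_zero, max_eq_right (abs_nonneg _)] at h2
  refine (h1.trans h2).trans ?_
  have : (3 - ‖x - y₀‖ / r) - (3 - ‖y - y₀‖ / r) = (‖y - y₀‖ - ‖x - y₀‖) / r := by ring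
  rw [this, abs_div, abs_of_pos hr]
  gcongr
  refine (abs_norm_sub_norm_le _ _).trans ?_
  rw [sub_sub_sub_cancel_right, norm_sub_rev]

end Cutoff

/-! ### Local existence and uniqueness -/

section Picard

variable {P : Type w} [TopologicalSpace P]

theorem IsCaratheodory.mono {E F : Type*} [NormedAddCommGroup E] [NormedAddCommGroup F]
    {c d c' d' : ℝ} (hcd : Icc c' d' ⊆ Icc c d) {Ω Ω' : Set E} (hΩ : Ω' ⊆ Ω) {X : P → ℝ → E → F}
    (h : IsCaratheodory c d Ω X) : IsCaratheodory c' d' Ω' X where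
  cont p t ht := (h.cont p t (hcd ht)).mono hΩ
  meas p x hx := (h.meas p x (hΩ hx)).mono_measure (Measure.restrict_mono hcd le_rfl)
  bound p K hK hKc := by
    obtain ⟨g, hg, hb⟩ := h.bound p K (hK.trans hΩ) hKc
    exact ⟨g, hg.mono_set hcd, fun t ht ↦ hb t (hcd ht)⟩
  tend p₀ K hK hKc ε hε := by
    filter_upwards [h.tend p₀ K (hK.trans hΩ) hKc ε hε] with p hp
    exact (lintegral_mono_set hcd).trans_lt hp

theorem IsCaratheodoryC.mono {c d c' d' : ℝ} (hcd : Icc c' d' ⊆ Icc c d) (m : ℕ) :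
    ∀ {E : Type u} [NormedAddCommGroup E] [NormedSpace ℝ E]
      {F : Type v} [NormedAddCommGroup F] [NormedSpace ℝ F] {Ω Ω' : Set E} (_ : Ω' ⊆ Ω)
      {X : P → ℝ → E → F} (_ : IsCaratheodoryC c d m Ω X), IsCaratheodoryC c' d' m Ω' X := by
  induction m with
  | zero =>
    intro E _ _ F _ _ Ω Ω' hΩ X h
    exact IsCaratheodory.mono hcd hΩ h
  | succ m ih =>
    intro E _ _ F _ _ Ω Ω' hΩ X h
    exact ⟨IsCaratheodory.mono hcd hΩ h.1, fun p t ht ↦ (h.2.1 p t (hcd ht)).mono hΩ,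
      ih (prod_mono hΩ le_rfl) h.2.2⟩

variable {E : Type u} [NormedAddCommGroup E] [NormedSpace ℝ E] [FiniteDimensional ℝ E]

/-- On a compact convex set the fields `X p t` are Lipschitz with an integrable constant. -/
theorem exists_lipschitz {X : P → ℝ → E → E} {c d : ℝ} {Ω : Set E} (hΩ : IsOpen Ω)
    (hX : IsCaratheodoryC c d 1 Ω X) (p : P) {K : Set E} (hK : K ⊆ Ω) (hKc : IsCompact K)
    (hKv : Convex ℝ K) : ∃ L : ℝ → ℝ, IntegrableOn L (Icc c d) ∧ (∀ t ∈ Icc c d, 0 ≤ L t) ∧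
      ∀ t ∈ Icc c d, ∀ x ∈ K, ∀ y ∈ K, ‖X p t x - X p t y‖ ≤ L t * ‖x - y‖ := by
  have hpE : ProperSpace E := FiniteDimensional.proper ℝ E
  obtain ⟨L, hL, hLb⟩ := hX.2.2.zero.bound p (K ×ˢ Metric.closedBall 0 1)
    (prod_mono hK (subset_univ _)) (hKc.prod (isCompact_closedBall 0 1))
  refine ⟨fun t ↦ |L t|, hL.abs, fun t _ ↦ abs_nonneg _, fun t ht x hx y hy ↦ ?_⟩
  refine hKv.norm_image_sub_le_of_norm_fderiv_le (𝕜 := ℝ) (fun z hz ↦ (hX.2.1 p t ht).differentiableAt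
    (hΩ.mem_nhds (hK hz))) (fun z hz ↦ opNorm_le_of_tmap fun v hv ↦ ?_) hy hx
  exact ((norm_snd_le (tmap (X p t) (z, v))).trans (hLb t ht (z, v) ⟨hz, hv⟩)).trans (le_abs_self _)

/-- Over the compact time interval both trajectories stay in a smaller closed ball, which is compact
and convex. There the field is Lipschitz with an integrable constant, and Grönwall applies with zero
data. -/
theorem IsSol.unique {X : P → ℝ → E → E} {c d a : ℝ} (ha : a ∈ Icc c d) {y₀ : E} {R : ℝ}
    (hX : IsCaratheodoryC c d 1 (Metric.ball y₀ R) X) {p : P} {x : E} {ξ ξ' : ℝ → E}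
    (hξ : IsSol (X p) c d a (Metric.ball y₀ R) x ξ)
    (hξ' : IsSol (X p) c d a (Metric.ball y₀ R) x ξ') : EqOn ξ ξ' (Icc c d) := by
  have hpE : ProperSpace E := FiniteDimensional.proper ℝ E
  obtain ⟨t₁, ht₁, h₁⟩ := isCompact_Icc.exists_isMaxOn ⟨a, ha⟩
    (by have := hξ.cont; fun_prop : ContinuousOn (fun t ↦ dist (ξ t) y₀) _)
  obtain ⟨t₂, ht₂, h₂⟩ := isCompact_Icc.exists_isMaxOn ⟨a, ha⟩
    (by have := hξ'.cont; fun_prop : ContinuousOn (fun t ↦ dist (ξ' t) y₀) _)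
  set K := Metric.closedBall y₀ (max (dist (ξ t₁) y₀) (dist (ξ' t₂) y₀)) with hK
  have hKΩ : K ⊆ Metric.ball y₀ R := Metric.closedBall_subset_ball
    (max_lt (hξ.mem t₁ ht₁) (hξ'.mem t₂ ht₂))
  have hm : ∀ t ∈ Icc c d, ξ t ∈ K := fun t ht ↦
    Metric.mem_closedBall.2 (le_trans (h₁ ht) (le_max_left _ _))
  have hm' : ∀ t ∈ Icc c d, ξ' t ∈ K := fun t ht ↦
    Metric.mem_closedBall.2 (le_trans (h₂ ht) (le_max_right _ _))
  obtain ⟨L, hL, hL0, hLb⟩ := exists_lipschitz Metric.isOpen_ball hX p hKΩ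
    (isCompact_closedBall _ _) (convex_closedBall _ _)
  obtain ⟨G, -, hG⟩ := exists_gronwall hL hL0 ha
  intro t ht
  have := norm_le_of_gronwall hL ha hG (δ := fun t ↦ ξ t - ξ' t) (x := 0) (k := 0) (e := fun _ ↦ 0)
    (f := fun t ↦ X p t (ξ t) - X p t (ξ' t)) (hξ.cont.sub hξ'.cont) (hξ.int.sub hξ'.int)
    (fun t ht ↦ by
      rw [intervalIntegral.integral_sub (intervalIntegrable_of_Icc hξ.int ha ht)
        (intervalIntegrable_of_Icc hξ'.int ha ht), hξ.eq t ht, hξ'.eq t ht]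
      abel) integrableOn_zero (fun _ _ ↦ le_rfl)
    (fun t ht ↦ by rw [add_zero]; exact hLb t ht _ (hm t ht) _ (hm' t ht)) (by simp) t ht
  rw [mul_zero] at this
  exact sub_eq_zero.1 (norm_le_zero_iff.1 this)

/-- Local existence, uniformly for short time intervals, nearby parameters and initial points. -/
theorem exists_isSolFamily {X : P → ℝ → E → E} {c₀ d₀ : ℝ} {Ω : Set E} (hΩ : IsOpen Ω)
    (hX : IsCaratheodoryC c₀ d₀ 1 Ω X) (p₀ : P) {y₀ : E} (hy₀ : y₀ ∈ Ω) :
    ∃ r > 0, ∃ ε > 0, ∃ O, IsOpen O ∧ p₀ ∈ O ∧ ∀ c d, Icc c d ⊆ Icc c₀ d₀ → d - c ≤ ε →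
      ∀ a ∈ Icc c d, ∃ ξ, IsSolFamily X c d a Ω O (Metric.ball y₀ r) ξ := by
  have hpE : ProperSpace E := FiniteDimensional.proper ℝ E
  obtain ⟨R, hR, hRΩ⟩ := Metric.nhds_basis_closedBall.mem_iff.1 (hΩ.mem_nhds hy₀)
  -- Solutions start within `r` of `y₀` and will move by at most `r / 2`, so they remain where the
  -- cutoff is `1` (distance at most `2 * r`). The cutoff vanishes from distance `3 * r = R` on.
  set r := R / 3 with hr
  have hr0 : 0 < r := by positivity
  have h3r : 3 * r = R := by rw [hr]; ring
  set K := Metric.closedBall y₀ R with hK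
  have hKc : IsCompact K := isCompact_closedBall _ _
  have hKv : Convex ℝ K := convex_closedBall _ _
  obtain ⟨h, hh, hhb⟩ := hX.1.bound p₀ K hRΩ hKc
  have hr4 : ENNReal.ofReal (r / 4) ≠ 0 := by simpa using hr0
  -- Absolute continuity of the integral allots `r / 4` of displacement to the field at `p₀` on
  -- short intervals; closeness of the parameter allots the other `r / 4`.
  obtain ⟨δ, hδ, hδh⟩ := exists_pos_setLIntegral_lt_of_measure_lt
    (μ := volume.restrict (Icc c₀ d₀)) (f := fun t ↦ ‖h t‖ₑ) hh.hasFiniteIntegral.ne hr4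
  obtain ⟨ε, hε, hεδ⟩ : ∃ ε : ℝ, 0 < ε ∧ ENNReal.ofReal ε < δ := by
    obtain ⟨q, hq0, hq⟩ := ENNReal.lt_iff_exists_nnreal_btwn.1 hδ
    exact ⟨q, by exact_mod_cast hq0, by rwa [ENNReal.ofReal_coe_nnreal]⟩
  obtain ⟨O, hOs, hO, hpO⟩ := mem_nhds_iff.1 (hX.1.tend p₀ K hRΩ hKc _ (pos_iff_ne_zero.2 hr4))
  refine ⟨r, hr0, ε, hε, O, hO, hpO, fun c d hcd hlen a ha ↦ ?_⟩
  have hhint : ∫⁻ t in Icc c d, ‖h t‖ₑ ≤ ENNReal.ofReal (r / 4) := by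
    have := hδh (Icc c d) ?_
    · rw [Measure.restrict_restrict measurableSet_Icc, inter_eq_left.2 hcd] at this
      exact this.le
    · refine (Measure.restrict_apply_le _ _).trans_lt ?_
      rw [Real.volume_Icc]
      exact (ENNReal.ofReal_le_ofReal hlen).trans_lt hεδ
  have hX' : IsCaratheodoryC c d 1 Ω X := IsCaratheodoryC.mono hcd 1 le_rfl hX
  have hex : ∀ p ∈ O, ∀ x ∈ Metric.ball y₀ r, ∃ ξ, IsSol (X p) c d a K x ξ := by
    intro p hp x hx
    obtain ⟨L, hL, hL0, hLb⟩ := exists_lipschitz hΩ hX' p hRΩ hKc hKv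
    obtain ⟨g, hg, hgb⟩ := hX'.1.bound p K hRΩ hKc
    have hg0 : ∀ t ∈ Icc c d, 0 ≤ g t := fun t ht ↦
      (norm_nonneg _).trans (hgb t ht y₀ (Metric.mem_closedBall_self hR.le))
    -- The cut-off field is globally Lipschitz with an integrable constant, so it has a solution on
    -- all of `[c, d]`, and that solution never meets the region where the field was altered.
    set Z : ℝ → E → E := fun t y ↦ cutoff y₀ r y • X p t y with hZ
    have hZout : ∀ t y, y ∉ K → Z t y = 0 := fun t y hy ↦ by
      have : 3 * r ≤ ‖y - y₀‖ := by
        rw [h3r]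
        rw [hK, mem_closedBall_iff_norm, not_le] at hy
        exact hy.le
      simp only [hZ, cutoff_eq_zero hr0 this, zero_smul]
    have hZK : ∀ t ∈ Icc c d, ∀ y ∈ K, ∀ z, ‖Z t y - Z t z‖ ≤ (g t / r + L t) * ‖y - z‖ := by
      intro t ht y hy z
      have hg1 : |cutoff y₀ r y - cutoff y₀ r z| * ‖X p t y‖ ≤ g t / r * ‖y - z‖ := by
        calc _ ≤ ‖y - z‖ / r * g t :=
              mul_le_mul (abs_cutoff_sub_le y₀ hr0 y z) (hgb t ht y hy) (norm_nonneg _)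
                (by positivity)
          _ = _ := by ring
      by_cases hz : z ∈ K
      · have e : Z t y - Z t z = (cutoff y₀ r y - cutoff y₀ r z) • X p t y
            + cutoff y₀ r z • (X p t y - X p t z) := by
          simp only [hZ, sub_smul, smul_sub]; abel
        rw [e]
        refine (norm_add_le _ _).trans ?_
        rw [norm_smul, norm_smul, add_mul, Real.norm_eq_abs, Real.norm_eq_abs,
          abs_of_nonneg (cutoff_mem y₀ r z).1]
        refine add_le_add hg1 ?_
        have := mul_le_mul (cutoff_mem y₀ r z).2 (hLb t ht y hy z hz) (norm_nonneg _) zero_le_one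
        rwa [one_mul] at this
      · have e : Z t y - Z t z = (cutoff y₀ r y - cutoff y₀ r z) • X p t y := by
          have : 3 * r ≤ ‖z - y₀‖ := by
            rw [h3r]
            rw [hK, mem_closedBall_iff_norm, not_le] at hz
            exact hz.le
          rw [hZout t z hz, cutoff_eq_zero hr0 this, sub_zero, sub_zero]
        rw [e, norm_smul, Real.norm_eq_abs]
        have := mul_nonneg (hL0 t ht) (norm_nonneg (y - z))
        linarith [hg1, add_mul (g t / r) (L t) ‖y - z‖]
    have hZlip : ∀ t ∈ Icc c d, ∀ y z, ‖Z t y - Z t z‖ ≤ (g t / r + L t) * ‖y - z‖ := by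
      intro t ht y z
      by_cases hy : y ∈ K
      · exact hZK t ht y hy z
      · by_cases hz : z ∈ K
        · rw [norm_sub_rev, norm_sub_rev y z]
          exact hZK t ht z hz y
        · rw [hZout t y hy, hZout t z hz, sub_zero, norm_zero]
          have := hg0 t ht
          have := hL0 t ht
          positivity
    have hZb : ∀ t ∈ Icc c d, ∀ y, ‖Z t y‖ ≤ g t := by
      intro t ht y
      by_cases hy : y ∈ K
      · simp only [hZ]
        rw [norm_smul, Real.norm_eq_abs, abs_of_nonneg (cutoff_mem y₀ r y).1]
        have := mul_le_mul (cutoff_mem y₀ r y).2 (hgb t ht y hy) (norm_nonneg _) zero_le_one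
        rwa [one_mul] at this
      · rw [hZout t y hy, norm_zero]
        exact hg0 t ht
    obtain ⟨ξ, hξ⟩ := exists_isSol_of_lipschitz ha (X := Z) (fun y ↦ by
        by_cases hy : y ∈ K
        · exact (hX'.1.meas p y (hRΩ hy)).const_smul (cutoff y₀ r y)
        · simp only [hZout _ y hy]
          exact aestronglyMeasurable_const) ((hg.div_const r).add hL)
      (fun t ht ↦ by
        have := hg0 t ht
        have := hL0 t ht
        simp only [Pi.add_apply]
        positivity) hZlip hg (fun t ht ↦ hZb t ht 0) x
    have hZS : ∀ t ∈ Icc c d, ∀ y, ‖Z t y‖ₑ ≤ (⨆ y ∈ K, ‖X p t y - X p₀ t y‖ₑ) + ‖h t‖ₑ := by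
      intro t ht y
      by_cases hy : y ∈ K
      · have h1 : ‖Z t y‖ₑ ≤ ‖X p t y‖ₑ := by
          rw [enorm_le_iff_norm_le]
          simp only [hZ]
          rw [norm_smul, Real.norm_eq_abs, abs_of_nonneg (cutoff_mem y₀ r y).1]
          exact mul_le_of_le_one_left (norm_nonneg _) (cutoff_mem y₀ r y).2
        have h2 : ‖X p t y‖ₑ ≤ ‖X p t y - X p₀ t y‖ₑ + ‖X p₀ t y‖ₑ := by
          conv_lhs => rw [← sub_add_cancel (X p t y) (X p₀ t y)]
          exact enorm_add_le _ _
        refine h1.trans (h2.trans (add_le_add (le_biSup (fun y ↦ ‖X p t y - X p₀ t y‖ₑ) hy) ?_))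
        rw [enorm_le_iff_norm_le]
        exact (hhb t (hcd ht) y hy).trans (le_abs_self _)
      · rw [hZout t y hy, enorm_zero]
        exact zero_le
    have hsub : ∀ t ∈ Icc c d, uIoc a t ⊆ Icc c d := fun t ht ↦
      uIoc_subset_uIcc.trans (ordConnected_Icc.uIcc_subset ha ht)
    have hdist : ∀ t ∈ Icc c d, ‖ξ t - x‖ ≤ r / 2 := by
      intro t ht
      rw [hξ.eq t ht, add_sub_cancel_left]
      refine intervalIntegral.norm_integral_le_integral_norm_uIoc.trans ?_
      have hi := hξ.int.mono_set (hsub t ht)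
      rw [integral_norm_eq_lintegral_enorm hi.aestronglyMeasurable]
      refine ENNReal.toReal_le_of_le_ofReal (by positivity) ?_
      calc ∫⁻ s in uIoc a t, ‖Z s (ξ s)‖ₑ ≤ ∫⁻ s in Icc c d, ‖Z s (ξ s)‖ₑ :=
            lintegral_mono_set (hsub t ht)
        _ ≤ ∫⁻ s in Icc c d, ((⨆ y ∈ K, ‖X p s y - X p₀ s y‖ₑ) + ‖h s‖ₑ) :=
            setLIntegral_mono' measurableSet_Icc fun s hs ↦ hZS s hs _
        _ = (∫⁻ s in Icc c d, ⨆ y ∈ K, ‖X p s y - X p₀ s y‖ₑ) + ∫⁻ s in Icc c d, ‖h s‖ₑ :=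
            lintegral_add_right' _ (hh.mono_set hcd).aestronglyMeasurable.enorm
        _ ≤ ENNReal.ofReal (r / 4) + ENNReal.ofReal (r / 4) := by
            refine add_le_add ((lintegral_mono_set hcd).trans (le_of_lt (hOs hp))) hhint
        _ = ENNReal.ofReal (r / 2) := by
            rw [← ENNReal.ofReal_add (by positivity) (by positivity)]
            congr 1
            ring
    have hnear : ∀ t ∈ Icc c d, ‖ξ t - y₀‖ ≤ 2 * r := fun t ht ↦ by
      have h1 : ‖x - y₀‖ < r := mem_ball_iff_norm.1 hx
      have h2 := norm_sub_le_norm_sub_add_norm_sub (ξ t) x y₀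
      linarith [hdist t ht]
    have hZX : ∀ t ∈ Icc c d, Z t (ξ t) = X p t (ξ t) := fun t ht ↦ by
      simp only [hZ, cutoff_eq_one hr0 (hnear t ht), one_smul]
    refine ⟨ξ, hξ.cont, fun t ht ↦ ?_, hξ.int.congr_fun hZX measurableSet_Icc, fun t ht ↦ ?_⟩
    · rw [hK, mem_closedBall_iff_norm]
      linarith [hnear t ht]
    · rw [hξ.eq t ht]
      congr 1
      exact intervalIntegral.integral_congr fun s hs ↦ hZX s (ordConnected_Icc.uIcc_subset ha ht hs)
  choose! ξ hξ using hex
  refine ⟨ξ, fun p hp x hx ↦ ⟨(hξ p hp x hx).cont, fun t ht ↦ hRΩ ((hξ p hp x hx).mem t ht),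
    (hξ p hp x hx).int, (hξ p hp x hx).eq⟩, fun p₁ hp₁ x₁ hx₁ η hη ↦ ?_⟩
  obtain ⟨L, hL, hL0, hLb⟩ := exists_lipschitz hΩ hX' p₁ hRΩ hKc hKv
  obtain ⟨G, hG1, hG⟩ := exists_gronwall hL hL0 ha
  have hG0 : 0 < G := by linarith
  -- One `κ` covers the change of initial point and one the change of parameter; Grönwall gives `2 *
  -- G * κ = η / 2`.
  set κ := η / (4 * G) with hκ
  have hκ0 : 0 < κ := by positivity
  have hev1 := hX'.1.tend p₁ K hRΩ hKc (ENNReal.ofReal κ) (by simpa using hκ0)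
  filter_upwards [prod_mem_nhds (inter_mem (hO.mem_nhds hp₁) hev1)
    (inter_mem (Metric.isOpen_ball.mem_nhds hx₁) (Metric.ball_mem_nhds x₁ hκ0))] with z hz t ht
  obtain ⟨p, x⟩ := z
  obtain ⟨⟨hp, hpS⟩, hx, hxκ⟩ := hz
  have s1 := hξ p₁ hp₁ x₁ hx₁
  have s2 := hξ p hp x hx
  simp only at hp hx hxκ
  set e : ℝ → E := fun t ↦ X p t (ξ p x t) - X p₁ t (ξ p x t) with he
  have hem : IntegrableOn (fun t ↦ X p₁ t (ξ p x t)) (Icc c d) := by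
    obtain ⟨g, hg, hgb⟩ := hX'.1.bound p₁ K hRΩ hKc
    refine Integrable.mono' hg (aestronglyMeasurable_caratheodory (hX'.1.cont p₁) (hX'.1.meas p₁)
      s2.cont fun t ht ↦ hRΩ (s2.mem t ht)) ?_
    exact (ae_restrict_iff' measurableSet_Icc).2 (Eventually.of_forall fun t ht ↦
      hgb t ht _ (s2.mem t ht))
  have hei : IntegrableOn e (Icc c d) := s2.int.sub hem
  have hek : ∫ t in Icc c d, ‖e t‖ ≤ κ := by
    rw [integral_norm_eq_lintegral_enorm hei.aestronglyMeasurable]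
    refine ENNReal.toReal_le_of_le_ofReal (by positivity) (le_trans ?_ (le_of_lt hpS))
    exact setLIntegral_mono' measurableSet_Icc fun t ht ↦
      le_biSup (fun y ↦ ‖X p t y - X p₁ t y‖ₑ) (s2.mem t ht)
  have := norm_le_of_gronwall hL ha hG (δ := fun t ↦ ξ p x t - ξ p₁ x₁ t) (x := x - x₁)
    (k := 2 * κ) (e := fun t ↦ ‖e t‖)
    (f := fun t ↦ X p t (ξ p x t) - X p₁ t (ξ p₁ x₁ t)) (s2.cont.sub s1.cont) (s2.int.sub s1.int)
    (fun t ht ↦ by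
      rw [intervalIntegral.integral_sub (intervalIntegrable_of_Icc s2.int ha ht)
        (intervalIntegrable_of_Icc s1.int ha ht), s2.eq t ht, s1.eq t ht]
      abel) hei.norm (fun _ _ ↦ norm_nonneg _)
    (fun t ht ↦ by
      have e1 : X p t (ξ p x t) - X p₁ t (ξ p₁ x₁ t)
          = (X p₁ t (ξ p x t) - X p₁ t (ξ p₁ x₁ t)) + e t := by simp only [he]; abel
      rw [e1]
      exact (norm_add_le _ _).trans
        (add_le_add (hLb t ht _ (s2.mem t ht) _ (s1.mem t ht)) le_rfl))
    (by
      have : ‖x - x₁‖ < κ := mem_ball_iff_norm.1 hxκ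
      linarith) t ht
  refine this.trans_lt ?_
  have : G * (2 * κ) = η / 2 := by rw [hκ]; field_simp; norm_num
  linarith

/-- If the derivatives of the field commute with `J`, so do those of the flow. -/
theorem IsSolFamily.fderiv_comm {X : P → ℝ → E → E} {c d a : ℝ} (ha : a ∈ Icc c d)
    {Ω : Set E} (hΩ : IsOpen Ω) {O : Set P} (hO : IsOpen O) {W : Set E} (hW : IsOpen W)
    (hX : IsCaratheodoryC c d 1 Ω X) {ξ : P → E → ℝ → E} (hξ : IsSolFamily X c d a Ω O W ξ)
    (J : E →L[ℝ] E) (hJ : ∀ p, ∀ t ∈ Icc c d, ∀ y ∈ Ω, ∀ v,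
      fderiv ℝ (X p t) y (J v) = J (fderiv ℝ (X p t) y v)) {p : P} (hp : p ∈ O) {x : E}
    (hx : x ∈ W) {t : ℝ} (ht : t ∈ Icc c d) (v : E) :
    fderiv ℝ (fun x ↦ ξ p x t) x (J v) = J (fderiv ℝ (fun x ↦ ξ p x t) x v) := by
  have hpE : ProperSpace E := FiniteDimensional.proper ℝ E
  have hcE : CompleteSpace E := FiniteDimensional.complete ℝ E
  obtain ⟨V, hV, -, hV'⟩ := hξ.exists_strict ha hΩ hO hW hX.2.1 hX.2.2.zero hp hx
  have hs := hξ.sol p hp x hx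
  have hder : HasFDerivAt (fun y ↦ ξ p y t) (V t) x := by
    rw [hasFDerivAt_iff_isLittleO, Asymptotics.isLittleO_iff]
    intro ε hε
    obtain ⟨N, hN, r, hr, h⟩ := hV' ε hε
    filter_upwards [Metric.ball_mem_nhds x hr] with y hy
    exact h p (mem_of_mem_nhds hN) x (Metric.mem_ball_self hr) y hy t ht
  rw [hder.fderiv]
  obtain ⟨L, hL, hLb⟩ := hX.2.2.zero.bound p ((ξ p x '' Icc c d) ×ˢ Metric.closedBall 0 1)
    (prod_mono (image_subset_iff.2 hs.mem) (subset_univ _))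
    ((isCompact_Icc.image_of_continuousOn hs.cont).prod (isCompact_closedBall 0 1))
  have hBL : ∀ t ∈ Icc c d, ‖fderiv ℝ (X p t) (ξ p x t)‖ ≤ L t := fun t ht ↦
    opNorm_le_of_tmap fun v hv ↦ (norm_snd_le (ParamFlow.tmap (X p t) (ξ p x t, v))).trans
      (hLb t ht _ ⟨mem_image_of_mem _ ht, hv⟩)
  have hL0 : ∀ t ∈ Icc c d, 0 ≤ L t := fun t ht ↦ (norm_nonneg _).trans (hBL t ht)
  obtain ⟨G, -, hG⟩ := exists_gronwall hL hL0 ha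
  have i1 := (hV (J v)).int
  have i2 : IntegrableOn (fun s ↦ J (fderiv ℝ (X p s) (ξ p x s) (V s v))) (Icc c d) :=
    J.integrable_comp (hV v).int
  -- The commutator `V t (J v) - J (V t v)` solves the homogeneous variational equation and vanishes
  -- at time `a`.
  have := norm_le_of_gronwall hL ha hG (δ := fun t ↦ V t (J v) - J (V t v)) (x := 0) (k := 0)
    (e := fun _ ↦ 0) ((hV (J v)).cont.sub (J.continuous.comp_continuousOn (hV v).cont))
    (i1.sub i2)
    (fun t ht ↦ by
      have ii2 := intervalIntegrable_of_Icc i2 ha ht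
      simp only [Pi.sub_apply]
      rw [intervalIntegral.integral_sub (intervalIntegrable_of_Icc i1 ha ht) ii2,
        J.intervalIntegral_comp_comm (intervalIntegrable_of_Icc (hV v).int ha ht),
        (hV (J v)).eq t ht, (hV v).eq t ht, map_add]
      abel) integrableOn_zero (fun _ _ ↦ le_rfl)
    (fun t ht ↦ by
      simp only [Pi.sub_apply]
      rw [add_zero, ← hJ p t ht _ (hs.mem t ht), ← map_sub]
      exact (ContinuousLinearMap.le_opNorm _ _).trans (by gcongr; exact hBL t ht)) (by simp) t ht
  rw [mul_zero] at this
  exact sub_eq_zero.1 (norm_le_zero_iff.1 this)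

end Picard

/-! ### Integral curves on a manifold: gluing, uniqueness and patching of local flows -/

section Patching

variable {𝕜 : Type*} [RCLike 𝕜] {E : Type*} [NormedAddCommGroup E] [NormedSpace 𝕜 E]
  {M : Type*} [TopologicalSpace M] [ChartedSpace E M] {A : Set (M → 𝕜)}

theorem IsIntegralCurve.mono {X : ℝ → Π x : M, TangentSpace 𝓘(𝕜, E) x} {S S' : Set ℝ} {ξ : ℝ → M}
    (h : IsIntegralCurve A X S ξ) (hS : S' ⊆ S) : IsIntegralCurve A X S' ξ :=
  ⟨h.continuousOn.mono hS, fun f hf a ha t ht ↦ h.intervalIntegrable f hf a (hS ha) t (hS ht),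
    fun f hf a ha t ht ↦ h.integral_eq f hf a (hS ha) t (hS ht)⟩

theorem IsIntegralCurve.congr {X : ℝ → Π x : M, TangentSpace 𝓘(𝕜, E) x} {S : Set ℝ} {ξ ξ' : ℝ → M}
    (h : IsIntegralCurve A X S ξ) (hS : S.OrdConnected) (he : EqOn ξ' ξ S) :
    IsIntegralCurve A X S ξ' := by
  have hd : ∀ f : M → 𝕜, ∀ a ∈ S, ∀ t ∈ S,
      EqOn (fun s ↦ mvfderiv 𝓘(𝕜, E) f (ξ' s) (X s (ξ' s)))
        (fun s ↦ mvfderiv 𝓘(𝕜, E) f (ξ s) (X s (ξ s))) (uIcc a t) := by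
    intro f a ha t ht s hs
    exact congrArg (fun y ↦ (mvfderiv 𝓘(𝕜, E) f y (X s y) : 𝕜)) (he (hS.uIcc_subset ha ht hs))
  refine ⟨h.continuousOn.congr he, fun f hf a ha t ht ↦ ?_, fun f hf a ha t ht ↦ ?_⟩
  · exact (intervalIntegrable_congr fun s hs ↦ hd f a ha t ht (uIoc_subset_uIcc hs)).2
      (h.intervalIntegrable f hf a ha t ht)
  · rw [he ha, he ht, h.integral_eq f hf a ha t ht, intervalIntegral.integral_congr (hd f a ha t ht)]

/-- Closedness of both intervals makes the piecewise curve continuous, and integrals from one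
interval to the other are split at the common time `b`. -/
theorem IsIntegralCurve.exists_union {X : ℝ → Π x : M, TangentSpace 𝓘(𝕜, E) x} {S S' : Set ℝ}
    {ξ ξ' : ℝ → M} (h : IsIntegralCurve A X S ξ) (h' : IsIntegralCurve A X S' ξ')
    (hS : S.OrdConnected) (hS' : S'.OrdConnected) (hSc : IsClosed S) (hSc' : IsClosed S')
    (he : EqOn ξ ξ' (S ∩ S')) {b : ℝ} (hb : b ∈ S) (hb' : b ∈ S') :
    ∃ ζ, IsIntegralCurve A X (S ∪ S') ζ ∧ EqOn ζ ξ S ∧ EqOn ζ ξ' S' := by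
  classical
  set ζ := S.piecewise ξ ξ' with hζ
  have e1 : EqOn ζ ξ S := piecewise_eqOn _ _ _
  have e2 : EqOn ζ ξ' S' := fun t ht ↦ by
    by_cases hts : t ∈ S
    · rw [e1 hts, he ⟨hts, ht⟩]
    · exact piecewise_eq_of_notMem _ _ _ hts
  have c1 := h.congr hS e1
  have c2 := h'.congr hS' e2
  refine ⟨ζ, ⟨c1.continuousOn.union_of_isClosed c2.continuousOn hSc hSc', ?_, ?_⟩, e1, e2⟩
  · rintro f hf a (ha | ha) t (ht | ht)
    · exact c1.intervalIntegrable f hf a ha t ht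
    · exact (c1.intervalIntegrable f hf a ha b hb).trans (c2.intervalIntegrable f hf b hb' t ht)
    · exact (c2.intervalIntegrable f hf a ha b hb').trans (c1.intervalIntegrable f hf b hb t ht)
    · exact c2.intervalIntegrable f hf a ha t ht
  · rintro f hf a (ha | ha) t (ht | ht)
    · exact c1.integral_eq f hf a ha t ht
    · rw [c2.integral_eq f hf b hb' t ht, c1.integral_eq f hf a ha b hb, add_assoc,
        intervalIntegral.integral_add_adjacent_intervals (c1.intervalIntegrable f hf a ha b hb)
          (c2.intervalIntegrable f hf b hb' t ht)]
    · rw [c1.integral_eq f hf b hb t ht, c2.integral_eq f hf a ha b hb', add_assoc,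
        intervalIntegral.integral_add_adjacent_intervals (c2.intervalIntegrable f hf a ha b hb')
          (c1.intervalIntegrable f hf b hb t ht)]
    · exact c2.integral_eq f hf a ha t ht

variable {P : Type*} [TopologicalSpace P]

/-- Local uniqueness of integral curves. -/
def LocallyUnique (A : Set (M → 𝕜)) (T : Set ℝ)
    (X : P → ℝ → Π x : M, TangentSpace 𝓘(𝕜, E) x) : Prop :=
  ∀ p c d, Icc c d ⊆ T → ∀ ζ ζ' : ℝ → M, IsIntegralCurve A (X p) (Icc c d) ζ →
    IsIntegralCurve A (X p) (Icc c d) ζ' → ∀ s ∈ Icc c d, ζ s = ζ' s →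
      ∀ᶠ t in 𝓝[Icc c d] s, ζ t = ζ' t

/-- Local flows for short times, whose germs have the property `R`. -/
def HasLocalFlows (A : Set (M → 𝕜)) (T : Set ℝ)
    (X : P → ℝ → Π x : M, TangentSpace 𝓘(𝕜, E) x) (R : P → M → (P → M → M) → Prop) : Prop :=
  ∀ p₀ y₀ c₀ d₀, Icc c₀ d₀ ⊆ T → ∃ ε > 0, ∃ O ∈ 𝓝 p₀, ∃ N ∈ 𝓝 y₀,
    ∀ c d, Icc c d ⊆ Icc c₀ d₀ → d - c ≤ ε → ∀ a ∈ Icc c d, ∀ b ∈ Icc c d, ∃ Ψ : P → M → M,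
      ∀ p ∈ O, ∀ x ∈ N, R p x Ψ ∧
        ∃ ζ, IsIntegralCurve A (X p) (Icc c d) ζ ∧ ζ a = x ∧ ζ b = Ψ p x

/-- A property of germs of parametrised maps that is stable under composition. -/
structure IsRegularity (R : P → M → (P → M → M) → Prop) : Prop where
  id : ∀ p x, R p x (fun _ y ↦ y)
  continuousAt : ∀ p x Ψ, R p x Ψ → ContinuousAt (fun z : P × M ↦ Ψ z.1 z.2) (p, x)
  comp : ∀ p x Ψ Ψ', R p x Ψ → R p (Ψ p x) Ψ' → R p x (fun q y ↦ Ψ' q (Ψ q y))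
  congr : ∀ p x Ψ Ψ', R p x Ψ → (∀ᶠ z : P × M in 𝓝 (p, x), Ψ' z.1 z.2 = Ψ z.1 z.2) → R p x Ψ'

variable {T : Set ℝ} {X : P → ℝ → Π x : M, TangentSpace 𝓘(𝕜, E) x}

/-- The set of times where the curves agree is open by local uniqueness and closed because `M` is
Hausdorff; the interval is connected. -/
theorem LocallyUnique.eqOn [T2Space M] (hU : LocallyUnique A T X) {p : P} {c d : ℝ}
    (hcd : Icc c d ⊆ T) {ζ ζ' : ℝ → M} (h : IsIntegralCurve A (X p) (Icc c d) ζ)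
    (h' : IsIntegralCurve A (X p) (Icc c d) ζ') {s : ℝ} (hs : s ∈ Icc c d) (he : ζ s = ζ' s) :
    EqOn ζ ζ' (Icc c d) := by
  intro t ht
  refine isPreconnected_Icc.induction₂' (fun a b ↦ ζ a = ζ' a → ζ b = ζ' b) ?_ ?_ hs ht he
  · intro a ha
    by_cases hae : ζ a = ζ' a
    · filter_upwards [hU p c d hcd ζ ζ' h h' a ha hae] with b hb
      exact ⟨fun _ ↦ hb, fun _ ↦ hae⟩
    · have := (h.continuousOn a ha).tendsto.prodMk_nhds (h'.continuousOn a ha).tendsto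
      have hne := this.eventually (isClosed_diagonal.isOpen_compl.mem_nhds hae)
      filter_upwards [hne] with b hb
      exact ⟨fun h ↦ absurd h hae, fun h ↦ absurd h hb⟩
  · intro a b c _ _ _ hab hbc
    exact fun h ↦ hbc (hab h)

theorem LocallyUnique.eqOn_inter [T2Space M] (hU : LocallyUnique A T X) {p : P} {S S' : Set ℝ}
    (hS : S.OrdConnected) (hS' : S'.OrdConnected) (hST : S ⊆ T) {ζ ζ' : ℝ → M}
    (h : IsIntegralCurve A (X p) S ζ) (h' : IsIntegralCurve A (X p) S' ζ') {s : ℝ}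
    (hs : s ∈ S) (hs' : s ∈ S') (he : ζ s = ζ' s) : EqOn ζ ζ' (S ∩ S') := by
  rintro t ⟨ht, ht'⟩
  have h1 : Icc (min s t) (max s t) ⊆ S := hS.uIcc_subset hs ht
  have h2 : Icc (min s t) (max s t) ⊆ S' := hS'.uIcc_subset hs' ht'
  exact hU.eqOn (h1.trans hST) (h.mono h1) (h'.mono h2) (left_mem_uIcc : s ∈ uIcc s t) he
    right_mem_uIcc

/-- The value at `t₁` does not depend on the integral curve. -/
theorem LocallyUnique.eq_flow [T2Space M] (hU : LocallyUnique A T X) {p : P} {t₁ t₀ : ℝ} {x : M}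
    {ζ : ℝ → M} (h : IsIntegralCurveFrom A T (X p) t₁ t₀ x ζ) :
    ζ t₁ = flow A T (X p) t₁ t₀ x := by
  have hx : x ∈ flowDomain A T (X p) t₁ t₀ := ⟨ζ, h⟩
  rw [flow, dif_pos hx]
  obtain ⟨S, hST, hS, h0, h1, hc, he⟩ := h
  obtain ⟨S', hST', hS', h0', h1', hc', he'⟩ := hx.choose_spec
  exact hU.eqOn_inter hS hS' hST hc hc' h0 h0' (he.trans he'.symm) ⟨h1, h1'⟩

/-- The local flows are patched along an integral curve. -/
theorem exists_patched_flow [T2Space M] (hT : T.OrdConnected) (hU : LocallyUnique A T X)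
    {R : P → M → (P → M → M) → Prop} (hR : IsRegularity R) (hF : HasLocalFlows A T X R)
    {t₀ t₁ : ℝ} (ht₀ : t₀ ∈ T) (ht₁ : t₁ ∈ T) {p₀ : P} {x₀ : M} {ζ₀ : ℝ → M}
    (hζ₀ : IsIntegralCurve A (X p₀) (uIcc t₀ t₁) ζ₀) (hx₀ : ζ₀ t₀ = x₀) :
    ∃ Ψ : P → M → M, R p₀ x₀ Ψ ∧ ∀ᶠ z : P × M in 𝓝 (p₀, x₀),
      ∃ ζ, IsIntegralCurve A (X z.1) (uIcc t₀ t₁) ζ ∧ ζ t₀ = z.2 ∧ ζ t₁ = Ψ z.1 z.2 := by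
  have hJT : uIcc t₀ t₁ ⊆ T := hT.uIcc_subset ht₀ ht₁
  -- A time is good if the flow from `t₀` to it exists near `(p₀, x₀)` and is regular. The clause `Ψ
  -- p₀ x₀ = ζ₀ b` ties it to the reference curve, so that the local flow found there can be
  -- composed.
  set Good : ℝ → Prop := fun b ↦ ∃ Ψ : P → M → M, R p₀ x₀ Ψ ∧ Ψ p₀ x₀ = ζ₀ b ∧
    ∀ᶠ z : P × M in 𝓝 (p₀, x₀),
      ∃ ζ, IsIntegralCurve A (X z.1) (uIcc t₀ b) ζ ∧ ζ t₀ = z.2 ∧ ζ b = Ψ z.1 z.2 with hGood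
  have hstart : Good t₀ := by
    refine ⟨fun _ y ↦ y, hR.id _ _, hx₀.symm, Eventually.of_forall fun z ↦ ⟨fun _ ↦ z.2, ?_, rfl, rfl⟩⟩
    rw [uIcc_self]
    refine ⟨continuousOn_const, ?_, ?_⟩
    · rintro f hf a rfl t rfl
      exact IntervalIntegrable.refl
    · rintro f hf a rfl t rfl
      simp
  -- Goodness passes between nearby times in both directions, so connectedness of the interval
  -- replaces a finite subdivision and no direction of time is singled out.
  have hstep : ∀ s ∈ uIcc t₀ t₁, ∀ᶠ b in 𝓝[uIcc t₀ t₁] s, (Good s → Good b) ∧ (Good b → Good s) := by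
    intro s hs
    obtain ⟨ε, hε, O, hO, N, hN, hloc⟩ := hF p₀ (ζ₀ s) (min t₀ t₁) (max t₀ t₁) hJT
    have key : ∀ a ∈ uIcc t₀ t₁, ∀ b ∈ uIcc t₀ t₁, |a - b| ≤ ε → ζ₀ a ∈ interior N →
        Good a → Good b := by
      rintro a ha b hb hab haN ⟨Ψ, hΨR, hΨ0, hΨ⟩
      have habJ : uIcc a b ⊆ uIcc t₀ t₁ := ordConnected_uIcc.uIcc_subset ha hb
      obtain ⟨Ψ', hΨ'⟩ := hloc (min a b) (max a b) habJ (by rwa [max_sub_min_eq_abs'])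
        a left_mem_uIcc b right_mem_uIcc
      have hO' := mem_of_mem_nhds hO
      obtain ⟨hR', ζ', hζ', hζ'a, hζ'b⟩ := hΨ' p₀ hO' (ζ₀ a) (interior_subset haN)
      refine ⟨fun p y ↦ Ψ' p (Ψ p y), hR.comp _ _ _ _ hΨR (hΨ0 ▸ hR'), ?_, ?_⟩
      · simp only [hΨ0]
        rw [← hζ'b]
        exact (hU.eqOn (habJ.trans hJT) hζ' (hζ₀.mono habJ) left_mem_uIcc hζ'a right_mem_uIcc)
      · have hc := hR.continuousAt _ _ _ hΨR
        have hcN : ∀ᶠ z : P × M in 𝓝 (p₀, x₀), Ψ z.1 z.2 ∈ N := by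
          refine hc.eventually_mem ?_
          simp only [hΨ0]
          exact mem_interior_iff_mem_nhds.1 haN
        have hcO : ∀ᶠ z : P × M in 𝓝 (p₀, x₀), z.1 ∈ O :=
          (continuous_fst.tendsto (p₀, x₀)).eventually hO
        filter_upwards [hΨ, hcN, hcO] with z hz hzN hzO
        obtain ⟨ζ₁, hζ₁, h10, h1a⟩ := hz
        obtain ⟨-, ζ₂, hζ₂, h2a, h2b⟩ := hΨ' z.1 hzO _ hzN
        have hJ1 : uIcc t₀ a ⊆ uIcc t₀ t₁ := ordConnected_uIcc.uIcc_subset left_mem_uIcc ha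
        -- If `b` lies between `t₀` and `a`, the two intervals share more than the time `a`, and
        -- uniqueness is needed before gluing.
        have hEq : EqOn ζ₁ ζ₂ (uIcc t₀ a ∩ uIcc a b) :=
          hU.eqOn_inter ordConnected_uIcc ordConnected_Icc (hJ1.trans hJT) hζ₁ hζ₂
            right_mem_uIcc left_mem_uIcc (h1a.trans h2a.symm)
        obtain ⟨ζ, hζ, e1, e2⟩ := hζ₁.exists_union hζ₂ ordConnected_uIcc ordConnected_Icc
          isClosed_Icc isClosed_Icc hEq right_mem_uIcc left_mem_uIcc
        refine ⟨ζ, hζ.mono uIcc_subset_uIcc_union_uIcc, ?_, ?_⟩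
        · rw [e1 left_mem_uIcc, h10]
        · rw [e2 right_mem_uIcc, h2b]
    have hsN : ζ₀ s ∈ interior N := mem_interior_iff_mem_nhds.2 hN
    have h1 : ∀ᶠ b in 𝓝[uIcc t₀ t₁] s, ζ₀ b ∈ interior N :=
      (hζ₀.continuousOn s hs).eventually (isOpen_interior.mem_nhds hsN)
    have h2 : ∀ᶠ b in 𝓝[uIcc t₀ t₁] s, |b - s| ≤ ε :=
      nhdsWithin_le_nhds (mem_of_superset (Metric.closedBall_mem_nhds s hε) fun b hb ↦ by
        rwa [Metric.mem_closedBall, Real.dist_eq] at hb)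
    filter_upwards [h1, h2, self_mem_nhdsWithin] with b hb1 hb2 hb
    exact ⟨key s hs b hb (by rwa [abs_sub_comm]) hsN, key b hb s hs hb2 hb1⟩
  obtain ⟨Ψ, h1, -, h3⟩ : Good t₁ :=
    isPreconnected_uIcc.induction₂' (fun a b ↦ Good a → Good b) hstep
      (fun a b c _ _ _ hab hbc h ↦ hbc (hab h)) left_mem_uIcc right_mem_uIcc hstart
  exact ⟨Ψ, h1, h3⟩

/-- The flow is regular, and its domain is open in the parameter and the initial point. -/
theorem flow_regular [T2Space M] (hT : T.OrdConnected) (hU : LocallyUnique A T X)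
    {R : P → M → (P → M → M) → Prop} (hR : IsRegularity R) (hF : HasLocalFlows A T X R)
    {t₀ t₁ : ℝ} (ht₀ : t₀ ∈ T) (ht₁ : t₁ ∈ T) {p₀ : P} {x₀ : M}
    (hx₀ : x₀ ∈ flowDomain A T (X p₀) t₁ t₀) :
    R p₀ x₀ (fun p ↦ flow A T (X p) t₁ t₀) ∧
      ∀ᶠ z : P × M in 𝓝 (p₀, x₀), z.2 ∈ flowDomain A T (X z.1) t₁ t₀ := by
  obtain ⟨ζ₀, S, hST, hS, h0, h1, hc, he⟩ := hx₀
  obtain ⟨Ψ, hΨR, hΨ⟩ := exists_patched_flow hT hU hR hF ht₀ ht₁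
    (hc.mono (hS.uIcc_subset h0 h1)) he
  have key : ∀ᶠ z : P × M in 𝓝 (p₀, x₀), ∃ ζ, IsIntegralCurveFrom A T (X z.1) t₁ t₀ z.2 ζ ∧
      ζ t₁ = Ψ z.1 z.2 := by
    filter_upwards [hΨ] with z ⟨ζ, hζ, h0, h1⟩
    exact ⟨ζ, ⟨uIcc t₀ t₁, hT.uIcc_subset ht₀ ht₁, ordConnected_uIcc, left_mem_uIcc, right_mem_uIcc,
      hζ, h0⟩, h1⟩
  refine ⟨hR.congr _ _ _ _ hΨR ?_, ?_⟩
  · filter_upwards [key] with z ⟨ζ, hζ, h1⟩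
    rw [← h1, hU.eq_flow hζ]
  · filter_upwards [key] with z ⟨ζ, hζ, _⟩
    exact ⟨ζ, hζ⟩

/-- The domain is open near each `(p₀, x)` with `x ∈ K`; compactness of `K` gives one neighbourhood
of `p₀` for all of them. -/
theorem eventually_subset_flowDomain [T2Space M] (hT : T.OrdConnected) (hU : LocallyUnique A T X)
    {R : P → M → (P → M → M) → Prop} (hR : IsRegularity R) (hF : HasLocalFlows A T X R)
    {t₀ t₁ : ℝ} (ht₀ : t₀ ∈ T) (ht₁ : t₁ ∈ T) {p₀ : P} {K : Set M} (hK : IsCompact K)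
    (hKD : K ⊆ flowDomain A T (X p₀) t₁ t₀) :
    ∀ᶠ p in 𝓝 p₀, K ⊆ flowDomain A T (X p) t₁ t₀ := by
  have := hK.eventually_forall_of_forall_eventually (x₀ := p₀)
    (P := fun p x ↦ x ∈ flowDomain A T (X p) t₁ t₀)
    fun x hx ↦ (flow_regular hT hU hR hF ht₀ ht₁ (hKD hx)).2
  exact this

end Patching

/-! ### Integral curves in charts -/

section Charts

variable {𝕜 : Type*} [RCLike 𝕜] {E : Type*} [NormedAddCommGroup E] [NormedSpace 𝕜 E]
  {M : Type*} [TopologicalSpace M] [ChartedSpace E M]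

/-- The coordinate expression of tangent vectors at `x` in the chart at `x₀`. -/
def tcoord [IsManifold 𝓘(𝕜, E) 1 M] (x₀ x : M) : TangentSpace 𝓘(𝕜, E) x →L[𝕜] E :=
  (trivializationAt E (TangentSpace 𝓘(𝕜, E)) x₀).continuousLinearMapAt 𝕜 x

/-- The coordinate expression of a vector field in the chart at `x₀`. -/
def chartRep [IsManifold 𝓘(𝕜, E) 1 M] (x₀ : M) (V : Π x : M, TangentSpace 𝓘(𝕜, E) x) (y : E) : E :=
  tcoord x₀ ((chartAt E x₀).symm y) (V ((chartAt E x₀).symm y))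

/-- The test functions are of class `C¹` and provide local coordinates. -/
structure HasCoordinates (A : Set (M → 𝕜)) : Prop where
  contDiffOn : ∀ f ∈ A, ∀ x₀ : M, ContDiffOn 𝕜 1 (f ∘ (chartAt E x₀).symm) (chartAt E x₀).target
  coords : ∀ x₀ : M, ∃ z : M → E, (∀ l : E →L[𝕜] 𝕜, (fun x ↦ l (z x)) ∈ A) ∧
    ContDiffOn 𝕜 1 (z ∘ (chartAt E x₀).symm) (chartAt E x₀).target ∧
    ∃ G : E → E, ContDiffAt 𝕜 1 G (z x₀) ∧ ∀ᶠ x in 𝓝 x₀, G (z x) = chartAt E x₀ x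

variable [IsManifold 𝓘(𝕜, E) 1 M]

theorem chartRep_apply {x₀ x : M} (hx : x ∈ (chartAt E x₀).source)
    (V : Π x : M, TangentSpace 𝓘(𝕜, E) x) :
    chartRep x₀ V (chartAt E x₀ x) = tcoord x₀ x (V x) :=
  congrArg (fun y ↦ tcoord x₀ y (V y)) ((chartAt E x₀).left_inv hx)

theorem mvfderiv_eq_fderiv_chart {F : Type*} [NormedAddCommGroup F] [NormedSpace 𝕜 F]
    {f : M → F} {x₀ x : M} (hx : x ∈ (chartAt E x₀).source)
    (hf : DifferentiableAt 𝕜 (f ∘ (chartAt E x₀).symm) (chartAt E x₀ x))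
    (v : TangentSpace 𝓘(𝕜, E) x) :
    mvfderiv 𝓘(𝕜, E) f x v
      = fderiv 𝕜 (f ∘ (chartAt E x₀).symm) (chartAt E x₀ x) (tcoord x₀ x v) := by
  have h1 : f =ᶠ[𝓝 x] (f ∘ (chartAt E x₀).symm) ∘ (extChartAt 𝓘(𝕜, E) x₀) := by
    filter_upwards [(chartAt E x₀).open_source.mem_nhds hx] with y hy
    simp [(chartAt E x₀).left_inv hy]
  have h2 : MDifferentiableAt 𝓘(𝕜, E) 𝓘(𝕜, E) (extChartAt 𝓘(𝕜, E) x₀) x :=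
    mdifferentiableAt_extChartAt hx
  have h3 : MDifferentiableAt 𝓘(𝕜, E) 𝓘(𝕜, F) (f ∘ (chartAt E x₀).symm)
      (extChartAt 𝓘(𝕜, E) x₀ x) := by
    simpa using hf.mdifferentiableAt
  have h4 : mfderiv 𝓘(𝕜, E) 𝓘(𝕜, F) f x v
      = mfderiv 𝓘(𝕜, E) 𝓘(𝕜, F) (f ∘ (chartAt E x₀).symm) (extChartAt 𝓘(𝕜, E) x₀ x)
        (mfderiv 𝓘(𝕜, E) 𝓘(𝕜, E) (extChartAt 𝓘(𝕜, E) x₀) x v) := by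
    have := h1.mfderiv_eq (I := 𝓘(𝕜, E)) (I' := 𝓘(𝕜, F))
    rw [mfderiv_comp x h3 h2] at this
    exact congrArg (fun L : E →L[𝕜] F ↦ L v) this
  rw [← TangentBundle.continuousLinearMapAt_trivializationAt hx, mfderiv_eq_fderiv] at h4
  exact h4

variable {A : Set (M → 𝕜)} [NormedSpace ℝ E] [IsScalarTower ℝ 𝕜 E]

/-- Solutions in a chart are integral curves. -/
theorem IsSol.isIntegralCurve [CompleteSpace E] (hA : HasCoordinates (E := E) A) {x₀ : M}
    {X : ℝ → Π x : M, TangentSpace 𝓘(𝕜, E) x} {c d a : ℝ} (ha : a ∈ Icc c d) {Ω : Set E}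
    (hΩ : Ω ⊆ (chartAt E x₀).target) {x : E} {ξ : ℝ → E}
    (hξ : IsSol (fun t ↦ chartRep x₀ (X t)) c d a Ω x ξ) :
    IsIntegralCurve A X (Icc c d) (fun t ↦ (chartAt E x₀).symm (ξ t)) := by
  have hmem : ∀ t ∈ Icc c d, ξ t ∈ (chartAt E x₀).target := fun t ht ↦ hΩ (hξ.mem t ht)
  have hop := (chartAt E x₀).open_target
  have key : ∀ f ∈ A, ∀ s ∈ Icc c d, mvfderiv 𝓘(𝕜, E) f ((chartAt E x₀).symm (ξ s))
      (X s ((chartAt E x₀).symm (ξ s)))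
      = (fderiv 𝕜 (f ∘ (chartAt E x₀).symm) (ξ s)).restrictScalars ℝ (chartRep x₀ (X s) (ξ s)) := by
    intro f hf s hs
    have hs' := hmem s hs
    have hd := ((hA.contDiffOn f hf x₀).contDiffAt (hop.mem_nhds hs')).differentiableAt one_ne_zero
    rw [mvfderiv_eq_fderiv_chart ((chartAt E x₀).map_target hs')
      (by rwa [(chartAt E x₀).right_inv hs']), (chartAt E x₀).right_inv hs']
    rfl
  have hcont : ∀ f ∈ A, ContinuousOn
      (fun s ↦ (fderiv 𝕜 (f ∘ (chartAt E x₀).symm) (ξ s)).restrictScalars ℝ) (Icc c d) := by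
    intro f hf
    have h1 := (hA.contDiffOn f hf x₀).continuousOn_fderiv_of_isOpen hop le_rfl
    have h2 : Continuous (ContinuousLinearMap.restrictScalars ℝ : (E →L[𝕜] 𝕜) → (E →L[ℝ] 𝕜)) :=
      (ContinuousLinearMap.restrictScalarsL 𝕜 E 𝕜 ℝ ℝ).continuous
    exact h2.comp_continuousOn (h1.comp hξ.cont hmem)
  have heq : ∀ b ∈ Icc c d, ∀ t ∈ Icc c d,
      ξ t = ξ b + ∫ s in b..t, chartRep x₀ (X s) (ξ s) := by
    intro b hb t ht
    rw [hξ.eq t ht, hξ.eq b hb, add_assoc, intervalIntegral.integral_add_adjacent_intervals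
      (intervalIntegrable_of_Icc hξ.int ha hb) (intervalIntegrable_of_Icc hξ.int hb ht)]
  refine ⟨(chartAt E x₀).continuousOn_symm.comp hξ.cont hmem, fun f hf b hb t ht ↦ ?_,
    fun f hf b hb t ht ↦ ?_⟩
  · refine intervalIntegrable_of_Icc ?_ hb ht
    exact (integrableOn_clm_apply (hcont f hf) hξ.int).congr_fun (fun s hs ↦ (key f hf s hs).symm)
      measurableSet_Icc
  · have := chain_integral (Φ := f ∘ (chartAt E x₀).symm)
      (Φ' := fun y ↦ (fderiv 𝕜 (f ∘ (chartAt E x₀).symm) y).restrictScalars ℝ) hξ.int heq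
      (fun t ht ↦ (((hA.contDiffOn f hf x₀).contDiffAt
        (hop.mem_nhds (hmem t ht))).hasStrictFDerivAt one_ne_zero).restrictScalars ℝ)
      (hcont f hf) hb ht
    rw [intervalIntegral.integral_congr (g := fun s ↦
      (fderiv 𝕜 (f ∘ (chartAt E x₀).symm) (ξ s)).restrictScalars ℝ (chartRep x₀ (X s) (ξ s)))
      (fun s hs ↦ key f hf s (ordConnected_Icc.uIcc_subset hb ht hs))]
    exact this

/-- Integral curves are solutions in a chart, for short times. -/
theorem IsIntegralCurve.eventually_isSol [FiniteDimensional 𝕜 E] (hA : HasCoordinates (E := E) A)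
    {X : ℝ → Π x : M, TangentSpace 𝓘(𝕜, E) x} {c d : ℝ} {ζ : ℝ → M}
    (hζ : IsIntegralCurve A X (Icc c d) ζ) {s₀ : ℝ} (hs₀ : s₀ ∈ Icc c d) {R : ℝ} (hR : 0 < R) :
    ∀ᶠ δ : ℝ in 𝓝[>] 0, (∀ t ∈ Icc (max c (s₀ - δ)) (min d (s₀ + δ)),
        ζ t ∈ (chartAt E (ζ s₀)).source) ∧
      IsSol (fun t ↦ chartRep (ζ s₀) (X t)) (max c (s₀ - δ)) (min d (s₀ + δ)) s₀
        (Metric.ball (chartAt E (ζ s₀) (ζ s₀)) R) (chartAt E (ζ s₀) (ζ s₀))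
        (fun t ↦ chartAt E (ζ s₀) (ζ t)) := by
  have hcE : CompleteSpace E := FiniteDimensional.complete 𝕜 E
  set x₀ := ζ s₀ with hx₀
  set e := chartAt E x₀ with he
  -- The chart itself need not consist of test functions. The integral equation is obtained for the
  -- coordinates `z`, whose components are test functions, and carried to the chart by `G` through
  -- the chain rule.
  obtain ⟨z, hzA, hzc, G, hG, hGz⟩ := hA.coords x₀
  have hx₀e : x₀ ∈ e.source := mem_chart_source E x₀
  -- good points
  have hcz : ContinuousAt z x₀ := by
    have h1 : ContinuousAt (z ∘ e.symm) (e x₀) :=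
      (hzc.continuousOn).continuousAt (e.open_target.mem_nhds (e.map_source hx₀e))
    have h2 : ContinuousAt ((z ∘ e.symm) ∘ e) x₀ := h1.comp (e.continuousAt hx₀e)
    refine h2.congr ?_
    filter_upwards [e.open_source.mem_nhds hx₀e] with y hy
    simp [e.left_inv hy]
  have hgood : ∀ᶠ x in 𝓝 x₀, x ∈ e.source ∧ e x ∈ Metric.ball (e x₀) R ∧
      ContDiffAt 𝕜 1 G (z x) ∧ ∀ᶠ x' in 𝓝 x, G (z x') = e x' := by
    refine Eventually.and (e.open_source.mem_nhds hx₀e) (((e.continuousAt hx₀e).eventually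
      (Metric.ball_mem_nhds _ hR)).and ((hcz.eventually (hG.eventually (by simp))).and
        (eventually_eventually_nhds.2 hGz)))
  have hgood' : ∀ᶠ t in 𝓝[Icc c d] s₀, ζ t ∈ {x | x ∈ e.source ∧ e x ∈ Metric.ball (e x₀) R ∧
      ContDiffAt 𝕜 1 G (z x) ∧ ∀ᶠ x' in 𝓝 x, G (z x') = e x'} :=
    (hζ.continuousOn s₀ hs₀).eventually hgood
  obtain ⟨δ₀, hδ₀, hsub⟩ := Metric.mem_nhdsWithin_iff.1 hgood'
  filter_upwards [Ioo_mem_nhdsGT hδ₀] with δ hδ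
  set c' := max c (s₀ - δ)
  set d' := min d (s₀ + δ)
  have hJ : Icc c' d' ⊆ Icc c d := Icc_subset_Icc (le_max_left _ _) (min_le_left _ _)
  have hs₀' : s₀ ∈ Icc c' d' :=
    ⟨max_le hs₀.1 (by linarith [hδ.1]), le_min hs₀.2 (by linarith [hδ.1])⟩
  have hgt : ∀ t ∈ Icc c' d', ζ t ∈ e.source ∧ e (ζ t) ∈ Metric.ball (e x₀) R ∧
      ContDiffAt 𝕜 1 G (z (ζ t)) ∧ ∀ᶠ x' in 𝓝 (ζ t), G (z x') = e x' := by
    intro t ht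
    refine hsub ⟨?_, hJ ht⟩
    rw [Metric.mem_ball, Real.dist_eq, abs_lt]
    have h1 := (le_max_right c (s₀ - δ)).trans ht.1
    have h2 := ht.2.trans (min_le_right d (s₀ + δ))
    constructor <;> linarith [hδ.2]
  have hζc : ContinuousOn ζ (Icc c' d') := hζ.continuousOn.mono hJ
  have hec : ContinuousOn (fun t ↦ e (ζ t)) (Icc c' d') :=
    e.continuousOn.comp hζc fun t ht ↦ (hgt t ht).1
  have hzsymm : ∀ t ∈ Icc c' d', ContDiffAt 𝕜 1 (z ∘ e.symm) (e (ζ t)) := fun t ht ↦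
    hzc.contDiffAt (e.open_target.mem_nhds (e.map_source (hgt t ht).1))
  have hzζ : ContinuousOn (fun t ↦ z (ζ t)) (Icc c' d') := by
    refine (hzc.continuousOn.comp hec fun t ht ↦ e.map_source (hgt t ht).1).congr ?_
    intro t ht
    exact congrArg z (e.left_inv (hgt t ht).1).symm
  -- the velocity in the coordinates `z`
  set g : ℝ → E := fun s ↦ mvfderiv 𝓘(𝕜, E) z (ζ s) (X s (ζ s)) with hg
  have hgl : ∀ l : E →L[𝕜] 𝕜, ∀ s ∈ Icc c' d',
      mvfderiv 𝓘(𝕜, E) (fun x ↦ l (z x)) (ζ s) (X s (ζ s)) = l (g s) := by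
    intro l s hs
    have hd := (hzsymm s hs).differentiableAt one_ne_zero
    simp only [hg]
    rw [mvfderiv_eq_fderiv_chart (hgt s hs).1 hd,
      mvfderiv_eq_fderiv_chart (f := fun x ↦ l (z x)) (hgt s hs).1 (l.differentiableAt.comp _ hd)]
    have := (l.hasFDerivAt.comp (e (ζ s)) hd.hasFDerivAt).fderiv
    exact congrArg (fun L : E →L[𝕜] 𝕜 ↦ L (tcoord x₀ (ζ s) (X s (ζ s)))) this
  have hcd' : c' ≤ d' := hs₀'.1.trans hs₀'.2
  set b := Module.finBasis 𝕜 E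
  -- Integrability is part of the definition for each scalar test function, hence for every
  -- component of the velocity in a basis.
  have hgint : IntegrableOn g (Icc c' d') := by
    have h1 : ∀ i, IntegrableOn (fun s ↦ (b.coord i).toContinuousLinearMap (g s)) (Icc c' d') := by
      intro i
      have := hζ.intervalIntegrable _ (hzA (b.coord i).toContinuousLinearMap) c'
        (hJ ⟨le_rfl, hcd'⟩) d' (hJ ⟨hcd', le_rfl⟩)
      rw [intervalIntegrable_iff_integrableOn_Icc_of_le hcd'] at this
      exact this.congr_fun (fun s hs ↦ hgl _ s hs) measurableSet_Icc
    have h2 : IntegrableOn (fun s ↦ ∑ i, (b.coord i).toContinuousLinearMap (g s) • b i) (Icc c' d') :=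
      integrable_finsetSum _ fun i _ ↦ (h1 i).smul_const (b i)
    refine h2.congr_fun (fun s _ ↦ ?_) measurableSet_Icc
    exact b.sum_repr (g s)
  have hgeq : ∀ a ∈ Icc c' d', ∀ t ∈ Icc c' d', z (ζ t) = z (ζ a) + ∫ s in a..t, g s := by
    intro a ha t ht
    refine b.ext_elem fun i ↦ ?_
    have h1 := hζ.integral_eq _ (hzA (b.coord i).toContinuousLinearMap) a (hJ ha) t (hJ ht)
    rw [intervalIntegral.integral_congr (g := fun s ↦ (b.coord i).toContinuousLinearMap (g s))
      (fun s hs ↦ hgl _ s (ordConnected_Icc.uIcc_subset ha ht hs)),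
      ContinuousLinearMap.intervalIntegral_comp_comm _ (intervalIntegrable_of_Icc hgint ha ht),
      ← map_add] at h1
    exact h1
  have hGc : ContinuousOn (fun t ↦ (fderiv 𝕜 G (z (ζ t))).restrictScalars ℝ) (Icc c' d') := by
    have h2 : Continuous (ContinuousLinearMap.restrictScalars ℝ : (E →L[𝕜] E) → (E →L[ℝ] E)) :=
      (ContinuousLinearMap.restrictScalarsL 𝕜 E E ℝ ℝ).continuous
    refine h2.comp_continuousOn fun t ht ↦ ?_
    have h3 : ContinuousAt (fderiv 𝕜 G) (z (ζ t)) :=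
      ((hgt t ht).2.2.1.fderiv_right (m := 0) (by simp)).continuousAt
    exact ContinuousAt.comp_continuousWithinAt (f := fun t ↦ z (ζ t)) h3 (hzζ t ht)
  -- Since `G ∘ z` is the chart near `ζ s`, the derivative of `G` undoes that of `z` and returns the
  -- velocity in the chart.
  have hrep : ∀ s ∈ Icc c' d', (fderiv 𝕜 G (z (ζ s))).restrictScalars ℝ (g s)
      = chartRep x₀ (X s) (e (ζ s)) := by
    intro s hs
    have hd := (hzsymm s hs).differentiableAt one_ne_zero
    simp only [hg]
    rw [chartRep_apply (hgt s hs).1, mvfderiv_eq_fderiv_chart (hgt s hs).1 hd]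
    have h1 : DifferentiableAt 𝕜 G ((z ∘ e.symm) (e (ζ s))) := by
      simpa [e.left_inv (hgt s hs).1] using (hgt s hs).2.2.1.differentiableAt one_ne_zero
    have h2 := fderiv_comp (e (ζ s)) h1 hd
    have h3 : G ∘ z ∘ e.symm =ᶠ[𝓝 (e (ζ s))] id := by
      have h4 := (e.continuousAt_symm (e.map_source (hgt s hs).1)).tendsto
      rw [e.left_inv (hgt s hs).1] at h4
      filter_upwards [h4.eventually (hgt s hs).2.2.2,
        e.open_target.mem_nhds (e.map_source (hgt s hs).1)] with y hy hy'
      simp only [Function.comp_apply, hy, e.right_inv hy', id]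
    rw [h3.fderiv_eq, fderiv_id] at h2
    have h5 := congrArg (fun L : E →L[𝕜] E ↦ L (tcoord x₀ (ζ s) (X s (ζ s)))) h2
    simp only [Function.comp_apply, e.left_inv (hgt s hs).1] at h5
    exact h5.symm
  refine ⟨fun t ht ↦ (hgt t ht).1, hec, fun t ht ↦ (hgt t ht).2.1, ?_, fun t ht ↦ ?_⟩
  · exact (integrableOn_clm_apply hGc hgint).congr_fun hrep measurableSet_Icc
  · have := chain_integral (Φ := G) (Φ' := fun y ↦ (fderiv 𝕜 G y).restrictScalars ℝ) hgint hgeq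
      (fun t ht ↦ ((hgt t ht).2.2.1.hasStrictFDerivAt one_ne_zero).restrictScalars ℝ) hGc hs₀' ht
    rw [(hgt t ht).2.2.2.self_of_nhds, (hgt s₀ hs₀').2.2.2.self_of_nhds,
      intervalIntegral.integral_congr
        (fun s hs ↦ hrep s (ordConnected_Icc.uIcc_subset hs₀' ht hs))] at this
    exact this

end Charts

/-! ### Local uniqueness and local flows from Carathéodory fields in charts -/

section LocalFlows

variable {𝕜 : Type*} [RCLike 𝕜] {E : Type u} [NormedAddCommGroup E] [NormedSpace 𝕜 E]
  {M : Type v} [TopologicalSpace M] [ChartedSpace E M] [IsManifold 𝓘(𝕜, E) 1 M]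
  {A : Set (M → 𝕜)} [NormedSpace ℝ E] [IsScalarTower ℝ 𝕜 E] [FiniteDimensional 𝕜 E]
  [FiniteDimensional ℝ E] {P : Type w} [TopologicalSpace P]

/-- The coordinate expressions of the vector fields are Carathéodory fields of class `C^m`. -/
def IsLocallyCaratheodory (T : Set ℝ) (m : ℕ) (X : P → ℝ → Π x : M, TangentSpace 𝓘(𝕜, E) x) :
    Prop :=
  ∀ (x₀ : M) (c d : ℝ), Icc c d ⊆ T → ∃ R > 0,
    Metric.ball (chartAt E x₀ x₀) R ⊆ (chartAt E x₀).target ∧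
    IsCaratheodoryC c d m (Metric.ball (chartAt E x₀ x₀) R) (fun p t ↦ chartRep x₀ (X p t))

theorem IsCaratheodoryC.of_succ {c d : ℝ} (m : ℕ) :
    ∀ {E : Type u} [NormedAddCommGroup E] [NormedSpace ℝ E]
      {F : Type v} [NormedAddCommGroup F] [NormedSpace ℝ F] {Ω : Set E}
      {X : P → ℝ → E → F} (_ : IsCaratheodoryC c d (m + 1) Ω X), IsCaratheodoryC c d m Ω X := by
  induction m with
  | zero => exact fun h ↦ h.1
  | succ m ih => exact fun h ↦ ⟨h.1, h.2.1, ih h.2.2⟩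

theorem IsCaratheodoryC.of_le {c d : ℝ} {j m : ℕ} (hj : j ≤ m) {E : Type u} [NormedAddCommGroup E]
    [NormedSpace ℝ E] {F : Type v} [NormedAddCommGroup F] [NormedSpace ℝ F] {Ω : Set E}
    {X : P → ℝ → E → F} (h : IsCaratheodoryC c d m Ω X) : IsCaratheodoryC c d j Ω X := by
  induction hj with
  | refl => exact h
  | step _ ih => exact ih (IsCaratheodoryC.of_succ _ h)

variable {T : Set ℝ} {X : P → ℝ → Π x : M, TangentSpace 𝓘(𝕜, E) x}

/-- For short times both curves are solutions in the same ball of the chart at their common point,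
where Euclidean uniqueness applies. -/
theorem IsLocallyCaratheodory.locallyUnique (hA : HasCoordinates (E := E) A)
    (hX : IsLocallyCaratheodory T 1 X) : LocallyUnique A T X := by
  intro p c d hcd ζ ζ' hζ hζ' s hs hss
  obtain ⟨R, hR, -, hC⟩ := hX (ζ s) c d hcd
  have h1 := hζ.eventually_isSol hA hs hR
  have h2 := hζ'.eventually_isSol hA hs hR
  rw [← hss] at h2
  obtain ⟨δ, ⟨⟨hδ1, hδ2⟩, hδ1', hδ2'⟩, hδ⟩ := ((h1.and h2).and self_mem_nhdsWithin).exists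
  have hJ : Icc (max c (s - δ)) (min d (s + δ)) ⊆ Icc c d :=
    Icc_subset_Icc (le_max_left _ _) (min_le_left _ _)
  have hδ0 : (0 : ℝ) < δ := hδ
  have hs' : s ∈ Icc (max c (s - δ)) (min d (s + δ)) :=
    ⟨max_le hs.1 (by linarith), le_min hs.2 (by linarith)⟩
  have heq := IsSol.unique hs' (hC.mono hJ 1 Subset.rfl) hδ2 hδ2'
  have hnb : Icc (max c (s - δ)) (min d (s + δ)) ∈ 𝓝[Icc c d] s := by
    filter_upwards [self_mem_nhdsWithin,
      nhdsWithin_le_nhds (Icc_mem_nhds (show s - δ < s by linarith) (show s < s + δ by linarith))]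
      with t ht ht'
    exact ⟨max_le ht.1 ht'.1, le_min ht.2 ht'.2⟩
  filter_upwards [hnb] with t ht
  exact (chartAt E (ζ s)).injOn (hδ1 t ht) (hδ1' t ht) (heq ht)

/-- The predicate `Reg` stays abstract so that jointly `C^m` families and holomorphic families share
one construction; `hReg` asks only that local solution families, read through the chart, be regular.
-/
theorem IsLocallyCaratheodory.hasLocalFlows (hA : HasCoordinates (E := E) A) {m : ℕ} (hm : 1 ≤ m)
    (hX : IsLocallyCaratheodory T m X) {Reg : P → M → (P → M → M) → Prop}
    (hReg : ∀ (x₀ : M) (c d a b : ℝ), a ∈ Icc c d → b ∈ Icc c d → Icc c d ⊆ T → ∀ (Ω : Set E),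
      IsOpen Ω → Ω ⊆ (chartAt E x₀).target →
      IsCaratheodoryC c d m Ω (fun p t ↦ chartRep x₀ (X p t)) → ∀ (O : Set P) (W : Set E), IsOpen O →
      IsOpen W → ∀ ξ, IsSolFamily (fun p t ↦ chartRep x₀ (X p t)) c d a Ω O W ξ →
      ∀ p ∈ O, ∀ x ∈ (chartAt E x₀).source, chartAt E x₀ x ∈ W →
        Reg p x (fun p x ↦ (chartAt E x₀).symm (ξ p (chartAt E x₀ x) b))) :
    HasLocalFlows A T X Reg := by
  have hcE : CompleteSpace E := FiniteDimensional.complete 𝕜 E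
  intro p₀ y₀ c₀ d₀ hT
  obtain ⟨R, hR, hRt, hC⟩ := hX y₀ c₀ d₀ hT
  obtain ⟨r, hr, ε, hε, O, hO, hp₀, hfam⟩ := exists_isSolFamily Metric.isOpen_ball (hC.of_le hm) p₀
    (Metric.mem_ball_self hR)
  refine ⟨ε, hε, O, hO.mem_nhds hp₀, (chartAt E y₀).source ∩
    chartAt E y₀ ⁻¹' Metric.ball (chartAt E y₀ y₀) r, ?_, ?_⟩
  · exact inter_mem ((chartAt E y₀).open_source.mem_nhds (mem_chart_source E y₀))
      (((chartAt E y₀).continuousAt (mem_chart_source E y₀)) (Metric.ball_mem_nhds _ hr))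
  · intro c d hcd hε' a ha b hb
    obtain ⟨ξ, hξ⟩ := hfam c d hcd hε' a ha
    refine ⟨_, fun p hp x hx ↦ ⟨hReg y₀ c d a b ha hb (hcd.trans hT) _ Metric.isOpen_ball hRt
      (hC.mono hcd m Subset.rfl) O _ hO Metric.isOpen_ball ξ hξ p hp x hx.1 hx.2, ?_⟩⟩
    have hs := hξ.sol p hp _ hx.2
    refine ⟨_, IsSol.isIntegralCurve (X := X p) hA ha hRt hs, ?_, rfl⟩
    have := hs.eq a ha
    rw [intervalIntegral.integral_same, add_zero] at this
    simp only [this, (chartAt E y₀).left_inv hx.1]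

end LocalFlows

/-! ### Jointly `C^m` families of maps of a manifold -/

section Regularity

variable {E : Type u} [NormedAddCommGroup E] [NormedSpace ℝ E]
  {M : Type v} [TopologicalSpace M] [ChartedSpace E M] {P : Type w} [TopologicalSpace P]

/-- The family `Ψ` is jointly of class `C^m` near `(p₀, x₀)`. -/
def RegAt (E : Type u) [NormedAddCommGroup E] [NormedSpace ℝ E]
    {M : Type v} [TopologicalSpace M] [ChartedSpace E M] {P : Type w} [TopologicalSpace P]
    (m : ℕ) (p₀ : P) (x₀ : M) (Ψ : P → M → M) : Prop :=
  ∃ (w₁ w₂ : M) (O : Set P) (W : Set E), IsOpen O ∧ p₀ ∈ O ∧ IsOpen W ∧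
    x₀ ∈ (chartAt E w₁).source ∧ chartAt E w₁ x₀ ∈ W ∧ W ⊆ (chartAt E w₁).target ∧
    (∀ p ∈ O, ∀ y ∈ W, Ψ p ((chartAt E w₁).symm y) ∈ (chartAt E w₂).source) ∧
    IsJointC O m W (fun p y ↦ chartAt E w₂ (Ψ p ((chartAt E w₁).symm y)))

theorem RegAt.of_le {m m' : ℕ} (hm : m ≤ m') {p₀ : P} {x₀ : M} {Ψ : P → M → M}
    (h : RegAt E m' p₀ x₀ Ψ) : RegAt E m p₀ x₀ Ψ := by
  obtain ⟨w₁, w₂, O, W, hO, hp, hW, hx, hxW, hWt, hmem, hJ⟩ := h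
  exact ⟨w₁, w₂, O, W, hO, hp, hW, hx, hxW, hWt, hmem, hJ.of_le hm⟩

theorem RegAt.continuousAt {m : ℕ} {p₀ : P} {x₀ : M} {Ψ : P → M → M} (h : RegAt E m p₀ x₀ Ψ) :
    ContinuousAt (fun z : P × M ↦ Ψ z.1 z.2) (p₀, x₀) := by
  obtain ⟨w₁, w₂, O, W, hO, hp, hW, hx, hxW, hWt, hmem, hJ⟩ := h
  have h1 : ContinuousAt (fun z : P × E ↦ chartAt E w₂ (Ψ z.1 ((chartAt E w₁).symm z.2)))
      (p₀, chartAt E w₁ x₀) :=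
    hJ.continuousOn.continuousAt ((hO.prod hW).mem_nhds ⟨hp, hxW⟩)
  have h2 : ContinuousAt (fun z : P × M ↦ (z.1, chartAt E w₁ z.2)) (p₀, x₀) :=
    continuousAt_fst.prodMk (((chartAt E w₁).continuousAt hx).comp continuousAt_snd)
  have h3 : ContinuousAt (fun z : P × M ↦
      chartAt E w₂ (Ψ z.1 ((chartAt E w₁).symm (chartAt E w₁ z.2)))) (p₀, x₀) :=
    ContinuousAt.comp (g := fun z : P × E ↦ chartAt E w₂ (Ψ z.1 ((chartAt E w₁).symm z.2)))
      (f := fun z : P × M ↦ (z.1, chartAt E w₁ z.2)) h1 h2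
  have h0 := hmem p₀ hp _ hxW
  have h4 := ((chartAt E w₂).continuousAt_symm ((chartAt E w₂).map_source h0)).comp_of_eq h3 rfl
  refine h4.congr ?_
  have h5 : ∀ᶠ z : P × M in 𝓝 (p₀, x₀), (z.1, chartAt E w₁ z.2) ∈ O ×ˢ W :=
    h2.eventually_mem ((hO.prod hW).mem_nhds ⟨hp, hxW⟩)
  filter_upwards [h5, (continuousAt_snd : ContinuousAt (Prod.snd : P × M → M) (p₀, x₀)).eventually_mem
    ((chartAt E w₁).open_source.mem_nhds hx)] with z hz hz'
  have := hmem z.1 hz.1 _ hz.2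
  simp only [Function.comp_apply]
  rw [(chartAt E w₂).left_inv this, (chartAt E w₁).left_inv hz']

variable [IsManifold 𝓘(ℝ, E) ∞ M]

/-- Composition with a smooth map of the target, in an arbitrary chart of the source. -/
theorem RegAt.exists_isJointC {m : ℕ} {p₀ : P} {x₀ : M} {Ψ : P → M → M} (h : RegAt E m p₀ x₀ Ψ)
    {F : Type*} [NormedAddCommGroup F] [NormedSpace ℝ F] {f : M → F} {S : Set M} (hS : IsOpen S)
    (hf : ContMDiffOn 𝓘(ℝ, E) 𝓘(ℝ, F) ∞ f S) (hxS : Ψ p₀ x₀ ∈ S) {w : M}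
    (hw : x₀ ∈ (chartAt E w).source) :
    ∃ (O : Set P) (W : Set E), IsOpen O ∧ p₀ ∈ O ∧ IsOpen W ∧ chartAt E w x₀ ∈ W ∧
      W ⊆ (chartAt E w).target ∧ (∀ p ∈ O, ∀ y ∈ W, Ψ p ((chartAt E w).symm y) ∈ S) ∧
      IsJointC O m W (fun p y ↦ f (Ψ p ((chartAt E w).symm y))) := by
  have hcont := h.continuousAt
  obtain ⟨w₁, w₂, O, W, hO, hp, hW, hx, hxW, hWt, hmem, hJ⟩ := h
  -- the set where `Ψ` takes values in `S`
  have hpre : ∀ᶠ z : P × M in 𝓝 (p₀, x₀), Ψ z.1 z.2 ∈ S := hcont.eventually_mem (hS.mem_nhds hxS)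
  rw [nhds_prod_eq, Filter.eventually_prod_iff] at hpre
  obtain ⟨pa, hpa, pb, hpb, hab⟩ := hpre
  obtain ⟨O', hO'pa, hO', hpO'⟩ := mem_nhds_iff.1 hpa
  obtain ⟨N, hNpb, hN, hxN⟩ := mem_nhds_iff.1 hpb
  set e := chartAt E w
  set e₁ := chartAt E w₁
  set e₂ := chartAt E w₂
  have hN1 : IsOpen (e₁.source ∩ e₁ ⁻¹' W) := e₁.continuousOn.isOpen_inter_preimage e₁.open_source hW
  set W' : Set E := e.target ∩ e.symm ⁻¹' (N ∩ (e₁.source ∩ e₁ ⁻¹' W)) with hW'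
  have hW'o : IsOpen W' := e.continuousOn_symm.isOpen_inter_preimage e.open_target (hN.inter hN1)
  refine ⟨O ∩ O', W', hO.inter hO', ⟨hp, hpO'⟩, hW'o, ?_, inter_subset_left, ?_, ?_⟩
  · refine ⟨e.map_source hw, ?_⟩
    rw [mem_preimage, e.left_inv hw]
    exact ⟨hxN, hx, hxW⟩
  · rintro p ⟨-, hp'⟩ y ⟨-, hy, -⟩
    exact hab (hO'pa hp') (hNpb hy)
  · have hT : ContDiffOn ℝ m (fun y ↦ e₁ (e.symm y)) W' := by
      have h1 : ContMDiffOn 𝓘(ℝ, E) 𝓘(ℝ, E) m (fun y ↦ e₁ (e.symm y)) W' :=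
        (contMDiffOn_chart (n := m)).comp ((contMDiffOn_chart_symm (n := m)).mono inter_subset_left)
          fun y hy ↦ hy.2.2.1
      exact contMDiffOn_iff_contDiffOn.1 h1
    have hV : IsOpen (e₂.target ∩ e₂.symm ⁻¹' S) :=
      e₂.continuousOn_symm.isOpen_inter_preimage e₂.open_target hS
    have hFc : ContDiffOn ℝ m (fun y ↦ f (e₂.symm y)) (e₂.target ∩ e₂.symm ⁻¹' S) := by
      have h1 : ContMDiffOn 𝓘(ℝ, E) 𝓘(ℝ, F) m (fun y ↦ f (e₂.symm y)) (e₂.target ∩ e₂.symm ⁻¹' S) :=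
        (hf.of_le (mod_cast le_top)).comp
          ((contMDiffOn_chart_symm (n := m)).mono inter_subset_left) fun y hy ↦ hy.2
      exact contMDiffOn_iff_contDiffOn.1 h1
    have hsub : ∀ p ∈ O ∩ O', ∀ y ∈ W', Ψ p (e.symm y) ∈ e₂.source := by
      rintro p ⟨hp, -⟩ y ⟨-, -, hy1, hy2⟩
      have := hmem p hp _ hy2
      rwa [e₁.left_inv hy1] at this
    have hA := IsJointC.comp m hW'o hW (hJ.mono inter_subset_left m Subset.rfl)
      (IsJointC.of_contDiffOn (O ∩ O') m hW'o hT) (fun p _ y hy ↦ hy.2.2.2)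
    have hA' : IsJointC (O ∩ O') m W' (fun p y ↦ e₂ (Ψ p (e.symm y))) := by
      refine IsJointC.congr m hW'o hA ?_
      intro p _ y hy
      simp only [Function.comp_apply]
      rw [e₁.left_inv hy.2.2.1]
    have hB := IsJointC.comp m hW'o hV (IsJointC.of_contDiffOn (O ∩ O') m hV hFc) hA' ?_
    · refine IsJointC.congr m hW'o hB ?_
      intro p hp y hy
      simp only [Function.comp_apply]
      rw [e₂.left_inv (hsub p hp y hy)]
    · intro p hp y hy
      refine ⟨e₂.map_source (hsub p hp y hy), ?_⟩
      rw [mem_preimage, e₂.left_inv (hsub p hp y hy)]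
      exact hab (hO'pa hp.2) (hNpb hy.2.1)

/-- For a composition, the first map is re-read in the source chart of the second, by
`RegAt.exists_isJointC` applied to that chart; jointly `C^m` families then compose. -/
theorem isRegularity_regAt (m : ℕ) : IsRegularity (P := P) (M := M) (RegAt E m) where
  id p x := by
    refine ⟨x, x, univ, (chartAt E x).target, isOpen_univ, mem_univ _, (chartAt E x).open_target,
      mem_chart_source E x, mem_chart_target E x, Subset.rfl,
      fun _ _ y hy ↦ (chartAt E x).map_target hy, ?_⟩
    refine IsJointC.congr m (chartAt E x).open_target
      (IsJointC.of_contDiffOn univ m (chartAt E x).open_target contDiffOn_id) ?_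
    exact fun p _ y hy ↦ (chartAt E x).right_inv hy
  continuousAt p x Ψ h := h.continuousAt
  comp p x Ψ Ψ' h h' := by
    obtain ⟨w₁, w₂, O', W', hO', hp', hW', hx', hxW', hWt', hmem', hJ'⟩ := h'
    obtain ⟨O, W, hO, hp, hW, hxW, hWt, hmem, hJ⟩ := h.exists_isJointC
      ((chartAt E w₁).continuousOn.isOpen_inter_preimage (chartAt E w₁).open_source hW')
      ((contMDiffOn_chart (n := ∞)).mono inter_subset_left) ⟨hx', hxW'⟩ (mem_chart_source E x)
    refine ⟨x, w₂, O ∩ O', W, hO.inter hO', ⟨hp, hp'⟩, hW, mem_chart_source E x, hxW, hWt, ?_, ?_⟩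
    · intro q hq y hy
      have h1 := hmem q hq.1 y hy
      have h2 := hmem' q hq.2 _ h1.2
      rwa [(chartAt E w₁).left_inv h1.1] at h2
    · have h3 := IsJointC.comp m hW hW' (hJ'.mono inter_subset_right m Subset.rfl)
        (hJ.mono inter_subset_left m Subset.rfl) (fun q hq y hy ↦ (hmem q hq.1 y hy).2)
      refine IsJointC.congr m hW h3 ?_
      intro q hq y hy
      simp only [Function.comp_apply]
      rw [(chartAt E w₁).left_inv (hmem q hq.1 y hy).1]
  congr p x Ψ Ψ' h he := by
    obtain ⟨w₁, w₂, O, W, hO, hp, hW, hx, hxW, hWt, hmem, hJ⟩ := h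
    rw [nhds_prod_eq, Filter.eventually_prod_iff] at he
    obtain ⟨pa, hpa, pb, hpb, hab⟩ := he
    obtain ⟨O', hO'pa, hO', hpO'⟩ := mem_nhds_iff.1 hpa
    obtain ⟨N, hNpb, hN, hxN⟩ := mem_nhds_iff.1 hpb
    set e₁ := chartAt E w₁
    have hW'o : IsOpen (e₁.target ∩ e₁.symm ⁻¹' N) :=
      e₁.continuousOn_symm.isOpen_inter_preimage e₁.open_target hN
    have key : ∀ q ∈ O ∩ O', ∀ y ∈ W ∩ (e₁.target ∩ e₁.symm ⁻¹' N),
        Ψ' q (e₁.symm y) = Ψ q (e₁.symm y) := fun q hq y hy ↦ hab (hO'pa hq.2) (hNpb hy.2.2)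
    refine ⟨w₁, w₂, O ∩ O', W ∩ (e₁.target ∩ e₁.symm ⁻¹' N), hO.inter hO', ⟨hp, hpO'⟩,
      hW.inter hW'o, hx, ⟨hxW, e₁.map_source hx, ?_⟩, inter_subset_left.trans hWt, ?_, ?_⟩
    · rw [mem_preimage, e₁.left_inv hx]
      exact hxN
    · intro q hq y hy
      rw [key q hq y hy]
      exact hmem q hq.1 y hy.1
    · refine IsJointC.congr m (hW.inter hW'o) (hJ.mono inter_subset_left m inter_subset_left) ?_
      intro q hq y hy
      exact congrArg (chartAt E w₂) (key q hq y hy)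

theorem RegAt.contMDiffAt [FiniteDimensional ℝ E] {m : ℕ} {p₀ : P} {x₀ : M} {Ψ : P → M → M}
    (h : RegAt E m p₀ x₀ Ψ) : ContMDiffAt 𝓘(ℝ, E) 𝓘(ℝ, E) m (Ψ p₀) x₀ := by
  have hc : ContinuousAt (Ψ p₀) x₀ :=
    ContinuousAt.comp (f := fun x ↦ (p₀, x)) h.continuousAt (by fun_prop)
  obtain ⟨w₁, w₂, O, W, hO, hp, hW, hx, hxW, hWt, hmem, hJ⟩ := h
  have h0 := hmem p₀ hp _ hxW
  rw [(chartAt E w₁).left_inv hx] at h0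
  rw [contMDiffAt_iff_of_mem_source hx h0]
  refine ⟨hc, ?_⟩
  have := ((IsJointC.contDiffOn m hW hJ p₀ hp).contDiffAt (hW.mem_nhds hxW)).contDiffWithinAt
    (s := range 𝓘(ℝ, E))
  simpa [Function.comp_def] using this

/-- The local flows are jointly of class `C^m`. -/
theorem IsSolFamily.regAt [FiniteDimensional ℝ E] {m : ℕ}
    {X : P → ℝ → Π x : M, TangentSpace 𝓘(ℝ, E) x} (x₀ : M) {c d a b : ℝ} (ha : a ∈ Icc c d)
    (hb : b ∈ Icc c d) {Ω : Set E} (hΩ : IsOpen Ω) (hΩt : Ω ⊆ (chartAt E x₀).target)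
    (hX : IsCaratheodoryC c d m Ω (fun p t ↦ chartRep x₀ (X p t))) {O : Set P} {W : Set E}
    (hO : IsOpen O) (hW : IsOpen W) {ξ : P → E → ℝ → E}
    (hξ : IsSolFamily (fun p t ↦ chartRep x₀ (X p t)) c d a Ω O W ξ) {p : P} (hp : p ∈ O) {x : M}
    (hx : x ∈ (chartAt E x₀).source) (hxW : chartAt E x₀ x ∈ W) :
    RegAt E m p x (fun p x ↦ (chartAt E x₀).symm (ξ p (chartAt E x₀ x) b)) := by
  set e := chartAt E x₀
  have hmem : ∀ q ∈ O, ∀ y ∈ W, ξ q y b ∈ e.target := fun q hq y hy ↦ hΩt ((hξ.sol q hq y hy).mem b hb)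
  refine ⟨x₀, x₀, O, W ∩ e.target, hO, hp, hW.inter e.open_target, hx, ⟨hxW, e.map_source hx⟩,
    inter_subset_right, ?_, ?_⟩
  · intro q hq y hy
    change e.symm (ξ q (e (e.symm y)) b) ∈ e.source
    rw [e.right_inv hy.2]
    exact e.map_target (hmem q hq y hy.1)
  · refine IsJointC.congr m (hW.inter e.open_target)
      ((IsSolFamily.isJointC ha hO m hΩ hW hX hξ b hb).mono Subset.rfl m inter_subset_left) ?_
    intro q hq y hy
    change e (e.symm (ξ q (e (e.symm y)) b)) = ξ q y b
    rw [e.right_inv hy.2, e.right_inv (hmem q hq y hy.1)]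

end Regularity

/-! ### Holomorphic families -/

section Holomorphic

variable {E : Type u} [NormedAddCommGroup E] [NormedSpace ℂ E]
  {M : Type v} [TopologicalSpace M] [ChartedSpace E M] {P : Type w} [TopologicalSpace P]

/-- The family `Ψ` is jointly continuous and consists of holomorphic maps near `(p₀, x₀)`. -/
def RegHolAt (E : Type u) [NormedAddCommGroup E] [NormedSpace ℂ E]
    {M : Type v} [TopologicalSpace M] [ChartedSpace E M] {P : Type w} [TopologicalSpace P]
    (p₀ : P) (x₀ : M) (Ψ : P → M → M) : Prop :=
  ∃ (O : Set P) (W : Set M), IsOpen O ∧ p₀ ∈ O ∧ IsOpen W ∧ x₀ ∈ W ∧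
    ContinuousOn (fun z : P × M ↦ Ψ z.1 z.2) (O ×ˢ W) ∧
    ∀ p ∈ O, MDifferentiableOn 𝓘(ℂ, E) 𝓘(ℂ, E) (Ψ p) W

theorem RegHolAt.continuousAt {p₀ : P} {x₀ : M} {Ψ : P → M → M} (h : RegHolAt E p₀ x₀ Ψ) :
    ContinuousAt (fun z : P × M ↦ Ψ z.1 z.2) (p₀, x₀) := by
  obtain ⟨O, W, hO, hp, hW, hx, hc, -⟩ := h
  exact hc.continuousAt ((hO.prod hW).mem_nhds ⟨hp, hx⟩)

theorem RegHolAt.mdifferentiableAt {p₀ : P} {x₀ : M} {Ψ : P → M → M} (h : RegHolAt E p₀ x₀ Ψ) :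
    MDifferentiableAt 𝓘(ℂ, E) 𝓘(ℂ, E) (Ψ p₀) x₀ := by
  obtain ⟨O, W, hO, hp, hW, hx, -, hd⟩ := h
  exact (hd p₀ hp).mdifferentiableAt (hW.mem_nhds hx)

/-- In the holomorphic case joint continuity is all that is tracked in the parameter, because the
target topology only involves suprema of values. -/
theorem isRegularity_regHolAt : IsRegularity (P := P) (M := M) (RegHolAt E) where
  id p x := ⟨univ, univ, isOpen_univ, mem_univ _, isOpen_univ, mem_univ _, continuousOn_snd,
    fun _ _ ↦ mdifferentiableOn_id⟩
  continuousAt p x Ψ h := h.continuousAt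
  comp p x Ψ Ψ' h h' := by
    have hc := h.continuousAt
    obtain ⟨O, W, hO, hp, hW, hx, hcW, hd⟩ := h
    obtain ⟨O', W', hO', hp', hW', hx', hcW', hd'⟩ := h'
    have he : ∀ᶠ z : P × M in 𝓝 (p, x), Ψ z.1 z.2 ∈ W' := hc.eventually_mem (hW'.mem_nhds hx')
    rw [nhds_prod_eq, Filter.eventually_prod_iff] at he
    obtain ⟨pa, hpa, pb, hpb, hab⟩ := he
    obtain ⟨O₁, hO₁pa, hO₁, hpO₁⟩ := mem_nhds_iff.1 hpa
    obtain ⟨N, hNpb, hN, hxN⟩ := mem_nhds_iff.1 hpb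
    refine ⟨O ∩ O' ∩ O₁, W ∩ N, (hO.inter hO').inter hO₁, ⟨⟨hp, hp'⟩, hpO₁⟩, hW.inter hN, ⟨hx, hxN⟩,
      ?_, ?_⟩
    · refine hcW'.comp (f := fun z : P × M ↦ (z.1, Ψ z.1 z.2)) (continuousOn_fst.prodMk (hcW.mono ?_))
        fun z hz ↦ ⟨hz.1.1.2, hab (hO₁pa hz.1.2) (hNpb hz.2.2)⟩
      exact prod_mono (fun q hq ↦ hq.1.1) inter_subset_left
    · intro q hq
      exact (hd' q hq.1.2).comp ((hd q hq.1.1).mono inter_subset_left)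
        fun y hy ↦ hab (hO₁pa hq.2) (hNpb hy.2)
  congr p x Ψ Ψ' h he := by
    obtain ⟨O, W, hO, hp, hW, hx, hcW, hd⟩ := h
    rw [nhds_prod_eq, Filter.eventually_prod_iff] at he
    obtain ⟨pa, hpa, pb, hpb, hab⟩ := he
    obtain ⟨O₁, hO₁pa, hO₁, hpO₁⟩ := mem_nhds_iff.1 hpa
    obtain ⟨N, hNpb, hN, hxN⟩ := mem_nhds_iff.1 hpb
    refine ⟨O ∩ O₁, W ∩ N, hO.inter hO₁, ⟨hp, hpO₁⟩, hW.inter hN, ⟨hx, hxN⟩, ?_, ?_⟩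
    · refine (hcW.mono (prod_mono inter_subset_left inter_subset_left)).congr ?_
      exact fun z hz ↦ hab (hO₁pa hz.1.2) (hNpb hz.2.2)
    · intro q hq
      refine ((hd q hq.1).mono inter_subset_left).congr ?_
      exact fun y hy ↦ hab (hO₁pa hq.2) (hNpb hy.2)

theorem smul_eq_re_add_im {G : Type*} [NormedAddCommGroup G] [NormedSpace ℂ G] (c : ℂ) (w : G) :
    c • w = c.re • w + c.im • (Complex.I • w) := by
  conv_lhs => rw [← Complex.re_add_im c]
  rw [add_smul, mul_smul]
  rfl

/-- A real differentiable map whose derivative commutes with multiplication by `i` is complex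
differentiable. -/
theorem differentiableAt_complex_of_fderiv_comm {E F : Type*} [NormedAddCommGroup E]
    [NormedSpace ℂ E] [NormedAddCommGroup F] [NormedSpace ℂ F] {f : E → F} {x : E}
    (hf : DifferentiableAt ℝ f x)
    (hI : ∀ v, fderiv ℝ f x (Complex.I • v) = Complex.I • fderiv ℝ f x v) :
    DifferentiableAt ℂ f x := by
  have hlin : ∀ (c : ℂ) v, fderiv ℝ f x (c • v) = c • fderiv ℝ f x v := by
    intro c v
    rw [smul_eq_re_add_im c v, map_add, map_smul, map_smul, hI, ← smul_eq_re_add_im]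
  let L : E →L[ℂ] F :=
    { toFun := fderiv ℝ f x
      map_add' := map_add _
      map_smul' := hlin
      cont := (fderiv ℝ f x).continuous }
  have hL : HasFDerivAt f L x := by
    have := hf.hasFDerivAt
    rw [hasFDerivAt_iff_isLittleO_nhds_zero] at this ⊢
    exact this
  exact hL.differentiableAt

variable [IsManifold 𝓘(ℂ, E) 1 M]

/-- The local flows of holomorphic vector fields are holomorphic. -/
theorem IsSolFamily.regHolAt [FiniteDimensional ℝ E]
    {X : P → ℝ → Π x : M, TangentSpace 𝓘(ℂ, E) x} (x₀ : M) {c d a b : ℝ} (ha : a ∈ Icc c d)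
    (hb : b ∈ Icc c d) {Ω : Set E} (hΩ : IsOpen Ω) (hΩt : Ω ⊆ (chartAt E x₀).target)
    (hX : IsCaratheodoryC c d 1 Ω (fun p t ↦ chartRep x₀ (X p t)))
    (hhol : ∀ p, ∀ t ∈ Icc c d, DifferentiableOn ℂ (chartRep x₀ (X p t)) Ω) {O : Set P} {W : Set E}
    (hO : IsOpen O) (hW : IsOpen W) {ξ : P → E → ℝ → E}
    (hξ : IsSolFamily (fun p t ↦ chartRep x₀ (X p t)) c d a Ω O W ξ) {p : P} (hp : p ∈ O) {x : M}
    (hx : x ∈ (chartAt E x₀).source) (hxW : chartAt E x₀ x ∈ W) :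
    RegHolAt E p x (fun p x ↦ (chartAt E x₀).symm (ξ p (chartAt E x₀ x) b)) := by
  set e := chartAt E x₀
  have hmem : ∀ q ∈ O, ∀ y ∈ W, ξ q y b ∈ e.target := fun q hq y hy ↦ hΩt ((hξ.sol q hq y hy).mem b hb)
  have hJ := IsSolFamily.isJointC ha hO 1 hΩ hW hX hξ b hb
  refine ⟨O, e.source ∩ e ⁻¹' W, hO, hp, e.continuousOn.isOpen_inter_preimage e.open_source hW,
    ⟨hx, hxW⟩, ?_, ?_⟩
  · refine e.continuousOn_symm.comp (hJ.continuousOn.comp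
      (f := fun z : P × M ↦ (z.1, e z.2)) ?_ ?_) ?_
    · exact continuousOn_fst.prodMk (e.continuousOn.comp continuousOn_snd fun z hz ↦ hz.2.1)
    · exact fun z hz ↦ ⟨hz.1, hz.2.2⟩
    · exact fun z hz ↦ hmem _ hz.1 _ hz.2.2
  · intro q hq
    have hd : DifferentiableOn ℂ (fun y ↦ ξ q y b) W := by
      intro y hy
      have hy' : DifferentiableAt ℝ (fun y ↦ ξ q y b) y :=
        (hJ.2.1 q hq).differentiableAt (hW.mem_nhds hy)
      refine (differentiableAt_complex_of_fderiv_comm hy' fun v ↦ ?_).differentiableWithinAt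
      -- The Cauchy–Riemann equations for the flow follow from those for the fields, with `J`
      -- multiplication by `i`.
      refine IsSolFamily.fderiv_comm ha hΩ hO hW hX hξ
        ((Complex.I • ContinuousLinearMap.id ℂ E).restrictScalars ℝ) ?_ hq hy hb v
      intro p' t ht y' hy' v'
      have h1 := ((hhol p' t ht).differentiableAt (hΩ.mem_nhds hy')).hasFDerivAt
      have h2 := (h1.restrictScalars ℝ).fderiv
      rw [h2]
      simp
    have h1 : MDifferentiableOn 𝓘(ℂ, E) 𝓘(ℂ, E) e e.source :=
      (contMDiffOn_chart (n := 1)).mdifferentiableOn one_ne_zero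
    have h2 : MDifferentiableOn 𝓘(ℂ, E) 𝓘(ℂ, E) e.symm e.target :=
      (contMDiffOn_chart_symm (n := 1)).mdifferentiableOn one_ne_zero
    refine h2.comp (f := fun x ↦ ξ q (e x) b) (hd.mdifferentiableOn.comp (h1.mono inter_subset_left)
      fun y hy ↦ hy.2) fun y hy ↦ hmem q hq _ hy.2

end Holomorphic

/-! ### A criterion for Carathéodory fields of class `C^m` -/

section Criterion

theorem norm_iteratedFDeriv_comp_fst_le {E F G : Type*} [NormedAddCommGroup E] [NormedSpace ℝ E]
    [NormedAddCommGroup F] [NormedSpace ℝ F] [NormedAddCommGroup G] [NormedSpace ℝ G] {Ω : Set E}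
    (hΩ : IsOpen Ω) {f : E → F} {j : ℕ} (hf : ContDiffOn ℝ j f Ω) {z : E × G} (hz : z.1 ∈ Ω) :
    ‖iteratedFDeriv ℝ j (fun z : E × G ↦ f z.1) z‖ ≤ ‖iteratedFDeriv ℝ j f z.1‖ := by
  have hpre : IsOpen (ContinuousLinearMap.fst ℝ E G ⁻¹' Ω) :=
    hΩ.preimage (ContinuousLinearMap.fst ℝ E G).continuous
  have h := (ContinuousLinearMap.fst ℝ E G).iteratedFDerivWithin_comp_right hf hΩ.uniqueDiffOn
    hpre.uniqueDiffOn (x := z) hz (i := j) le_rfl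
  rw [iteratedFDerivWithin_of_isOpen j hpre hz,
    iteratedFDerivWithin_of_isOpen j hΩ (show ContinuousLinearMap.fst ℝ E G z ∈ Ω from hz)] at h
  change ‖iteratedFDeriv ℝ j (f ∘ ContinuousLinearMap.fst ℝ E G) z‖ ≤ _
  rw [h]
  refine (ContinuousMultilinearMap.norm_compContinuousLinearMap_le _ _).trans ?_
  refine (mul_le_mul_of_nonneg_left (Finset.prod_le_one (fun _ _ ↦ norm_nonneg _)
    fun _ _ ↦ ContinuousLinearMap.norm_fst_le ℝ E G) (norm_nonneg _)).trans ?_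
  rw [mul_one]
  exact le_rfl

theorem norm_iteratedFDeriv_snd_le {E G : Type*} [NormedAddCommGroup E] [NormedSpace ℝ E]
    [NormedAddCommGroup G] [NormedSpace ℝ G] (j : ℕ) (z : E × G) :
    ‖iteratedFDeriv ℝ j (fun z : E × G ↦ z.2) z‖ ≤ max ‖z.2‖ 1 := by
  have hs : (fun z : E × G ↦ z.2) = ContinuousLinearMap.snd ℝ E G := rfl
  rcases j with _ | _ | j
  · rw [norm_iteratedFDeriv_zero]
    exact le_max_left _ _
  · rw [norm_iteratedFDeriv_one, hs, ContinuousLinearMap.fderiv]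
    exact (ContinuousLinearMap.norm_snd_le ℝ E G).trans (le_max_right _ _)
  · rw [← norm_iteratedFDeriv_fderiv]
    have : fderiv ℝ (fun z : E × G ↦ z.2) = fun _ ↦ ContinuousLinearMap.snd ℝ E G := by
      ext1 z
      rw [hs, ContinuousLinearMap.fderiv]
    rw [this, iteratedFDeriv_succ_const, Pi.zero_apply, norm_zero]
    positivity

/-- The constant depends only on the order and on the bound `r` for the fibre variable, so it serves
all times, parameters and differences of fields at once. -/
theorem exists_norm_iteratedFDeriv_tmap_le (j : ℕ) (r : ℝ) :
    ∃ C : ℝ, 0 ≤ C ∧ ∀ {E F : Type*} [NormedAddCommGroup E] [NormedSpace ℝ E]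
      [NormedAddCommGroup F] [NormedSpace ℝ F] {Ω : Set E} (_ : IsOpen Ω) {f : E → F}
      (_ : ContDiffOn ℝ (j + 1 : ℕ) f Ω) {z : E × E} (_ : z.1 ∈ Ω) (_ : ‖z.2‖ ≤ r) {B : ℝ}
      (_ : ∀ i ≤ j + 1, ‖iteratedFDeriv ℝ i f z.1‖ ≤ B), ‖iteratedFDeriv ℝ j (tmap f) z‖ ≤ C * B := by
  -- The `1` bounds the base component. The sum is Leibniz's rule for `Df(x) v`, where the
  -- derivatives of `(x, v) ↦ v` are `v`, the projection and zero, all of norm at most `max r 1`.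
  refine ⟨max 1 (∑ i ∈ Finset.range (j + 1), (j.choose i : ℝ) * max r 1), by positivity, ?_⟩
  intro E F _ _ _ _ Ω hΩ f hf z hz hr B hB
  have hB0 : 0 ≤ B := (norm_nonneg _).trans (hB 0 (Nat.zero_le _))
  have hs : IsOpen (Ω ×ˢ (univ : Set E)) := hΩ.prod isOpen_univ
  have hzs : z ∈ Ω ×ˢ (univ : Set E) := ⟨hz, mem_univ _⟩
  have hfj : ContDiffOn ℝ j f Ω := hf.of_le (mod_cast Nat.le_succ j)
  have hf' : ContDiffOn ℝ j (fderiv ℝ f) Ω := hf.fderiv_of_isOpen hΩ (by norm_cast)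
  have c1 : ContDiffOn ℝ j (fun z : E × E ↦ f z.1) (Ω ×ˢ univ) :=
    hfj.comp contDiffOn_fst fun z hz ↦ hz.1
  have c2 : ContDiffOn ℝ j (fun z : E × E ↦ fderiv ℝ f z.1) (Ω ×ˢ univ) :=
    hf'.comp contDiffOn_fst fun z hz ↦ hz.1
  have c3 : ContDiffOn ℝ j (fun z : E × E ↦ z.2) (Ω ×ˢ univ) := contDiffOn_snd
  have e1 : iteratedFDeriv ℝ j (tmap f) z = _ :=
    iteratedFDeriv_prodMk (c1.contDiffAt (hs.mem_nhds hzs))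
      ((c2.clm_apply c3).contDiffAt (hs.mem_nhds hzs)) le_rfl
  rw [e1, ContinuousMultilinearMap.opNorm_prod, max_mul_of_nonneg _ _ hB0, one_mul]
  refine max_le_max ?_ ?_
  · exact (norm_iteratedFDeriv_comp_fst_le hΩ hfj hz).trans (hB j (Nat.le_succ j))
  · have := norm_iteratedFDerivWithin_clm_apply c2 c3 hs.uniqueDiffOn hzs (n := j) le_rfl
    rw [iteratedFDerivWithin_of_isOpen j hs hzs] at this
    refine this.trans ?_
    rw [Finset.sum_mul]
    refine Finset.sum_le_sum fun i hi ↦ ?_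
    have hi' : i ≤ j := Nat.lt_succ_iff.1 (Finset.mem_range.1 hi)
    rw [iteratedFDerivWithin_of_isOpen i hs hzs, iteratedFDerivWithin_of_isOpen (j - i) hs hzs,
      mul_assoc, mul_assoc, mul_comm (max r 1)]
    refine mul_le_mul_of_nonneg_left (mul_le_mul ?_ ?_ (norm_nonneg _) hB0) (Nat.cast_nonneg _)
    · refine (norm_iteratedFDeriv_comp_fst_le hΩ (hf'.of_le (mod_cast hi')) hz).trans ?_
      rw [norm_iteratedFDeriv_fderiv]
      exact hB _ (by omega)
    · exact (norm_iteratedFDeriv_snd_le _ z).trans (max_le_max hr le_rfl)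

variable {P : Type w} [TopologicalSpace P]

/-- A directional derivative is a limit of difference quotients along a sequence, each measurable in
time. The index is shifted by `N` to keep the points in `Ω`. -/
theorem aestronglyMeasurable_fderiv {E F : Type*} [NormedAddCommGroup E] [NormedSpace ℝ E]
    [NormedAddCommGroup F] [NormedSpace ℝ F] {c d : ℝ} {Y : ℝ → E → F} {Ω : Set E} (hΩ : IsOpen Ω)
    (hm : ∀ x ∈ Ω, AEStronglyMeasurable (fun t ↦ Y t x) (volume.restrict (Icc c d)))
    (hd : ∀ t ∈ Icc c d, DifferentiableOn ℝ (Y t) Ω) {x : E} (hx : x ∈ Ω) (v : E) :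
    AEStronglyMeasurable (fun t ↦ fderiv ℝ (Y t) x v) (volume.restrict (Icc c d)) := by
  have hlim : Tendsto (fun n : ℕ ↦ x + ((n : ℝ) + 1)⁻¹ • v) atTop (𝓝 x) := by
    have h1 : Tendsto (fun n : ℕ ↦ ((n : ℝ) + 1)⁻¹) atTop (𝓝 0) := by
      simpa [one_div] using tendsto_one_div_add_atTop_nhds_zero_nat (𝕜 := ℝ)
    simpa using tendsto_const_nhds.add (h1.smul_const v)
  obtain ⟨N, hN⟩ := eventually_atTop.1 (hlim.eventually_mem (hΩ.mem_nhds hx))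
  refine aestronglyMeasurable_of_tendsto_ae atTop
    (f := fun (n : ℕ) t ↦ (((n + N : ℕ) : ℝ) + 1) • (Y t (x + (((n + N : ℕ) : ℝ) + 1)⁻¹ • v) - Y t x))
    (fun n ↦ ?_) ?_
  · exact ((hm _ (hN _ (Nat.le_add_left N n))).sub (hm x hx)).const_smul _
  · filter_upwards [ae_restrict_mem measurableSet_Icc] with t ht
    have h1 := ((hd t ht).differentiableAt (hΩ.mem_nhds hx)).hasFDerivAt
    have h2 : Tendsto (fun n : ℕ ↦ ‖(((n + N : ℕ) : ℝ) + 1)‖) atTop atTop := by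
      have h3 : Tendsto (fun n : ℕ ↦ ((n + N : ℕ) : ℝ)) atTop atTop :=
        tendsto_natCast_atTop_atTop.comp (tendsto_add_atTop_nat N)
      exact tendsto_norm_atTop_atTop.comp (h3.atTop_add tendsto_const_nhds)
    exact h1.lim v h2

/-- Bounds on the derivatives up to order `m` give a Carathéodory field of class `C^m`. -/
theorem isCaratheodoryC_of_bounds {c d : ℝ} (m : ℕ) :
    ∀ {E : Type u} [NormedAddCommGroup E] [NormedSpace ℝ E]
      {F : Type v} [NormedAddCommGroup F] [NormedSpace ℝ F] {Ω : Set E} (_ : IsOpen Ω)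
      {Y : P → ℝ → E → F} (_ : ∀ p, ∀ t ∈ Icc c d, ContDiffOn ℝ m (Y p t) Ω)
      (_ : ∀ p, ∀ x ∈ Ω, AEStronglyMeasurable (fun t ↦ Y p t x) (volume.restrict (Icc c d)))
      (_ : ∀ p, ∀ K ⊆ Ω, IsCompact K → ∃ h : ℝ → ℝ, IntegrableOn h (Icc c d) ∧
        ∀ t ∈ Icc c d, ∀ x ∈ K, ∀ j ≤ m, ‖iteratedFDeriv ℝ j (Y p t) x‖ ≤ h t)
      (_ : ∀ p₀, ∀ K ⊆ Ω, IsCompact K → ∀ ε > 0, ∀ᶠ p in 𝓝 p₀, ∃ h : ℝ → ℝ≥0∞,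
        ∫⁻ t in Icc c d, h t < ε ∧ ∀ t ∈ Icc c d, ∀ x ∈ K, ∀ j ≤ m,
          ‖iteratedFDeriv ℝ j (fun y ↦ Y p t y - Y p₀ t y) x‖ₑ ≤ h t),
      IsCaratheodoryC c d m Ω Y := by
  -- The conditions on values alone. They are needed at every order of the induction, so `m` remains
  -- arbitrary.
  have base : ∀ (m : ℕ) {E : Type u} [NormedAddCommGroup E] [NormedSpace ℝ E]
      {F : Type v} [NormedAddCommGroup F] [NormedSpace ℝ F] {Ω : Set E} (_ : IsOpen Ω)
      {Y : P → ℝ → E → F} (_ : ∀ p, ∀ t ∈ Icc c d, ContDiffOn ℝ m (Y p t) Ω)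
      (_ : ∀ p, ∀ x ∈ Ω, AEStronglyMeasurable (fun t ↦ Y p t x) (volume.restrict (Icc c d)))
      (_ : ∀ p, ∀ K ⊆ Ω, IsCompact K → ∃ h : ℝ → ℝ, IntegrableOn h (Icc c d) ∧
        ∀ t ∈ Icc c d, ∀ x ∈ K, ∀ j ≤ m, ‖iteratedFDeriv ℝ j (Y p t) x‖ ≤ h t)
      (_ : ∀ p₀, ∀ K ⊆ Ω, IsCompact K → ∀ ε > 0, ∀ᶠ p in 𝓝 p₀, ∃ h : ℝ → ℝ≥0∞,
        ∫⁻ t in Icc c d, h t < ε ∧ ∀ t ∈ Icc c d, ∀ x ∈ K, ∀ j ≤ m,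
          ‖iteratedFDeriv ℝ j (fun y ↦ Y p t y - Y p₀ t y) x‖ₑ ≤ h t),
      IsCaratheodory c d Ω Y := by
    intro m E _ _ F _ _ Ω hΩ Y hC hm hb ht
    refine ⟨fun p t ht ↦ (hC p t ht).continuousOn, hm, fun p K hK hKc ↦ ?_, fun p₀ K hK hKc ε hε ↦ ?_⟩
    · obtain ⟨h, hi, hh⟩ := hb p K hK hKc
      refine ⟨h, hi, fun t ht x hx ↦ ?_⟩
      simpa using hh t ht x hx 0 (Nat.zero_le m)
    · filter_upwards [ht p₀ K hK hKc ε hε] with p ⟨h, hi, hh⟩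
      refine (setLIntegral_mono' measurableSet_Icc fun t ht ↦ iSup₂_le fun x hx ↦ ?_).trans_lt hi
      refine le_trans (le_of_eq ?_) (hh t ht x hx 0 (Nat.zero_le m))
      rw [← ofReal_norm, ← ofReal_norm, norm_iteratedFDeriv_zero]
  induction m with
  | zero =>
    intro E _ _ F _ _ Ω hΩ Y hC hm hb ht
    exact base 0 hΩ hC hm hb ht
  | succ m ih =>
    intro E _ _ F _ _ Ω hΩ Y hC hm hb ht
    have hd : ∀ p, ∀ t ∈ Icc c d, DifferentiableOn ℝ (Y p t) Ω := fun p t ht ↦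
      (hC p t ht).differentiableOn (by simp)
    have hproj : ∀ K : Set (E × E), K ⊆ Ω ×ˢ univ → IsCompact K →
        Prod.fst '' K ⊆ Ω ∧ IsCompact (Prod.fst '' K) ∧ ∃ r : ℝ, ∀ z ∈ K, ‖z.2‖ ≤ r := by
      intro K hK hKc
      refine ⟨?_, hKc.image continuous_fst, ?_⟩
      · rintro _ ⟨z, hz, rfl⟩
        exact (hK hz).1
      · obtain ⟨r, hr⟩ := (hKc.image continuous_snd).isBounded.exists_norm_le
        exact ⟨r, fun z hz ↦ hr _ ⟨z, hz, rfl⟩⟩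
    have hconst : ∀ r : ℝ, ∃ C : ℝ, 0 ≤ C ∧ ∀ {f : E → F} (_ : ContDiffOn ℝ (m + 1 : ℕ) f Ω)
        {z : E × E} (_ : z.1 ∈ Ω) (_ : ‖z.2‖ ≤ r) {B : ℝ}
        (_ : ∀ i ≤ m + 1, ‖iteratedFDeriv ℝ i f z.1‖ ≤ B), ∀ j ≤ m,
        ‖iteratedFDeriv ℝ j (tmap f) z‖ ≤ C * B := by
      intro r
      choose C hC0 hC1 using fun j ↦ exists_norm_iteratedFDeriv_tmap_le j r
      refine ⟨∑ j ∈ Finset.range (m + 1), C j, Finset.sum_nonneg fun j _ ↦ hC0 j, ?_⟩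
      intro f hf z hz hr B hB j hj
      have hB0 : 0 ≤ B := (norm_nonneg _).trans (hB 0 (Nat.zero_le _))
      refine (hC1 j hΩ (hf.of_le (mod_cast Nat.succ_le_succ hj)) hz hr
        fun i hi ↦ hB i (by omega)).trans (mul_le_mul_of_nonneg_right ?_ hB0)
      exact Finset.single_le_sum (f := C) (fun i _ ↦ hC0 i) (Finset.mem_range.2 (by omega))
    refine ⟨base (m + 1) hΩ hC hm hb ht, hd, ih (hΩ.prod isOpen_univ) ?_ ?_ ?_ ?_⟩
    · exact fun p t ht ↦ contDiffOn_tmap hΩ (hC p t ht)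
    · rintro p ⟨x, v⟩ ⟨hx, -⟩
      exact (hm p x hx).prodMk (aestronglyMeasurable_fderiv hΩ (hm p) (hd p) hx v)
    · intro p K hK hKc
      obtain ⟨hK1, hK1c, r, hr⟩ := hproj K hK hKc
      obtain ⟨C, hC0, hC1⟩ := hconst r
      obtain ⟨h, hi, hh⟩ := hb p _ hK1 hK1c
      refine ⟨fun t ↦ C * h t, hi.const_mul C, fun t ht z hz j hj ↦ ?_⟩
      exact hC1 (hC p t ht) (hK hz).1 (hr z hz) (fun i hi ↦ hh t ht _ ⟨z, hz, rfl⟩ i hi) j hj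
    · intro p₀ K hK hKc ε hε
      obtain ⟨hK1, hK1c, r, hr⟩ := hproj K hK hKc
      obtain ⟨C, hC0, hC1⟩ := hconst r
      have hC' : ENNReal.ofReal C ≠ ⊤ := ENNReal.ofReal_ne_top
      obtain ⟨ε', hε', hε''⟩ : ∃ ε' : ℝ≥0∞, 0 < ε' ∧ ENNReal.ofReal C * ε' < ε := by
        have := (ENNReal.continuous_const_mul hC').tendsto' 0 0 (by simp)
        have h1 := (this.eventually_lt_const hε)
        have h2 : ∀ᶠ a in 𝓝[>] (0 : ℝ≥0∞), ENNReal.ofReal C * a < ε := nhdsWithin_le_nhds h1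
        obtain ⟨ε', h3, h4⟩ := (h2.and self_mem_nhdsWithin).exists
        exact ⟨ε', h4, h3⟩
      filter_upwards [ht p₀ _ hK1 hK1c ε' hε'] with p ⟨h, hi, hh⟩
      refine ⟨fun t ↦ ENNReal.ofReal C * h t, ?_, fun t ht z hz j hj ↦ ?_⟩
      · rw [lintegral_const_mul' _ _ hC']
        exact (mul_le_mul_right hi.le _).trans_lt hε''
      · have hlin : EqOn (fun y : E × E ↦ tmap (Y p t) y - tmap (Y p₀ t) y)
            (tmap (fun y ↦ Y p t y - Y p₀ t y)) (Ω ×ˢ univ) := by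
          rintro ⟨y, v⟩ ⟨hy, -⟩
          have h1 := (hd p t ht).differentiableAt (hΩ.mem_nhds hy)
          have h2 := (hd p₀ t ht).differentiableAt (hΩ.mem_nhds hy)
          simp only [tmap, Prod.mk_sub_mk]
          rw [fderiv_fun_sub h1 h2]
          rfl
        have hev : (fun y : E × E ↦ tmap (Y p t) y - tmap (Y p₀ t) y)
            =ᶠ[𝓝 z] tmap (fun y ↦ Y p t y - Y p₀ t y) :=
          hlin.eventuallyEq_of_mem ((hΩ.prod isOpen_univ).mem_nhds (hK hz))
        rw [(Filter.EventuallyEq.iteratedFDeriv ℝ hev j).eq_of_nhds]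
        -- The bound function may be infinite at some times, and `0 * ⊤ = 0` would spoil the
        -- estimate if `C = 0`. In that case the tangent estimate with any finite `B` already gives
        -- zero.
        by_cases htop : h t = ⊤
        · by_cases hC00 : C = 0
          · have := hC1 ((hC p t ht).sub (hC p₀ t ht)) (hK hz).1 (hr z hz)
              (B := ∑ i ∈ Finset.range (m + 2), ‖iteratedFDeriv ℝ i (fun y ↦ Y p t y - Y p₀ t y) z.1‖)
              (fun i hi ↦ Finset.single_le_sum
                (f := fun i ↦ ‖iteratedFDeriv ℝ i (fun y ↦ Y p t y - Y p₀ t y) z.1‖)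
                (fun _ _ ↦ norm_nonneg _) (Finset.mem_range.2 (by omega))) j hj
            rw [hC00, zero_mul] at this
            rw [← ofReal_norm, ENNReal.ofReal_of_nonpos this]
            exact zero_le
          · simp only [htop]
            rw [ENNReal.mul_top (by simpa using lt_of_le_of_ne hC0 (Ne.symm hC00))]
            exact le_top
        · have := hC1 ((hC p t ht).sub (hC p₀ t ht)) (hK hz).1 (hr z hz) (B := (h t).toReal)
            (fun i hi ↦ by
              have h3 := hh t ht _ ⟨z, hz, rfl⟩ i hi
              rw [← ofReal_norm] at h3
              exact (ENNReal.ofReal_le_iff_le_toReal htop).1 h3) j hj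
          rw [← ofReal_norm]
          refine (ENNReal.ofReal_le_ofReal this).trans (le_of_eq ?_)
          rw [ENNReal.ofReal_mul hC0, ENNReal.ofReal_toReal htop]

end Criterion

/-! ### Linear differential operators and iterated covariant derivatives in coordinates -/

section DiffOp

set_option synthInstance.maxHeartbeats 200000

instance instNormedAddCommGroupMultilinear {E F : Type*} [NormedAddCommGroup E] [NormedSpace ℝ E]
    [NormedAddCommGroup F] [NormedSpace ℝ F] (k : ℕ) : NormedAddCommGroup (E [×k]→L[ℝ] F) :=
  ContinuousMultilinearMap.normedAddCommGroup

instance instNormedSpaceMultilinear {E F : Type*} [NormedAddCommGroup E] [NormedSpace ℝ E]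
    [NormedAddCommGroup F] [NormedSpace ℝ F] (k : ℕ) : NormedSpace ℝ (E [×k]→L[ℝ] F) :=
  ContinuousMultilinearMap.normedSpace

variable {E : Type*} [NormedAddCommGroup E] [NormedSpace ℝ E]
  {F : Type*} [NormedAddCommGroup F] [NormedSpace ℝ F]
  {G : Type*} [NormedAddCommGroup G] [NormedSpace ℝ G]
  {G' : Type*} [NormedAddCommGroup G'] [NormedSpace ℝ G'] {Ω : Set E}

/-- `L` is a linear differential operator of order less than `n` with smooth coefficients. -/
def IsDiffOp (Ω : Set E) (n : ℕ) (L : (E → F) → E → G) : Prop :=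
  ∃ A : (i : ℕ) → E → (E [×i]→L[ℝ] F) →L[ℝ] G, (∀ i, ContDiffOn ℝ ∞ (A i) Ω) ∧
    ∀ s, ∀ y ∈ Ω, ContDiffAt ℝ n s y →
      L s y = ∑ i ∈ Finset.range n, A i y (iteratedFDeriv ℝ i s y)

theorem IsDiffOp.add {n : ℕ} {L L' : (E → F) → E → G} (h : IsDiffOp Ω n L) (h' : IsDiffOp Ω n L') :
    IsDiffOp Ω n (fun s y ↦ L s y + L' s y) := by
  obtain ⟨A, hA, hL⟩ := h
  obtain ⟨A', hA', hL'⟩ := h'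
  refine ⟨fun i y ↦ A i y + A' i y, fun i ↦ (hA i).add (hA' i), fun s y hy hs ↦ ?_⟩
  simp only [hL s y hy hs, hL' s y hy hs, ← Finset.sum_add_distrib, add_apply]

theorem IsDiffOp.clm_comp {n : ℕ} {L : (E → F) → E → G} (h : IsDiffOp Ω n L)
    {B : E → G →L[ℝ] G'} (hB : ContDiffOn ℝ ∞ B Ω) : IsDiffOp Ω n (fun s y ↦ B y (L s y)) := by
  obtain ⟨A, hA, hL⟩ := h
  refine ⟨fun i y ↦ (B y).comp (A i y), fun i ↦ hB.clm_comp (hA i), fun s y hy hs ↦ ?_⟩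
  simp only [hL s y hy hs, map_sum, ContinuousLinearMap.comp_apply]

theorem IsDiffOp.of_le {n n' : ℕ} (hn : n ≤ n') {L : (E → F) → E → G} (h : IsDiffOp Ω n L) :
    IsDiffOp Ω n' L := by
  obtain ⟨A, hA, hL⟩ := h
  refine ⟨fun i y ↦ if i < n then A i y else 0, fun i ↦ ?_, fun s y hy hs ↦ ?_⟩
  · by_cases hi : i < n
    · simpa only [hi, if_true] using hA i
    · simpa only [hi, if_false] using contDiffOn_const
  · rw [hL s y hy (hs.of_le (mod_cast hn))]
    have : Finset.range n ⊆ Finset.range n' := Finset.range_mono hn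
    rw [← Finset.sum_subset this (f := fun i ↦ (if i < n then A i y else 0) (iteratedFDeriv ℝ i s y))]
    · refine Finset.sum_congr rfl fun i hi ↦ ?_
      rw [if_pos (Finset.mem_range.1 hi)]
    · intro i _ hi
      rw [if_neg (by simpa using hi)]
      rfl

theorem isDiffOp_iteratedFDeriv (j : ℕ) :
    IsDiffOp Ω (j + 1) (fun (s : E → F) y ↦ iteratedFDeriv ℝ j s y) := by
  refine ⟨Pi.single (M := fun i ↦ E → (E [×i]→L[ℝ] F) →L[ℝ] (E [×j]→L[ℝ] F)) j
    (fun _ ↦ ContinuousLinearMap.id ℝ _), fun i ↦ ?_, fun s y hy hs ↦ ?_⟩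
  · by_cases hi : i = j
    · subst hi
      rw [Pi.single_eq_same]
      exact contDiffOn_const
    · rw [Pi.single_eq_of_ne hi]
      exact contDiffOn_const
  · rw [Finset.sum_eq_single j]
    · rw [Pi.single_eq_same]
      rfl
    · intro i _ hi
      rw [Pi.single_eq_of_ne hi]
      rfl
    · intro hj
      exact absurd (Finset.self_mem_range_succ j) hj

/-- Leibniz's rule on each `A i y (D^i s y)`: one term raises the order, the other differentiates
the coefficient. Class `C^n` at a point persists nearby, so the formula for `L s` may be
differentiated; and order below `n` leaves one derivative to spare. -/
theorem IsDiffOp.exists_hasFDerivAt (hΩ : IsOpen Ω) {n : ℕ} {L : (E → F) → E → G}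
    (h : IsDiffOp Ω n L) : ∃ A : (i : ℕ) → E → (E [×i]→L[ℝ] F) →L[ℝ] G,
      (∀ i, ContDiffOn ℝ ∞ (A i) Ω) ∧ ∀ s, ∀ y ∈ Ω, ContDiffAt ℝ n s y →
        HasFDerivAt (L s) (∑ i ∈ Finset.range n, ((A i y).comp
          (continuousMultilinearCurryLeftEquiv ℝ (fun _ : Fin (i + 1) ↦ E) F
            (iteratedFDeriv ℝ (i + 1) s y)) + (fderiv ℝ (A i) y).flip (iteratedFDeriv ℝ i s y))) y := by
  obtain ⟨A, hA, hL⟩ := h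
  refine ⟨A, hA, fun s y hy hs ↦ ?_⟩
  have hev : L s =ᶠ[𝓝 y] fun y ↦ ∑ i ∈ Finset.range n, A i y (iteratedFDeriv ℝ i s y) := by
    filter_upwards [hΩ.mem_nhds hy, hs.eventually (by simp)] with y' hy' hs'
    exact hL s y' hy' hs'
  refine HasFDerivAt.congr_of_eventuallyEq (HasFDerivAt.fun_sum fun i hi ↦ ?_) hev
  have h1 : HasFDerivAt (A i) (fderiv ℝ (A i) y) y :=
    (((hA i).contDiffAt (hΩ.mem_nhds hy)).differentiableAt (by simp)).hasFDerivAt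
  have h2 : HasFDerivAt (iteratedFDeriv ℝ i s) (fderiv ℝ (iteratedFDeriv ℝ i s) y) y :=
    (hs.differentiableAt_iteratedFDeriv (mod_cast Finset.mem_range.1 hi)).hasFDerivAt
  have h3 := h1.clm_apply h2
  rw [fderiv_iteratedFDeriv] at h3
  exact h3

theorem IsDiffOp.differentiableAt (hΩ : IsOpen Ω) {n : ℕ} {L : (E → F) → E → G}
    (h : IsDiffOp Ω n L) {s : E → F} {y : E} (hy : y ∈ Ω) (hs : ContDiffAt ℝ n s y) :
    DifferentiableAt ℝ (L s) y := by
  obtain ⟨A, -, hA⟩ := h.exists_hasFDerivAt hΩ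
  exact (hA s y hy hs).differentiableAt

theorem contDiffOn_flip {A B C : Type*} [NormedAddCommGroup A] [NormedSpace ℝ A]
    [NormedAddCommGroup B] [NormedSpace ℝ B] [NormedAddCommGroup C] [NormedSpace ℝ C]
    {f : E → A →L[ℝ] B →L[ℝ] C} (hf : ContDiffOn ℝ ∞ f Ω) :
    ContDiffOn ℝ ∞ (fun y ↦ (f y).flip) Ω := by
  have h : ContDiff ℝ ∞ (fun g : A →L[ℝ] B →L[ℝ] C ↦ g.flip) := by
    refine IsBoundedLinearMap.contDiff ⟨⟨fun x y ↦ rfl, fun c x ↦ rfl⟩, 1, one_pos, fun x ↦ ?_⟩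
    rw [ContinuousLinearMap.opNorm_flip, one_mul]
  exact h.comp_contDiffOn hf

/-- Composition of operator-valued linear maps with a fixed linear map. -/
def postcomp {A B C D : Type*} [NormedAddCommGroup A] [NormedSpace ℝ A]
    [NormedAddCommGroup B] [NormedSpace ℝ B] [NormedAddCommGroup C] [NormedSpace ℝ C]
    [NormedAddCommGroup D] [NormedSpace ℝ D] (T : B →L[ℝ] C) (U : D →L[ℝ] A →L[ℝ] B) :
    D →L[ℝ] A →L[ℝ] C :=
  (ContinuousLinearMap.compL ℝ A B C T).comp U

theorem contDiffOn_postcomp {A B C D : Type*} [NormedAddCommGroup A] [NormedSpace ℝ A]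
    [NormedAddCommGroup B] [NormedSpace ℝ B] [NormedAddCommGroup C] [NormedSpace ℝ C]
    [NormedAddCommGroup D] [NormedSpace ℝ D] {T : E → B →L[ℝ] C} (hT : ContDiffOn ℝ ∞ T Ω)
    (U : D →L[ℝ] A →L[ℝ] B) : ContDiffOn ℝ ∞ (fun y ↦ postcomp (T y) U) Ω := by
  have h : ContDiff ℝ ∞ (fun g : B →L[ℝ] C ↦ ContinuousLinearMap.compL ℝ A B C g) :=
    ContinuousLinearMap.contDiff _
  exact (h.comp_contDiffOn hT).clm_comp contDiffOn_const

theorem IsDiffOp.congr {n : ℕ} {L L' : (E → F) → E → G} (h : IsDiffOp Ω n L)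
    (he : ∀ s, ∀ y ∈ Ω, ContDiffAt ℝ n s y → L' s y = L s y) : IsDiffOp Ω n L' := by
  obtain ⟨A, hA, hL⟩ := h
  exact ⟨A, hA, fun s y hy hs ↦ (he s y hy hs).trans (hL s y hy hs)⟩

/-- The coefficients move up by one index, and order zero receives the coefficient zero. -/
theorem isDiffOp_shift {n : ℕ} {S : (k : ℕ) → E → (E [×(k + 1)]→L[ℝ] F) →L[ℝ] G}
    (hS : ∀ k, ContDiffOn ℝ ∞ (S k) Ω) : IsDiffOp Ω (n + 1) (fun (s : E → F) y ↦
      ∑ k ∈ Finset.range n, S k y (iteratedFDeriv ℝ (k + 1) s y)) := by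
  refine ⟨fun i ↦ Nat.casesOn i (fun _ ↦ 0) S, fun i ↦ ?_, fun s y hy hs ↦ ?_⟩
  · cases i with
    | zero => exact contDiffOn_const
    | succ k => exact hS k
  · rw [Finset.sum_range_succ']
    exact (add_zero _).symm

theorem IsDiffOp.fderiv (hΩ : IsOpen Ω) {n : ℕ} {L : (E → F) → E → G} (h : IsDiffOp Ω n L) :
    IsDiffOp Ω (n + 1) (fun s y ↦ fderiv ℝ (L s) y) := by
  obtain ⟨A, hA, hd⟩ := h.exists_hasFDerivAt hΩ
  have h1 : IsDiffOp Ω n (fun (s : E → F) y ↦ ∑ i ∈ Finset.range n,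
      (_root_.fderiv ℝ (A i) y).flip (iteratedFDeriv ℝ i s y)) :=
    ⟨fun i y ↦ (_root_.fderiv ℝ (A i) y).flip,
      fun i ↦ contDiffOn_flip ((hA i).fderiv_of_isOpen hΩ (by simp)), fun _ _ _ _ ↦ rfl⟩
  have h2 : IsDiffOp Ω (n + 1) (fun (s : E → F) y ↦ ∑ k ∈ Finset.range n,
      postcomp (A k y) (continuousMultilinearCurryLeftEquiv ℝ (fun _ : Fin (k + 1) ↦ E) F
        : (E [×(k + 1)]→L[ℝ] F) →L[ℝ] (E →L[ℝ] (E [×k]→L[ℝ] F))) (iteratedFDeriv ℝ (k + 1) s y)) :=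
    isDiffOp_shift fun k ↦ contDiffOn_postcomp (hA k) _
  refine (h2.add (h1.of_le (Nat.le_succ n))).congr fun s y hy hs ↦ ?_
  rw [(hd s y hy (hs.of_le (mod_cast Nat.le_succ n))).fderiv, Finset.sum_add_distrib]
  rfl

/-- Operators with continuous coefficients are locally bounded. -/
theorem IsDiffOp.exists_bound (hΩ : IsOpen Ω) {n : ℕ} {L : (E → F) → E → G} (h : IsDiffOp Ω n L)
    {y₀ : E} (hy₀ : y₀ ∈ Ω) : ∃ C : ℝ, 0 ≤ C ∧ ∀ᶠ y in 𝓝 y₀, ∀ s, ContDiffAt ℝ n s y →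
      ‖L s y‖ ≤ C * ∑ i ∈ Finset.range n, ‖iteratedFDeriv ℝ i s y‖ := by
  obtain ⟨A, hA, hL⟩ := h
  refine ⟨∑ i ∈ Finset.range n, (‖A i y₀‖ + 1), Finset.sum_nonneg fun _ _ ↦ by positivity, ?_⟩
  have h1 : ∀ᶠ y in 𝓝 y₀, ∀ i ∈ Finset.range n, ‖A i y‖ ≤ ‖A i y₀‖ + 1 := by
    rw [Filter.eventually_all_finset]
    intro i _
    have hc : ContinuousAt (fun y ↦ ‖A i y‖) y₀ :=
      ((hA i).continuousOn.continuousAt (hΩ.mem_nhds hy₀)).norm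
    filter_upwards [hc.eventually_lt_const (lt_add_one _)] with y hy using hy.le
  filter_upwards [h1, hΩ.mem_nhds hy₀] with y hy hyΩ s hs
  rw [hL s y hyΩ hs, Finset.mul_sum]
  refine (norm_sum_le _ _).trans (Finset.sum_le_sum fun i hi ↦ ?_)
  refine (ContinuousLinearMap.le_opNorm _ _).trans (mul_le_mul_of_nonneg_right ?_ (norm_nonneg _))
  exact (hy i hi).trans (Finset.single_le_sum (f := fun i ↦ ‖A i y₀‖ + 1)
    (fun _ _ ↦ by positivity) hi)

theorem IsDiffOp.map_add {n : ℕ} {L : (E → F) → E → G} (h : IsDiffOp Ω n L) {s s' : E → F} {y : E}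
    (hy : y ∈ Ω) (hs : ContDiffAt ℝ n s y) (hs' : ContDiffAt ℝ n s' y) :
    L (s + s') y = L s y + L s' y := by
  obtain ⟨A, -, hL⟩ := h
  rw [hL s y hy hs, hL s' y hy hs', hL (s + s') y hy (hs.add hs'), ← Finset.sum_add_distrib]
  refine Finset.sum_congr rfl fun i hi ↦ ?_
  have hi' : (i : WithTop ℕ∞) ≤ n := mod_cast (Finset.mem_range.1 hi).le
  rw [iteratedFDeriv_add_apply (hs.of_le hi') (hs'.of_le hi'), _root_.map_add]

end DiffOp

section CovIter

set_option synthInstance.maxHeartbeats 200000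

variable {E : Type*} [NormedAddCommGroup E] [NormedSpace ℝ E]
  {F : Type*} [NormedAddCommGroup F] [NormedSpace ℝ F] {Ω : Set E}

/-- The zeroth order part of the connection on `T^j(T^*M) ⊗ V` in coordinates. -/
def christoffelTensor (a : E →L[ℝ] E →L[ℝ] E) (b : E →L[ℝ] F →L[ℝ] F) (j : ℕ) :
    (E [×j]→L[ℝ] F) →L[ℝ] E →L[ℝ] (E [×j]→L[ℝ] F) :=
  ((ContinuousLinearMap.compContinuousMultilinearMapL ℝ (fun _ : Fin j ↦ E) F F).comp b
    - ∑ i : Fin j, ((ContinuousMultilinearMap.compContinuousLinearMapContinuousMultilinear ℝ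
      (fun _ : Fin j ↦ E) (fun _ : Fin j ↦ E) F).toContinuousLinearMap
        (fun _ ↦ ContinuousLinearMap.id ℝ E) i).comp a).flip

theorem christoffelTensor_apply (a : E →L[ℝ] E →L[ℝ] E) (b : E →L[ℝ] F →L[ℝ] F) {j : ℕ}
    (A : E [×j]→L[ℝ] F) (v₀ : E) (v : Fin j → E) :
    christoffelTensor a b j A v₀ v
      = b v₀ (A v) - ∑ i : Fin j, A (Function.update v i (a v₀ (v i))) := by
  simp only [christoffelTensor, ContinuousLinearMap.flip_apply, sub_apply, ContinuousLinearMap.comp_apply,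
    sum_apply]
  congr 1
  refine Finset.sum_congr rfl fun i _ ↦ ?_
  change A (fun k ↦ Function.update (fun _ : Fin j ↦ ContinuousLinearMap.id ℝ E) i (a v₀) k (v k)) = _
  congr 1
  ext1 k
  by_cases hk : k = i
  · subst hk
    simp
  · simp [hk]

theorem contDiffOn_christoffelTensor {ΓM : E → E →L[ℝ] E →L[ℝ] E} {ΓV : E → E →L[ℝ] F →L[ℝ] F}
    (hM : ContDiffOn ℝ ∞ ΓM Ω) (hV : ContDiffOn ℝ ∞ ΓV Ω) (j : ℕ) :
    ContDiffOn ℝ ∞ (fun y ↦ christoffelTensor (ΓM y) (ΓV y) j) Ω := by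
  refine contDiffOn_flip ?_
  refine ContDiffOn.sub (contDiffOn_const.clm_comp hV) (ContDiffOn.sum fun i _ ↦ ?_)
  exact contDiffOn_const.clm_comp hM

/-- The `j`-th covariant derivative of a section in coordinates. -/
def covIter (ΓM : E → E →L[ℝ] E →L[ℝ] E) (ΓV : E → E →L[ℝ] F →L[ℝ] F) (s : E → F) :
    (j : ℕ) → E → (E [×j]→L[ℝ] F)
  | 0 => fun y ↦ (continuousMultilinearCurryFin0 ℝ E F).symm (s y)
  | j + 1 => fun y ↦ (continuousMultilinearCurryLeftEquiv ℝ (fun _ : Fin (j + 1) ↦ E) F).symm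
      (fderiv ℝ (covIter ΓM ΓV s j) y
        + christoffelTensor (ΓM y) (ΓV y) j (covIter ΓM ΓV s j y))

variable {ΓM : E → E →L[ℝ] E →L[ℝ] E} {ΓV : E → E →L[ℝ] F →L[ℝ] F}

/-- The covariant derivative is the usual derivative up to terms of lower order. -/
theorem exists_covIter_eq (hΩ : IsOpen Ω) (hM : ContDiffOn ℝ ∞ ΓM Ω) (hV : ContDiffOn ℝ ∞ ΓV Ω)
    (j : ℕ) : ∃ L : (E → F) → E → (E [×j]→L[ℝ] F), IsDiffOp Ω j L ∧
      ∀ s, ∀ y ∈ Ω, ContDiffAt ℝ j s y → covIter ΓM ΓV s j y = iteratedFDeriv ℝ j s y + L s y := by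
  induction j with
  | zero =>
    refine ⟨fun _ _ ↦ 0, ⟨fun _ _ ↦ 0, fun _ ↦ contDiffOn_const, fun _ _ _ _ ↦ by simp⟩, ?_⟩
    intro s y _ _
    rw [add_zero, iteratedFDeriv_zero_eq_comp]
    rfl
  | succ j ih =>
    obtain ⟨L, hL, hLs⟩ := ih
    have hχ := contDiffOn_christoffelTensor hM hV j
    set U := (continuousMultilinearCurryLeftEquiv ℝ (fun _ : Fin (j + 1) ↦ E) F).symm
    have hU : ContDiffOn ℝ ∞ (fun _ : E ↦ (U : (E →L[ℝ] (E [×j]→L[ℝ] F)) →L[ℝ]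
        (E [×(j + 1)]→L[ℝ] F))) Ω := contDiffOn_const
    -- Differentiating `D^j s + L s` gives the leading term `D^(j+1) s`. The derivative of `L s` and
    -- the Christoffel term have order at most `j` and form the new remainder.
    refine ⟨_, ((hL.fderiv hΩ).add (((isDiffOp_iteratedFDeriv j).add
      (hL.of_le (Nat.le_succ j))).clm_comp hχ)).clm_comp hU, ?_⟩
    intro s y hy hs
    have hs' : ContDiffAt ℝ j s y := hs.of_le (mod_cast Nat.le_succ j)
    have hev : covIter ΓM ΓV s j =ᶠ[𝓝 y] fun y ↦ iteratedFDeriv ℝ j s y + L s y := by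
      filter_upwards [hΩ.mem_nhds hy, hs'.eventually (by simp)] with y' hy' hs''
      exact hLs s y' hy' hs''
    have h1 : DifferentiableAt ℝ (iteratedFDeriv ℝ j s) y :=
      hs.differentiableAt_iteratedFDeriv (mod_cast Nat.lt_succ_self j)
    have h2 := hL.differentiableAt hΩ hy hs'
    have h3 : iteratedFDeriv ℝ (j + 1) s y = U (fderiv ℝ (iteratedFDeriv ℝ j s) y) := by
      rw [iteratedFDeriv_succ_eq_comp_left]
      rfl
    rw [h3]
    change U _ = U _ + U _
    rw [hev.fderiv_eq, fderiv_fun_add h1 h2, hev.eq_of_nhds, ← map_add, add_assoc]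

theorem differentiableAt_covIter (hΩ : IsOpen Ω) (hM : ContDiffOn ℝ ∞ ΓM Ω)
    (hV : ContDiffOn ℝ ∞ ΓV Ω) {j : ℕ} {s : E → F} {y : E} (hy : y ∈ Ω)
    (hs : ContDiffAt ℝ (j + 1 : ℕ) s y) : DifferentiableAt ℝ (covIter ΓM ΓV s j) y := by
  obtain ⟨L, hL, hLs⟩ := exists_covIter_eq hΩ hM hV (F := F) j
  have hs' : ContDiffAt ℝ j s y := hs.of_le (mod_cast Nat.le_succ j)
  have hev : covIter ΓM ΓV s j =ᶠ[𝓝 y] fun y ↦ iteratedFDeriv ℝ j s y + L s y := by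
    filter_upwards [hΩ.mem_nhds hy, hs'.eventually (by simp)] with y' hy' hs''
    exact hLs s y' hy' hs''
  have h1 : DifferentiableAt ℝ (iteratedFDeriv ℝ j s) y :=
    hs.differentiableAt_iteratedFDeriv (mod_cast Nat.lt_succ_self j)
  exact (h1.add (hL.differentiableAt hΩ hy hs')).congr_of_eventuallyEq hev

/-- The recursion for the covariant derivatives, evaluated on vector fields. -/
theorem covIter_succ_apply {j : ℕ} {s : E → F} {y : E}
    (hd : DifferentiableAt ℝ (covIter ΓM ΓV s j) y) (v₀ : E) {Y : Fin j → E → E}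
    (hY : ∀ i, DifferentiableAt ℝ (Y i) y) :
    fderiv ℝ (fun y ↦ covIter ΓM ΓV s j y (fun i ↦ Y i y)) y v₀
      + ΓV y v₀ (covIter ΓM ΓV s j y (fun i ↦ Y i y))
      - ∑ i, covIter ΓM ΓV s j y (Function.update (fun i ↦ Y i y) i
          (fderiv ℝ (Y i) y v₀ + ΓM y v₀ (Y i y)))
      = covIter ΓM ΓV s (j + 1) y (Fin.cons v₀ (fun i ↦ Y i y)) := by
  have h1 := (hd.hasFDerivAt.continuousMultilinearMap_apply fun i ↦ (hY i).hasFDerivAt).fderiv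
  have h2 : covIter ΓM ΓV s (j + 1) y (Fin.cons v₀ (fun i ↦ Y i y))
      = fderiv ℝ (covIter ΓM ΓV s j) y v₀ (fun i ↦ Y i y)
        + christoffelTensor (ΓM y) (ΓV y) j (covIter ΓM ΓV s j y) v₀ (fun i ↦ Y i y) := by
    simp [covIter]
  rw [h1, h2, christoffelTensor_apply]
  simp only [ContinuousMultilinearMap.map_update_add, Finset.sum_add_distrib, add_apply, sum_apply,
    ContinuousLinearMap.comp_apply]
  simp only [ContinuousMultilinearMap.toContinuousLinearMap_apply]
  simp only [ContinuousMultilinearMap.apply_apply]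
  abel

end CovIter

/-! ### Sections of vector bundles and connections in coordinates -/

section LocalForm

variable {E : Type*} [NormedAddCommGroup E] [NormedSpace ℝ E]
  {M : Type*} [TopologicalSpace M] [ChartedSpace E M]
  {F : Type*} [NormedAddCommGroup F] [NormedSpace ℝ F]
  {V : M → Type*} [TopologicalSpace (TotalSpace F V)]
  [∀ x, AddCommGroup (V x)] [∀ x, Module ℝ (V x)] [∀ x, TopologicalSpace (V x)]
  [FiberBundle F V] [VectorBundle ℝ F V]

variable (F V) in
/-- The coordinate expression of vectors in the fibre over `x`, in the trivialization at `x₀`. -/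
def vcoord (x₀ x : M) : V x →L[ℝ] F :=
  (trivializationAt F V x₀).continuousLinearMapAt ℝ x

variable (E F) in
/-- The coordinate expression of a section in the chart and the trivialization at `x₀`. -/
def vrep (x₀ : M) (σ : Π x : M, V x) (y : E) : F :=
  vcoord F V x₀ ((chartAt E x₀).symm y) (σ ((chartAt E x₀).symm y))

theorem vrep_apply {x₀ x : M} (hx : x ∈ (chartAt E x₀).source) (σ : Π x : M, V x) :
    vrep E F x₀ σ (chartAt E x₀ x) = vcoord F V x₀ x (σ x) :=
  congrArg (fun y ↦ vcoord F V x₀ y (σ y)) ((chartAt E x₀).left_inv hx)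

theorem vcoord_eq {x₀ x : M} (hx : x ∈ (trivializationAt F V x₀).baseSet) (v : V x) :
    vcoord F V x₀ x v = (trivializationAt F V x₀ ⟨x, v⟩).2 :=
  congrFun ((trivializationAt F V x₀).coe_linearMapAt_of_mem hx) v

theorem vcoord_injective {x₀ x : M} (hx : x ∈ (trivializationAt F V x₀).baseSet) :
    Function.Injective (vcoord F V x₀ x) := fun v w h ↦ by
  rw [← (trivializationAt F V x₀).symmL_continuousLinearMapAt (R := ℝ) hx v,
    ← (trivializationAt F V x₀).symmL_continuousLinearMapAt (R := ℝ) hx w]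
  exact congrArg _ h

theorem vcoord_symmL {x₀ x : M} (hx : x ∈ (trivializationAt F V x₀).baseSet) (f : F) :
    vcoord F V x₀ x ((trivializationAt F V x₀).symmL ℝ x f) = f :=
  (trivializationAt F V x₀).continuousLinearMapAt_symmL hx f

theorem vrep_comp_chart_eventuallyEq {x₀ x : M} (hx : x ∈ (chartAt E x₀).source)
    (hx' : x ∈ (trivializationAt F V x₀).baseSet) (σ : Π x : M, V x) :
    (fun x' ↦ (trivializationAt F V x₀ ⟨x', σ x'⟩).2) ∘ (chartAt E x₀).symm
      =ᶠ[𝓝 (chartAt E x₀ x)] vrep E F x₀ σ := by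
  have h : ∀ᶠ y in 𝓝 (chartAt E x₀ x),
      (chartAt E x₀).symm y ∈ (trivializationAt F V x₀).baseSet := by
    refine ((chartAt E x₀).symm.continuousAt ((chartAt E x₀).map_source hx)).eventually ?_
    rw [(chartAt E x₀).left_inv hx]
    exact (trivializationAt F V x₀).open_baseSet.mem_nhds hx'
  filter_upwards [h] with y hy
  exact (vcoord_eq hy _).symm

theorem contMDiffAt_section_iff_vrep [IsManifold 𝓘(ℝ, E) ∞ M]
    [ContMDiffVectorBundle ∞ F V 𝓘(ℝ, E)] {n : WithTop ℕ∞} (hn : n ≤ (∞ : WithTop ℕ∞)) {x₀ x : M}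
    (hx : x ∈ (chartAt E x₀).source) (hx' : x ∈ (trivializationAt F V x₀).baseSet)
    (σ : Π x : M, V x) :
    ContMDiffAt 𝓘(ℝ, E) (𝓘(ℝ, E).prod 𝓘(ℝ, F)) n (fun x ↦ TotalSpace.mk' F x (σ x)) x
      ↔ ContDiffAt ℝ n (vrep E F x₀ σ) (chartAt E x₀ x) := by
  have : IsManifold 𝓘(ℝ, E) n M := IsManifold.of_le hn
  have : ContMDiffVectorBundle n F V 𝓘(ℝ, E) := ContMDiffVectorBundle.of_le hn
  rw [(trivializationAt F V x₀).contMDiffAt_section_iff hx',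
    contMDiffAt_iff_source_of_mem_source hx, modelWithCornersSelf_coe, range_id,
    contMDiffWithinAt_univ, contMDiffAt_iff_contDiffAt]
  exact ⟨fun h ↦ h.congr_of_eventuallyEq (EventuallyEq.symm (vrep_comp_chart_eventuallyEq hx hx' σ)),
    fun h ↦ h.congr_of_eventuallyEq (vrep_comp_chart_eventuallyEq hx hx' σ)⟩

theorem mdifferentiableAt_section_iff_vrep [IsManifold 𝓘(ℝ, E) ∞ M]
    [ContMDiffVectorBundle ∞ F V 𝓘(ℝ, E)] {x₀ x : M}
    (hx : x ∈ (chartAt E x₀).source) (hx' : x ∈ (trivializationAt F V x₀).baseSet)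
    (σ : Π x : M, V x) :
    MDifferentiableAt 𝓘(ℝ, E) (𝓘(ℝ, E).prod 𝓘(ℝ, F)) (fun x ↦ TotalSpace.mk' F x (σ x)) x
      ↔ DifferentiableAt ℝ (vrep E F x₀ σ) (chartAt E x₀ x) := by
  have : IsManifold 𝓘(ℝ, E) 1 M := IsManifold.of_le (n := ∞) (by simp)
  have : ContMDiffVectorBundle 1 F V 𝓘(ℝ, E) := ContMDiffVectorBundle.of_le (n := ∞) (by simp)
  rw [(trivializationAt F V x₀).mdifferentiableAt_section_iff 𝓘(ℝ, E) σ hx',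
    mdifferentiableAt_iff_source_of_mem_source hx, modelWithCornersSelf_coe, range_id,
    mdifferentiableWithinAt_univ, mdifferentiableAt_iff_differentiableAt]
  exact Filter.EventuallyEq.differentiableAt_iff (vrep_comp_chart_eventuallyEq hx hx' σ)

theorem chartRep_eq_vrep [IsManifold 𝓘(ℝ, E) ∞ M] (x₀ : M)
    (X : Π x : M, TangentSpace 𝓘(ℝ, E) x) : chartRep x₀ X = vrep E E x₀ X := rfl

variable [IsManifold 𝓘(ℝ, E) ∞ M]
  [∀ x, IsTopologicalAddGroup (V x)] [∀ x, ContinuousSMul ℝ (V x)]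

/-- In the coordinates at `x₀`, the connection `cov` is `d + Γ` on `Ω`. -/
structure IsLocalForm (cov : CovariantDerivative 𝓘(ℝ, E) F V) (x₀ : M) (Ω : Set E)
    (Γ : E → E →L[ℝ] F →L[ℝ] F) : Prop where
  isOpen : IsOpen Ω
  subset : Ω ⊆ (chartAt E x₀).target
  mem_baseSet : ∀ y ∈ Ω, (chartAt E x₀).symm y ∈ (trivializationAt F V x₀).baseSet
  contDiffOn : ContDiffOn ℝ ∞ Γ Ω
  eq : ∀ x ∈ (chartAt E x₀).source, chartAt E x₀ x ∈ Ω → ∀ σ : Π x : M, V x,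
    DifferentiableAt ℝ (vrep E F x₀ σ) (chartAt E x₀ x) → ∀ v : TangentSpace 𝓘(ℝ, E) x,
    vcoord F V x₀ x (cov σ x v)
      = fderiv ℝ (vrep E F x₀ σ) (chartAt E x₀ x) (tcoord x₀ x v)
        + Γ (chartAt E x₀ x) (tcoord x₀ x v) (vcoord F V x₀ x (σ x))

theorem IsLocalForm.mono {cov : CovariantDerivative 𝓘(ℝ, E) F V} {x₀ : M} {Ω Ω' : Set E}
    {Γ : E → E →L[ℝ] F →L[ℝ] F} (h : IsLocalForm cov x₀ Ω Γ) (hΩ' : IsOpen Ω') (hs : Ω' ⊆ Ω) :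
    IsLocalForm cov x₀ Ω' Γ :=
  ⟨hΩ', hs.trans h.subset, fun y hy ↦ h.mem_baseSet y (hs hy), h.contDiffOn.mono hs,
    fun x hx hxΩ ↦ h.eq x hx (hs hxΩ)⟩

theorem CovariantDerivative.sum_smul [ContMDiffVectorBundle ∞ F V 𝓘(ℝ, E)]
    (cov : CovariantDerivative 𝓘(ℝ, E) F V) {ι : Type*} (s : Finset ι) {c : ι → M → ℝ}
    {S : ι → Π x : M, V x} {x : M} (hc : ∀ i, MDifferentiableAt 𝓘(ℝ, E) 𝓘(ℝ, ℝ) (c i) x)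
    (hS : ∀ i, MDifferentiableAt 𝓘(ℝ, E) (𝓘(ℝ, E).prod 𝓘(ℝ, F))
      (fun x ↦ TotalSpace.mk' F x (S i x)) x) (v : TangentSpace 𝓘(ℝ, E) x) :
    cov (fun x ↦ ∑ i ∈ s, c i x • S i x) x v
      = ∑ i ∈ s, (c i x • cov (S i) x v + mvfderiv 𝓘(ℝ, E) (c i) x v • S i x) := by
  classical
  have : ContMDiffVectorBundle 1 F V 𝓘(ℝ, E) := ContMDiffVectorBundle.of_le (n := ∞) (by simp)
  induction s using Finset.induction_on with
  | empty =>
    have : (fun x : M ↦ ∑ i ∈ (∅ : Finset ι), c i x • S i x) = 0 := by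
      ext x
      simp
    rw [this, cov.zero]
    simp
  | insert i s hi ih =>
    have : (fun x : M ↦ ∑ i ∈ insert i s, c i x • S i x)
        = (c i • S i) + (fun x : M ↦ ∑ i ∈ s, c i x • S i x) := by
      ext x
      simp [Finset.sum_insert hi]
    rw [this, cov.isCovariantDerivativeOnUniv.add ((hc i).smul_section (hS i))
      (MDifferentiableAt.sum_section (t := fun i x ↦ c i x • S i x)
        fun k _ ↦ (hc k).smul_section (hS k)),
      cov.isCovariantDerivativeOnUniv.leibniz (hS i) (hc i), Finset.sum_insert hi,
      add_apply, ih]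
    rfl

/-- The connection is applied to sections defined on all of `M`, so a local frame is multiplied by a
bump function. Near `x₀` a section is a combination of these global sections, and Leibniz's rule
leaves `d` of the coefficients plus a term of order zero built from the covariant derivatives of the
frame. -/
theorem exists_isLocalForm [FiniteDimensional ℝ E] [FiniteDimensional ℝ F] [T2Space M]
    [ContMDiffVectorBundle ∞ F V 𝓘(ℝ, E)]
    (cov : CovariantDerivative 𝓘(ℝ, E) F V)
    [CovariantDerivative.ContMDiffCovariantDerivative cov ∞] (x₀ : M) :
    ∃ Ω Γ, chartAt E x₀ x₀ ∈ Ω ∧ IsLocalForm cov x₀ Ω Γ := by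
  set e := trivializationAt F V x₀ with he
  set ψ := chartAt E x₀ with hψ
  have hx₀ψ : x₀ ∈ ψ.source := mem_chart_source E x₀
  have hx₀e : x₀ ∈ e.baseSet := FiberBundle.mem_baseSet_trivializationAt' x₀
  have hW : ψ.source ∩ e.baseSet ∈ 𝓝 x₀ :=
    (ψ.open_source.inter e.open_baseSet).mem_nhds ⟨hx₀ψ, hx₀e⟩
  obtain ⟨χ, -, hχ⟩ := (SmoothBumpFunction.nhds_basis_tsupport (I := 𝓘(ℝ, E)) x₀).mem_iff.1 hW
  -- On `N` the bump function is `1`, so the sections `S i` below form the honest frame of the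
  -- trivialization.
  obtain ⟨N, hN1, hNo, hxN⟩ := eventually_nhds_iff.1 ((χ.eventuallyEq_one).and hW)
  set b := Module.finBasis ℝ F with hb
  set S : Fin (Module.finrank ℝ F) → Π x : M, V x := fun i x ↦ χ x • e.symmL ℝ x (b i) with hS
  have hSs : ∀ i, ContMDiff 𝓘(ℝ, E) (𝓘(ℝ, E).prod 𝓘(ℝ, F)) ∞
      (fun x ↦ TotalSpace.mk' F x (S i x)) := by
    intro i x
    by_cases hx : x ∈ tsupport χ
    · have hxW := hχ hx
      rw [e.contMDiffAt_section_iff hxW.2]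
      have h1 : ContMDiffAt 𝓘(ℝ, E) 𝓘(ℝ, F) ∞ (fun x ↦ χ x • b i) x :=
        (χ.contMDiff.contMDiffAt).smul contMDiffAt_const
      refine h1.congr_of_eventuallyEq ?_
      filter_upwards [e.open_baseSet.mem_nhds hxW.2] with x' hx'
      rw [← vcoord_eq hx', map_smul, vcoord_symmL hx']
    · have h0 : ContMDiffAt 𝓘(ℝ, E) (𝓘(ℝ, E).prod 𝓘(ℝ, F)) ∞
          (fun x ↦ TotalSpace.mk' F x (0 : V x)) x := (contMDiff_zeroSection ℝ V).contMDiffAt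
      refine h0.congr_of_eventuallyEq ?_
      filter_upwards [(isClosed_tsupport χ).isOpen_compl.mem_nhds hx] with x' hx'
      simp only [S]
      rw [image_eq_zero_of_notMem_tsupport hx', zero_smul]
  set A : Fin (Module.finrank ℝ F) → M → E →L[ℝ] F := fun i x ↦
    (vcoord F V x₀ x).comp ((cov (S i) x).comp
      ((trivializationAt E (TangentSpace 𝓘(ℝ, E)) x₀).symmL ℝ x)) with hA
  have hAs : ∀ i, ContMDiffOn 𝓘(ℝ, E) 𝓘(ℝ, E →L[ℝ] F) ∞ (A i) N := by
    intro i
    have h1 := (CovariantDerivative.ContMDiffCovariantDerivative.contMDiff (cov := cov)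
      (k := ∞)).contMDiff (σ := S i) (hSs i).contMDiffOn
    have h2 := ((trivializationAt (E →L[ℝ] F) (fun x ↦ TangentSpace 𝓘(ℝ, E) x →L[ℝ] V x)
      x₀).contMDiffOn_section_iff (n := ∞) (IB := 𝓘(ℝ, E)) (s := cov (S i)) hNo
        (fun x hx ↦ (hN1 x hx).2)).1 (h1.mono (subset_univ _))
    exact h2
  set A' : Fin (Module.finrank ℝ F) → E → E →L[ℝ] F := fun i y ↦ A i (ψ.symm y)
  set Ω : Set E := ψ.target ∩ ψ.symm ⁻¹' N
  have hΩo : IsOpen Ω := ψ.symm.isOpen_inter_preimage hNo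
  have hA's : ∀ i, ContDiffOn ℝ ∞ (A' i) Ω := by
    intro i y hy
    have h1 : ContMDiffAt 𝓘(ℝ, E) 𝓘(ℝ, E →L[ℝ] F) ∞ (A i) (ψ.symm y) :=
      (hAs i).contMDiffAt (hNo.mem_nhds hy.2)
    rw [contMDiffAt_iff_source_of_mem_source (ψ.map_target hy.1), modelWithCornersSelf_coe,
      range_id, contMDiffWithinAt_univ, contMDiffAt_iff_contDiffAt] at h1
    have h2 : extChartAt 𝓘(ℝ, E) x₀ (ψ.symm y) = y := ψ.right_inv hy.1
    rw [h2] at h1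
    exact h1.contDiffWithinAt
  -- The Christoffel form is `Γ y v f = ∑ i, f_i • A' i y v`. The flip places the tangent vector
  -- before the fibre vector.
  refine ⟨Ω, fun y ↦ (∑ i, (LinearMap.toContinuousLinearMap (b.coord i)).smulRight (A' i y)).flip,
    ⟨ψ.map_source hx₀ψ, by
      rw [mem_preimage, ψ.left_inv hx₀ψ]
      exact hxN⟩, hΩo, inter_subset_left, fun y hy ↦ (hN1 _ hy.2).2.2, ?_, ?_⟩
  · exact contDiffOn_flip (ContDiffOn.sum fun i _ ↦ contDiffOn_const.smulRight (hA's i))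
  · intro x hx hxΩ σ hσ v
    have hxN : x ∈ N := by
      have := hxΩ.2
      rwa [mem_preimage, ψ.left_inv hx] at this
    have hxe : x ∈ e.baseSet := (hN1 x hxN).2.2
    set c : Fin (Module.finrank ℝ F) → M → ℝ := fun i x ↦ b.repr (vcoord F V x₀ x (σ x)) i
    have hcψ : ∀ i, c i ∘ ψ.symm = fun y ↦
        LinearMap.toContinuousLinearMap (b.coord i) (vrep E F x₀ σ y) := fun i ↦ rfl
    have hcd : ∀ i, DifferentiableAt ℝ (c i ∘ ψ.symm) (ψ x) := fun i ↦ by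
      rw [hcψ]
      exact (LinearMap.toContinuousLinearMap (b.coord i)).differentiableAt.comp _ hσ
    have hcm : ∀ i, MDifferentiableAt 𝓘(ℝ, E) 𝓘(ℝ, ℝ) (c i) x := fun i ↦ by
      rw [mdifferentiableAt_iff_source_of_mem_source hx, modelWithCornersSelf_coe, range_id,
        mdifferentiableWithinAt_univ, mdifferentiableAt_iff_differentiableAt]
      exact hcd i
    have hSm : ∀ i, MDifferentiableAt 𝓘(ℝ, E) (𝓘(ℝ, E).prod 𝓘(ℝ, F))
        (fun x ↦ TotalSpace.mk' F x (S i x)) x := fun i ↦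
      (hSs i).contMDiffAt.mdifferentiableAt (by simp)
    have : ContMDiffVectorBundle 1 F V 𝓘(ℝ, E) := ContMDiffVectorBundle.of_le (n := ∞) (by simp)
    have hsum : ∀ᶠ x' in 𝓝 x, σ x' = ∑ i, c i x' • S i x' := by
      filter_upwards [hNo.mem_nhds hxN] with x' hx'
      have hx'e : x' ∈ e.baseSet := (hN1 x' hx').2.2
      apply vcoord_injective hx'e
      have h1 : χ x' = 1 := (hN1 x' hx').1
      simp only [map_sum, map_smul, S, h1, one_smul]
      simp only [he, vcoord_symmL hx'e, c, b.sum_repr]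
    have hcov : cov σ x v = ∑ i, (c i x • cov (S i) x v + mvfderiv 𝓘(ℝ, E) (c i) x v • S i x) := by
      rw [← CovariantDerivative.sum_smul cov Finset.univ hcm hSm v,
        cov.isCovariantDerivativeOnUniv.congr_of_eventuallyEq
          ((mdifferentiableAt_section_iff_vrep hx hxe σ).2 hσ)
          (MDifferentiableAt.sum_section fun k _ ↦ (hcm k).smul_section (hSm k)) univ_mem hsum]
      rfl
    have h1 : χ x = 1 := (hN1 x hxN).1
    have hvS : ∀ i, vcoord F V x₀ x (S i x) = b i := fun i ↦ by
      simp only [S, h1, one_smul]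
      exact vcoord_symmL hxe _
    have hAv : ∀ i, A' i (ψ x) (tcoord x₀ x v) = vcoord F V x₀ x (cov (S i) x v) := fun i ↦ by
      have h2 : A' i (ψ x) = A i x := congrArg (A i) (ψ.left_inv hx)
      rw [h2]
      exact congrArg (fun w ↦ vcoord F V x₀ x (cov (S i) x w))
        ((trivializationAt E (TangentSpace 𝓘(ℝ, E)) x₀).symmL_continuousLinearMapAt
          (R := ℝ) hx v)
    rw [hcov, map_sum]
    simp only [map_add, map_smul, hvS, Finset.sum_add_distrib]
    rw [add_comm]
    congr 1
    · have h2 : ∀ i, mvfderiv 𝓘(ℝ, E) (c i) x v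
          = b.repr (fderiv ℝ (vrep E F x₀ σ) (ψ x) (tcoord x₀ x v)) i := fun i ↦ by
        rw [mvfderiv_eq_fderiv_chart hx (hcd i)]
        change fderiv ℝ (c i ∘ ψ.symm) (ψ x) _ = _
        rw [hcψ, fderiv_fun_comp (ψ x) (LinearMap.toContinuousLinearMap (b.coord i)).differentiableAt hσ,
          ContinuousLinearMap.fderiv]
        rfl
      simp only [h2, b.sum_repr]
      rfl
    · simp only [ContinuousLinearMap.flip_apply, sum_apply,
        ContinuousLinearMap.smulRight_apply, smul_apply, ← hAv]
      rfl

end LocalForm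

/-! ### Jet norms in coordinates -/

section JetCoord

variable {E : Type*} [NormedAddCommGroup E] [NormedSpace ℝ E]
  {M : Type*} [TopologicalSpace M] [ChartedSpace E M] [IsManifold 𝓘(ℝ, E) ∞ M]
  {F : Type*} [NormedAddCommGroup F] [NormedSpace ℝ F]
  {V : M → Type*} [TopologicalSpace (TotalSpace F V)]
  [∀ x, AddCommGroup (V x)] [∀ x, Module ℝ (V x)] [∀ x, TopologicalSpace (V x)]
  [∀ x, IsTopologicalAddGroup (V x)] [∀ x, ContinuousSMul ℝ (V x)]
  [FiberBundle F V] [VectorBundle ℝ F V]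
  {covM : CovariantDerivative 𝓘(ℝ, E) E (fun x : M ↦ TangentSpace 𝓘(ℝ, E) x)}
  {covV : CovariantDerivative 𝓘(ℝ, E) F V} {x₀ : M} {Ω : Set E}
  {ΓM : E → E →L[ℝ] E →L[ℝ] E} {ΓV : E → E →L[ℝ] F →L[ℝ] F}

theorem eventually_chart {x : M} (hx : x ∈ (chartAt E x₀).source) {p : M → Prop}
    (hp : ∀ᶠ x' in 𝓝 x, p x') :
    ∀ᶠ y in 𝓝 (chartAt E x₀ x), p ((chartAt E x₀).symm y) := by
  refine ((chartAt E x₀).symm.continuousAt ((chartAt E x₀).map_source hx)).eventually ?_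
  rwa [(chartAt E x₀).left_inv hx]

/-- The coordinate expression of the iterated covariant derivative. -/
theorem vcoord_iteratedCov (hM : IsLocalForm covM x₀ Ω ΓM) (hV : IsLocalForm covV x₀ Ω ΓV)
    {σ : Π x : M, V x} (j : ℕ) : ∀ (X : Fin j → Π x : M, TangentSpace 𝓘(ℝ, E) x) (x : M),
    x ∈ (chartAt E x₀).source → chartAt E x₀ x ∈ Ω →
    ContDiffAt ℝ j (vrep E F x₀ σ) (chartAt E x₀ x) →
    (∀ i, ContDiffAt ℝ j (chartRep x₀ (X i)) (chartAt E x₀ x)) →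
    vcoord F V x₀ x (iteratedCov covM covV σ j X x)
      = covIter ΓM ΓV (vrep E F x₀ σ) j (chartAt E x₀ x) (fun i ↦ tcoord x₀ x (X i x)) := by
  induction j with
  | zero =>
    intro X x hx _ _ _
    simp only [iteratedCov, covIter, continuousMultilinearCurryFin0_symm_apply]
    exact (vrep_apply hx σ).symm
  | succ j ih =>
    intro X x hx hxΩ hσ hX
    have hjj : (j : WithTop ℕ∞) ≤ ((j + 1 : ℕ) : WithTop ℕ∞) := mod_cast Nat.le_succ j
    set y := chartAt E x₀ x with hy
    -- The identity is required near `y`, not only at it, because the connection differentiates it.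
    have hev : vrep E F x₀ (iteratedCov covM covV σ j (Fin.tail X)) =ᶠ[𝓝 y] fun y ↦
        covIter ΓM ΓV (vrep E F x₀ σ) j y (fun i ↦ chartRep x₀ (Fin.tail X i) y) := by
      filter_upwards [hM.isOpen.mem_nhds hxΩ, (hσ.of_le hjj).eventually (by simp),
        eventually_all.2 fun i : Fin j ↦ ((hX i.succ).of_le hjj).eventually (by simp)] with z hz hz1 hz2
      have hzt := hM.subset hz
      have h1 := ih (Fin.tail X) ((chartAt E x₀).symm z) ((chartAt E x₀).map_target hzt)
        (by rwa [(chartAt E x₀).right_inv hzt]) (by rwa [(chartAt E x₀).right_inv hzt])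
        (by rw [(chartAt E x₀).right_inv hzt]; exact hz2)
      rw [(chartAt E x₀).right_inv hzt] at h1
      exact h1
    have hdc : DifferentiableAt ℝ (covIter ΓM ΓV (vrep E F x₀ σ) j) y :=
      differentiableAt_covIter hM.isOpen hM.contDiffOn hV.contDiffOn hxΩ hσ
    have hdX : ∀ i : Fin j, DifferentiableAt ℝ (chartRep x₀ (Fin.tail X i)) y := fun i ↦
      (hX i.succ).differentiableAt (by simp)
    have hd : DifferentiableAt ℝ (fun y ↦
        covIter ΓM ΓV (vrep E F x₀ σ) j y (fun i ↦ chartRep x₀ (Fin.tail X i) y)) y :=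
      (hdc.hasFDerivAt.continuousMultilinearMap_apply
        fun i ↦ (hdX i).hasFDerivAt).differentiableAt
    have h1 := hV.eq x hx hxΩ _ (hev.differentiableAt_iff.2 hd) (X 0 x)
    have h2 : vcoord F V x₀ x (iteratedCov covM covV σ j (Fin.tail X) x)
        = covIter ΓM ΓV (vrep E F x₀ σ) j y (fun i ↦ chartRep x₀ (Fin.tail X i) y) := by
      rw [← vrep_apply hx]
      exact hev.eq_of_nhds
    have h3 : ∀ i : Fin j, vcoord F V x₀ x (iteratedCov covM covV σ j
        (Function.update (Fin.tail X) i (fun y ↦ covM (Fin.tail X i) y (X 0 y))) x)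
        = covIter ΓM ΓV (vrep E F x₀ σ) j y (Function.update
          (fun i ↦ chartRep x₀ (Fin.tail X i) y) i
          (fderiv ℝ (chartRep x₀ (Fin.tail X i)) y (tcoord x₀ x (X 0 x))
            + ΓM y (tcoord x₀ x (X 0 x)) (chartRep x₀ (Fin.tail X i) y))) := by
      intro i
      have hcev : chartRep x₀ (fun y ↦ covM (Fin.tail X i) y (X 0 y)) =ᶠ[𝓝 y] fun z ↦
          fderiv ℝ (chartRep x₀ (Fin.tail X i)) z (chartRep x₀ (X 0) z)
            + ΓM z (chartRep x₀ (X 0) z) (chartRep x₀ (Fin.tail X i) z) := by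
        filter_upwards [hM.isOpen.mem_nhds hxΩ, (hX i.succ).eventually (by simp)] with z hz hz1
        have hzt := hM.subset hz
        have h1 := hM.eq ((chartAt E x₀).symm z) ((chartAt E x₀).map_target hzt)
          (by rwa [(chartAt E x₀).right_inv hzt]) (Fin.tail X i)
          (by
            rw [(chartAt E x₀).right_inv hzt]
            exact hz1.differentiableAt (by simp)) (X 0 _)
        rw [(chartAt E x₀).right_inv hzt] at h1
        exact h1
      -- The field `∇_{X₀} X_i` has one derivative less than `X_i`; this is why the regularity
      -- demanded of the fields follows the order `j`.
      have hcd : ContDiffAt ℝ j (chartRep x₀ (fun y ↦ covM (Fin.tail X i) y (X 0 y))) y := by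
        refine ContDiffAt.congr_of_eventuallyEq ?_ hcev
        have hX0 := (hX 0).of_le hjj
        have hΓ : ContDiffAt ℝ j ΓM y :=
          ((hM.contDiffOn.contDiffAt (hM.isOpen.mem_nhds hxΩ)).of_le (mod_cast le_top))
        exact (((hX i.succ).fderiv_right (m := j) (by norm_cast)).clm_apply hX0).add
          ((hΓ.clm_apply hX0).clm_apply ((hX i.succ).of_le hjj))
      rw [ih _ x hx hxΩ (hσ.of_le hjj)]
      · congr 1
        ext1 k
        by_cases hk : k = i
        · subst hk
          simp only [Function.update_self]
          have h4 := hcev.eq_of_nhds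
          rw [hy, chartRep_apply hx, chartRep_apply hx (X 0)] at h4
          exact h4
        · simp only [Function.update_of_ne hk]
          exact (chartRep_apply hx _).symm
      · intro k
        by_cases hk : k = i
        · subst hk
          simpa only [Function.update_self] using hcd
        · rw [Function.update_of_ne hk]
          exact (hX k.succ).of_le hjj
    simp only [iteratedCov, map_sub, map_sum]
    rw [h1, h2, hev.fderiv_eq, Finset.sum_congr rfl fun i _ ↦ h3 i,
      covIter_succ_apply hdc _ hdX]
    congr 1
    ext1 k
    refine Fin.cases ?_ (fun i ↦ ?_) k
    · rfl
    · exact chartRep_apply hx _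

/-- The symmetrization of a multilinear map. -/
def symMul {j : ℕ} (A : E [×j]→L[ℝ] F) : MultilinearMap ℝ (fun _ : Fin j ↦ E) F :=
  ((j ! : ℕ) : ℝ)⁻¹ • ∑ s : Equiv.Perm (Fin j), A.toMultilinearMap.domDomCongr s

theorem symMul_apply {j : ℕ} (A : E [×j]→L[ℝ] F) (v : Fin j → E) :
    symMul A v = ((j ! : ℕ) : ℝ)⁻¹ • ∑ s : Equiv.Perm (Fin j), A (fun i ↦ v (s i)) := by
  simp [symMul]

theorem symMul_add {j : ℕ} (A B : E [×j]→L[ℝ] F) : symMul (A + B) = symMul A + symMul B := by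
  ext v
  simp [symMul_apply, Finset.sum_add_distrib]

theorem symMul_eq_self {j : ℕ} {A : E [×j]→L[ℝ] F}
    (h : ∀ (v : Fin j → E) (s : Equiv.Perm (Fin j)), A (fun i ↦ v (s i)) = A v) (v : Fin j → E) :
    symMul A v = A v := by
  simp only [symMul_apply, h, Finset.sum_const, Finset.card_univ, Fintype.card_perm,
    Fintype.card_fin, ← Nat.cast_smul_eq_nsmul ℝ, smul_smul]
  rw [inv_mul_cancel₀ (by positivity), one_smul]

theorem norm_symMul_apply_le {j : ℕ} (A : E [×j]→L[ℝ] F) (v : Fin j → E) :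
    ‖symMul A v‖ ≤ ‖A‖ * ∏ i, ‖v i‖ := by
  rw [symMul_apply, norm_smul, norm_inv, Real.norm_natCast, inv_mul_le_iff₀ (by positivity)]
  refine (norm_sum_le _ _).trans ?_
  refine (Finset.sum_le_card_nsmul _ _ (‖A‖ * ∏ i, ‖v i‖) fun s _ ↦ ?_).trans (le_of_eq ?_)
  · refine (A.le_opNorm _).trans (le_of_eq ?_)
    rw [Equiv.prod_comp s (fun i ↦ ‖v i‖)]
  · simp [Fintype.card_perm]

/-- The coordinate expression of the symmetrized covariant derivative. -/
theorem vcoord_symCov (hM : IsLocalForm covM x₀ Ω ΓM) (hV : IsLocalForm covV x₀ Ω ΓV)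
    {σ : Π x : M, V x} {j : ℕ} {x : M} (hx : x ∈ (chartAt E x₀).source)
    (hxΩ : chartAt E x₀ x ∈ Ω) (hσ : ContDiffAt ℝ j (vrep E F x₀ σ) (chartAt E x₀ x))
    (v : Fin j → TangentSpace 𝓘(ℝ, E) x) :
    vcoord F V x₀ x (symCov covM covV σ j x v)
      = symMul (covIter ΓM ΓV (vrep E F x₀ σ) j (chartAt E x₀ x)) (fun i ↦ tcoord x₀ x (v i)) := by
  rw [symMul_apply, symCov, map_smul, map_sum]
  congr 1
  refine Finset.sum_congr rfl fun s _ ↦ ?_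
  rw [vcoord_iteratedCov hM hV j _ x hx hxΩ hσ]
  · simp only [FiberBundle.extend_apply_self]
  · intro i
    rw [chartRep_eq_vrep]
    refine (contMDiffAt_section_iff_vrep (n := j) (mod_cast le_top) hx hx _).1 ?_
    exact FiberBundle.contMDiffAt_extend (k := j) 𝓘(ℝ, E) E (v (s i))

end JetCoord

/-! ### Orthonormal frames in coordinates -/

section Metric

variable {E : Type*} [NormedAddCommGroup E] [NormedSpace ℝ E] [FiniteDimensional ℝ E]
  {M : Type*} [TopologicalSpace M] [ChartedSpace E M] [IsManifold 𝓘(ℝ, E) ∞ M]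

/-- The orthonormal basis of `T_x M` that enters the norms of tensors. -/
def onb (gM : ContMDiffRiemannianMetric 𝓘(ℝ, E) ∞ E (fun x : M ↦ TangentSpace 𝓘(ℝ, E) x))
    (x : M) (k : Fin (Module.finrank ℝ (TangentSpace 𝓘(ℝ, E) x))) : TangentSpace 𝓘(ℝ, E) x :=
  let : RiemannianBundle (fun x : M ↦ TangentSpace 𝓘(ℝ, E) x) := ⟨gM.toRiemannianMetric⟩
  have : FiniteDimensional ℝ (TangentSpace 𝓘(ℝ, E) x) := inferInstanceAs (FiniteDimensional ℝ E)
  stdOrthonormalBasis ℝ (TangentSpace 𝓘(ℝ, E) x) k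

/-- Near `x₀` the Riemannian norm and the coordinate norm are comparable with one constant. Hence an
orthonormal basis of `T_x M`, read in the chart, has uniformly bounded vectors and coordinate
functionals. The basis is chosen separately at each `x`; bounds are enough, with no continuity in
`x`. -/
theorem exists_coord_bounds
    (gM : ContMDiffRiemannianMetric 𝓘(ℝ, E) ∞ E (fun x : M ↦ TangentSpace 𝓘(ℝ, E) x)) (x₀ : M) :
    ∃ C : ℝ, 0 < C ∧ ∀ᶠ x in 𝓝 x₀,
      (∀ v : TangentSpace 𝓘(ℝ, E) x, ‖tcoord x₀ x v‖ ≤ C * √(gM.inner x v v) ∧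
        √(gM.inner x v v) ≤ C * ‖tcoord x₀ x v‖) ∧
      ∃ b : Module.Basis (Fin (Module.finrank ℝ (TangentSpace 𝓘(ℝ, E) x))) ℝ E,
        (∀ k, b k = tcoord x₀ x (onb gM x k)) ∧ (∀ k, ‖b k‖ ≤ C) ∧
        ∀ v k, |b.repr v k| ≤ C * ‖v‖ := by
  let : RiemannianBundle (fun x : M ↦ TangentSpace 𝓘(ℝ, E) x) := ⟨gM.toRiemannianMetric⟩
  have : IsContinuousRiemannianBundle E (fun x : M ↦ TangentSpace 𝓘(ℝ, E) x) :=
    ⟨gM.inner, gM.contMDiff.continuous, fun _ _ _ ↦ rfl⟩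
  obtain ⟨C₁, hC₁, h₁⟩ := eventually_norm_trivializationAt_lt E
    (fun x : M ↦ TangentSpace 𝓘(ℝ, E) x) x₀
  obtain ⟨C₂, hC₂, h₂⟩ := eventually_norm_symmL_trivializationAt_lt E
    (fun x : M ↦ TangentSpace 𝓘(ℝ, E) x) x₀
  have hnorm : ∀ (x : M) (v : TangentSpace 𝓘(ℝ, E) x), ‖v‖ = √(gM.inner x v v) := fun x v ↦ by
    rw [norm_eq_sqrt_real_inner v]
    rfl
  refine ⟨max C₁ C₂, lt_max_of_lt_left hC₁, ?_⟩
  filter_upwards [h₁, h₂, (chartAt E x₀).open_source.mem_nhds (mem_chart_source E x₀)] with x h₁ h₂ hx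
  have : FiniteDimensional ℝ (TangentSpace 𝓘(ℝ, E) x) := inferInstanceAs (FiniteDimensional ℝ E)
  set e := trivializationAt E (fun x : M ↦ TangentSpace 𝓘(ℝ, E) x) x₀
  have hA : ∀ v : TangentSpace 𝓘(ℝ, E) x, ‖tcoord x₀ x v‖ ≤ max C₁ C₂ * ‖v‖ := fun v ↦
    ((e.continuousLinearMapAt ℝ x).le_opNorm v).trans
      (mul_le_mul_of_nonneg_right (h₁.le.trans (le_max_left _ _)) (norm_nonneg _))
  have hB : ∀ v : E, ‖e.symmL ℝ x v‖ ≤ max C₁ C₂ * ‖v‖ := fun v ↦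
    ((e.symmL ℝ x).le_opNorm v).trans
      (mul_le_mul_of_nonneg_right (h₂.le.trans (le_max_right _ _)) (norm_nonneg _))
  refine ⟨fun v ↦ ⟨hnorm x v ▸ hA v, ?_⟩,
    (stdOrthonormalBasis ℝ (TangentSpace 𝓘(ℝ, E) x)).toBasis.map
      (e.continuousLinearEquivAt ℝ x hx).toLinearEquiv, fun k ↦ ?_, fun k ↦ ?_, fun v k ↦ ?_⟩
  · rw [← hnorm]
    have := hB (tcoord x₀ x v)
    rwa [show e.symmL ℝ x (tcoord x₀ x v) = v from e.symmL_continuousLinearMapAt (R := ℝ) hx v]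
      at this
  · rw [Module.Basis.map_apply, OrthonormalBasis.coe_toBasis]
    exact congrFun (e.coe_continuousLinearEquivAt_eq (R := ℝ) hx) _
  · rw [Module.Basis.map_apply, OrthonormalBasis.coe_toBasis]
    have h3 := hA (stdOrthonormalBasis ℝ (TangentSpace 𝓘(ℝ, E) x) k)
    rw [OrthonormalBasis.norm_eq_one, mul_one] at h3
    refine le_trans (le_of_eq ?_) h3
    exact congrArg _ (congrFun (e.coe_continuousLinearEquivAt_eq (R := ℝ) hx) _)
  · rw [Module.Basis.map_repr, LinearEquiv.trans_apply, OrthonormalBasis.coe_toBasis_repr_apply,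
      OrthonormalBasis.repr_apply_apply]
    refine (abs_real_inner_le_norm _ _).trans ?_
    rw [OrthonormalBasis.norm_eq_one, one_mul]
    refine le_trans (le_of_eq ?_) (hB v)
    exact congrArg _ (congrFun (e.symm_continuousLinearEquivAt_eq (R := ℝ) hx) v)

end Metric

/-! ### Comparison of jet norms with derivatives in coordinates -/

section Symmetry

variable {E : Type*} [NormedAddCommGroup E] [NormedSpace ℝ E]
  {F : Type*} [NormedAddCommGroup F] [NormedSpace ℝ F]

theorem fderiv_iteratedFDeriv_apply {n : ℕ} {f : E → F} {x : E}
    (hf : DifferentiableAt ℝ (iteratedFDeriv ℝ n f) x) (u : E) (w : Fin n → E) :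
    fderiv ℝ (iteratedFDeriv ℝ n f) x u w = fderiv ℝ (fun y ↦ iteratedFDeriv ℝ n f y w) x u := by
  have h := ((ContinuousMultilinearMap.apply ℝ (fun _ : Fin n ↦ E) F w).hasFDerivAt.comp x
    hf.hasFDerivAt).fderiv
  exact (congrArg (fun L : E →L[ℝ] F ↦ L u) h).symm

/-- Exchanging the first two arguments is symmetry of the second derivative of `D^n f`. Any other
adjacent exchange is obtained by differentiating, in the first direction, the identity of one order
lower, which holds in a neighbourhood. -/
theorem iteratedFDeriv_comp_swap {f : E → F} (n : ℕ) : ∀ (i : Fin n) (x : E),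
    ContDiffAt ℝ (n + 1 : ℕ) f x → ∀ v : Fin (n + 1) → E,
    iteratedFDeriv ℝ (n + 1) f x (v ∘ Equiv.swap i.castSucc i.succ)
      = iteratedFDeriv ℝ (n + 1) f x v := by
  induction n with
  | zero => exact fun i ↦ i.elim0
  | succ n ih =>
    intro i x hf v
    refine Fin.cases ?_ (fun i ↦ ?_) i
    · have hc : ContDiffAt ℝ 2 (iteratedFDeriv ℝ n f) x :=
        hf.iteratedFDeriv_right (by norm_cast; omega)
      have hs := hc.isSymmSndFDerivAt (by simp)
      have h1 : ∀ w : Fin (n + 2) → E, iteratedFDeriv ℝ (n + 2) f x w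
          = fderiv ℝ (fderiv ℝ (iteratedFDeriv ℝ n f)) x (w 0) (w 1) (Fin.tail (Fin.tail w)) := by
        intro w
        have hd : DifferentiableAt ℝ (iteratedFDeriv ℝ (n + 1) f) x :=
          hf.differentiableAt_iteratedFDeriv (mod_cast Nat.lt_succ_self (n + 1))
        have hd' : DifferentiableAt ℝ (fderiv ℝ (iteratedFDeriv ℝ n f)) x :=
          (hc.fderiv_right (m := 1) (by norm_num)).differentiableAt (by simp)
        rw [iteratedFDeriv_succ_apply_left, fderiv_iteratedFDeriv_apply hd]
        have h2 : (fun y ↦ iteratedFDeriv ℝ (n + 1) f y (Fin.tail w))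
            = fun y ↦ fderiv ℝ (iteratedFDeriv ℝ n f) y (w 1) (Fin.tail (Fin.tail w)) := by
          ext y
          rw [iteratedFDeriv_succ_apply_left]
          rfl
        rw [h2]
        have h3 := ((ContinuousMultilinearMap.apply ℝ (fun _ : Fin n ↦ E) F
          (Fin.tail (Fin.tail w))).hasFDerivAt.comp x
          ((ContinuousLinearMap.apply ℝ _ (w 1)).hasFDerivAt.comp x hd'.hasFDerivAt)).fderiv
        exact congrArg (fun L : E →L[ℝ] F ↦ L (w 0)) h3
      rw [h1, h1]
      have e0 : (v ∘ Equiv.swap (Fin.castSucc 0) (Fin.succ 0)) 0 = v 1 := by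
        simp [Function.comp]
      have e1 : (v ∘ Equiv.swap (Fin.castSucc 0) (Fin.succ 0)) 1 = v 0 := by
        simp [Function.comp]
      have e2 : Fin.tail (Fin.tail (v ∘ Equiv.swap (Fin.castSucc 0) (Fin.succ 0)))
          = Fin.tail (Fin.tail v) := by
        ext1 k
        simp only [Fin.tail, Function.comp]
        rw [Equiv.swap_apply_of_ne_of_ne]
        · simp [Fin.ext_iff]
        · simp [Fin.ext_iff]
      rw [e0, e1, e2, hs (v 1) (v 0)]
    · have hd : DifferentiableAt ℝ (iteratedFDeriv ℝ (n + 1) f) x :=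
        hf.differentiableAt_iteratedFDeriv (mod_cast Nat.lt_succ_self (n + 1))
      rw [iteratedFDeriv_succ_apply_left, iteratedFDeriv_succ_apply_left,
        fderiv_iteratedFDeriv_apply hd, fderiv_iteratedFDeriv_apply hd]
      have e0 : (v ∘ Equiv.swap i.succ.castSucc i.succ.succ) 0 = v 0 := by
        simp only [Function.comp]
        rw [Equiv.swap_apply_of_ne_of_ne]
        · simp [Fin.ext_iff]
        · simp [Fin.ext_iff]
      have e1 : Fin.tail (v ∘ Equiv.swap i.succ.castSucc i.succ.succ)
          = Fin.tail v ∘ Equiv.swap i.castSucc i.succ := by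
        ext1 k
        simp only [Fin.tail, Function.comp]
        congr 1
        simp only [Equiv.swap_apply_def, Fin.ext_iff, Fin.val_succ, Fin.val_castSucc,
          Nat.add_right_cancel_iff]
        split_ifs <;> rfl
      rw [e0, e1]
      have hev : (fun y ↦ iteratedFDeriv ℝ (n + 1) f y
          (Fin.tail v ∘ Equiv.swap i.castSucc i.succ))
          =ᶠ[𝓝 x] fun y ↦ iteratedFDeriv ℝ (n + 1) f y (Fin.tail v) := by
        filter_upwards [(hf.of_le (mod_cast Nat.le_succ (n + 1)) :
          ContDiffAt ℝ (n + 1 : ℕ) f x).eventually (by simp)] with y hy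
        exact ih i y hy _
      rw [hev.fderiv_eq]

/-- The iterated derivatives of functions of class `C^n` on real spaces are symmetric. -/
theorem iteratedFDeriv_comp_perm_of_contDiffAt {f : E → F} {n : ℕ} {x : E}
    (hf : ContDiffAt ℝ n f x) (s : Equiv.Perm (Fin n)) (v : Fin n → E) :
    iteratedFDeriv ℝ n f x (v ∘ s) = iteratedFDeriv ℝ n f x v := by
  match n with
  | 0 => rw [Subsingleton.elim (v ∘ s) v]
  | n + 1 =>
    -- Adjacent transpositions generate all permutations.
    have hs : s ∈ Submonoid.closure (range fun i : Fin n ↦ Equiv.swap i.castSucc i.succ) := by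
      rw [Equiv.Perm.mclosure_swap_castSucc_succ]
      exact Submonoid.mem_top s
    induction hs using Submonoid.closure_induction generalizing v with
    | mem s hs =>
      obtain ⟨i, rfl⟩ := hs
      exact iteratedFDeriv_comp_swap n i x hf v
    | one => rfl
    | mul s t _ _ hs ht =>
      rw [Equiv.Perm.coe_mul, ← Function.comp_assoc, ht, hs]

end Symmetry

/-! ### Two-sided bounds between jet norms and coordinate derivatives -/

section JetBounds

variable {E : Type*} [NormedAddCommGroup E] [NormedSpace ℝ E] [FiniteDimensional ℝ E]
  {M : Type*} [TopologicalSpace M] [ChartedSpace E M] [IsManifold 𝓘(ℝ, E) ∞ M]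
  {F : Type*} [NormedAddCommGroup F] [NormedSpace ℝ F]
  {V : M → Type*} [TopologicalSpace (TotalSpace F V)]
  [∀ x, AddCommGroup (V x)] [∀ x, Module ℝ (V x)] [∀ x, TopologicalSpace (V x)]
  [∀ x, IsTopologicalAddGroup (V x)] [∀ x, ContinuousSMul ℝ (V x)]
  [FiberBundle F V] [VectorBundle ℝ F V]
  {gM : ContMDiffRiemannianMetric 𝓘(ℝ, E) ∞ E (fun x : M ↦ TangentSpace 𝓘(ℝ, E) x)}
  {covM : CovariantDerivative 𝓘(ℝ, E) E (fun x : M ↦ TangentSpace 𝓘(ℝ, E) x)}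
  {covV : CovariantDerivative 𝓘(ℝ, E) F V} {q : ∀ x, V x → ℝ} {x₀ : M} {Ω : Set E}
  {ΓM : E → E →L[ℝ] E →L[ℝ] E} {ΓV : E → E →L[ℝ] F →L[ℝ] F}

theorem jetNorm_eq (m : ℕ) (σ : Π x : M, V x) (x : M) :
    jetNorm gM covM q covV m σ x = √(∑ j ∈ Finset.range (m + 1),
      ∑ i : Fin j → Fin (Module.finrank ℝ (TangentSpace 𝓘(ℝ, E) x)),
        q x (((j ! : ℕ) : ℝ)⁻¹ • symCov covM covV σ j x (fun k ↦ onb gM x (i k)))) := rfl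

theorem sqrt_le_jetNorm (hq : ∀ x v, 0 ≤ q x v) {m j : ℕ} (hj : j ≤ m) (σ : Π x : M, V x) (x : M)
    (i : Fin j → Fin (Module.finrank ℝ (TangentSpace 𝓘(ℝ, E) x))) :
    √(q x (((j ! : ℕ) : ℝ)⁻¹ • symCov covM covV σ j x (fun k ↦ onb gM x (i k))))
      ≤ jetNorm gM covM q covV m σ x := by
  rw [jetNorm_eq]
  refine Real.sqrt_le_sqrt ?_
  refine (Finset.single_le_sum (f := fun i : Fin j → _ ↦ q x (((j ! : ℕ) : ℝ)⁻¹ •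
    symCov covM covV σ j x (fun k ↦ onb gM x (i k)))) (fun _ _ ↦ hq _ _) (Finset.mem_univ i)).trans ?_
  exact Finset.single_le_sum (f := fun j ↦ ∑ i : Fin j → _, q x (((j ! : ℕ) : ℝ)⁻¹ •
    symCov covM covV σ j x (fun k ↦ onb gM x (i k))))
    (fun _ _ ↦ Finset.sum_nonneg fun _ _ ↦ hq _ _) (Finset.mem_range.2 (Nat.lt_succ_of_le hj))

/-- The constant counts multi-indices: there are `n ^ j` tuples of frame vectors at order `j`, where
`n` is the dimension. -/
theorem jetNorm_le {m : ℕ} {σ : Π x : M, V x} {x : M} {B : ℝ} (hB : 0 ≤ B)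
    (h : ∀ j ≤ m, ∀ i : Fin j → Fin (Module.finrank ℝ (TangentSpace 𝓘(ℝ, E) x)),
      q x (((j ! : ℕ) : ℝ)⁻¹ • symCov covM covV σ j x (fun k ↦ onb gM x (i k))) ≤ B ^ 2) :
    jetNorm gM covM q covV m σ x
      ≤ √(∑ j ∈ Finset.range (m + 1), (Module.finrank ℝ E : ℝ) ^ j) * B := by
  conv_rhs => rw [← Real.sqrt_sq hB]
  rw [jetNorm_eq, ← Real.sqrt_mul (Finset.sum_nonneg fun _ _ ↦ by positivity)]
  refine Real.sqrt_le_sqrt ?_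
  rw [Finset.sum_mul]
  refine Finset.sum_le_sum fun j hj ↦ ?_
  refine (Finset.sum_le_card_nsmul _ _ (B ^ 2) fun i _ ↦
    h j (Nat.lt_succ_iff.1 (Finset.mem_range.1 hj)) i).trans (le_of_eq ?_)
  rw [Finset.card_univ, Fintype.card_fun, Fintype.card_fin, Fintype.card_fin, nsmul_eq_mul]
  push_cast
  rfl

/-- The remainder terms of the covariant derivatives are locally bounded. -/
theorem exists_covIter_bound (hM : IsLocalForm covM x₀ Ω ΓM) (hV : IsLocalForm covV x₀ Ω ΓV)
    (hx₀ : chartAt E x₀ x₀ ∈ Ω) (j : ℕ) :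
    ∃ C : ℝ, 0 ≤ C ∧ ∀ᶠ x in 𝓝 x₀, ∀ s : E → F, ContDiffAt ℝ j s (chartAt E x₀ x) →
      ∃ R : E [×j]→L[ℝ] F, covIter ΓM ΓV s j (chartAt E x₀ x)
        = iteratedFDeriv ℝ j s (chartAt E x₀ x) + R ∧
        ‖R‖ ≤ C * ∑ i ∈ Finset.range j, ‖iteratedFDeriv ℝ i s (chartAt E x₀ x)‖ := by
  obtain ⟨L, hL, hLs⟩ := exists_covIter_eq hM.isOpen hM.contDiffOn hV.contDiffOn (F := F) j
  obtain ⟨C, hC, hb⟩ := hL.exists_bound hM.isOpen hx₀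
  refine ⟨C, hC, ?_⟩
  have hc : ContinuousAt (chartAt E x₀) x₀ := (chartAt E x₀).continuousAt (mem_chart_source E x₀)
  filter_upwards [hc.eventually hb, hc.eventually (hM.isOpen.mem_nhds hx₀)] with x hx hxΩ s hs
  exact ⟨L s (chartAt E x₀ x), hLs s _ hxΩ hs, hx s hs⟩

/-- The covariant derivative is the usual one plus lower-order terms with locally bounded
coefficients, and the frame vectors it is evaluated on are bounded in coordinates. -/
theorem exists_jetNorm_le (hM : IsLocalForm covM x₀ Ω ΓM)
    (hV : IsLocalForm covV x₀ Ω ΓV)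
    (hx₀ : chartAt E x₀ x₀ ∈ Ω) (hq : ∀ x v, 0 ≤ q x v) {Cq : ℝ} (hCq : 0 ≤ Cq)
    (hqC : ∀ᶠ x in 𝓝 x₀, ∀ v, √(q x v) ≤ Cq * ‖vcoord F V x₀ x v‖) (m : ℕ) :
    ∃ C : ℝ, 0 ≤ C ∧ ∀ᶠ x in 𝓝 x₀, ∀ σ : Π x : M, V x,
      ContDiffAt ℝ m (vrep E F x₀ σ) (chartAt E x₀ x) →
      jetNorm gM covM q covV m σ x
        ≤ C * ∑ j ∈ Finset.range (m + 1),
          ‖iteratedFDeriv ℝ j (vrep E F x₀ σ) (chartAt E x₀ x)‖ := by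
  choose Cj hCj hj using exists_covIter_bound hM hV hx₀
  obtain ⟨Cb, hCb, hb⟩ := exists_coord_bounds gM x₀
  set K : ℝ := ∑ j ∈ Finset.range (m + 1), Cq * ((1 + Cj j) * Cb ^ j) with hK
  have hK0 : 0 ≤ K := Finset.sum_nonneg fun j _ ↦ by
    have := hCj j
    positivity
  refine ⟨√(∑ j ∈ Finset.range (m + 1), (Module.finrank ℝ E : ℝ) ^ j) * K, by positivity, ?_⟩
  have hall : ∀ᶠ x in 𝓝 x₀, ∀ j ∈ Finset.range (m + 1), ∀ s : E → F,
      ContDiffAt ℝ j s (chartAt E x₀ x) →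
      ∃ R : E [×j]→L[ℝ] F, covIter ΓM ΓV s j (chartAt E x₀ x)
        = iteratedFDeriv ℝ j s (chartAt E x₀ x) + R ∧
        ‖R‖ ≤ Cj j * ∑ i ∈ Finset.range j, ‖iteratedFDeriv ℝ i s (chartAt E x₀ x)‖ :=
    (eventually_all_finset _).2 fun j _ ↦ hj j
  have hc : ContinuousAt (chartAt E x₀) x₀ := (chartAt E x₀).continuousAt (mem_chart_source E x₀)
  filter_upwards [hall, hb, hqC, (chartAt E x₀).open_source.mem_nhds (mem_chart_source E x₀),
    hc.eventually (hM.isOpen.mem_nhds hx₀)] with x hall hb hqC hxs hxΩ σ hσ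
  obtain ⟨-, b, hbe, hbC, -⟩ := hb
  set y := chartAt E x₀ x
  set S := ∑ j ∈ Finset.range (m + 1), ‖iteratedFDeriv ℝ j (vrep E F x₀ σ) y‖ with hS
  have hS0 : 0 ≤ S := Finset.sum_nonneg fun _ _ ↦ norm_nonneg _
  rw [mul_assoc]
  refine jetNorm_le (mul_nonneg hK0 hS0) fun j hjm i ↦ ?_
  have hjr : j ∈ Finset.range (m + 1) := Finset.mem_range.2 (Nat.lt_succ_of_le hjm)
  have hσj : ContDiffAt ℝ j (vrep E F x₀ σ) y := hσ.of_le (mod_cast hjm)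
  obtain ⟨R, hR, hRn⟩ := hall j hjr _ hσj
  rw [← Real.sq_sqrt (hq x _)]
  refine pow_le_pow_left₀ (Real.sqrt_nonneg _) ((hqC _).trans ?_) 2
  rw [map_smul, vcoord_symCov hM hV hxs hxΩ hσj, norm_smul, norm_inv, Real.norm_natCast]
  have h1 : ‖covIter ΓM ΓV (vrep E F x₀ σ) j y‖ ≤ (1 + Cj j) * S := by
    rw [hR, add_mul, one_mul]
    refine (norm_add_le _ _).trans (add_le_add ?_ (hRn.trans
      (mul_le_mul_of_nonneg_left ?_ (hCj j))))
    · exact Finset.single_le_sum (f := fun j ↦ ‖iteratedFDeriv ℝ j (vrep E F x₀ σ) y‖)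
        (fun _ _ ↦ norm_nonneg _) hjr
    · exact Finset.sum_le_sum_of_subset_of_nonneg
        (Finset.range_mono (hjm.trans (Nat.le_succ m))) fun _ _ _ ↦ norm_nonneg _
  have h2 : ∏ k, ‖tcoord x₀ x (onb gM x (i k))‖ ≤ Cb ^ j := by
    refine (Finset.prod_le_prod (fun _ _ ↦ norm_nonneg _) (g := fun _ ↦ Cb) fun k _ ↦ ?_).trans
      (le_of_eq (by simp))
    rw [← hbe]
    exact hbC _
  have h3 : ‖symMul (covIter ΓM ΓV (vrep E F x₀ σ) j y) (fun k ↦ tcoord x₀ x (onb gM x (i k)))‖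
      ≤ (1 + Cj j) * S * Cb ^ j :=
    (norm_symMul_apply_le _ _).trans (mul_le_mul h1 h2 (Finset.prod_nonneg fun _ _ ↦ norm_nonneg _)
      (mul_nonneg (by linarith [hCj j]) hS0))
  have h4 : ((j ! : ℕ) : ℝ)⁻¹ ≤ 1 := inv_le_one_of_one_le₀ (mod_cast Nat.factorial_pos j)
  calc Cq * (((j ! : ℕ) : ℝ)⁻¹ * ‖symMul (covIter ΓM ΓV (vrep E F x₀ σ) j y)
        (fun k ↦ tcoord x₀ x (onb gM x (i k)))‖)
      ≤ Cq * (1 * ((1 + Cj j) * S * Cb ^ j)) := by gcongr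
    _ = Cq * ((1 + Cj j) * Cb ^ j) * S := by ring
    _ ≤ K * S := by
      refine mul_le_mul_of_nonneg_right ?_ hS0
      exact Finset.single_le_sum (f := fun j ↦ Cq * ((1 + Cj j) * Cb ^ j)) (fun j _ ↦ by
        have := hCj j
        positivity) hjr

/-- The jet norm sees only symmetrized covariant derivatives, but the usual derivative is symmetric,
so it equals the symmetrized covariant derivative minus the symmetrized remainder. The remainder
involves lower orders, which strong induction controls. -/
theorem exists_norm_iteratedFDeriv_le_jetNorm (hM : IsLocalForm covM x₀ Ω ΓM)
    (hV : IsLocalForm covV x₀ Ω ΓV)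
    (hx₀ : chartAt E x₀ x₀ ∈ Ω) (hq : ∀ x v, 0 ≤ q x v) {Cq : ℝ} (hCq : 0 ≤ Cq)
    (hqC : ∀ᶠ x in 𝓝 x₀, ∀ v, ‖vcoord F V x₀ x v‖ ≤ Cq * √(q x v)) (m : ℕ) (j : ℕ) (hjm : j ≤ m) :
    ∃ C : ℝ, 0 ≤ C ∧ ∀ᶠ x in 𝓝 x₀, ∀ σ : Π x : M, V x,
      ContDiffAt ℝ m (vrep E F x₀ σ) (chartAt E x₀ x) →
      ‖iteratedFDeriv ℝ j (vrep E F x₀ σ) (chartAt E x₀ x)‖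
        ≤ C * jetNorm gM covM q covV m σ x := by
  induction j using Nat.strong_induction_on with
  | _ j ih =>
  have ih' : ∀ i, ∃ C : ℝ, 0 ≤ C ∧ (i < j → ∀ᶠ x in 𝓝 x₀, ∀ σ : Π x : M, V x,
      ContDiffAt ℝ m (vrep E F x₀ σ) (chartAt E x₀ x) →
      ‖iteratedFDeriv ℝ i (vrep E F x₀ σ) (chartAt E x₀ x)‖
        ≤ C * jetNorm gM covM q covV m σ x) := fun i ↦ by
    by_cases hi : i < j
    · obtain ⟨C, hC, h⟩ := ih i hi (hi.le.trans hjm)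
      exact ⟨C, hC, fun _ ↦ h⟩
    · exact ⟨0, le_rfl, fun h ↦ absurd h hi⟩
  choose Ci hCi hi using ih'
  obtain ⟨Cj, hCj, hj⟩ := exists_covIter_bound hM hV hx₀ j
  obtain ⟨Cb, hCb, hb⟩ := exists_coord_bounds gM x₀
  set n := Module.finrank ℝ E
  -- First summand: expansion in the orthonormal frame, its number of tuples, and `j !`, which
  -- undoes the normalization in the jet norm. Second summand: the remainder, through the constants
  -- of lower order.
  set K : ℝ := Cb ^ j * ((n : ℝ) ^ j * ((j ! : ℕ) * Cq)) + Cj * ∑ i ∈ Finset.range j, Ci i with hK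
  have hsum0 : 0 ≤ ∑ i ∈ Finset.range j, Ci i := Finset.sum_nonneg fun i _ ↦ hCi i
  refine ⟨K, by positivity, ?_⟩
  have hc : ContinuousAt (chartAt E x₀) x₀ := (chartAt E x₀).continuousAt (mem_chart_source E x₀)
  have hall : ∀ᶠ x in 𝓝 x₀, ∀ i ∈ Finset.range j, ∀ σ : Π x : M, V x,
      ContDiffAt ℝ m (vrep E F x₀ σ) (chartAt E x₀ x) →
      ‖iteratedFDeriv ℝ i (vrep E F x₀ σ) (chartAt E x₀ x)‖
        ≤ Ci i * jetNorm gM covM q covV m σ x :=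
    (eventually_all_finset _).2 fun i hij ↦ hi i (Finset.mem_range.1 hij)
  filter_upwards [hall, hj, hb, hqC, (chartAt E x₀).open_source.mem_nhds (mem_chart_source E x₀),
    hc.eventually (hM.isOpen.mem_nhds hx₀)] with x hall hj hb hqC hxs hxΩ σ hσ
  obtain ⟨-, b, hbe, hbC, hbr⟩ := hb
  set y := chartAt E x₀ x
  set J := jetNorm gM covM q covV m σ x with hJ
  have hJ0 : 0 ≤ J := Real.sqrt_nonneg _
  have hσj : ContDiffAt ℝ j (vrep E F x₀ σ) y := hσ.of_le (mod_cast hjm)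
  obtain ⟨R, hR, hRn⟩ := hj _ hσj
  have hRJ : ‖R‖ ≤ Cj * (∑ i ∈ Finset.range j, Ci i) * J := by
    refine hRn.trans ?_
    rw [mul_assoc, Finset.sum_mul]
    exact mul_le_mul_of_nonneg_left (Finset.sum_le_sum fun i hi ↦ hall i hi σ hσ) hCj
  refine ContinuousMultilinearMap.opNorm_le_bound (by positivity) fun v ↦ ?_
  have hsym : symMul (iteratedFDeriv ℝ j (vrep E F x₀ σ) y) v
      = iteratedFDeriv ℝ j (vrep E F x₀ σ) y v :=
    symMul_eq_self (fun w s ↦ iteratedFDeriv_comp_perm_of_contDiffAt hσj s w) v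
  have h1 : iteratedFDeriv ℝ j (vrep E F x₀ σ) y v
      = symMul (covIter ΓM ΓV (vrep E F x₀ σ) j y) v - symMul R v := by
    rw [hR, symMul_add, add_apply, hsym, add_sub_cancel_right]
  have h2 : ‖symMul R v‖ ≤ Cj * (∑ i ∈ Finset.range j, Ci i) * J * ∏ k, ‖v k‖ :=
    (norm_symMul_apply_le _ _).trans (mul_le_mul_of_nonneg_right hRJ
      (Finset.prod_nonneg fun _ _ ↦ norm_nonneg _))
  have h3 : ∀ i : Fin j → Fin (Module.finrank ℝ (TangentSpace 𝓘(ℝ, E) x)),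
      ‖symMul (covIter ΓM ΓV (vrep E F x₀ σ) j y) (fun k ↦ b (i k))‖ ≤ (j ! : ℕ) * Cq * J := by
    intro i
    have h4 := (hqC (((j ! : ℕ) : ℝ)⁻¹ • symCov covM covV σ j x (fun k ↦ onb gM x (i k)))).trans
      (mul_le_mul_of_nonneg_left (sqrt_le_jetNorm hq hjm σ x i) hCq)
    rw [map_smul, vcoord_symCov hM hV hxs hxΩ hσj, norm_smul, norm_inv, Real.norm_natCast,
      inv_mul_le_iff₀ (by positivity), ← mul_assoc] at h4
    simpa only [hbe] using h4
  have h5 : ∑ i : Fin j → Fin (Module.finrank ℝ (TangentSpace 𝓘(ℝ, E) x)),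
      ‖symMul (covIter ΓM ΓV (vrep E F x₀ σ) j y) (fun k ↦ b (i k))‖
      ≤ (n : ℝ) ^ j * ((j ! : ℕ) * Cq * J) := by
    refine (Finset.sum_le_card_nsmul _ _ _ fun i _ ↦ h3 i).trans (le_of_eq ?_)
    rw [Finset.card_univ, Fintype.card_fun, Fintype.card_fin, Fintype.card_fin, nsmul_eq_mul]
    push_cast
    rfl
  have hP : 0 ≤ ∏ k, ‖v k‖ := Finset.prod_nonneg fun _ _ ↦ norm_nonneg _
  rw [h1]
  refine (norm_sub_le _ _).trans ?_
  refine (add_le_add ((norm_multilinear_apply_le_of_basis b hbr _ v).trans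
    (mul_le_mul_of_nonneg_left h5 (by positivity))) h2).trans (le_of_eq ?_)
  rw [hK]
  ring

/-- The covariant derivatives are additive. -/
theorem symCov_add (hM : IsLocalForm covM x₀ Ω ΓM) (hV : IsLocalForm covV x₀ Ω ΓV)
    {x : M} (hx : x ∈ (chartAt E x₀).source)
    (hxΩ : chartAt E x₀ x ∈ Ω) {σ τ : Π x : M, V x} {j : ℕ}
    (hσ : ContDiffAt ℝ j (vrep E F x₀ σ) (chartAt E x₀ x))
    (hτ : ContDiffAt ℝ j (vrep E F x₀ τ) (chartAt E x₀ x)) (v : Fin j → TangentSpace 𝓘(ℝ, E) x) :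
    symCov covM covV (σ + τ) j x v = symCov covM covV σ j x v + symCov covM covV τ j x v := by
  have hxe : x ∈ (trivializationAt F V x₀).baseSet := by
    have := hV.mem_baseSet _ hxΩ
    rwa [(chartAt E x₀).left_inv hx] at this
  have hadd : vrep E F x₀ (σ + τ) = vrep E F x₀ σ + vrep E F x₀ τ := by
    ext y
    simp [vrep]
  obtain ⟨L, hL, hLs⟩ := exists_covIter_eq hM.isOpen hM.contDiffOn hV.contDiffOn (F := F) j
  have hστ : ContDiffAt ℝ j (vrep E F x₀ σ + vrep E F x₀ τ) (chartAt E x₀ x) := hσ.add hτ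
  apply vcoord_injective hxe
  rw [map_add, vcoord_symCov hM hV hx hxΩ hσ, vcoord_symCov hM hV hx hxΩ hτ,
    vcoord_symCov hM hV hx hxΩ (by rwa [hadd]), hadd, hLs _ _ hxΩ hστ,
    hLs _ _ hxΩ hσ, hLs _ _ hxΩ hτ, hL.map_add hxΩ hσ hτ, iteratedFDeriv_add_apply hσ hτ]
  simp only [symMul_add, add_apply]
  abel

theorem sqrt_sum_add_sq_le {ι : Type*} (s : Finset ι) (a b : ι → ℝ) :
    √(∑ i ∈ s, (a i + b i) ^ 2) ≤ √(∑ i ∈ s, a i ^ 2) + √(∑ i ∈ s, b i ^ 2) := by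
  rw [Real.sqrt_le_iff]
  refine ⟨by positivity, ?_⟩
  have hA : 0 ≤ ∑ i ∈ s, a i ^ 2 := Finset.sum_nonneg fun _ _ ↦ sq_nonneg _
  have hB : 0 ≤ ∑ i ∈ s, b i ^ 2 := Finset.sum_nonneg fun _ _ ↦ sq_nonneg _
  have h := Real.sum_mul_le_sqrt_mul_sqrt s a b
  have h1 : ∑ i ∈ s, (a i + b i) ^ 2
      = ∑ i ∈ s, a i ^ 2 + ∑ i ∈ s, b i ^ 2 + 2 * ∑ i ∈ s, a i * b i := by
    rw [Finset.mul_sum, ← Finset.sum_add_distrib, ← Finset.sum_add_distrib]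
    exact Finset.sum_congr rfl fun i _ ↦ by ring
  rw [h1, add_sq, Real.sq_sqrt hA, Real.sq_sqrt hB]
  linarith

end JetBounds

/-! ### Functions as sections of the trivial line bundle -/

section Functions

variable {E : Type*} [NormedAddCommGroup E] [NormedSpace ℝ E]
  {M : Type*} [TopologicalSpace M] [ChartedSpace E M] [IsManifold 𝓘(ℝ, E) ∞ M]

theorem vcoord_trivial (x₀ x : M) (r : ℝ) : vcoord ℝ (Bundle.Trivial M ℝ) x₀ x r = r :=
  congrArg (fun L : ℝ →L[ℝ] ℝ ↦ L r) (Bundle.Trivial.continuousLinearMapAt_trivialization ℝ M ℝ x)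

theorem vrep_trivial (x₀ : M) (f : M → ℝ) :
    vrep E ℝ (V := Bundle.Trivial M ℝ) x₀ f = f ∘ (chartAt E x₀).symm :=
  funext fun _ ↦ vcoord_trivial _ _ _

theorem isLocalForm_flatConnection (x₀ : M) :
    IsLocalForm (flatConnection E M) x₀ (chartAt E x₀).target 0 where
  isOpen := (chartAt E x₀).open_target
  subset := subset_rfl
  mem_baseSet _ _ := mem_univ _
  contDiffOn := contDiffOn_const
  eq x hx _ σ hσ v := by
    rw [vrep_trivial] at hσ ⊢
    simp only [Pi.zero_apply, zero_apply, add_zero]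
    exact (vcoord_trivial _ _ _).trans (mvfderiv_eq_fderiv_chart (f := fun x ↦ (σ x : ℝ)) hx hσ v)

variable [FiniteDimensional ℝ E]
  {gM : ContMDiffRiemannianMetric 𝓘(ℝ, E) ∞ E (fun x : M ↦ TangentSpace 𝓘(ℝ, E) x)}
  {covM : CovariantDerivative 𝓘(ℝ, E) E (fun x : M ↦ TangentSpace 𝓘(ℝ, E) x)}

variable (gM covM) in
/-- The norm of the `m`-jet of a function. -/
def funJetNorm (m : ℕ) (f : M → ℝ) (x : M) : ℝ :=
  jetNorm gM covM (V := Bundle.Trivial M ℝ) (fun _ (v : ℝ) ↦ v ^ 2) (flatConnection E M) m f x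

/-- This is Minkowski's inequality, once the covariant derivatives are additive. Additivity requires
differentiability, hence the assumptions of class `C^m` at the point. -/
theorem funJetNorm_add_le [T2Space M] [CovariantDerivative.ContMDiffCovariantDerivative covM ∞]
    {m : ℕ} {f g : M → ℝ} {x : M} (hf : ContDiffAt ℝ m (f ∘ (chartAt E x).symm) (chartAt E x x))
    (hg : ContDiffAt ℝ m (g ∘ (chartAt E x).symm) (chartAt E x x)) :
    funJetNorm gM covM m (f + g) x ≤ funJetNorm gM covM m f x + funJetNorm gM covM m g x := by
  obtain ⟨Ω, Γ, hxΩ, hM⟩ := exists_isLocalForm covM x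
  have hV := (isLocalForm_flatConnection (E := E) x).mono hM.isOpen hM.subset
  have hadd : ∀ j ∈ Finset.range (m + 1), ∀ v : Fin j → TangentSpace 𝓘(ℝ, E) x,
      symCov covM (flatConnection E M) (f + g) j x v
        = symCov covM (flatConnection E M) f j x v + symCov covM (flatConnection E M) g j x v := by
    intro j hj v
    have hjm : (j : WithTop ℕ∞) ≤ m := mod_cast Nat.lt_succ_iff.1 (Finset.mem_range.1 hj)
    exact symCov_add hM hV (mem_chart_source E x) hxΩ (by rw [vrep_trivial]; exact hf.of_le hjm)
      (by rw [vrep_trivial]; exact hg.of_le hjm) v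
  simp only [funJetNorm, jetNorm_eq, Finset.sum_sigma']
  refine le_trans (le_of_eq ?_) (sqrt_sum_add_sq_le _ _ _)
  congr 1
  refine Finset.sum_congr rfl fun i hi ↦ ?_
  rw [hadd i.1 (Finset.mem_sigma.1 hi).1, smul_add]

theorem exists_funJetNorm_le [T2Space M] [CovariantDerivative.ContMDiffCovariantDerivative covM ∞]
    (m : ℕ) (x₀ : M) : ∃ C : ℝ, 0 ≤ C ∧ ∀ᶠ x in 𝓝 x₀, ∀ f : M → ℝ,
      ContDiffAt ℝ m (f ∘ (chartAt E x₀).symm) (chartAt E x₀ x) →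
      funJetNorm gM covM m f x ≤ C * ∑ j ∈ Finset.range (m + 1),
        ‖iteratedFDeriv ℝ j (f ∘ (chartAt E x₀).symm) (chartAt E x₀ x)‖ := by
  obtain ⟨Ω, Γ, hxΩ, hM⟩ := exists_isLocalForm covM x₀
  have hV := (isLocalForm_flatConnection (E := E) x₀).mono hM.isOpen hM.subset
  have h := exists_jetNorm_le (gM := gM) (q := fun _ (v : ℝ) ↦ v ^ 2) hM hV hxΩ
    (fun _ _ ↦ sq_nonneg _) zero_le_one (Eventually.of_forall fun x v ↦ by
      rw [one_mul, Real.sqrt_sq_eq_abs, vcoord_trivial]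
      exact le_rfl) m
  simp only [vrep_trivial] at h
  exact h

end Functions

/-! ### Jet norms of vector fields control coordinate derivatives -/

section Fields

variable {E : Type*} [NormedAddCommGroup E] [NormedSpace ℝ E] [FiniteDimensional ℝ E]
  {M : Type*} [TopologicalSpace M] [T2Space M] [ChartedSpace E M] [IsManifold 𝓘(ℝ, E) ∞ M]
  {gM gV : ContMDiffRiemannianMetric 𝓘(ℝ, E) ∞ E (fun x : M ↦ TangentSpace 𝓘(ℝ, E) x)}
  {covM covV : CovariantDerivative 𝓘(ℝ, E) E (fun x : M ↦ TangentSpace 𝓘(ℝ, E) x)}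
  [CovariantDerivative.ContMDiffCovariantDerivative covM ∞]
  [CovariantDerivative.ContMDiffCovariantDerivative covV ∞]

theorem inner_self_nonneg_of_metric
    (g : ContMDiffRiemannianMetric 𝓘(ℝ, E) ∞ E (fun x : M ↦ TangentSpace 𝓘(ℝ, E) x)) (x : M)
    (v : TangentSpace 𝓘(ℝ, E) x) : 0 ≤ g.inner x v v := by
  by_cases hv : v = 0
  · rw [hv, map_zero]
  · exact (g.pos x v hv).le

theorem exists_norm_iteratedFDeriv_chartRep_le (m : ℕ) (x₀ : M) :
    ∃ C : ℝ, 0 ≤ C ∧ ∀ᶠ x in 𝓝 x₀, ∀ X : Π x : M, TangentSpace 𝓘(ℝ, E) x,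
      ContDiffAt ℝ m (chartRep x₀ X) (chartAt E x₀ x) → ∀ j ≤ m,
      ‖iteratedFDeriv ℝ j (chartRep x₀ X) (chartAt E x₀ x)‖
        ≤ C * jetNorm gM covM (fun x v ↦ gV.inner x v v) covV m X x := by
  obtain ⟨Ω, Γ, hxΩ, hM⟩ := exists_isLocalForm covM x₀
  obtain ⟨Ω', Γ', hxΩ', hV⟩ := exists_isLocalForm covV x₀
  have ho := hM.isOpen.inter hV.isOpen
  obtain ⟨Cq, hCq, hq⟩ := exists_coord_bounds gV x₀
  have h : ∀ j, ∃ C : ℝ, 0 ≤ C ∧ (j ≤ m → ∀ᶠ x in 𝓝 x₀, ∀ X : Π x : M, TangentSpace 𝓘(ℝ, E) x,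
      ContDiffAt ℝ m (chartRep x₀ X) (chartAt E x₀ x) →
      ‖iteratedFDeriv ℝ j (chartRep x₀ X) (chartAt E x₀ x)‖
        ≤ C * jetNorm gM covM (fun x v ↦ gV.inner x v v) covV m X x) := by
    intro j
    by_cases hj : j ≤ m
    · obtain ⟨C, hC, h⟩ := exists_norm_iteratedFDeriv_le_jetNorm (gM := gM)
        (q := fun x v ↦ gV.inner x v v) (hM.mono ho inter_subset_left)
        (hV.mono ho inter_subset_right) ⟨hxΩ, hxΩ'⟩ (inner_self_nonneg_of_metric gV) hCq.le
        (hq.mono fun x hx v ↦ (hx.1 v).1) m j hj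
      exact ⟨C, hC, fun _ ↦ h⟩
    · exact ⟨0, le_rfl, fun h ↦ absurd h hj⟩
  choose C hC h using h
  refine ⟨∑ j ∈ Finset.range (m + 1), C j, Finset.sum_nonneg fun j _ ↦ hC j, ?_⟩
  have hall : ∀ᶠ x in 𝓝 x₀, ∀ j ∈ Finset.range (m + 1), ∀ X : Π x : M, TangentSpace 𝓘(ℝ, E) x,
      ContDiffAt ℝ m (chartRep x₀ X) (chartAt E x₀ x) →
      ‖iteratedFDeriv ℝ j (chartRep x₀ X) (chartAt E x₀ x)‖
        ≤ C j * jetNorm gM covM (fun x v ↦ gV.inner x v v) covV m X x :=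
    (eventually_all_finset _).2 fun j hj ↦ h j (Nat.lt_succ_iff.1 (Finset.mem_range.1 hj))
  filter_upwards [hall] with x hx X hX j hj
  have hjr : j ∈ Finset.range (m + 1) := Finset.mem_range.2 (Nat.lt_succ_of_le hj)
  refine (hx j hjr X hX).trans (mul_le_mul_of_nonneg_right ?_ (Real.sqrt_nonneg _))
  exact Finset.single_le_sum (fun j _ ↦ hC j) hjr

end Fields

/-! ### The flow on a smooth manifold -/

section Bounds

/-- Derivatives that are bounded by an integrable function for almost all times are bounded by an
integrable function for all times. -/
theorem exists_integrable_bound {E : Type*} [NormedAddCommGroup E] [NormedSpace ℝ E]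
    {F : Type*} [NormedAddCommGroup F] [NormedSpace ℝ F] {Ω : Set E} (hΩ : IsOpen Ω) {c d : ℝ}
    {m : ℕ} {Y : ℝ → E → F} (hY : ∀ t ∈ Icc c d, ContDiffOn ℝ m (Y t) Ω) {K : Set E}
    (hK : IsCompact K) (hKΩ : K ⊆ Ω) {C : ℝ} (hC : 0 < C) {q : ℝ → ℝ≥0∞}
    (hq : AEMeasurable q (volume.restrict (Icc c d))) (hfin : ∫⁻ t in Icc c d, q t ≠ ⊤)
    (hb : ∀ t ∈ Icc c d, ∀ x ∈ K, ∀ j ≤ m,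
      ‖iteratedFDeriv ℝ j (Y t) x‖ₑ ≤ ENNReal.ofReal C * q t) :
    ∃ h : ℝ → ℝ, IntegrableOn h (Icc c d) ∧
      ∀ t ∈ Icc c d, ∀ x ∈ K, ∀ j ≤ m, ‖iteratedFDeriv ℝ j (Y t) x‖ ≤ h t := by
  have hB : ∀ t, ∃ B : ℝ, t ∈ Icc c d → ∀ x ∈ K, ∀ j ≤ m, ‖iteratedFDeriv ℝ j (Y t) x‖ ≤ B := by
    intro t
    by_cases ht : t ∈ Icc c d
    · have h1 : ∀ j, ∃ B : ℝ, 0 ≤ B ∧ (j ≤ m → ∀ x ∈ K, ‖iteratedFDeriv ℝ j (Y t) x‖ ≤ B) := by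
        intro j
        by_cases hj : j ≤ m
        · obtain ⟨B, hB⟩ := hK.exists_bound_of_continuousOn
            ((((hY t ht).continuousOn_iteratedFDerivWithin (mod_cast hj) hΩ.uniqueDiffOn).congr
              fun y hy ↦ (iteratedFDerivWithin_of_isOpen j hΩ hy).symm).mono hKΩ)
          exact ⟨max B 0, le_max_right _ _, fun _ x hx ↦ (hB x hx).trans (le_max_left _ _)⟩
        · exact ⟨0, le_rfl, fun h ↦ absurd h hj⟩
      choose B hB0 hB using h1
      refine ⟨∑ j ∈ Finset.range (m + 1), B j, fun _ x hx j hj ↦ (hB j hj x hx).trans ?_⟩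
      exact Finset.single_le_sum (fun j _ ↦ hB0 j) (Finset.mem_range.2 (Nat.lt_succ_of_le hj))
    · exact ⟨0, fun h ↦ absurd h ht⟩
  choose B hB using hB
  -- The seminorm is infinite only on a null set of times. There a bound from compactness is
  -- inserted, which leaves integrability unaffected.
  refine ⟨fun t ↦ if q t = ⊤ then B t else C * (q t).toReal, ?_, ?_⟩
  · have h1 : IntegrableOn (fun t ↦ C * (q t).toReal) (Icc c d) :=
      (integrable_toReal_of_lintegral_ne_top hq hfin).const_mul C
    refine h1.congr ?_
    filter_upwards [ae_lt_top' hq hfin] with t ht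
    rw [if_neg ht.ne]
  · intro t ht x hx j hj
    beta_reduce
    by_cases hqt : q t = ⊤
    · rw [if_pos hqt]
      exact hB t ht x hx j hj
    · rw [if_neg hqt]
      have h1 := hb t ht x hx j hj
      rw [← ofReal_norm, ENNReal.ofReal_le_iff_le_toReal (by finiteness), ENNReal.toReal_mul,
        ENNReal.toReal_ofReal hC.le] at h1
      exact h1

end Bounds

/-! ### Smooth coordinates and Carathéodory bounds for fields of class `C^ν` -/

section SmoothFields

variable {E : Type u} [NormedAddCommGroup E] [NormedSpace ℝ E] [FiniteDimensional ℝ E]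
  {M : Type v} [TopologicalSpace M] [T2Space M] [ChartedSpace E M] [IsManifold 𝓘(ℝ, E) ∞ M]

theorem contDiffOn_comp_chart_symm {F : Type*} [NormedAddCommGroup F] [NormedSpace ℝ F]
    {n : WithTop ℕ∞} [IsManifold 𝓘(ℝ, E) n M] {f : M → F}
    (hf : ContMDiff 𝓘(ℝ, E) 𝓘(ℝ, F) n f) (x₀ : M) :
    ContDiffOn ℝ n (f ∘ (chartAt E x₀).symm) (chartAt E x₀).target := by
  have h := hf.comp_contMDiffOn (contMDiffOn_extChartAt_symm (I := 𝓘(ℝ, E)) (n := n) x₀)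
  rw [contMDiffOn_iff_contDiffOn, extChartAt_target] at h
  simpa using h

/-- A bump function times the chart is a global smooth map that equals the chart near `x₀`, so `G`
can be the identity. -/
theorem hasCoordinates_smoothFunctions : HasCoordinates (E := E) (smoothFunctions E M) where
  contDiffOn f hf x₀ := (contDiffOn_comp_chart_symm (n := ∞) hf x₀).of_le (by simp)
  coords x₀ := by
    obtain ⟨χ, -, -⟩ := (SmoothBumpFunction.nhds_basis_tsupport (I := 𝓘(ℝ, E)) x₀).mem_iff.1
      univ_mem
    have hz : ContMDiff 𝓘(ℝ, E) 𝓘(ℝ, E) ∞ (fun x ↦ χ x • chartAt E x₀ x) := by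
      refine χ.contMDiff_smul ?_
      have := contMDiffOn_extChartAt (I := 𝓘(ℝ, E)) (n := ∞) (x := x₀)
      simpa using this
    refine ⟨fun x ↦ χ x • chartAt E x₀ x, fun l ↦ l.contMDiff.comp hz,
      (contDiffOn_comp_chart_symm (n := ∞) hz x₀).of_le (by simp), id, contDiffAt_id, ?_⟩
    filter_upwards [χ.eventuallyEq_one] with x hx
    simp [hx]

variable {gM gV : ContMDiffRiemannianMetric 𝓘(ℝ, E) ∞ E (fun x : M ↦ TangentSpace 𝓘(ℝ, E) x)}
  {covM covV : CovariantDerivative 𝓘(ℝ, E) E (fun x : M ↦ TangentSpace 𝓘(ℝ, E) x)}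
  [CovariantDerivative.ContMDiffCovariantDerivative covM ∞]
  [CovariantDerivative.ContMDiffCovariantDerivative covV ∞]
  {P : Type w} [TopologicalSpace P] {ν : ℕ∞} {T : Set ℝ}
  {X : P → ℝ → Π x : M, TangentSpace 𝓘(ℝ, E) x}

theorem contDiffOn_chartRep {m : ℕ} (hm : (m : ℕ∞) ≤ ν) {ξ : Π x : M, TangentSpace 𝓘(ℝ, E) x}
    (hξ : ξ ∈ fields E M ν) (x₀ : M) :
    ContDiffOn ℝ m (chartRep x₀ ξ) (chartAt E x₀).target := by
  intro y hy
  have hm' : (m : WithTop ℕ∞) ≤ ((ν : ℕ∞) : WithTop ℕ∞) := mod_cast hm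
  have hx := (chartAt E x₀).map_target hy
  have h := (contMDiffAt_section_iff_vrep (n := m) (mod_cast le_top) hx hx ξ).1
    ((hξ _).of_le hm')
  rw [(chartAt E x₀).right_inv hy] at h
  exact h.contDiffWithinAt

/-- On a small ball the coordinate derivatives are bounded by the jet norm, hence by a seminorm on
the compact image of `K` in `M`. Integrability by seminorm and continuity in the mean then become
the hypotheses of `isCaratheodoryC_of_bounds`. -/
theorem isLocallyCaratheodory_of_isL1Loc {m : ℕ} (hm : IsJetOrder ν m)
    (hX : ∀ p, IsL1Loc T (fields E M ν) (fieldSeminorms gM covM gV covV ν) (X p))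
    (hXc : ContinuousInParameter T (fieldSeminorms gM covM gV covV ν) X) :
    IsLocallyCaratheodory T m X := by
  intro x₀ c d hcd
  have hmν : (m : ℕ∞) ≤ ν := by
    rcases hm with h | h
    · rw [h]
      exact le_top
    · exact h.ge
  obtain ⟨C₀, hC₀, hev⟩ := exists_norm_iteratedFDeriv_chartRep_le (gM := gM) (gV := gV)
    (covM := covM) (covV := covV) m x₀
  obtain ⟨C, hC, hCC⟩ : ∃ C : ℝ, 0 < C ∧ C₀ ≤ C := ⟨C₀ + 1, by linarith, by linarith⟩
  have hev' := (eventually_chart (mem_chart_source E x₀) hev).and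
    ((chartAt E x₀).open_target.mem_nhds (mem_chart_target E x₀))
  obtain ⟨R, hR, hball⟩ := Metric.eventually_nhds_iff_ball.1 hev'
  set J : (Π x : M, TangentSpace 𝓘(ℝ, E) x) → M → ℝ :=
    jetNorm gM covM (fun x v ↦ gV.inner x v v) covV m with hJ
  have hJ0 : ∀ ξ x, 0 ≤ J ξ x := fun ξ x ↦ Real.sqrt_nonneg _
  have hbd : ∀ ξ : Π x : M, TangentSpace 𝓘(ℝ, E) x,
      ContDiffOn ℝ m (chartRep x₀ ξ) (chartAt E x₀).target →
      ∀ y ∈ Metric.ball (chartAt E x₀ x₀) R, ∀ j ≤ m,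
      ‖iteratedFDeriv ℝ j (chartRep x₀ ξ) y‖ ≤ C * J ξ ((chartAt E x₀).symm y) := by
    intro ξ hξ y hy j hj
    obtain ⟨h1, h2⟩ := hball y hy
    rw [(chartAt E x₀).right_inv h2] at h1
    exact (h1 ξ (hξ.contDiffAt ((chartAt E x₀).open_target.mem_nhds h2)) j hj).trans
      (mul_le_mul_of_nonneg_right hCC (hJ0 _ _))
  have hsub : Metric.ball (chartAt E x₀ x₀) R ⊆ (chartAt E x₀).target := fun y hy ↦ (hball y hy).2
  have hCD : ∀ p, ∀ t ∈ Icc c d, ContDiffOn ℝ m (chartRep x₀ (X p t)) (chartAt E x₀).target :=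
    fun p t ht ↦ contDiffOn_chartRep hmν ((hX p).mem t (hcd ht)) x₀
  have hKc : ∀ K ⊆ Metric.ball (chartAt E x₀ x₀) R, IsCompact K →
      IsCompact ((chartAt E x₀).symm '' K) := fun K hK hKc ↦
    hKc.image_of_continuousOn ((chartAt E x₀).continuousOn_symm.mono (hK.trans hsub))
  set q : Set E → (Π x : M, TangentSpace 𝓘(ℝ, E) x) → ℝ≥0∞ := fun K ξ ↦
    ⨆ x ∈ (chartAt E x₀).symm '' K, ENNReal.ofReal (J ξ x) with hq
  have hqmem : ∀ K ⊆ Metric.ball (chartAt E x₀ x₀) R, IsCompact K →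
      q K ∈ fieldSeminorms gM covM gV covV ν := fun K hK hKK ↦
    ⟨_, hKc K hK hKK, m, hm, rfl⟩
  have hqle : ∀ K ξ, ∀ y ∈ K, ENNReal.ofReal (J ξ ((chartAt E x₀).symm y)) ≤ q K ξ :=
    fun K ξ y hy ↦ le_iSup₂ (f := fun x (_ : x ∈ (chartAt E x₀).symm '' K) ↦
      ENNReal.ofReal (J ξ x)) _ (mem_image_of_mem _ hy)
  refine ⟨R, hR, hsub, isCaratheodoryC_of_bounds m Metric.isOpen_ball
    (fun p t ht ↦ (hCD p t ht).mono hsub) (fun p y hy ↦ ?_) (fun p K hK hKK ↦ ?_)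
    (fun p₀ K hK hKK ε hε ↦ ?_)⟩
  · exact (tcoord x₀ ((chartAt E x₀).symm y)).continuous.comp_aestronglyMeasurable
      (((hX p).measurable _).mono_measure (Measure.restrict_mono hcd le_rfl))
  · obtain ⟨hmeas, hfin⟩ := (hX p).integrable _ (hqmem K hK hKK) (Icc c d) hcd isCompact_Icc
    refine exists_integrable_bound (chartAt E x₀).open_target (hCD p) hKK (hK.trans hsub) hC hmeas
      hfin.ne fun t ht x hx k hk ↦ ?_
    rw [← ofReal_norm]
    refine (ENNReal.ofReal_le_ofReal (hbd _ (hCD p t ht) x (hK hx) k hk)).trans ?_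
    rw [ENNReal.ofReal_mul hC.le]
    exact mul_le_mul_right (hqle K _ x hx) _
  · have hε' : 0 < ε / ENNReal.ofReal C := ENNReal.div_pos hε.ne' ENNReal.ofReal_ne_top
    filter_upwards [hXc p₀ _ (hqmem K hK hKK) (Icc c d) hcd isCompact_Icc _ hε'] with p hp
    refine ⟨fun t ↦ ENNReal.ofReal C * q K (X p t - X p₀ t), ?_, fun t ht x hx j hj ↦ ?_⟩
    · rw [lintegral_const_mul' _ _ ENNReal.ofReal_ne_top]
      exact ENNReal.mul_lt_of_lt_div' hp
    · have hsubt : chartRep x₀ (X p t - X p₀ t)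
          = fun y ↦ chartRep x₀ (X p t) y - chartRep x₀ (X p₀ t) y := by
        ext y
        simp [chartRep]
      have h1 := hbd (X p t - X p₀ t) (by
        rw [hsubt]
        exact (hCD p t ht).sub (hCD p₀ t ht)) x (hK hx) j hj
      rw [hsubt] at h1
      rw [← ofReal_norm]
      refine (ENNReal.ofReal_le_ofReal h1).trans ?_
      rw [ENNReal.ofReal_mul hC.le]
      exact mul_le_mul_right (hqle K _ x hx) _

end SmoothFields

/-! ### Continuity of the flow in the `C^ν`-topology -/

section SmoothFlow

variable {E : Type u} [NormedAddCommGroup E] [NormedSpace ℝ E] [FiniteDimensional ℝ E]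
  {M : Type v} [TopologicalSpace M] [T2Space M] [ChartedSpace E M] [IsManifold 𝓘(ℝ, E) ∞ M]
  {gM : ContMDiffRiemannianMetric 𝓘(ℝ, E) ∞ E (fun x : M ↦ TangentSpace 𝓘(ℝ, E) x)}
  {covM : CovariantDerivative 𝓘(ℝ, E) E (fun x : M ↦ TangentSpace 𝓘(ℝ, E) x)}
  [CovariantDerivative.ContMDiffCovariantDerivative covM ∞]
  {P : Type w} [TopologicalSpace P]

theorem contDiffAt_extend_comp_chart_symm {m : ℕ} {U : TopologicalSpace.Opens M} {g : U → ℝ}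
    (hg : ContMDiff 𝓘(ℝ, E) 𝓘(ℝ, ℝ) m g) {x₀ x : M} (hxU : x ∈ U)
    (hx : x ∈ (chartAt E x₀).source) :
    ContDiffAt ℝ m (Function.extend Subtype.val g 0 ∘ (chartAt E x₀).symm) (chartAt E x₀ x) := by
  have : IsManifold 𝓘(ℝ, E) m M := IsManifold.of_le (n := ∞) (mod_cast le_top)
  have h : ContMDiffAt 𝓘(ℝ, E) 𝓘(ℝ, ℝ) m (Function.extend Subtype.val g 0) x := by
    refine (contMDiffAt_subtype_iff (x := (⟨x, hxU⟩ : U))).1 ?_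
    simpa only [Subtype.val_injective.extend_apply] using hg ⟨x, hxU⟩
  rw [contMDiffAt_iff_source_of_mem_source hx, modelWithCornersSelf_coe, range_id,
    contMDiffWithinAt_univ, contMDiffAt_iff_contDiffAt] at h
  exact h

/-- Pullbacks along a regular family of maps depend continuously on the parameter. -/
theorem RegAt.eventually_funJetNorm_le {m : ℕ} {p₁ : P} {x₀ : M} {Φ : P → M → M}
    (h : RegAt E m p₁ x₀ Φ) {f : M → ℝ} (hf : ContMDiff 𝓘(ℝ, E) 𝓘(ℝ, ℝ) ∞ f)
    {U : TopologicalSpace.Opens M} (hx₀ : x₀ ∈ U) {δ : ℝ} (hδ : 0 < δ) :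
    ∀ᶠ z in 𝓝 (p₁, x₀), funJetNorm gM covM m
      (Function.extend Subtype.val (fun y : U ↦ f (Φ z.1 y) - f (Φ p₁ y)) 0) z.2 ≤ δ := by
  obtain ⟨O, W, hO, hpO, hW, hxW, hWt, -, hJ⟩ := h.exists_isJointC isOpen_univ hf.contMDiffOn
    (mem_univ _) (mem_chart_source E x₀)
  obtain ⟨C, hC, hCb⟩ := exists_funJetNorm_le (gM := gM) (covM := covM) m x₀
  have hmp : (0 : ℝ) < C * (m + 1) + 1 := by positivity
  -- There are `m + 1` derivatives, each within `ε`, and the jet norm costs a factor `C`. The added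
  -- `1` keeps the denominator positive.
  set ε := δ / (C * (m + 1) + 1) with hε
  have hε0 : 0 < ε := div_pos hδ hmp
  have hc : ContinuousAt (fun z : P × M ↦ (z.1, chartAt E x₀ z.2)) (p₁, x₀) :=
    continuousAt_fst.prodMk (((chartAt E x₀).continuousAt (mem_chart_source E x₀)).comp
      continuousAt_snd)
  have hdiff : ∀ᶠ z : P × M in 𝓝 (p₁, x₀), ∀ j ∈ Finset.range (m + 1),
      ‖iteratedFDeriv ℝ j (fun y ↦ f (Φ z.1 ((chartAt E x₀).symm y))) (chartAt E x₀ z.2)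
        - iteratedFDeriv ℝ j (fun y ↦ f (Φ p₁ ((chartAt E x₀).symm y))) (chartAt E x₀ z.2)‖ < ε := by
    rw [eventually_all_finset]
    intro j hj
    exact hc.eventually ((hJ.of_le (Nat.lt_succ_iff.1 (Finset.mem_range.1 hj))
      ).eventually_norm_iteratedFDeriv_sub_lt hO hW hpO hxW hε0)
  have hOW : ∀ᶠ z : P × M in 𝓝 (p₁, x₀), z.1 ∈ O ∧ chartAt E x₀ z.2 ∈ W :=
    hc.eventually ((hO.prod hW).mem_nhds ⟨hpO, hxW⟩)
  have hsnd : Tendsto (fun z : P × M ↦ z.2) (𝓝 (p₁, x₀)) (𝓝 x₀) := continuousAt_snd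
  filter_upwards [hdiff, hOW, hsnd.eventually hCb, hsnd.eventually (U.isOpen.mem_nhds hx₀),
    hsnd.eventually ((chartAt E x₀).open_source.mem_nhds (mem_chart_source E x₀))]
    with z hz hzW hzC hzU hzs
  set y := chartAt E x₀ z.2
  have hcd : ∀ p ∈ O, ContDiffAt ℝ m (fun y ↦ f (Φ p ((chartAt E x₀).symm y))) y := fun p hp ↦
    (IsJointC.contDiffOn m hW hJ p hp).contDiffAt (hW.mem_nhds hzW.2)
  have heq : Function.extend Subtype.val (fun y : U ↦ f (Φ z.1 y) - f (Φ p₁ y)) 0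
      ∘ (chartAt E x₀).symm =ᶠ[𝓝 y] (fun y ↦ f (Φ z.1 ((chartAt E x₀).symm y)))
        - fun y ↦ f (Φ p₁ ((chartAt E x₀).symm y)) := by
    filter_upwards [eventually_chart hzs (U.isOpen.mem_nhds hzU)] with y' hy'
    exact Subtype.val_injective.extend_apply (fun y : U ↦ f (Φ z.1 y) - f (Φ p₁ y)) 0 ⟨_, hy'⟩
  have hcd' := (hcd z.1 hzW.1).sub (hcd p₁ hpO)
  refine (hzC _ (hcd'.congr_of_eventuallyEq heq)).trans ?_
  have hsum : ∑ j ∈ Finset.range (m + 1), ‖iteratedFDeriv ℝ j (Function.extend Subtype.val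
      (fun y : U ↦ f (Φ z.1 y) - f (Φ p₁ y)) 0 ∘ (chartAt E x₀).symm) y‖ ≤ (m + 1) * ε := by
    refine (Finset.sum_le_card_nsmul _ _ ε fun j hj ↦ ?_).trans (le_of_eq (by simp))
    have hjm : (j : WithTop ℕ∞) ≤ m := mod_cast Nat.lt_succ_iff.1 (Finset.mem_range.1 hj)
    rw [(Filter.EventuallyEq.iteratedFDeriv ℝ heq j).eq_of_nhds,
      iteratedFDeriv_sub_apply ((hcd z.1 hzW.1).of_le hjm) ((hcd p₁ hpO).of_le hjm)]
    exact (hz j hj).le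
  refine (mul_le_mul_of_nonneg_left hsum hC).trans ?_
  rw [hε, ← mul_assoc, mul_div_assoc', div_le_iff₀ hmp]
  nlinarith

theorem exists_smooth_flow_continuous
    (gM gV : ContMDiffRiemannianMetric 𝓘(ℝ, E) ∞ E (fun x : M ↦ TangentSpace 𝓘(ℝ, E) x))
    (covM covV : CovariantDerivative 𝓘(ℝ, E) E (fun x : M ↦ TangentSpace 𝓘(ℝ, E) x))
    [CovariantDerivative.ContMDiffCovariantDerivative covM ∞]
    [CovariantDerivative.ContMDiffCovariantDerivative covV ∞]
    {ν : ℕ∞} (hν : 1 ≤ ν) {T : Set ℝ} (hT : T.OrdConnected)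
    {X : P → ℝ → Π x : M, TangentSpace 𝓘(ℝ, E) x}
    (hX : ∀ p, IsL1Loc T (fields E M ν) (fieldSeminorms gM covM gV covV ν) (X p))
    (hXc : ContinuousInParameter T (fieldSeminorms gM covM gV covV ν) X)
    {t₀ t₁ : ℝ} (ht₀ : t₀ ∈ T) (ht₁ : t₁ ∈ T) {p₀ : P}
    {U : TopologicalSpace.Opens M} (hU : IsCompact (closure (U : Set M)))
    (hUD : closure (U : Set M) ⊆ flowDomain (smoothFunctions E M) T (X p₀) t₁ t₀) :
    ∃ O ∈ 𝓝 p₀, ∃ Ψ : O → CMap E ν U,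
      Continuous[instTopologicalSpaceSubtype, mapTopology gM covM ν U] Ψ ∧
      ∀ (p : O) (x : U), (x : M) ∈ flowDomain (smoothFunctions E M) T (X p) t₁ t₀ ∧
        (∀ ξ, IsIntegralCurveFrom (smoothFunctions E M) T (X p) t₁ t₀ x ξ →
          ξ t₁ = flow (smoothFunctions E M) T (X p) t₁ t₀ x) ∧
        (Ψ p).1 x = flow (smoothFunctions E M) T (X p) t₁ t₀ x := by
  set A := smoothFunctions E M with hA
  have hcoord : HasCoordinates (E := E) A := hasCoordinates_smoothFunctions
  have hflows : ∀ m, IsJetOrder ν m → 1 ≤ m → HasLocalFlows A T X (RegAt E m) := fun m hm h1 ↦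
    (isLocallyCaratheodory_of_isL1Loc hm hX hXc).hasLocalFlows hcoord h1
      fun x₀ c d a b ha hb _ Ω hΩ hΩt hC O W hO hW ξ hξ p hp x hx hxW ↦
        IsSolFamily.regAt x₀ ha hb hΩ hΩt hC hO hW hξ hp hx hxW
  -- For `ν = ∞` the order `0` also occurs among the seminorms, but flows need a derivative of the
  -- field; such a seminorm is treated through order `1`.
  have hge : ∀ m, IsJetOrder ν m → ∃ m', m ≤ m' ∧ 1 ≤ m' ∧ IsJetOrder ν m' := by
    rintro m (h | h)
    · exact ⟨max m 1, le_max_left _ _, le_max_right _ _, Or.inl h⟩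
    · exact ⟨m, le_rfl, by
        rw [h] at hν
        exact_mod_cast hν, Or.inr h⟩
  obtain ⟨m₁, hm₁, hm₁J⟩ : ∃ m₁, 1 ≤ m₁ ∧ IsJetOrder ν m₁ := by
    by_cases h : ν = ⊤
    · exact ⟨1, le_rfl, Or.inl h⟩
    · obtain ⟨n, rfl⟩ := ENat.ne_top_iff_exists.1 h
      exact ⟨n, by exact_mod_cast hν, Or.inr rfl⟩
  have huniq : LocallyUnique A T X := IsLocallyCaratheodory.locallyUnique hcoord
    fun x₀ c d hcd ↦ by
      obtain ⟨R, hR, hRt, hC⟩ := isLocallyCaratheodory_of_isL1Loc hm₁J hX hXc x₀ c d hcd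
      exact ⟨R, hR, hRt, hC.of_le hm₁⟩
  have hreg : ∀ m, IsJetOrder ν m → 1 ≤ m → ∀ p, ∀ x ∈ flowDomain A T (X p) t₁ t₀,
      RegAt E m p x (fun p ↦ flow A T (X p) t₁ t₀) := fun m hm h1 p x hx ↦
    (flow_regular hT huniq (isRegularity_regAt m) (hflows m hm h1) ht₀ ht₁ hx).1
  -- Every `p` in this set satisfies the hypothesis imposed on `p₀`, so the regularity of the flow
  -- may be used at each of them.
  set O : Set P := {p | closure (U : Set M) ⊆ flowDomain A T (X p) t₁ t₀} with hO
  have hOn : O ∈ 𝓝 p₀ := eventually_subset_flowDomain hT huniq (isRegularity_regAt m₁)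
    (hflows m₁ hm₁J hm₁) ht₀ ht₁ hU hUD
  have hdom : ∀ (p : O) (x : U), (x : M) ∈ flowDomain A T (X p) t₁ t₀ := fun p x ↦
    p.2 (subset_closure x.2)
  have hsmooth : ∀ p : O, ContMDiff 𝓘(ℝ, E) 𝓘(ℝ, E) ν
      (fun x : U ↦ flow A T (X p) t₁ t₀ (x : M)) := by
    intro p
    have h1 : ∀ m, IsJetOrder ν m → 1 ≤ m → ContMDiff 𝓘(ℝ, E) 𝓘(ℝ, E) m
        (fun x : U ↦ flow A T (X p) t₁ t₀ (x : M)) := fun m hm hm1 x ↦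
      contMDiffAt_subtype_iff.2 (hreg m hm hm1 p x (hdom p x)).contMDiffAt
    by_cases h : ν = ⊤
    · subst h
      refine contMDiff_infty.2 fun n ↦ ?_
      exact (h1 (max n 1) (Or.inl rfl) (le_max_right _ _)).of_le (mod_cast le_max_left n 1)
    · obtain ⟨n, rfl⟩ := ENat.ne_top_iff_exists.1 h
      exact h1 n (Or.inr rfl) (by exact_mod_cast hν)
  refine ⟨O, hOn, fun p ↦ ⟨fun x ↦ flow A T (X p) t₁ t₀ (x : M), hsmooth p⟩, ?_,
    fun p x ↦ ⟨hdom p x, fun ξ hξ ↦ huniq.eq_flow hξ, rfl⟩⟩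
  refine continuous_iInf_rng.2 fun f ↦ continuous_induced_rng.2 (continuous_generateFrom_iff.2 ?_)
  rintro B ⟨d, ⟨K, hK, hKU, m, hm, rfl⟩, a, ε, hε, rfl⟩
  rw [isOpen_iff_mem_nhds]
  intro p₁ hp₁
  have hmν : (m : WithTop ℕ∞) ≤ ((ν : ℕ∞) : WithTop ℕ∞) := by
    rcases hm with h | h
    · rw [h]
      exact mod_cast le_top
    · rw [h]
      exact le_rfl
  obtain ⟨m', hmm', hm'1, hm'⟩ := hge m hm
  -- A subbasic ball may be centred at a function `a` that is not on the family. The slack `δ` at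
  -- `p₁` leaves room for the triangle inequality.
  obtain ⟨δ, hδ, hδε⟩ := ENNReal.lt_iff_exists_add_pos_lt.1
    (show (⨆ x ∈ K, ENNReal.ofReal (funJetNorm gM covM m (Function.extend Subtype.val
      ((fun x : U ↦ f.1 (flow A T (X p₁) t₁ t₀ (x : M))) - a.1) 0) x)) < ε from hp₁)
  have hev : ∀ᶠ p in 𝓝 (p₁ : P), ∀ x ∈ K, funJetNorm gM covM m (Function.extend Subtype.val
      (fun y : U ↦ f.1 (flow A T (X p) t₁ t₀ y) - f.1 (flow A T (X p₁) t₁ t₀ y)) 0) x ≤ δ := by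
    refine hK.eventually_forall_of_forall_eventually fun x hx ↦ ?_
    exact ((hreg m' hm' hm'1 p₁ x (hdom p₁ ⟨x, hKU hx⟩)).of_le hmm').eventually_funJetNorm_le f.2
      (hKU hx) hδ
  filter_upwards [continuous_subtype_val.continuousAt.eventually hev] with p hp
  refine lt_of_le_of_lt (iSup₂_le fun x hx ↦ ?_) hδε
  have hcf : ∀ p : O, ContMDiff 𝓘(ℝ, E) 𝓘(ℝ, ℝ) m
      (fun x : U ↦ f.1 (flow A T (X p) t₁ t₀ (x : M))) := fun p ↦
    (ContMDiff.comp (f.2.of_le (mod_cast le_top)) (hsmooth p)).of_le hmν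
  have hadd : Function.extend Subtype.val
      ((fun x : U ↦ f.1 (flow A T (X p) t₁ t₀ (x : M))) - a.1) (0 : M → ℝ)
      = Function.extend Subtype.val (fun y : U ↦ f.1 (flow A T (X p) t₁ t₀ y)
          - f.1 (flow A T (X p₁) t₁ t₀ y)) 0
        + Function.extend Subtype.val
          ((fun x : U ↦ f.1 (flow A T (X p₁) t₁ t₀ (x : M))) - a.1) 0 := by
    ext x
    by_cases hx : x ∈ U
    · have he : ∀ g : U → ℝ, Function.extend Subtype.val g (0 : M → ℝ) x = g ⟨x, hx⟩ := fun g ↦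
        Subtype.val_injective.extend_apply g 0 ⟨x, hx⟩
      simp [he]
    · have he : ∀ g : U → ℝ, Function.extend Subtype.val g (0 : M → ℝ) x = 0 := fun g ↦
        Function.extend_apply' _ _ _ (by
          rintro ⟨y, rfl⟩
          exact hx y.2)
      simp [he]
  have htri := funJetNorm_add_le (gM := gM) (covM := covM) (m := m) (x := x)
    (contDiffAt_extend_comp_chart_symm (E := E) ((hcf p).sub (hcf p₁)) (hKU hx)
      (mem_chart_source E x))
    (contDiffAt_extend_comp_chart_symm (E := E) ((hcf p₁).sub (a.2.of_le hmν)) (hKU hx)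
      (mem_chart_source E x))
  change ENNReal.ofReal (funJetNorm gM covM m (Function.extend Subtype.val
      ((fun x : U ↦ f.1 (flow A T (X p) t₁ t₀ (x : M))) - a.1) (0 : M → ℝ)) x) ≤ _
  rw [hadd]
  refine (ENNReal.ofReal_le_ofReal (htri.trans (add_le_add_left (hp x hx) _))).trans ?_
  refine (ENNReal.ofReal_add_le).trans ?_
  rw [add_comm, ENNReal.ofReal_coe_nnreal]
  refine add_le_add_left ?_ _
  exact le_iSup₂ (f := fun x (_ : x ∈ K) ↦ ENNReal.ofReal (funJetNorm gM covM m
    (Function.extend Subtype.val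
      ((fun x : U ↦ f.1 (flow A T (X p₁) t₁ t₀ (x : M))) - a.1) (0 : M → ℝ)) x)) x hx

end SmoothFlow

/-! ### Holomorphic maps of several variables -/

section Cauchy

variable {E : Type*} [NormedAddCommGroup E] [NormedSpace ℂ E]
  {F : Type*} [NormedAddCommGroup F] [NormedSpace ℂ F]

/-- Schwarz's lemma: `f` maps the ball into the closed ball of radius `2 * B` about `f c`. -/
theorem norm_fderiv_le_of_norm_le {f : E → F} {c : E} {R B : ℝ} (hR : 0 < R)
    (hf : DifferentiableOn ℂ f (Metric.ball c R)) (hB : ∀ z ∈ Metric.ball c R, ‖f z‖ ≤ B) :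
    ‖fderiv ℂ f c‖ ≤ 2 * B / R := by
  refine Complex.norm_fderiv_le_div_of_mapsTo_ball hf (fun z hz ↦ ?_) hR
  rw [Metric.mem_closedBall, dist_eq_norm]
  exact (norm_sub_le _ _).trans
    (by linarith [hB z hz, hB c (Metric.mem_ball_self hR)])

/-- The difference of the derivatives at `y` and `x` is the derivative at `x` of `z ↦ f (z + (y -
x)) - f z`. This function is uniformly small for `y` near `x`, so Cauchy's estimate bounds its
derivative. -/
theorem continuousOn_fderiv_of_differentiableOn [FiniteDimensional ℂ E] {f : E → F} {Ω : Set E}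
    (hΩ : IsOpen Ω) (hf : DifferentiableOn ℂ f Ω) : ContinuousOn (fderiv ℂ f) Ω := by
  have : ProperSpace E := FiniteDimensional.proper ℂ E
  intro x hx
  refine ContinuousAt.continuousWithinAt ?_
  obtain ⟨s, hs, hsub⟩ := Metric.nhds_basis_closedBall.mem_iff.1 (hΩ.mem_nhds hx)
  set r := s / 2 with hr
  have hr0 : 0 < r := by positivity
  have huc := (isCompact_closedBall x s).uniformContinuousOn_of_continuous
    (hf.continuousOn.mono hsub)
  rw [Metric.uniformContinuousOn_iff] at huc
  rw [Metric.continuousAt_iff]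
  intro ε hε
  -- Cauchy's estimate on the ball of radius `r` turns `ε * r / 4` into `ε / 2`.
  obtain ⟨δ, hδ, huc⟩ := huc (ε * r / 4) (by positivity)
  refine ⟨min δ r, lt_min hδ hr0, fun {y} hy ↦ ?_⟩
  have hyδ : ‖y - x‖ < δ := by
    rw [← dist_eq_norm]
    exact hy.trans_le (min_le_left _ _)
  have hyr : ‖y - x‖ < r := by
    rw [← dist_eq_norm]
    exact hy.trans_le (min_le_right _ _)
  have hm1 : ∀ z ∈ Metric.ball x r, z ∈ Metric.closedBall x s := fun z hz ↦
    Metric.mem_closedBall.2 ((Metric.mem_ball.1 hz).le.trans (by rw [hr]; linarith))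
  have hm2 : ∀ z ∈ Metric.ball x r, z + (y - x) ∈ Metric.closedBall x s := fun z hz ↦ by
    rw [Metric.mem_closedBall, dist_eq_norm]
    rw [Metric.mem_ball, dist_eq_norm] at hz
    calc ‖z + (y - x) - x‖ = ‖(z - x) + (y - x)‖ := by congr 1; abel
      _ ≤ ‖z - x‖ + ‖y - x‖ := norm_add_le _ _
      _ ≤ s := by linarith
  have hd1 : ∀ z ∈ Metric.ball x r, DifferentiableAt ℂ f z := fun z hz ↦
    hf.differentiableAt (hΩ.mem_nhds (hsub (hm1 z hz)))
  have hd2 : ∀ z ∈ Metric.ball x r, DifferentiableAt ℂ (fun z ↦ f (z + (y - x))) z := fun z hz ↦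
    DifferentiableAt.comp (g := f) (f := fun z ↦ z + (y - x)) z
      (hf.differentiableAt (hΩ.mem_nhds (hsub (hm2 z hz)))) (by fun_prop)
  have h := norm_fderiv_le_of_norm_le (f := fun z ↦ f (z + (y - x)) - f z) (B := ε * r / 4) hr0
    (fun z hz ↦ ((hd2 z hz).sub (hd1 z hz)).differentiableWithinAt) fun z hz ↦ by
      rw [← dist_eq_norm]
      refine (huc _ (hm2 z hz) _ (hm1 z hz) ?_).le
      rw [dist_eq_norm]
      simpa using hyδ
  have hxm := Metric.mem_ball_self (x := x) hr0
  rw [fderiv_fun_sub (hd2 x hxm) (hd1 x hxm), fderiv_comp_add_right, add_sub_cancel] at h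
  rw [dist_eq_norm]
  refine h.trans_lt ?_
  rw [div_lt_iff₀ hr0]
  nlinarith [mul_pos hε hr0]

theorem contDiffOn_one_of_differentiableOn [FiniteDimensional ℂ E] {f : E → F} {Ω : Set E}
    (hΩ : IsOpen Ω) (hf : DifferentiableOn ℂ f Ω) : ContDiffOn ℂ 1 f Ω := by
  rw [show (1 : WithTop ℕ∞) = 0 + 1 by simp, contDiffOn_succ_iff_fderiv_of_isOpen hΩ]
  exact ⟨hf, by simp, contDiffOn_zero.2 (continuousOn_fderiv_of_differentiableOn hΩ hf)⟩

end Cauchy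

/-! ### The flow on a Stein manifold -/

section HolFields

variable {E : Type u} [NormedAddCommGroup E] [NormedSpace ℂ E] [FiniteDimensional ℂ E]
  {M : Type v} [TopologicalSpace M] [ChartedSpace E M] [IsManifold 𝓘(ℂ, E) ω M]

theorem differentiableOn_comp_chart_symm {F : Type*} [NormedAddCommGroup F] [NormedSpace ℂ F]
    {f : M → F} (hf : MDifferentiable 𝓘(ℂ, E) 𝓘(ℂ, F) f) (x₀ : M) :
    DifferentiableOn ℂ (f ∘ (chartAt E x₀).symm) (chartAt E x₀).target := by
  intro y hy
  have h := hf ((chartAt E x₀).symm y)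
  rw [mdifferentiableAt_iff_source_of_mem_source ((chartAt E x₀).map_target hy),
    modelWithCornersSelf_coe, range_id, mdifferentiableWithinAt_univ,
    mdifferentiableAt_iff_differentiableAt] at h
  have h2 : extChartAt 𝓘(ℂ, E) x₀ ((chartAt E x₀).symm y) = y := (chartAt E x₀).right_inv hy
  rw [h2] at h
  exact h.differentiableWithinAt

/-- The global holomorphic map given by the Stein property has invertible derivative at `x₀`. The
inverse function theorem supplies `G` as a local inverse composed with the chart. -/
theorem hasCoordinates_holFunctions (hS : IsStein E M) :
    HasCoordinates (E := E) (holFunctions E M) where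
  contDiffOn f hf x₀ := contDiffOn_one_of_differentiableOn (chartAt E x₀).open_target
    (differentiableOn_comp_chart_symm hf x₀)
  coords x₀ := by
    have : CompleteSpace E := FiniteDimensional.complete ℂ E
    obtain ⟨z, hz, hbij⟩ := hS.coordinates x₀
    have hzc := contDiffOn_one_of_differentiableOn (chartAt E x₀).open_target
      (differentiableOn_comp_chart_symm hz x₀)
    refine ⟨z, fun l ↦ ?_, hzc, ?_⟩
    · exact MDifferentiable.comp (I' := 𝓘(ℂ, E)) l.mdifferentiable hz
    have hx₀ := mem_chart_source E x₀
    have hzat : ContDiffAt ℂ 1 (z ∘ (chartAt E x₀).symm) (chartAt E x₀ x₀) :=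
      hzc.contDiffAt ((chartAt E x₀).open_target.mem_nhds (mem_chart_target E x₀))
    have hzd := hzat.differentiableAt one_ne_zero
    set D := fderiv ℂ (z ∘ (chartAt E x₀).symm) (chartAt E x₀ x₀) with hD
    have hDb : Function.Bijective D := by
      have h1 : ∀ w : E, D w = mvfderiv 𝓘(ℂ, E) z x₀
          ((trivializationAt E (TangentSpace 𝓘(ℂ, E)) x₀).symmL ℂ x₀ w) := fun w ↦ by
        rw [mvfderiv_eq_fderiv_chart hx₀ hzd]
        exact congrArg D ((trivializationAt E (TangentSpace 𝓘(ℂ, E)) x₀).continuousLinearMapAt_symmL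
          (R := ℂ) hx₀ w).symm
      have h2 : Function.Bijective ((trivializationAt E (TangentSpace 𝓘(ℂ, E)) x₀).symmL ℂ x₀) := by
        refine Function.bijective_iff_has_inverse.2
          ⟨(trivializationAt E (TangentSpace 𝓘(ℂ, E)) x₀).continuousLinearMapAt ℂ x₀,
          fun w ↦ (trivializationAt E (TangentSpace 𝓘(ℂ, E)) x₀).continuousLinearMapAt_symmL
            (R := ℂ) hx₀ w, fun w ↦
          (trivializationAt E (TangentSpace 𝓘(ℂ, E)) x₀).symmL_continuousLinearMapAt
            (R := ℂ) hx₀ w⟩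
      have h3 : (D : E → E) = (mvfderiv 𝓘(ℂ, E) z x₀) ∘
          ((trivializationAt E (TangentSpace 𝓘(ℂ, E)) x₀).symmL ℂ x₀) := funext h1
      rw [h3]
      exact hbij.comp h2
    set De : E ≃L[ℂ] E := (LinearEquiv.ofBijective (D : E →ₗ[ℂ] E) hDb).toContinuousLinearEquiv
    have hDe : (De : E →L[ℂ] E) = D := by
      ext w
      rfl
    have hfd : HasFDerivAt (z ∘ (chartAt E x₀).symm) (De : E →L[ℂ] E) (chartAt E x₀ x₀) := by
      rw [hDe]
      exact hzd.hasFDerivAt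
    refine ⟨hzat.localInverse hfd one_ne_zero, ?_, ?_⟩
    · have h := hzat.to_localInverse hfd one_ne_zero
      rwa [Function.comp_apply, (chartAt E x₀).left_inv hx₀] at h
    · have h := (hzat.hasStrictFDerivAt' hfd one_ne_zero).eventually_left_inverse
      filter_upwards [((chartAt E x₀).continuousAt hx₀).eventually h,
        (chartAt E x₀).open_source.mem_nhds hx₀] with x hx hxs
      rw [Function.comp_apply, (chartAt E x₀).left_inv hxs] at hx
      exact hx

theorem differentiableOn_chartRep {ξ : Π x : M, TangentSpace 𝓘(ℂ, E) x} (hξ : ξ ∈ holFields E M)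
    (x₀ : M) : DifferentiableOn ℂ (chartRep x₀ ξ) (chartAt E x₀).target := by
  have : ContMDiffVectorBundle 1 E (TangentSpace 𝓘(ℂ, E) : M → Type _) 𝓘(ℂ, E) :=
    ContMDiffVectorBundle.of_le (n := ω) le_top
  intro y hy
  have hx := (chartAt E x₀).map_target hy
  have h := ((trivializationAt E (TangentSpace 𝓘(ℂ, E)) x₀).mdifferentiableAt_section_iff
    𝓘(ℂ, E) ξ hx).1 (hξ _)
  rw [mdifferentiableAt_iff_source_of_mem_source hx,
    modelWithCornersSelf_coe, range_id, mdifferentiableWithinAt_univ,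
    mdifferentiableAt_iff_differentiableAt] at h
  have h2 : extChartAt 𝓘(ℂ, E) x₀ ((chartAt E x₀).symm y) = y := (chartAt E x₀).right_inv hy
  rw [h2] at h
  refine (h.congr_of_eventuallyEq ?_).differentiableWithinAt
  filter_upwards [(chartAt E x₀).open_target.mem_nhds hy] with y' hy'
  exact congrFun ((trivializationAt E (TangentSpace 𝓘(ℂ, E)) x₀).coe_linearMapAt_of_mem
    ((chartAt E x₀).map_target hy')) _

/-- Hermitian metrics are locally bounded below in coordinates. -/
theorem HermitianMetric.exists_norm_tcoord_le (g : HermitianMetric E M) (x₀ : M) :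
    ∃ C : ℝ, 0 < C ∧ ∀ᶠ x in 𝓝 x₀, ∀ v : TangentSpace 𝓘(ℂ, E) x,
      ‖tcoord x₀ x v‖ ≤ C * √(g.inner x v v).re := by
  have : ProperSpace E := FiniteDimensional.proper ℂ E
  set e := trivializationAt E (TangentSpace 𝓘(ℂ, E)) x₀ with he
  have hx₀ : x₀ ∈ e.baseSet := mem_chart_source E x₀
  set Q : M × E → ℝ := fun z ↦ (g.inner z.1 (e.symmL ℂ z.1 z.2) (e.symmL ℂ z.1 z.2)).re with hQ
  have hQc : ContinuousOn Q (e.baseSet ×ˢ univ) := by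
    have h1 : ContinuousOn e.toOpenPartialHomeomorph.symm e.target :=
      e.toOpenPartialHomeomorph.continuousOn_symm
    rw [e.target_eq] at h1
    have h2 : ContinuousOn
        (fun z : M × E ↦ (⟨z.1, e.symmL ℂ z.1 z.2⟩ : TangentBundle 𝓘(ℂ, E) M))
        (e.baseSet ×ˢ univ) := h1.congr fun z hz ↦ by
          rw [e.symmL_apply (R := ℂ) hz.1]
          exact e.mk_symm hz.1 z.2
    exact (Complex.continuous_re.comp g.continuous).comp_continuousOn h2
  have hQpos : ∀ w ∈ Metric.sphere (0 : E) 1, 0 < Q (x₀, w) := by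
    intro w hw
    refine g.pos x₀ _ fun h0 ↦ ?_
    have h1 := e.continuousLinearMapAt_symmL (R := ℂ) hx₀ w
    rw [h0, map_zero] at h1
    rw [← h1] at hw
    simp at hw
  -- The metric has a positive minimum `a` on the coordinate unit sphere at `x₀`, and stays above `a
  -- / 2` for nearby points by compactness of the sphere.
  obtain ⟨a, ha, hle⟩ := (isCompact_sphere (0 : E) 1).exists_forall_le'
    (f := fun w ↦ Q (x₀, w)) (hQc.comp (by fun_prop) fun w _ ↦ ⟨hx₀, mem_univ _⟩) hQpos
  have hev : ∀ᶠ x in 𝓝 x₀, ∀ w ∈ Metric.sphere (0 : E) 1, a / 2 < Q (x, w) := by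
    refine (isCompact_sphere (0 : E) 1).eventually_forall_of_forall_eventually fun w hw ↦ ?_
    have hc : ContinuousAt Q (x₀, w) := hQc.continuousAt
      ((e.open_baseSet.prod isOpen_univ).mem_nhds ⟨hx₀, mem_univ _⟩)
    exact hc.eventually_const_lt ((half_lt_self ha).trans_le (hle w hw))
  -- The bound `a / 2` on unit vectors extends to all vectors by homogeneity of the square of the
  -- norm.
  refine ⟨√(2 / a), by positivity, ?_⟩
  filter_upwards [hev, e.open_baseSet.mem_nhds hx₀] with x hx hxe v
  by_cases hv : tcoord x₀ x v = 0
  · rw [hv, norm_zero]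
    positivity
  have hn : 0 < ‖tcoord x₀ x v‖ := norm_pos_iff.2 hv
  set w : E := ((‖tcoord x₀ x v‖⁻¹ : ℝ) : ℂ) • tcoord x₀ x v with hw
  have hw1 : w ∈ Metric.sphere (0 : E) 1 := by
    rw [mem_sphere_zero_iff_norm, hw, norm_smul, Complex.norm_real, norm_inv, norm_norm,
      inv_mul_cancel₀ hn.ne']
  have hsv : e.symmL ℂ x (tcoord x₀ x v) = v := e.symmL_continuousLinearMapAt (R := ℂ) hxe v
  have h1 : Q (x, w) = (‖tcoord x₀ x v‖⁻¹) ^ 2 * (g.inner x v v).re := by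
    simp only [hQ, hw, map_smul, hsv, LinearMap.map_smulₛₗ, LinearMap.smul_apply, smul_eq_mul,
      Complex.conj_ofReal]
    rw [← mul_assoc, ← Complex.ofReal_mul, Complex.re_ofReal_mul, pow_two]
  have h2 := hx w hw1
  rw [h1, inv_pow, ← div_eq_inv_mul, lt_div_iff₀ (by positivity)] at h2
  rw [← Real.sqrt_mul (by positivity)]
  refine Real.le_sqrt_of_sq_le ?_
  rw [div_mul_eq_mul_div, le_div_iff₀ ha]
  linarith

variable {g : HermitianMetric E M} {P : Type w} [TopologicalSpace P] {T : Set ℝ}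
  {X : P → ℝ → Π x : M, TangentSpace 𝓘(ℂ, E) x}

/-- Suprema over a closed ball control first derivatives on the concentric ball of half the radius.
One seminorm, over the image of the larger ball, thus yields class `C^1` in the Carathéodory sense.
-/
theorem isLocallyCaratheodory_of_isL1Loc_hol
    (hX : ∀ p, IsL1Loc T (holFields E M) (holFieldSeminorms g) (X p))
    (hXc : ContinuousInParameter T (holFieldSeminorms g) X) : IsLocallyCaratheodory T 1 X := by
  have : ProperSpace E := FiniteDimensional.proper ℂ E
  intro x₀ c d hcd
  obtain ⟨C₀, hC₀, hev⟩ := g.exists_norm_tcoord_le x₀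
  have hev' : ∀ᶠ y in 𝓝 (chartAt E x₀ x₀), (∀ v : TangentSpace 𝓘(ℂ, E) ((chartAt E x₀).symm y),
      ‖tcoord x₀ ((chartAt E x₀).symm y) v‖ ≤ C₀ * √(g.inner ((chartAt E x₀).symm y) v v).re) ∧
      y ∈ (chartAt E x₀).target := by
    refine Eventually.and ?_ ((chartAt E x₀).open_target.mem_nhds (mem_chart_target E x₀))
    refine ((chartAt E x₀).symm.continuousAt (mem_chart_target E x₀)).eventually
      (p := fun x ↦ ∀ v : TangentSpace 𝓘(ℂ, E) x, ‖tcoord x₀ x v‖ ≤ C₀ * √(g.inner x v v).re) ?_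
    rwa [(chartAt E x₀).left_inv (mem_chart_source E x₀)]
  obtain ⟨s, hs, hball⟩ := Metric.nhds_basis_closedBall.mem_iff.1 hev'
  set R := s / 2 with hR
  have hR0 : 0 < R := by positivity
  set L := Metric.closedBall (chartAt E x₀ x₀) s with hL
  set Ω := Metric.ball (chartAt E x₀ x₀) R with hΩ
  have hLt : L ⊆ (chartAt E x₀).target := fun y hy ↦ (hball hy).2
  have hΩL : Ω ⊆ L := (Metric.ball_subset_ball (by linarith)).trans Metric.ball_subset_closedBall
  have hsub : Ω ⊆ (chartAt E x₀).target := hΩL.trans hLt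
  set q : (Π x : M, TangentSpace 𝓘(ℂ, E) x) → ℝ≥0∞ := fun ξ ↦
    ⨆ x ∈ (chartAt E x₀).symm '' L, ENNReal.ofReal √(g.inner x (ξ x) (ξ x)).re with hq
  have hqmem : q ∈ holFieldSeminorms g :=
    ⟨_, (isCompact_closedBall _ _).image_of_continuousOn
      ((chartAt E x₀).continuousOn_symm.mono hLt), rfl⟩
  -- `C₀` bounds the values, and `2 * C₀ / R` the derivative by Cauchy's estimate on balls of radius
  -- `R`, which remain in `L` when centred in `Ω`.
  set C := C₀ + 2 * C₀ / R with hC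
  have hCpos : 0 < C := by positivity
  have hbd : ∀ ξ : Π x : M, TangentSpace 𝓘(ℂ, E) x,
      DifferentiableOn ℂ (chartRep x₀ ξ) (chartAt E x₀).target → ∀ y ∈ Ω, ∀ j ≤ 1,
      ‖iteratedFDeriv ℝ j (chartRep x₀ ξ) y‖ₑ ≤ ENNReal.ofReal C * q ξ := by
    intro ξ hξ y hy j hj
    by_cases hqt : q ξ = ⊤
    · rw [hqt, ENNReal.mul_top (by simpa using hCpos)]
      exact le_top
    have h0 : ∀ z ∈ L, ‖chartRep x₀ ξ z‖ ≤ C₀ * (q ξ).toReal := fun z hz ↦ by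
      refine ((hball hz).1 _).trans (mul_le_mul_of_nonneg_left ?_ hC₀.le)
      refine (ENNReal.ofReal_le_iff_le_toReal hqt).1 ?_
      exact le_iSup₂ (f := fun x (_ : x ∈ (chartAt E x₀).symm '' L) ↦
        ENNReal.ofReal √(g.inner x (ξ x) (ξ x)).re) _ (mem_image_of_mem _ hz)
    have hqC : ∀ a : ℝ, a ≤ C * (q ξ).toReal → ENNReal.ofReal a ≤ ENNReal.ofReal C * q ξ :=
      fun a ha ↦ by
        refine (ENNReal.ofReal_le_ofReal ha).trans (le_of_eq ?_)
        rw [ENNReal.ofReal_mul hCpos.le, ENNReal.ofReal_toReal hqt]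
    have hq0 : 0 ≤ (q ξ).toReal := ENNReal.toReal_nonneg
    rw [← ofReal_norm]
    refine hqC _ ?_
    have hyb : Metric.ball y R ⊆ L := fun z hz ↦ by
      rw [hL, Metric.mem_closedBall]
      have := dist_triangle z y (chartAt E x₀ x₀)
      have h1 := Metric.mem_ball.1 hz
      have h2 := Metric.mem_ball.1 hy
      linarith
    interval_cases j
    · rw [norm_iteratedFDeriv_zero]
      refine (h0 y (hΩL hy)).trans (mul_le_mul_of_nonneg_right ?_ hq0)
      rw [hC]
      have : 0 < 2 * C₀ / R := by positivity
      linarith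
    · have hd : DifferentiableAt ℂ (chartRep x₀ ξ) y :=
        hξ.differentiableAt ((chartAt E x₀).open_target.mem_nhds (hsub hy))
      rw [norm_iteratedFDeriv_one, hd.fderiv_restrictScalars ℝ,
        ContinuousLinearMap.norm_restrictScalars]
      refine (norm_fderiv_le_of_norm_le hR0 (hξ.mono (hyb.trans hLt))
        fun z hz ↦ h0 z (hyb hz)).trans ?_
      rw [show 2 * (C₀ * (q ξ).toReal) / R = 2 * C₀ / R * (q ξ).toReal by ring]
      refine mul_le_mul_of_nonneg_right ?_ hq0
      rw [hC]
      linarith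
  have hD : ∀ p, ∀ t ∈ Icc c d, DifferentiableOn ℂ (chartRep x₀ (X p t)) (chartAt E x₀).target :=
    fun p t ht ↦ differentiableOn_chartRep ((hX p).mem t (hcd ht)) x₀
  have hCD : ∀ p, ∀ t ∈ Icc c d,
      ContDiffOn ℝ (1 : ℕ) (chartRep x₀ (X p t)) (chartAt E x₀).target := fun p t ht ↦ by
    exact_mod_cast (contDiffOn_one_of_differentiableOn (chartAt E x₀).open_target
      (hD p t ht)).restrict_scalars ℝ
  refine ⟨R, hR0, hsub, isCaratheodoryC_of_bounds 1 Metric.isOpen_ball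
    (fun p t ht ↦ (hCD p t ht).mono hsub) (fun p y hy ↦ ?_) (fun p K hK hKK ↦ ?_)
    (fun p₀ K hK hKK ε hε ↦ ?_)⟩
  · exact (tcoord x₀ ((chartAt E x₀).symm y)).continuous.comp_aestronglyMeasurable
      (((hX p).measurable _).mono_measure (Measure.restrict_mono hcd le_rfl))
  · obtain ⟨hmeas, hfin⟩ := (hX p).integrable _ hqmem (Icc c d) hcd isCompact_Icc
    exact exists_integrable_bound (chartAt E x₀).open_target (hCD p) hKK (hK.trans hsub) hCpos hmeas
      hfin.ne fun t ht x hx k hk ↦ hbd _ (hD p t ht) x (hK hx) k hk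
  · have hε' : 0 < ε / ENNReal.ofReal C := ENNReal.div_pos hε.ne' ENNReal.ofReal_ne_top
    filter_upwards [hXc p₀ _ hqmem (Icc c d) hcd isCompact_Icc _ hε'] with p hp
    refine ⟨fun t ↦ ENNReal.ofReal C * q (X p t - X p₀ t), ?_, fun t ht x hx j hj ↦ ?_⟩
    · rw [lintegral_const_mul' _ _ ENNReal.ofReal_ne_top]
      exact ENNReal.mul_lt_of_lt_div' hp
    · have hsubt : chartRep x₀ (X p t - X p₀ t)
          = fun y ↦ chartRep x₀ (X p t) y - chartRep x₀ (X p₀ t) y := by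
        ext y
        simp [chartRep]
      have h1 := hbd (X p t - X p₀ t) (by
        rw [hsubt]
        exact (hD p t ht).sub (hD p₀ t ht)) x (hK hx) j hj
      rwa [hsubt] at h1

theorem exists_hol_flow_continuous [T2Space M] (hS : IsStein E M) (hT : T.OrdConnected)
    (hX : ∀ p, IsL1Loc T (holFields E M) (holFieldSeminorms g) (X p))
    (hXc : ContinuousInParameter T (holFieldSeminorms g) X)
    {t₀ t₁ : ℝ} (ht₀ : t₀ ∈ T) (ht₁ : t₁ ∈ T) {p₀ : P}
    {U : TopologicalSpace.Opens M} (hU : IsCompact (closure (U : Set M)))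
    (hUD : closure (U : Set M) ⊆ flowDomain (holFunctions E M) T (X p₀) t₁ t₀) :
    ∃ O ∈ 𝓝 p₀, ∃ Ψ : O → HolMap E U,
      Continuous[instTopologicalSpaceSubtype, holMapTopology U] Ψ ∧
      ∀ (p : O) (x : U), (x : M) ∈ flowDomain (holFunctions E M) T (X p) t₁ t₀ ∧
        (∀ ξ, IsIntegralCurveFrom (holFunctions E M) T (X p) t₁ t₀ x ξ →
          ξ t₁ = flow (holFunctions E M) T (X p) t₁ t₀ x) ∧
        (Ψ p).1 x = flow (holFunctions E M) T (X p) t₁ t₀ x := by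
  have : FiniteDimensional ℝ E := FiniteDimensional.complexToReal E
  set A := holFunctions E M with hA
  have hcoord : HasCoordinates (E := E) A := hasCoordinates_holFunctions hS
  have hcar := isLocallyCaratheodory_of_isL1Loc_hol hX hXc
  -- Order one suffices: complex differentiability of the flow together with joint continuity.
  have hflows : HasLocalFlows A T X (RegHolAt E) :=
    hcar.hasLocalFlows hcoord le_rfl
      fun x₀ c d a b ha hb hcd Ω hΩ hΩt hC O W hO hW ξ hξ p hp x hx hxW ↦
        IsSolFamily.regHolAt x₀ ha hb hΩ hΩt hC (fun p t ht ↦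
          (differentiableOn_chartRep ((hX p).mem t (hcd ht)) x₀).mono hΩt) hO hW hξ hp hx hxW
  have huniq : LocallyUnique A T X := hcar.locallyUnique hcoord
  have hreg : ∀ p, ∀ x ∈ flowDomain A T (X p) t₁ t₀,
      RegHolAt E p x (fun p ↦ flow A T (X p) t₁ t₀) := fun p x hx ↦
    (flow_regular hT huniq isRegularity_regHolAt hflows ht₀ ht₁ hx).1
  set O : Set P := {p | closure (U : Set M) ⊆ flowDomain A T (X p) t₁ t₀} with hO
  have hOn : O ∈ 𝓝 p₀ := eventually_subset_flowDomain hT huniq isRegularity_regHolAt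
    hflows ht₀ ht₁ hU hUD
  have hdom : ∀ (p : O) (x : U), (x : M) ∈ flowDomain A T (X p) t₁ t₀ := fun p x ↦
    p.2 (subset_closure x.2)
  have hhol : ∀ p : O, MDifferentiable 𝓘(ℂ, E) 𝓘(ℂ, E)
      (fun x : U ↦ flow A T (X p) t₁ t₀ (x : M)) := fun p x ↦
    MDifferentiableAt.comp (I' := 𝓘(ℂ, E)) x (hreg p x (hdom p x)).mdifferentiableAt
      ((contMDiff_subtype_val (n := 1) (I := 𝓘(ℂ, E)) x).mdifferentiableAt one_ne_zero)
  refine ⟨O, hOn, fun p ↦ ⟨fun x ↦ flow A T (X p) t₁ t₀ (x : M), hhol p⟩, ?_,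
    fun p x ↦ ⟨hdom p x, fun ξ hξ ↦ huniq.eq_flow hξ, rfl⟩⟩
  refine continuous_iInf_rng.2 fun f ↦ continuous_induced_rng.2 (continuous_generateFrom_iff.2 ?_)
  rintro B ⟨d, ⟨K, hK, rfl⟩, a, ε, hε, rfl⟩
  rw [isOpen_iff_mem_nhds]
  intro p₁ hp₁
  obtain ⟨δ, hδ, hδε⟩ := ENNReal.lt_iff_exists_add_pos_lt.1
    (show (⨆ x ∈ K, ENNReal.ofReal ‖f.1 (flow A T (X p₁) t₁ t₀ (x : M)) - a.1 x‖) < ε from hp₁)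
  have hδ' : (0 : ℝ) < δ := hδ
  -- Joint continuity of the flow at each `(p₁, x)` makes the difference small near that point;
  -- compactness of `K` makes it uniform.
  have hev : ∀ᶠ p in 𝓝 (p₁ : P), ∀ x ∈ K,
      ‖f.1 (flow A T (X p) t₁ t₀ (x : M)) - f.1 (flow A T (X p₁) t₁ t₀ (x : M))‖ ≤ δ := by
    refine hK.eventually_forall_of_forall_eventually fun x hx ↦ ?_
    have hc : ContinuousAt (fun z : P × U ↦ f.1 (flow A T (X z.1) t₁ t₀ (z.2 : M))) (p₁, x) := by
      have h1 : ContinuousAt (fun z : P × U ↦ flow A T (X z.1) t₁ t₀ (z.2 : M)) (p₁, x) :=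
        ContinuousAt.comp (g := fun z : P × M ↦ flow A T (X z.1) t₁ t₀ z.2)
          (f := fun z : P × U ↦ (z.1, (z.2 : M))) (x := (↑p₁, x))
          (hreg p₁ x (hdom p₁ x)).continuousAt (by fun_prop)
      exact ContinuousAt.comp (g := f.1) (MDifferentiable.continuous f.2).continuousAt h1
    have hc' : ContinuousAt (fun z : P × U ↦ f.1 (flow A T (X p₁) t₁ t₀ (z.2 : M))) (p₁, x) :=
      ContinuousAt.comp (g := fun z : P × U ↦ f.1 (flow A T (X z.1) t₁ t₀ (z.2 : M)))
        (f := fun z : P × U ↦ ((p₁ : P), z.2)) (x := (↑p₁, x)) hc (by fun_prop)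
    have h0 := (hc.sub hc').norm.eventually_lt_const (u := (δ : ℝ)) (by simpa using hδ')
    exact h0.mono fun z hz ↦ hz.le
  filter_upwards [continuous_subtype_val.continuousAt.eventually hev] with p hp
  refine lt_of_le_of_lt (iSup₂_le fun x hx ↦ ?_) hδε
  have htri : ‖f.1 (flow A T (X p) t₁ t₀ (x : M)) - a.1 x‖
      ≤ ‖f.1 (flow A T (X p₁) t₁ t₀ (x : M)) - a.1 x‖ + δ := by
    refine (norm_sub_le_norm_sub_add_norm_sub _ (f.1 (flow A T (X p₁) t₁ t₀ (x : M))) _).trans ?_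
    linarith [hp x hx]
  refine (ENNReal.ofReal_le_ofReal htri).trans (ENNReal.ofReal_add_le.trans ?_)
  rw [ENNReal.ofReal_coe_nnreal]
  refine add_le_add_left ?_ _
  exact le_iSup₂ (f := fun x (_ : x ∈ K) ↦
    ENNReal.ofReal ‖f.1 (flow A T (X p₁) t₁ t₀ (x : M)) - a.1 x‖) x hx

end HolFields

end ParamFlow

end

open ParamFlow in
theorem mainTheorem1 :
    -- `ν = m` with `m ≥ 1`, or `ν = ∞`, on a smooth manifold
    (∀ (E : Type*) [NormedAddCommGroup E] [NormedSpace ℝ E] [FiniteDimensional ℝ E]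
      (M : Type*) [TopologicalSpace M] [T2Space M] [SecondCountableTopology M] [ConnectedSpace M]
      [ChartedSpace E M] [IsManifold 𝓘(ℝ, E) ∞ M]
      (gM gV : ContMDiffRiemannianMetric 𝓘(ℝ, E) ∞ E (fun x : M ↦ TangentSpace 𝓘(ℝ, E) x))
      (covM covV : CovariantDerivative 𝓘(ℝ, E) E (fun x : M ↦ TangentSpace 𝓘(ℝ, E) x))
      [CovariantDerivative.ContMDiffCovariantDerivative covM ∞]
      [CovariantDerivative.ContMDiffCovariantDerivative covV ∞]
      (ν : ℕ∞) (_ : 1 ≤ ν) (T : Set ℝ) (_ : T.OrdConnected)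
      (P : Type*) [TopologicalSpace P]
      (X : P → ℝ → Π x : M, TangentSpace 𝓘(ℝ, E) x)
      (_ : ∀ p, IsL1Loc T (fields E M ν) (fieldSeminorms gM covM gV covV ν) (X p))
      (_ : ContinuousInParameter T (fieldSeminorms gM covM gV covV ν) X)
      (t₀ t₁ : ℝ) (_ : t₀ ∈ T) (_ : t₁ ∈ T) (p₀ : P)
      (U : TopologicalSpace.Opens M) (_ : IsCompact (closure (U : Set M)))
      (_ : closure (U : Set M) ⊆ flowDomain (smoothFunctions E M) T (X p₀) t₁ t₀),
      ∃ O ∈ 𝓝 p₀, ∃ Ψ : O → CMap E ν U,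
        Continuous[instTopologicalSpaceSubtype, mapTopology gM covM ν U] Ψ ∧
        ∀ (p : O) (x : U), (x : M) ∈ flowDomain (smoothFunctions E M) T (X p) t₁ t₀ ∧
          (∀ ξ, IsIntegralCurveFrom (smoothFunctions E M) T (X p) t₁ t₀ x ξ →
            ξ t₁ = flow (smoothFunctions E M) T (X p) t₁ t₀ x) ∧
          (Ψ p).1 x = flow (smoothFunctions E M) T (X p) t₁ t₀ x) ∧
    -- `ν = hol`, on a Stein manifold
    (∀ (E : Type*) [NormedAddCommGroup E] [NormedSpace ℂ E] [FiniteDimensional ℂ E]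
      (M : Type*) [TopologicalSpace M] [T2Space M] [SecondCountableTopology M] [ConnectedSpace M]
      [ChartedSpace E M] [IsManifold 𝓘(ℂ, E) ω M] (_ : IsStein E M)
      (g : HermitianMetric E M) (T : Set ℝ) (_ : T.OrdConnected)
      (P : Type*) [TopologicalSpace P]
      (X : P → ℝ → Π x : M, TangentSpace 𝓘(ℂ, E) x)
      (_ : ∀ p, IsL1Loc T (holFields E M) (holFieldSeminorms g) (X p))
      (_ : ContinuousInParameter T (holFieldSeminorms g) X)
      (t₀ t₁ : ℝ) (_ : t₀ ∈ T) (_ : t₁ ∈ T) (p₀ : P)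
      (U : TopologicalSpace.Opens M) (_ : IsCompact (closure (U : Set M)))
      (_ : closure (U : Set M) ⊆ flowDomain (holFunctions E M) T (X p₀) t₁ t₀),
      ∃ O ∈ 𝓝 p₀, ∃ Ψ : O → HolMap E U,
        Continuous[instTopologicalSpaceSubtype, holMapTopology U] Ψ ∧
        ∀ (p : O) (x : U), (x : M) ∈ flowDomain (holFunctions E M) T (X p) t₁ t₀ ∧
          (∀ ξ, IsIntegralCurveFrom (holFunctions E M) T (X p) t₁ t₀ x ξ →
            ξ t₁ = flow (holFunctions E M) T (X p) t₁ t₀ x) ∧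
          (Ψ p).1 x = flow (holFunctions E M) T (X p) t₁ t₀ x) := by
  refine ⟨?_, ?_⟩
  · intro E _ _ _ M _ _ _ _ _ _ gM gV covM covV _ _ ν hν T hT P _ X hX hXc t₀ t₁ ht₀ ht₁ p₀ U hU hUD
    exact exists_smooth_flow_continuous gM gV covM covV hν hT hX hXc ht₀ ht₁ hU hUD
  · intro E _ _ _ M _ _ _ _ _ _ hS g T hT P _ X hX hXc t₀ t₁ ht₀ ht₁ p₀ U hU hUD
    exact exists_hol_flow_continuous hS hT hX hXc ht₀ ht₁ hU hUD
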